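/- Fix integers $n\ge 1$, $d\ge 2$ and $q\in\mathbb{C}^\times$ with $q^k\neq 1$ for $1\le k\le n$. Latin indices run over $1,\dots,n$ and Greek ones over $1,\dots,d$. Parameters $\underline z=(z_{\alpha\beta})_{\alpha<\beta}\in\mathbb{C}^{d(d-1)/2}$ are extended to antisymmetric matrices. **Pencils.** On an affine complex variety $M$, a family of bivectors (antisymmetric biderivations of $\mathbb{C}[M]$) $(P_j)_{j\in J}$ is a *Poisson pencil* if every finite linear combination is a Poisson bracket. It has *order* $r$ if $r\geq1$ is the largest integer such that $P_{j_1,x},\dots,P_{j_r,x}\in\bigwedge^2T_xM$ are linearly independent for some $j_1,\dots,j_r\in J$ and $x\in M$. A bivector $P$ is *non-degenerate* if $P_x^\sharp:T_x^*M\to T_xM$ is surjective for all $x\in M$. **Local phase space.** Let $\mathfrak h_{\mathrm{reg}}$ be the set of all $(x_i,a_i^\alpha,b_i^\alpha)\in(\mathbb{C}^\times)^n\times\mathbb{C}^{2nd}$ such that $x_i\ne x_j$ and $x_i\neq qx_j$ for $i\ne j$, $\sum_\alpha a_i^\alpha=1$ for all $i$, and $\det(\mathcal Z_k)\ne0$ for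 $0\le k\le d$, where $(\mathcal Z_k)_{ij}=Z_{ij}+\sum_{\beta\le k}a_i^\beta b_j^\beta$ and $Z_{ij}=q\,\frac{\sum_\beta a_i^\beta b_j^\beta}{x_ix_j^{-1}-q}$. The group $S_n$ permutes the Latin indices simultaneously. Let $o(\alpha,\beta)=1,0,-1$ according to $\alpha<\beta$, $\alpha=\beta$, $\alpha>\beta$, and let $c_{ij}=\frac12\frac{x_i+x_j}{x_i-x_j}$ for $i\ne j$, $c_{ii}=0$. Let $\{-,-\}_0$ be the antisymmetric biderivation on $\mathfrak h_{\mathrm{reg}}/S_n$ determined by $$\{x_i,x_j\}_0=0,\quad \{x_i,a_j^\alpha\}_0=0,\quad \{x_i,b_j^\alpha\}_0=\delta_{ij}x_ib_j^\alpha,$$ $$\{a_i^\alpha,a_j^\beta\}_0=c_{ij}(a_i^\alpha a_j^\beta+a_j^\alpha a_i^\beta-a_j^\alpha a_j^\beta-a_i^\alpha a_i^\beta)+\tfrac12o(\beta,\alpha)(a_i^\alpha a_j^\beta+a_j^\alpha a_i^\beta)+\tfrac12\sum_\gamma o(\alpha,\gamma)a_j^\beta(a_i^\alpha a_j^\gamma+a_j^\alpha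 a_i^\gamma)-\tfrac12\sum_\gamma o(\beta,\gamma)a_i^\alpha(a_j^\beta a_i^\gamma+a_i^\beta a_j^\gamma),$$ $$\{a_i^\alpha,b_j^\beta\}_0=a_i^\alpha Z_{ij}-\delta_{\alpha\beta}Z_{ij}-c_{ij}(a_i^\alpha-a_j^\alpha)b_j^\beta+\delta_{(\alpha<\beta)}a_i^\alpha b_j^\beta+a_i^\alpha\sum_{\gamma<\beta}a_i^\gamma(b_j^\gamma-b_j^\beta)-\delta_{\alpha\beta}\sum_{\gamma<\beta}a_i^\gamma b_j^\gamma-\tfrac12\sum_\gamma o(\alpha,\gamma)b_j^\beta(a_i^\alpha a_j^\gamma+a_j^\alpha a_i^\gamma),$$ $$\{b_i^\alpha,b_j^\beta\}_0=c_{ij}(b_i^\alpha b_j^\beta+b_j^\alpha b_i^\beta)-b_i^\alpha Z_{ij}+b_j^\beta Z_{ji}+\tfrac12o(\beta,\alpha)(b_i^\alpha b_j^\beta-b_j^\alpha b_i^\beta)-b_i^\alpha\sum_{\gamma<\beta}a_i^\gamma(b_j^\gamma-b_j^\beta)+b_j^\beta\sum_{\gamma<\alpha}a_j^\gamma(b_i^\gamma-b_i^\alpha).$$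 Let $\psi^{\mathrm{loc}}_{\underline z}$ be the antisymmetric biderivation on $\mathfrak h_{\mathrm{reg}}/S_n$ determined by $\psi^{\mathrm{loc}}_{\underline z}(x_i,-)=0$ and $$\psi^{\mathrm{loc}}_{\underline z}(a_i^\alpha,a_j^\beta)=G\,a_i^\alpha a_j^\beta,\quad \psi^{\mathrm{loc}}_{\underline z}(a_i^\alpha,b_j^\beta)=-G\,a_i^\alpha b_j^\beta,\quad \psi^{\mathrm{loc}}_{\underline z}(b_i^\alpha,b_j^\beta)=G\,b_i^\alpha b_j^\beta,$$ where $G=z_{\alpha\beta}+\sum_\mu(z_{\mu\alpha}a_j^\mu-z_{\mu\beta}a_i^\mu)+\sum_{\mu,\nu}z_{\mu\nu}a_i^\mu a_j^\nu$. **Spin RS phase space.** Let $M$ be the set of $(X,Z,V_\alpha,W_\alpha)$ with $X,Z\in\mathrm{GL}_n(\mathbb{C})$, $V_\alpha\in\mathrm{Mat}_{1\times n}(\mathbb{C})$, $W_\alpha\in\mathrm{Mat}_{n\times1}(\mathbb{C})$ and $\det(\mathrm{Id}+W_\alpha V_\alpha)\ne0$, with the action $g\cdot(X,Z,V_\alpha,W_\alpha)=(gXg^{-1},gZg^{-1},V_\alpha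 g^{-1},gW_\alpha)$ of $\mathrm{GL}_n(\mathbb{C})$ and the map $\Phi=XZX^{-1}Z^{-1}(\mathrm{Id}+W_1V_1)^{-1}\cdots(\mathrm{Id}+W_dV_d)^{-1}$. Put $\mathcal C=\Phi^{-1}(q\,\mathrm{Id})/\mathrm{GL}_n(\mathbb{C})$. View $M$ as a space of representations on $\mathbb{C}^n\oplus\mathbb{C}$ of the quiver with arrows $x<x^*<v_1<v_1^*<\dots<v_d<v_d^*$, where $X,Z,V_\alpha,W_\alpha$ are the only nonzero blocks of the matrices $\mathtt X_x,\mathtt X_{x^*},\mathtt X_{v_\alpha},\mathtt X_{v_\alpha^*}$; let $a\mapsto a^*$ be the involution exchanging $x\leftrightarrow x^*$, $v_\alpha\leftrightarrow v_\alpha^*$, let $\epsilon=1$ on $x,v_\alpha$ and $\epsilon=-1$ on $x^*,v_\alpha^*$, let $\gamma_x=\gamma_{x^*}=0$, $\gamma_{v_\alpha}=\gamma_{v_\alpha^*}=1$, and $(\partial_a)_{ij}=\partial/\partial(\mathtt X_a)_{ji}$ (zero if this entry lies outside of the block). With $D\wedge E=D\otimes E-E\otimes D$, define on $M$ $$P=\tfrac12\sum_a\epsilon(a)\,\mathrm{tr}[(\gamma_a\mathrm{Id}+\mathtt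 X_{a^*}\mathtt X_a)\,\partial_a\wedge\partial_{a^*}]-\tfrac12\sum_{a<b}\mathrm{tr}[(\partial_{a^*}\mathtt X_{a^*}-\mathtt X_a\partial_a)\wedge(\partial_{b^*}\mathtt X_{b^*}-\mathtt X_b\partial_b)],$$ $$\psi_{\underline z}=\sum_{\alpha<\beta}z_{\alpha\beta}\,\mathrm{tr}[\mathtt X_{v_\alpha^*}\partial_{v_\alpha^*}-\mathtt X_{v_\alpha}\partial_{v_\alpha}]\wedge\mathrm{tr}[\mathtt X_{v_\beta^*}\partial_{v_\beta^*}-\mathtt X_{v_\beta}\partial_{v_\beta}].$$ A biderivation $Q$ on $M$ *induces* a biderivation $B$ on $\mathcal C$ if, for all $F,G\in\mathbb{C}[M]$ restricting on $\Phi^{-1}(q\,\mathrm{Id})$ to the pullbacks of $f,g\in\mathbb{C}[\mathcal C]$, the function $Q(F,G)$ restricts to the pullback of $B(f,g)$. **Statement.** 1. The brackets $\{-,-\}_0$ and $\psi^{\mathrm{loc}}_{\underline z}$ exist and are unique, and the family formed by $\{-,-\}_0$ and all $\psi^{\mathrm{loc}}_{\underline z}$ is a Poisson pencil on $\mathfrak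 h_{\mathrm{reg}}/S_n$. For all $z_0\in\mathbb{C}$ and $\underline z$, $z_0\{-,-\}_0+\psi^{\mathrm{loc}}_{\underline z}$ is a Poisson bracket, and it is non-degenerate when $z_0\ne0$. The pencil has an order $r\ge\frac{(d-1)(d-2)}2+1$. 2. Each of $P$ and $\psi_{\underline z}$ induces a unique bracket on $\mathcal C$, and the family formed by the induced brackets is a Poisson pencil on $\mathcal C$ of order $r\ge\frac{(d-1)(d-2)}2+1$. -/

import Mathlib

noncomputable section

namespace SpinRS

/-! ## Regular functions, biderivations and Poisson pencils -/

/-- The coordinate ring of a subset `U` of the affine space with coordinates indexed by `ι`, when `U`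
is a principal open subset of a Zariski closed subset: the complex functions on `U` of the form `p / r`
with polynomials `p`, `r` such that `r` vanishes nowhere on `U`. -/
def Reg {ι : Type} (U : Set (ι → ℂ)) : Subalgebra ℂ (U → ℂ) where
  carrier := {f | ∃ p r : MvPolynomial ι ℂ, ∀ u : U,
    MvPolynomial.eval u.1 r ≠ 0 ∧ f u = MvPolynomial.eval u.1 p / MvPolynomial.eval u.1 r}
  mul_mem' := by
    rintro f g ⟨p, r, h⟩ ⟨p', r', h'⟩
    refine ⟨p * p', r * r', fun u => ⟨?_, ?_⟩⟩
    · simpa using ⟨(h u).1, (h' u).1⟩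
    · have h1 := (h u).1
      have h2 := (h' u).1
      simp only [Pi.mul_apply, (h u).2, (h' u).2, map_mul]
      field_simp
  add_mem' := by
    rintro f g ⟨p, r, h⟩ ⟨p', r', h'⟩
    refine ⟨p * r' + p' * r, r * r', fun u => ⟨?_, ?_⟩⟩
    · simpa using ⟨(h u).1, (h' u).1⟩
    · have h1 := (h u).1
      have h2 := (h' u).1
      simp only [Pi.add_apply, (h u).2, (h' u).2, map_mul, map_add]
      field_simp
  algebraMap_mem' := by
    intro c
    refine ⟨MvPolynomial.C c, 1, fun u => ⟨by simp, by simp⟩⟩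

/-- The coordinate functions on `U`. -/
def coordFn {ι : Type} (U : Set (ι → ℂ)) (c : ι) : Reg U :=
  ⟨fun u => u.1 c, MvPolynomial.X c, 1, fun u => ⟨by simp, by simp⟩⟩

/-- The coordinate ring of the quotient of `U` by the relation `rel` (lying in the same orbit of a
group action): the functions on the set of orbits whose pullback to `U` is regular. -/
def RegQuot {ι : Type} (U : Set (ι → ℂ)) (rel : U → U → Prop) : Subalgebra ℂ (Quot rel → ℂ) where
  carrier := {f | (fun u => f (Quot.mk rel u)) ∈ Reg U}
  mul_mem' := fun {_ _} hf hg => (Reg U).mul_mem hf hg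
  add_mem' := fun {_ _} hf hg => (Reg U).add_mem hf hg
  algebraMap_mem' := fun c => (Reg U).algebraMap_mem c

/-- Biderivations of a commutative algebra: `P f g` is the bracket of `f` and `g`. -/
abbrev Bider (A : Type) [CommRing A] [Algebra ℂ A] : Type :=
  Derivation ℂ A (Derivation ℂ A A)

section Generic

variable {A : Type} [CommRing A] [Algebra ℂ A]

/-- The bivector `D ∧ E = D ⊗ E - E ⊗ D`, that is `(D ∧ E) f g = D f * E g - E f * D g`. -/
def wedge (D E : Derivation ℂ A A) : Bider A :=
  (LinearMap.toSpanSingleton A (Derivation ℂ A A) E).compDer D -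
    (LinearMap.toSpanSingleton A (Derivation ℂ A A) D).compDer E

/-- A bivector: an antisymmetric biderivation. -/
def IsBivector (P : Bider A) : Prop := ∀ f : A, P f f = 0

/-- A Poisson bracket: an antisymmetric biderivation satisfying the Jacobi identity. -/
def IsPoisson (P : Bider A) : Prop :=
  IsBivector P ∧ ∀ f g h : A, P f (P g h) + P g (P h f) + P h (P f g) = 0

/-- A Poisson pencil: every finite linear combination of the family is a Poisson bracket. -/
def IsPoissonPencil {J : Type} (P : J → Bider A) : Prop :=
  ∀ (s : Finset J) (c : J → ℂ), IsPoisson (∑ j ∈ s, c j • P j)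

end Generic

section Points

variable {X : Type} {A : Subalgebra ℂ (X → ℂ)}

/-- The value at the point `x` of a biderivation `P`, as the bilinear form `(f, g) ↦ (P f g) (x)`,
which only depends on the differentials of `f` and `g` at `x`. -/
def valueAt (x : X) (P : Bider A) : A → A → ℂ := fun f g => (P f g).1 x

/-- Tangent vectors at the point `x`, as point derivations of the coordinate ring. -/
def IsTangentVector (A : Subalgebra ℂ (X → ℂ)) (x : X) (v : A →ₗ[ℂ] ℂ) : Prop :=
  ∀ f g : A, v (f * g) = f.1 x * v g + g.1 x * v f

/-- Non-degeneracy of a bivector: at every point `x`, the map from the cotangent space to the tangent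
space given by `df ↦ P(df, -)` is surjective. -/
def IsNondegenerate (P : Bider A) : Prop :=
  ∀ (x : X) (v : A →ₗ[ℂ] ℂ), IsTangentVector A x v → ∃ f : A, ∀ g : A, v g = (P f g).1 x

/-- The pencil `P` has order `r`: `r ≥ 1` is the largest integer for which `r` members of the family
are linearly independent at some point. -/
def HasPencilOrder {J : Type} (P : J → Bider A) (r : ℕ) : Prop :=
  1 ≤ r ∧ IsGreatest {k : ℕ | ∃ (j : Fin k → J) (x : X),
    LinearIndependent ℂ (fun i : Fin k => valueAt x (P (j i)))} r

end Points

/-- `B` is the bracket induced on the quotient of `Y ⊆ U` by the biderivation `P` on `U`: whenever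
regular functions `F`, `G` on `U` restrict on `Y` to the pullbacks of functions `f`, `g` on the quotient,
`P F G` restricts to the pullback of `B f g`. -/
def IsReduction {ι : Type} {U Y : Set (ι → ℂ)} (hY : Y ⊆ U) (rel : Y → Y → Prop)
    (P : Bider (Reg U)) (B : Bider (RegQuot Y rel)) : Prop :=
  ∀ (F G : Reg U) (f g : RegQuot Y rel),
    (∀ y : Y, F.1 ⟨y.1, hY y.2⟩ = f.1 (Quot.mk rel y)) →
    (∀ y : Y, G.1 ⟨y.1, hY y.2⟩ = g.1 (Quot.mk rel y)) →
    ∀ y : Y, (P F G).1 ⟨y.1, hY y.2⟩ = (B f g).1 (Quot.mk rel y)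

/-! ## Partial derivatives on an open subset of affine space -/

/-- Extension of a function by zero. -/
def extZero {ι : Type} {U : Set (ι → ℂ)} (f : U → ℂ) : (ι → ℂ) → ℂ := by
  classical exact fun v => if h : v ∈ U then f ⟨v, h⟩ else 0

/-- The coordinate vector in direction `e`. -/
def dirVec {ι : Type} (e : ι) : ι → ℂ := by
  classical exact Pi.single e 1

/-- The partial derivative of a function on `U` in direction `e`. -/
def partialFn {ι : Type} {U : Set (ι → ℂ)} (e : ι) (f : U → ℂ) : U → ℂ :=
  fun u => deriv (fun t : ℂ => extZero f (u.1 + t • dirVec e)) 0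

theorem hasDerivAt_eval {ι : Type} (e : ι) (u : ι → ℂ) (p : MvPolynomial ι ℂ) :
    HasDerivAt (fun t : ℂ => MvPolynomial.eval (u + t • dirVec e) p)
      (MvPolynomial.eval u (MvPolynomial.pderiv e p)) 0 := by
  classical
  induction p using MvPolynomial.induction_on with
  | C a => simpa using hasDerivAt_const (0 : ℂ) a
  | add p q hp hq => simpa using! hp.add hq
  | mul_X p i hp =>
    have hX : HasDerivAt (fun t : ℂ => (u + t • dirVec e) i) (dirVec e i) 0 := by
      have := ((hasDerivAt_id (0 : ℂ)).mul_const (dirVec e i)).const_add (u i)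
      simpa using this
    have h := hp.mul hX
    have hd : MvPolynomial.eval u (MvPolynomial.pderiv e (MvPolynomial.X i)) = dirVec e i := by
      by_cases hie : i = e
      · subst hie; simp [dirVec]
      · rw [MvPolynomial.pderiv_X_of_ne hie]; simp [dirVec, hie]
    have e1 : MvPolynomial.eval u (MvPolynomial.pderiv e (p * MvPolynomial.X i)) =
        MvPolynomial.eval u (MvPolynomial.pderiv e p) * (u + (0 : ℂ) • dirVec e) i +
          MvPolynomial.eval (u + (0 : ℂ) • dirVec e) p * dirVec e i := by
      rw [Derivation.leibniz]
      simp only [map_add, smul_eq_mul, map_mul, hd, MvPolynomial.eval_X, zero_smul, add_zero]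
      ring
    rw [e1]
    refine h.congr_of_eventuallyEq (Filter.Eventually.of_forall fun t => ?_)
    simp

theorem hasDerivAt_ext {ι : Type} {U : Set (ι → ℂ)} (hU : IsOpen U) (e : ι) {f : U → ℂ}
    {p r : MvPolynomial ι ℂ}
    (h : ∀ u : U, MvPolynomial.eval u.1 r ≠ 0 ∧
      f u = MvPolynomial.eval u.1 p / MvPolynomial.eval u.1 r) (u : U) :
    HasDerivAt (fun t : ℂ => extZero f (u.1 + t • dirVec e))
      ((MvPolynomial.eval u.1 (MvPolynomial.pderiv e p) * MvPolynomial.eval u.1 r -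
        MvPolynomial.eval u.1 p * MvPolynomial.eval u.1 (MvPolynomial.pderiv e r)) /
          MvPolynomial.eval u.1 r ^ 2) 0 := by
  have h0 : MvPolynomial.eval (u.1 + (0 : ℂ) • dirVec e) r ≠ 0 := by simpa using (h u).1
  have hd := (hasDerivAt_eval e u.1 p).div (hasDerivAt_eval e u.1 r) h0
  simp only [zero_smul, add_zero] at hd
  refine hd.congr_of_eventuallyEq ?_
  have hc : Continuous (fun t : ℂ => u.1 + t • dirVec e) := by fun_prop
  have hm : ∀ᶠ t : ℂ in nhds 0, u.1 + t • dirVec e ∈ U :=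
    hc.continuousAt.eventually_mem (hU.mem_nhds (by simp))
  filter_upwards [hm] with t ht
  simp only [extZero, dif_pos ht, Pi.div_apply]
  exact (h ⟨_, ht⟩).2

theorem hasDerivAt_reg {ι : Type} {U : Set (ι → ℂ)} (hU : IsOpen U) (e : ι) (f : Reg U) (u : U) :
    HasDerivAt (fun t : ℂ => extZero f.1 (u.1 + t • dirVec e)) (partialFn e f.1 u) 0 := by
  obtain ⟨p, r, h⟩ := f.2
  exact (hasDerivAt_ext hU e h u).differentiableAt.hasDerivAt

theorem partialFn_mem {ι : Type} {U : Set (ι → ℂ)} (hU : IsOpen U) (e : ι) (f : Reg U) :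
    partialFn e f.1 ∈ Reg U := by
  obtain ⟨p, r, h⟩ := f.2
  refine ⟨MvPolynomial.pderiv e p * r - p * MvPolynomial.pderiv e r, r ^ 2, fun u => ⟨?_, ?_⟩⟩
  · simpa using (h u).1
  · rw [partialFn, (hasDerivAt_ext hU e h u).deriv]
    simp

/-- The coordinate vector field `∂/∂e` on the open set `U`. -/
def partialD {ι : Type} {U : Set (ι → ℂ)} (hU : IsOpen U) (e : ι) :
    Derivation ℂ (Reg U) (Reg U) :=
  Derivation.mk'
    { toFun := fun f => ⟨partialFn e f.1, partialFn_mem hU e f⟩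
      map_add' := by
        intro f g
        ext u
        refine ((((hasDerivAt_reg hU e f u).add (hasDerivAt_reg hU e g u)).congr_of_eventuallyEq
          (Filter.Eventually.of_forall fun t => ?_))).deriv
        by_cases ht : u.1 + t • dirVec e ∈ U <;> simp [extZero, ht]
      map_smul' := by
        intro c f
        ext u
        refine (((hasDerivAt_reg hU e f u).const_mul c).congr_of_eventuallyEq
          (Filter.Eventually.of_forall fun t => ?_)).deriv
        by_cases ht : u.1 + t • dirVec e ∈ U <;> simp [extZero, ht] }
    (by
      intro f g
      ext u
      have h := (hasDerivAt_reg hU e f u).mul (hasDerivAt_reg hU e g u)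
      have hz : ∀ k : Reg U, extZero k.1 (u.1 + (0 : ℂ) • dirVec e) = k.1 u := by
        intro k
        have : u.1 + (0 : ℂ) • dirVec e = u.1 := by simp
        rw [this]
        simp [extZero]
      rw [hz, hz] at h
      have h1 : (fun t : ℂ => extZero (f * g).1 (u.1 + t • dirVec e)) =
          (fun t : ℂ => extZero f.1 (u.1 + t • dirVec e)) *
            (fun t : ℂ => extZero g.1 (u.1 + t • dirVec e)) := by
        funext t
        by_cases ht : u.1 + t • dirVec e ∈ U <;> simp [extZero, ht]
      rw [← h1] at h
      refine h.deriv.trans ?_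
      change _ = f.1 u * partialFn e g.1 u + g.1 u * partialFn e f.1 u
      ring)

/-! ## Parameters of the pencil -/

/-- Parameters `(z_{αβ})_{α < β}`. -/
abbrev Param (d : ℕ) : Type := {p : Fin d × Fin d // p.1 < p.2} → ℂ

/-- The antisymmetric matrix extending the parameters. -/
def skewExt {d : ℕ} (z : Param d) (α β : Fin d) : ℂ :=
  if h : α < β then z ⟨(α, β), h⟩ else if h : β < α then -z ⟨(β, α), h⟩ else 0

/-- The family consisting of one bracket `B₀` and of the brackets `Ψ z`, for all parameters `z`. -/
def pencil {d : ℕ} {A : Type} [CommRing A] [Algebra ℂ A] (B₀ : Bider A) (Ψ : Param d → Bider A) :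
    Option (Param d) → Bider A
  | none => B₀
  | some z => Ψ z

/-! ## The local phase space -/

/-- Labels of the coordinates `x_i`, `a_i^α`, `b_i^α`. -/
inductive HCoord (n d : ℕ) : Type
  | x (i : Fin n) : HCoord n d
  | a (i : Fin n) (α : Fin d) : HCoord n d
  | b (i : Fin n) (α : Fin d) : HCoord n d

section Local

variable {n d : ℕ}

/-- `Z_{ij} = q (∑_β a_i^β b_j^β) / (x_i x_j⁻¹ - q)`. -/
def locZ (q : ℂ) (u : HCoord n d → ℂ) (i j : Fin n) : ℂ :=
  q * (∑ β, u (.a i β) * u (.b j β)) / (u (.x i) * (u (.x j))⁻¹ - q)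

/-- The matrix obtained from `Z` by adding the first `k` of the matrices `(a_i^β b_j^β)_{ij}`. -/
def locCalZ (q : ℂ) (u : HCoord n d → ℂ) (k : ℕ) : Matrix (Fin n) (Fin n) ℂ :=
  Matrix.of fun i j => locZ q u i j +
    ∑ β ∈ Finset.univ.filter (fun β : Fin d => β.1 < k), u (.a i β) * u (.b j β)

/-- The space `𝔥_reg`. -/
def hreg (n d : ℕ) (q : ℂ) : Set (HCoord n d → ℂ) :=
  {u | (∀ i, u (.x i) ≠ 0) ∧
    (∀ i j, i ≠ j → u (.x i) ≠ u (.x j) ∧ u (.x i) ≠ q * u (.x j)) ∧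
    (∀ i, ∑ α, u (.a i α) = 1) ∧
    ∀ k ≤ d, (locCalZ q u k).det ≠ 0}

/-- Simultaneous permutation of the indices `i`. -/
def permAct (σ : Equiv.Perm (Fin n)) (u : HCoord n d → ℂ) : HCoord n d → ℂ
  | .x i => u (.x (σ i))
  | .a i α => u (.a (σ i) α)
  | .b i α => u (.b (σ i) α)

/-- Two points of `𝔥_reg` lie in the same orbit of the symmetric group. -/
def permRel (n d : ℕ) (q : ℂ) (u v : hreg n d q) : Prop :=
  ∃ σ : Equiv.Perm (Fin n), v.1 = permAct σ u.1

/-- The coordinate ring of `𝔥_reg / S_n`. -/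
abbrev LocRing (n d : ℕ) (q : ℂ) : Subalgebra ℂ (Quot (permRel n d q) → ℂ) :=
  RegQuot (hreg n d q) (permRel n d q)

/-- The skew-symmetric sign function, `o α β = 1` if `α < β`. -/
def o (α β : Fin d) : ℂ := if α < β then 1 else if β < α then -1 else 0

/-- `½ δ_{i ≠ j} (x_i + x_j) / (x_i - x_j)`. -/
def cotTerm (u : HCoord n d → ℂ) (i j : Fin n) : ℂ :=
  if i = j then 0 else 1 / 2 * ((u (.x i) + u (.x j)) / (u (.x i) - u (.x j)))

/-- The bracket `{-,-}_0` on `𝔥_reg`, through its values on the coordinate functions. -/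
structure IsBracketZero (q : ℂ) (B : Bider (Reg (hreg n d q))) : Prop where
  bivector : IsBivector B
  xx : ∀ i j u, (B (coordFn _ (.x i)) (coordFn _ (.x j))).1 u = 0
  xa : ∀ i j α u, (B (coordFn _ (.x i)) (coordFn _ (.a j α))).1 u = 0
  xb : ∀ i j α u, (B (coordFn _ (.x i)) (coordFn _ (.b j α))).1 u =
    if i = j then u.1 (.x i) * u.1 (.b j α) else 0
  aa : ∀ i j α β u, (B (coordFn _ (.a i α)) (coordFn _ (.a j β))).1 u =
    cotTerm u.1 i j * (u.1 (.a i α) * u.1 (.a j β) + u.1 (.a j α) * u.1 (.a i β)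
      - u.1 (.a j α) * u.1 (.a j β) - u.1 (.a i α) * u.1 (.a i β))
    + 1 / 2 * o β α * (u.1 (.a i α) * u.1 (.a j β) + u.1 (.a j α) * u.1 (.a i β))
    + 1 / 2 * ∑ γ, o α γ * u.1 (.a j β) *
        (u.1 (.a i α) * u.1 (.a j γ) + u.1 (.a j α) * u.1 (.a i γ))
    - 1 / 2 * ∑ γ, o β γ * u.1 (.a i α) *
        (u.1 (.a j β) * u.1 (.a i γ) + u.1 (.a i β) * u.1 (.a j γ))
  ab : ∀ i j α β u, (B (coordFn _ (.a i α)) (coordFn _ (.b j β))).1 u =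
    u.1 (.a i α) * locZ q u.1 i j
    - (if α = β then locZ q u.1 i j else 0)
    - cotTerm u.1 i j * (u.1 (.a i α) - u.1 (.a j α)) * u.1 (.b j β)
    + (if α < β then u.1 (.a i α) * u.1 (.b j β) else 0)
    + u.1 (.a i α) * ∑ γ ∈ Finset.Iio β, u.1 (.a i γ) * (u.1 (.b j γ) - u.1 (.b j β))
    - (if α = β then ∑ γ ∈ Finset.Iio β, u.1 (.a i γ) * u.1 (.b j γ) else 0)
    - 1 / 2 * ∑ γ, o α γ * u.1 (.b j β) *
        (u.1 (.a i α) * u.1 (.a j γ) + u.1 (.a j α) * u.1 (.a i γ))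
  bb : ∀ i j α β u, (B (coordFn _ (.b i α)) (coordFn _ (.b j β))).1 u =
    cotTerm u.1 i j * (u.1 (.b i α) * u.1 (.b j β) + u.1 (.b j α) * u.1 (.b i β))
    - u.1 (.b i α) * locZ q u.1 i j + u.1 (.b j β) * locZ q u.1 j i
    + 1 / 2 * o β α * (u.1 (.b i α) * u.1 (.b j β) - u.1 (.b j α) * u.1 (.b i β))
    - u.1 (.b i α) * ∑ γ ∈ Finset.Iio β, u.1 (.a i γ) * (u.1 (.b j γ) - u.1 (.b j β))
    + u.1 (.b j β) * ∑ γ ∈ Finset.Iio α, u.1 (.a j γ) * (u.1 (.b i γ) - u.1 (.b i α))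

/-- The function `G_z(i,j;α,β)`. -/
def locG (z : Param d) (u : HCoord n d → ℂ) (i j : Fin n) (α β : Fin d) : ℂ :=
  skewExt z α β
    + ∑ μ, (skewExt z μ α * u (.a j μ) - skewExt z μ β * u (.a i μ))
    + ∑ μ, ∑ ν, skewExt z μ ν * u (.a i μ) * u (.a j ν)

/-- The bracket `ψ_z^loc` on `𝔥_reg`, through its values on the coordinate functions. -/
structure IsPsiLoc (q : ℂ) (z : Param d) (B : Bider (Reg (hreg n d q))) : Prop where
  bivector : IsBivector B
  xx : ∀ i j u, (B (coordFn _ (.x i)) (coordFn _ (.x j))).1 u = 0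
  xa : ∀ i j α u, (B (coordFn _ (.x i)) (coordFn _ (.a j α))).1 u = 0
  xb : ∀ i j α u, (B (coordFn _ (.x i)) (coordFn _ (.b j α))).1 u = 0
  aa : ∀ i j α β u, (B (coordFn _ (.a i α)) (coordFn _ (.a j β))).1 u =
    locG z u.1 i j α β * u.1 (.a i α) * u.1 (.a j β)
  ab : ∀ i j α β u, (B (coordFn _ (.a i α)) (coordFn _ (.b j β))).1 u =
    -locG z u.1 i j α β * u.1 (.a i α) * u.1 (.b j β)
  bb : ∀ i j α β u, (B (coordFn _ (.b i α)) (coordFn _ (.b j β))).1 u =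
    locG z u.1 i j α β * u.1 (.b i α) * u.1 (.b j β)

/-- `B` is the bracket `{-,-}_0` on `𝔥_reg / S_n`. -/
def IsLocalZero (q : ℂ) (B : Bider (LocRing n d q)) : Prop :=
  ∃ B' : Bider (Reg (hreg n d q)), IsBracketZero q B' ∧
    IsReduction (Set.Subset.refl _) (permRel n d q) B' B

/-- `B` is the bracket `ψ_z^loc` on `𝔥_reg / S_n`. -/
def IsLocalPsi (q : ℂ) (z : Param d) (B : Bider (LocRing n d q)) : Prop :=
  ∃ B' : Bider (Reg (hreg n d q)), IsPsiLoc q z B' ∧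
    IsReduction (Set.Subset.refl _) (permRel n d q) B' B

end Local

/-! ## The spin Ruijsenaars-Schneider phase space -/

/-- Labels of the entries of `X`, `Z` (size `n × n`), of the rows `V_α` and of the columns `W_α`. -/
inductive RSCoord (n d : ℕ) : Type
  | X (i j : Fin n) : RSCoord n d
  | Z (i j : Fin n) : RSCoord n d
  | V (α : Fin d) (j : Fin n) : RSCoord n d
  | W (α : Fin d) (i : Fin n) : RSCoord n d

section Phase

variable {n d : ℕ}

def matX (u : RSCoord n d → ℂ) : Matrix (Fin n) (Fin n) ℂ := Matrix.of fun i j => u (.X i j)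

def matZ (u : RSCoord n d → ℂ) : Matrix (Fin n) (Fin n) ℂ := Matrix.of fun i j => u (.Z i j)

/-- `Id + W_α V_α`. -/
def matWV (u : RSCoord n d → ℂ) (α : Fin d) : Matrix (Fin n) (Fin n) ℂ :=
  1 + Matrix.vecMulVec (fun i => u (.W α i)) (fun j => u (.V α j))

/-- The representation space: `X`, `Z` and all `Id + W_α V_α` are invertible. -/
def repSpace (n d : ℕ) : Set (RSCoord n d → ℂ) :=
  {u | (matX u).det ≠ 0 ∧ (matZ u).det ≠ 0 ∧ ∀ α, (matWV u α).det ≠ 0}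

theorem isOpen_repSpace (n d : ℕ) : IsOpen (repSpace n d) := by
  have h1 : Continuous fun u : RSCoord n d → ℂ => (matX u).det :=
    Continuous.matrix_det (continuous_matrix fun i j => continuous_apply _)
  have h2 : Continuous fun u : RSCoord n d → ℂ => (matZ u).det :=
    Continuous.matrix_det (continuous_matrix fun i j => continuous_apply _)
  have h3 : ∀ α, Continuous fun u : RSCoord n d → ℂ => (matWV u α).det := by
    intro α
    refine Continuous.matrix_det (continuous_const.add (continuous_matrix fun i j => ?_))
    exact (continuous_apply _).mul (continuous_apply _)
  have : repSpace n d = {u | (matX u).det ≠ 0} ∩ ({u | (matZ u).det ≠ 0} ∩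
      ⋂ α, {u | (matWV u α).det ≠ 0}) := by
    ext u; simp [repSpace]
  rw [this]
  exact (isOpen_ne_fun h1 continuous_const).inter ((isOpen_ne_fun h2 continuous_const).inter
    (isOpen_iInter_of_finite fun α => isOpen_ne_fun (h3 α) continuous_const))

/-- The moment map `X Z X⁻¹ Z⁻¹ (Id + W_1 V_1)⁻¹ ⋯ (Id + W_d V_d)⁻¹`. -/
def momentMap (u : RSCoord n d → ℂ) : Matrix (Fin n) (Fin n) ℂ :=
  matX u * matZ u * (matX u)⁻¹ * (matZ u)⁻¹ * (List.ofFn fun α : Fin d => (matWV u α)⁻¹).prod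

/-- The level set of the moment map at `q Id`. -/
def levelSet (n d : ℕ) (q : ℂ) : Set (RSCoord n d → ℂ) :=
  {u | u ∈ repSpace n d ∧ momentMap u = q • (1 : Matrix (Fin n) (Fin n) ℂ)}

theorem levelSet_subset (n d : ℕ) (q : ℂ) : levelSet n d q ⊆ repSpace n d := fun _ h => h.1

/-- The action `(g X g⁻¹, g Z g⁻¹, V_α g⁻¹, g W_α)` of the general linear group. -/
def glAct (g : GL (Fin n) ℂ) (u : RSCoord n d → ℂ) : RSCoord n d → ℂ
  | .X i j => (g.1 * matX u * (g⁻¹).1) i j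
  | .Z i j => (g.1 * matZ u * (g⁻¹).1) i j
  | .V α j => Matrix.vecMul (fun k => u (.V α k)) (g⁻¹).1 j
  | .W α i => Matrix.mulVec g.1 (fun k => u (.W α k)) i

/-- Two points of the level set lie in the same orbit of the general linear group. -/
def glRel (n d : ℕ) (q : ℂ) (u v : levelSet n d q) : Prop :=
  ∃ g : GL (Fin n) ℂ, v.1 = glAct g u.1

/-- The coordinate ring of the spin Ruijsenaars-Schneider phase space, the (geometric) quotient of the
level set by the general linear group. -/
abbrev RSRing (n d : ℕ) (q : ℂ) : Subalgebra ℂ (Quot (glRel n d q) → ℂ) :=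
  RegQuot (levelSet n d q) (glRel n d q)

/-- The arrows of the double quiver: `(none, false)`, `(none, true)` are the loops `x`, `x*` at the
vertex `0`, and `(some α, false)`, `(some α, true)` are `v_α : ∞ → 0` and `v_α* : 0 → ∞`. -/
abbrev Arrow (d : ℕ) : Type := Option (Fin d) × Bool

namespace Arrow

/-- The position of an arrow in the order `x < x* < v_1 < v_1* < ⋯ < v_d < v_d*`. -/
def pos (a : Arrow d) : ℕ :=
  2 * (a.1.elim 0 fun α => α.1 + 1) + (if a.2 then 1 else 0)

/-- The arrow `a*`. -/
def star (a : Arrow d) : Arrow d := (a.1, !a.2)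

/-- The sign `ε(a)`: `1` on `x`, `v_α` and `-1` on `x*`, `v_α*`. -/
def eps (a : Arrow d) : ℂ := if a.2 then -1 else 1

/-- The parameter `γ_a`: `0` on `x`, `x*` and `1` on `v_α`, `v_α*`. -/
def gam (a : Arrow d) : ℂ := a.1.elim 0 fun _ => 1

end Arrow

/-- Indices of a basis of `ℂⁿ ⊕ ℂ`, the spaces at the vertices `0` and `∞`. -/
abbrev BIdx (n : ℕ) : Type := Fin n ⊕ Unit

/-- The coordinate which is the `(i, j)` entry of the matrix of `a` acting on `ℂⁿ ⊕ ℂ`; it is `none`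
outside of the block where that matrix may be nonzero. -/
def blockCoord : Arrow d → BIdx n → BIdx n → Option (RSCoord n d)
  | (none, false), .inl i, .inl j => some (.X i j)
  | (none, true), .inl i, .inl j => some (.Z i j)
  | (some α, false), .inr _, .inl j => some (.V α j)
  | (some α, true), .inl i, .inr _ => some (.W α i)
  | _, _, _ => none

/-- The `(i, j)` entry of the matrix of `a`, as a function on the representation space. -/
def entry (a : Arrow d) (i j : BIdx n) : Reg (repSpace n d) :=
  (blockCoord a i j).elim 0 (coordFn (repSpace n d))

/-- The `(i, j)` entry of the matrix `∂_a`: the derivative with respect to the `(j, i)` entry of the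
matrix of `a`. -/
def del (a : Arrow d) (i j : BIdx n) : Derivation ℂ (Reg (repSpace n d)) (Reg (repSpace n d)) :=
  (blockCoord a j i).elim 0 (partialD (isOpen_repSpace n d))

/-- The `(i, j)` entry of the matrix `∂_{a*} X_{a*} - X_a ∂_a` of vector fields. -/
def fusField (a : Arrow d) (i j : BIdx n) :
    Derivation ℂ (Reg (repSpace n d)) (Reg (repSpace n d)) :=
  ∑ k, (entry a.star k j • del a.star i k - entry a i k • del a k j)

/-- The quasi-Poisson bivector
`P = ½ ∑_a ε(a) tr[(γ_a Id + X_{a*} X_a) ∂_a ∧ ∂_{a*}]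
  - ½ ∑_{a < b} tr[(∂_{a*} X_{a*} - X_a ∂_a) ∧ (∂_{b*} X_{b*} - X_b ∂_b)]`. -/
def quasiP (n d : ℕ) : Bider (Reg (repSpace n d)) :=
  (1 / 2 : ℂ) • ∑ a : Arrow d, a.eps • ∑ i : BIdx n, ∑ j : BIdx n, ∑ k : BIdx n,
      (algebraMap ℂ (Reg (repSpace n d)) (if i = j then a.gam else 0)
        + ∑ l : BIdx n, entry a.star i l * entry a l j) • wedge (del a j k) (del a.star k i)
  + (-(1 / 2) : ℂ) • ∑ a : Arrow d, ∑ b ∈ Finset.univ.filter (fun b : Arrow d => a.pos < b.pos),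
      ∑ i : BIdx n, ∑ j : BIdx n, wedge (fusField a i j) (fusField b j i)

/-- The vector field `tr[X_{a*} ∂_{a*} - X_a ∂_a]` for `a = v_α`, generating the scaling action
on `(W_α, V_α)`. -/
def scaleField (n : ℕ) {d : ℕ} (α : Fin d) :
    Derivation ℂ (Reg (repSpace n d)) (Reg (repSpace n d)) :=
  ∑ i : BIdx n, ∑ j : BIdx n,
    (entry (some α, true) i j • del (some α, true) j i
      - entry (some α, false) i j • del (some α, false) j i)

/-- The bivector `ψ_z = ∑_{α < β} z_{αβ} tr[X_{v_α*} ∂_{v_α*} - X_{v_α} ∂_{v_α}] ∧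
tr[X_{v_β*} ∂_{v_β*} - X_{v_β} ∂_{v_β}]`. -/
def psiRep (n : ℕ) {d : ℕ} (z : Param d) : Bider (Reg (repSpace n d)) :=
  ∑ p : {p : Fin d × Fin d // p.1 < p.2}, z p • wedge (scaleField n p.1.1) (scaleField n p.1.2)

/-- `B` is the bracket on the phase space defined by `P` through quasi-Poisson reduction. -/
def IsReducedP (q : ℂ) (B : Bider (RSRing n d q)) : Prop :=
  IsReduction (levelSet_subset n d q) (glRel n d q) (quasiP n d) B

/-- `B` is the bracket on the phase space defined by `ψ_z` through quasi-Poisson reduction. -/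
def IsReducedPsi (q : ℂ) (z : Param d) (B : Bider (RSRing n d q)) : Prop :=
  IsReduction (levelSet_subset n d q) (glRel n d q) (psiRep n z) B

end Phase

end SpinRS

end

/-!
The brackets on `C` come from quasi-Poisson reduction, those on the local phase space from a slice.

**Reduction.** `P` is a sum of brackets of single spins `(V_α, W_α)`, of a fusion term for the actions
of `GL_n` on `X`, `Z` and the spins, and of a combination of the bivectors `D_α ∧ D_β`, where `D_α`
scales `W_α` and `V_α` (`quasiP_eq`). Fusion changes a jacobiator by Cartan trivectors
(`jac_sub_fusion`), so that the jacobiator of `z₀ P + ψ_z` is a multiple of the Cartan trivector of the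
total action (`jac_combined`), which vanishes on invariant functions. The differential of the equation
of `Φ⁻¹(q Id)` is surjective: a conormal covector produces a matrix commuting with `X` and `Z`, on whose
range `X` and `Z` `q`-commute, and determinants with `q ^ k ≠ 1` make it vanish (`eq_zero_of_conormal`).
Hence functions vanishing on the level set have differentials vanishing on its tangent vectors, and as
Hamiltonian vectors of invariant functions are tangent (`dLevel_hamVec`), the brackets descend
(`quasiP_descends`, `psiRep_descends`).

**The slice.** The local phase space parametrizes points of the level set with `X` diagonal and
`∑ W_α = (1, …, 1)`, by `a^α = W_α` and `b^α = V_α Z_α` (`sliceVec`). The projection `rho` along gauge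
orbits turns the quasi-Poisson bivector into a bivector on the slice, and computing its Hamiltonian
vectors (`hamH_x`, `hamH_a`, `hamH_b`) gives the local formulas (`bracketZero_spec`, `bracketPsi_spec`).
Pullback along the slice intertwines the brackets of invariant functions (`bracketLoc_slicePull`).
By a Vandermonde argument the differentials of the invariants `tr X ^ k` and `V_α Z_α X ^ k W_β` span the
cotangent spaces (`tangent_eq_zero_of_slice`), so the Jacobi identity carries over (`jac_bracketLoc`).

**Non-degeneracy.** If the Hamiltonian vector of a basic covector is tangent to the orbit, it vanishes on
the vectors tangent to the level set (`pair_eq_zero_of_combVec`). As `S_n` acts freely, passing to its quotient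
does not change tangent spaces (`exists_extension_tangent`).

**Order.** At a point of the slice where the `Z_k` are Cauchy matrices up to diagonal factors, the values
of `{-,-}_0` and of the `D_α ∧ D_β` with `1 < α < β` are independent (`exists_linearIndependent`), and
independence is transported to both quotients (`exists_order_transfer`).
-/

noncomputable section

namespace SpinRS

open MvPolynomial (eval pderiv)

open Finset (add_sum_erase filter_true_of_mem mem_erase mem_filter mem_insert mem_insert_of_mem
  mem_insert_self mem_range mem_univ mul_sum ne_of_mem_erase prod_ne_zero_iff range range_zero smul_sum
  sum_add_distrib sum_comm sum_congr sum_const_zero sum_empty sum_eq_single sum_eq_zero sum_filter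
  sum_insert sum_ite_eq sum_ite_eq' sum_mul sum_mul_sum sum_neg_distrib sum_range sum_range_add
  sum_range_succ sum_singleton sum_sub_distrib sum_subtype univ univ_unique)

/-- Vectors and covectors of the representation space. -/
abbrev RVec (n d : ℕ) := RSCoord n d → ℂ

/-- Vectors and covectors of the local phase space. -/
abbrev HVec (n d : ℕ) := HCoord n d → ℂ

/-- Square matrices. -/
abbrev Mat (n : ℕ) := Matrix (Fin n) (Fin n) ℂ

/-- The derivations of a ring of functions: vector fields. -/
notation "Der(" A ")" => Derivation ℂ A A

/-! ### Tangent vectors and derivations on coordinate rings -/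

section Generic

variable {ι : Type} {U : Set (ι → ℂ)} {X : Type} {A : Subalgebra ℂ (X → ℂ)}

theorem Reg.inv_mem {f : U → ℂ} (hf : f ∈ Reg U) (h0 : ∀ u, f u ≠ 0) :
    (fun u => (f u)⁻¹) ∈ Reg U := by
  obtain ⟨p, r, h⟩ := hf
  refine ⟨r, p, fun u => ⟨fun hp => h0 u ?_, ?_⟩⟩
  · rw [(h u).2, hp, zero_div]
  · simp only [(h u).2, inv_div]

/-- Polynomials as regular functions. -/
def polyFn (U : Set (ι → ℂ)) : MvPolynomial ι ℂ →ₐ[ℂ] Reg U := MvPolynomial.aeval (coordFn U)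

/-- Evaluation of regular functions at a point. -/
def evalReg (u : U) : Reg U →ₐ[ℂ] ℂ := (Pi.evalAlgHom ℂ (fun _ : U => ℂ) u).comp (Reg U).val

theorem evalReg_apply (u : U) (f : Reg U) : evalReg u f = f.1 u := rfl

theorem polyFn_apply (p : MvPolynomial ι ℂ) (u : U) :
    (polyFn U p).1 u = eval u.1 p := by
  have : (evalReg u).comp (polyFn U) = MvPolynomial.aeval u.1 := by
    ext c
    simp [polyFn, evalReg_apply, coordFn]
  have h := DFunLike.congr_fun this p
  rw [← evalReg_apply]
  exact h.trans (MvPolynomial.aeval_eq_eval u.1 ▸ rfl)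

@[simp] theorem polyFn_X (c : ι) : polyFn U (MvPolynomial.X c) = coordFn U c := by simp [polyFn]

@[simp] theorem coordFn_apply (c : ι) (u : U) : (coordFn U c).1 u = u.1 c := rfl

/-- Every regular function becomes polynomial after multiplication by a polynomial without zeros. -/
theorem Reg.exists_poly (f : Reg U) : ∃ p r : MvPolynomial ι ℂ,
    (∀ u : U, eval u.1 r ≠ 0) ∧ f * polyFn U r = polyFn U p := by
  obtain ⟨p, r, h⟩ := f.2
  refine ⟨p, r, fun u => (h u).1, ?_⟩
  ext u
  have := (h u).1
  change f.1 u * (polyFn U r).1 u = (polyFn U p).1 u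
  rw [polyFn_apply, polyFn_apply, (h u).2]
  field_simp

theorem tangent_one {x : X} {v : A →ₗ[ℂ] ℂ} (hv : IsTangentVector A x v) : v 1 = 0 := by
  have h := hv 1 1
  simp only [mul_one, OneMemClass.coe_one, Pi.one_apply, one_mul] at h
  linear_combination -h

theorem tangent_algebraMap {x : X} {v : A →ₗ[ℂ] ℂ}
    (hv : IsTangentVector A x v) (c : ℂ) : v (algebraMap ℂ A c) = 0 := by
  rw [Algebra.algebraMap_eq_smul_one, map_smul, tangent_one hv, smul_zero]

/-- Tangent vectors of `U` are determined by their values on the coordinate functions. -/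
theorem tangent_ext {u : U} {v w : Reg U →ₗ[ℂ] ℂ} (hv : IsTangentVector (Reg U) u v)
    (hw : IsTangentVector (Reg U) u w) (h : ∀ c, v (coordFn U c) = w (coordFn U c)) : v = w := by
  have hp : ∀ p, v (polyFn U p) = w (polyFn U p) := by
    intro p
    induction p using MvPolynomial.induction_on with
    | C a =>
      have : polyFn U (MvPolynomial.C a) = algebraMap ℂ (Reg U) a := by
        simp [polyFn, MvPolynomial.algHom_C]
      rw [this, tangent_algebraMap hv, tangent_algebraMap hw]
    | add p q hp hq => simp only [map_add, hp, hq]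
    | mul_X p i hp => rw [map_mul, hv, hw, hp, polyFn_X, h]
  ext f
  obtain ⟨p, r, hr, hf⟩ := Reg.exists_poly f
  have h1 := hv f (polyFn U r)
  have h2 := hw f (polyFn U r)
  rw [hf, hp] at h1
  rw [hf, ← hp r] at h2
  have h3 : (polyFn U r).1 u ≠ 0 := by rw [polyFn_apply]; exact hr u
  apply mul_left_cancel₀ h3
  linear_combination h2 - h1

/-- The tangent vector at `u` defined by a vector field. -/
def derAt (x : X) (D : Der(A)) : A →ₗ[ℂ] ℂ where
  toFun f := (D f).1 x
  map_add' f g := by simp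
  map_smul' c f := by simp

@[simp] theorem derAt_apply (x : X) (D : Der(A)) (f : A) : derAt x D f = (D f).1 x := rfl

theorem derAt_tangent (x : X) (D : Der(A)) : IsTangentVector A x (derAt x D) := by
  intro f g
  simp [derAt_apply]

theorem derivation_ext_coord {D E : Der(Reg U)}
    (h : ∀ c, D (coordFn U c) = E (coordFn U c)) : D = E := by
  ext f u
  have : derAt u D = derAt u E :=
    tangent_ext (derAt_tangent u D) (derAt_tangent u E) fun c => by simp [h c]
  exact DFunLike.congr_fun this f

/-- The tangent vector `f ↦ B(f, g)(x)`. -/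
def derAtLeft (x : X) (B : Bider A) (g : A) : A →ₗ[ℂ] ℂ where
  toFun f := (B f g).1 x
  map_add' f g := by simp
  map_smul' c f := by simp

@[simp] theorem derAtLeft_apply (x : X) (B : Bider A)
    (f g : A) : derAtLeft x B g f = (B f g).1 x := rfl

theorem derAtLeft_tangent (x : X) (B : Bider A) (g : A) :
    IsTangentVector A x (derAtLeft x B g) := by
  intro f h
  simp [derAtLeft_apply]

/-- Biderivations are determined by their values on the coordinate functions. -/
theorem bider_ext_coord {B C : Bider (Reg U)}
    (h : ∀ c e, B (coordFn U c) (coordFn U e) = C (coordFn U c) (coordFn U e)) : B = C := by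
  ext f g u
  have h1 : ∀ c, derAt u (B (coordFn U c)) = derAt u (C (coordFn U c)) := fun c =>
    tangent_ext (derAt_tangent _ _) (derAt_tangent _ _) fun e => by simp [h c e]
  have h2 : derAtLeft u B g = derAtLeft u C g :=
    tangent_ext (derAtLeft_tangent _ _ _) (derAtLeft_tangent _ _ _) fun c => by
      simpa using DFunLike.congr_fun (h1 c) g
  exact DFunLike.congr_fun h2 f

end Generic

section Bivector

variable {A : Type} [CommRing A] [Algebra ℂ A]

theorem IsBivector.antisymm {P : Bider A} (hP : IsBivector P) (f g : A) : P f g = -P g f := by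
  have h := hP (f + g)
  simp only [map_add, Derivation.add_apply, hP f, hP g, zero_add, add_zero] at h
  exact eq_neg_of_add_eq_zero_right h

theorem wedge_apply (D E : Der(A)) (f g : A) : wedge D E f g = D f * E g - E f * D g := by
  simp [wedge]

theorem wedge_isBivector (D E : Der(A)) : IsBivector (wedge D E) := by
  intro f; rw [wedge_apply]; ring

theorem IsBivector.add {P Q : Bider A}
    (hP : IsBivector P) (hQ : IsBivector Q) : IsBivector (P + Q) := by
  intro f; simp [hP f, hQ f]

theorem IsBivector.smul {P : Bider A} (hP : IsBivector P) (c : ℂ) : IsBivector (c • P) := by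
  intro f; simp [hP f]

theorem derivation_sum_apply {M : Type} [AddCommGroup M] [Module A M]
    [Module ℂ M] {J : Type} (D : J → Derivation ℂ A M) (s : Finset J) (f : A) :
    (∑ j ∈ s, D j) f = ∑ j ∈ s, D j f := by
  classical
  induction s using Finset.induction_on with
  | empty => simp
  | insert j s hj ih => rw [sum_insert hj, sum_insert hj, Derivation.add_apply, ih]

theorem IsBivector.sum {J : Type} {P : J → Bider A}
    (s : Finset J) (hP : ∀ j ∈ s, IsBivector (P j)) : IsBivector (∑ j ∈ s, P j) := by
  intro f
  rw [derivation_sum_apply, derivation_sum_apply]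
  exact sum_eq_zero fun j hj => hP j hj f

theorem bider_sum_apply {J : Type} (P : J → Bider A)
    (s : Finset J) (f g : A) : (∑ j ∈ s, P j) f g = ∑ j ∈ s, P j f g := by
  rw [derivation_sum_apply, derivation_sum_apply]

/-- The jacobiator of a bracket. -/
def jac (P : Bider A) (f g h : A) : A := P f (P g h) + P g (P h f) + P h (P f g)

end Bivector

/-! ### Partial derivatives and directional derivatives -/

section Directional

variable {ι : Type} {U : Set (ι → ℂ)}

theorem partialD_polyFn (hU : IsOpen U) (e : ι) (p : MvPolynomial ι ℂ) :
    partialD hU e (polyFn U p) = polyFn U (pderiv e p) := by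
  ext u
  have h : ∀ u : U, eval u.1 (1 : MvPolynomial ι ℂ) ≠ 0 ∧
      (polyFn U p).1 u = eval u.1 p / eval u.1 (1 : MvPolynomial ι ℂ) :=
    fun u => ⟨by simp, by rw [polyFn_apply]; simp⟩
  have := (hasDerivAt_ext hU e h u).deriv
  rw [polyFn_apply]
  refine this.trans ?_
  simp

theorem partialD_coordFn (hU : IsOpen U) (e c : ι) :
    partialD hU e (coordFn U c) = algebraMap ℂ _ (dirVec e c) := by
  classical
  rw [← polyFn_X, partialD_polyFn]
  by_cases h : c = e
  · subst h; simp [dirVec]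
  · rw [MvPolynomial.pderiv_X_of_ne h]; simp [dirVec, h]

/-- The differential of a regular function at a point of an open set, as a covector. -/
def grad (hU : IsOpen U) (F : Reg U) (u : U) : ι → ℂ := fun e => (partialD hU e F).1 u

theorem grad_coordFn (hU : IsOpen U) (c : ι) (u : U) : grad hU (coordFn U c) u = dirVec c := by
  classical
  funext e
  simp only [grad, partialD_coordFn]
  change dirVec e c = dirVec c e
  simp [dirVec, Pi.single_apply, eq_comm]

variable [Fintype ι]

/-- The pairing of covectors and vectors. -/
def pair (ζ δ : ι → ℂ) : ℂ := ∑ e, ζ e * δ e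

theorem pair_dirVec (ζ : ι → ℂ) (c : ι) : pair ζ (dirVec c) = ζ c := by
  classical
  simp [pair, dirVec, Pi.single_apply]

theorem dirVec_pair (δ : ι → ℂ) (c : ι) : pair (dirVec c) δ = δ c := by
  classical
  simp [pair, dirVec, Pi.single_apply]

/-- The derivative in the direction of a vector, as a tangent vector. -/
def dirAt (hU : IsOpen U) (u : U) (δ : ι → ℂ) : Reg U →ₗ[ℂ] ℂ where
  toFun F := pair (grad hU F u) δ
  map_add' F G := by simp [pair, grad, add_mul, sum_add_distrib]
  map_smul' c F := by simp [pair, grad, mul_sum, mul_assoc]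

theorem dirAt_apply (hU : IsOpen U) (u : U) (δ : ι → ℂ) (F : Reg U) :
    dirAt hU u δ F = pair (grad hU F u) δ := rfl

theorem dirAt_tangent (hU : IsOpen U) (u : U) (δ : ι → ℂ) :
    IsTangentVector (Reg U) u (dirAt hU u δ) := by
  intro F G
  simp only [dirAt_apply, pair, grad, Derivation.leibniz, mul_sum, ← sum_add_distrib]
  refine sum_congr rfl fun e _ => ?_
  simp only [smul_eq_mul, Subalgebra.coe_add, Subalgebra.coe_mul, Pi.add_apply, Pi.mul_apply]
  ring

theorem tangent_eq_dirAt (hU : IsOpen U) {u : U} {v : Reg U →ₗ[ℂ] ℂ}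
    (hv : IsTangentVector (Reg U) u v) : v = dirAt hU u fun c => v (coordFn U c) :=
  tangent_ext hv (dirAt_tangent _ _ _) fun c => by rw [dirAt_apply, grad_coordFn, dirVec_pair]

/-- The derivative of a polynomial at a point in the direction of a vector. -/
def dd (y δ : ι → ℂ) (p : MvPolynomial ι ℂ) : ℂ :=
  ∑ e, eval y (pderiv e p) * δ e

theorem dd_mul (y δ : ι → ℂ) (p q : MvPolynomial ι ℂ) : dd y δ (p * q) =
    dd y δ p * eval y q + eval y p * dd y δ q := by
  simp only [dd, sum_mul, mul_sum, ← sum_add_distrib]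
  refine sum_congr rfl fun e _ => ?_
  rw [Derivation.leibniz]
  simp only [smul_eq_mul, map_add, map_mul]
  ring

theorem dd_add (y δ : ι → ℂ) (p q : MvPolynomial ι ℂ) : dd y δ (p + q) = dd y δ p + dd y δ q := by
  simp [dd, add_mul, sum_add_distrib]

theorem dd_C (y δ : ι → ℂ) (c : ℂ) : dd y δ (MvPolynomial.C c) = 0 := by simp [dd]

theorem dd_X (y δ : ι → ℂ) (c : ι) : dd y δ (MvPolynomial.X c) = δ c := by
  classical
  simp only [dd, MvPolynomial.pderiv_X, Pi.single_apply]
  simp [apply_ite]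

theorem dd_sum (y δ : ι → ℂ) {κ : Type} (s : Finset κ) (p : κ → MvPolynomial ι ℂ) :
    dd y δ (∑ k ∈ s, p k) = ∑ k ∈ s, dd y δ (p k) := by
  simp only [dd, map_sum, sum_mul]
  exact sum_comm

theorem dirAt_polyFn (hU : IsOpen U) (u : U) (δ : ι → ℂ) (p : MvPolynomial ι ℂ) :
    dirAt hU u δ (polyFn U p) = dd u.1 δ p := by
  simp only [dirAt_apply, pair, dd, grad, partialD_polyFn, polyFn_apply]

/-- The differential of a polynomial, as a continuous linear form. -/
def ddL (y : ι → ℂ) (p : MvPolynomial ι ℂ) : (ι → ℂ) →L[ℂ] ℂ :=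
  ∑ e, eval y (pderiv e p) • ContinuousLinearMap.proj e

theorem ddL_apply (y δ : ι → ℂ) (p : MvPolynomial ι ℂ) : ddL y p δ = dd y δ p := by simp [ddL, dd]

theorem hasStrictFDerivAt_poly (y : ι → ℂ) (p : MvPolynomial ι ℂ) :
    HasStrictFDerivAt (fun u : ι → ℂ => eval u p) (ddL y p) y := by
  induction p using MvPolynomial.induction_on with
  | C a =>
    have : ddL y (MvPolynomial.C a) = 0 := by ext δ; simp [ddL_apply, dd_C]
    rw [this]
    simpa using hasStrictFDerivAt_const a y
  | add p q hp hq =>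
    have : ddL y (p + q) = ddL y p + ddL y q := by ext δ; simp [ddL_apply, dd_add]
    rw [this]
    simpa using! hp.add hq
  | mul_X p i hp =>
    have h := hp.mul (ContinuousLinearMap.hasStrictFDerivAt
      (ContinuousLinearMap.proj (R := ℂ) (φ := fun _ : ι => ℂ) i) (x := y))
    have : ddL y (p * MvPolynomial.X i) =
        eval y p • ContinuousLinearMap.proj i + y i • ddL y p := by
      apply ContinuousLinearMap.ext
      intro δ
      simp only [ddL_apply, dd_mul, dd_X, MvPolynomial.eval_X, add_apply,
        smul_apply, ContinuousLinearMap.proj_apply, smul_eq_mul]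
      ring
    rw [this]
    simpa using! h

/-- A regular function which is constant along a curve in `U` has derivative zero in the direction
of the curve. -/
theorem dirAt_eq_zero_of_curve (hU : IsOpen U) (u : U) (δ : ι → ℂ) (γ : ℂ → ι → ℂ) (h0 : γ 0 = u.1)
    (hγ : HasDerivAt γ δ 0) (G : Reg U) (c : ℂ)
    (hc : ∀ᶠ t in nhds (0 : ℂ), ∃ h : γ t ∈ U, G.1 ⟨γ t, h⟩ = c) : dirAt hU u δ G = 0 := by
  obtain ⟨p, r, hr, hG⟩ := Reg.exists_poly G
  have hu : G.1 u = c := by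
    obtain ⟨h, h'⟩ := hc.self_of_nhds
    rw [← h']; exact congrArg G.1 (Subtype.ext h0.symm)
  have hval : ∀ w : U, G.1 w * eval w.1 r = eval w.1 p := by
    intro w
    have := congrArg (fun f : Reg U => f.1 w) hG
    simpa [polyFn_apply] using this
  have hp := ((hasStrictFDerivAt_poly (γ 0) p).hasFDerivAt.comp_hasDerivAt (0 : ℂ) hγ)
  have hq := ((hasStrictFDerivAt_poly (γ 0) r).hasFDerivAt.comp_hasDerivAt (0 : ℂ) hγ).const_mul c
  have he : (fun t => c * ((fun u : ι → ℂ => eval u r) ∘ γ) t) =ᶠ[nhds 0]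
      ((fun u : ι → ℂ => eval u p) ∘ γ) := by
    filter_upwards [hc] with t ht
    obtain ⟨h, h'⟩ := ht
    have := hval ⟨γ t, h⟩
    rw [h'] at this
    exact this
  have hd := (hp.congr_of_eventuallyEq he).unique hq
  rw [ddL_apply, ddL_apply, h0] at hd
  have h1 := dirAt_tangent hU u δ G (polyFn U r)
  rw [hG, dirAt_polyFn, dirAt_polyFn, hu, hd, polyFn_apply] at h1
  have h2 : eval u.1 r * dirAt hU u δ G = 0 := by linear_combination -h1
  exact (mul_eq_zero.1 h2).resolve_left (hr u)

end Directional

/-! ### Reduction of brackets to a quotient -/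

section Reduction

variable {ι : Type} {U Y : Set (ι → ℂ)} (hY : Y ⊆ U) (rel : Y → Y → Prop)

/-- `F` restricts on `Y` to the pullback of `f`. -/
def IsLift (F : Reg U) (f : RegQuot Y rel) : Prop :=
  ∀ y : Y, F.1 ⟨y.1, hY y.2⟩ = f.1 (Quot.mk rel y)

/-- The conditions under which the bracket `P` on `U` descends to the quotient of `Y`. -/
structure Descends (P : Bider (Reg U)) : Prop where
  bivector : IsBivector P
  left : ∀ (F G : Reg U) (g : RegQuot Y rel), (∀ y : Y, F.1 ⟨y.1, hY y.2⟩ = 0) →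
    IsLift hY rel G g → ∀ y : Y, (P F G).1 ⟨y.1, hY y.2⟩ = 0
  inv : ∀ (F G : Reg U) (f g : RegQuot Y rel), IsLift hY rel F f → IsLift hY rel G g →
    ∀ y y' : Y, rel y y' → (P F G).1 ⟨y.1, hY y.2⟩ = (P F G).1 ⟨y'.1, hY y'.2⟩

variable {hY rel}

theorem Descends.well_defined {P : Bider (Reg U)} (hP : Descends hY rel P) {F F' G G' : Reg U}
    {f g : RegQuot Y rel} (hF : IsLift hY rel F f) (hF' : IsLift hY rel F' f)
    (hG : IsLift hY rel G g) (hG' : IsLift hY rel G' g) (y : Y) :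
    (P F G).1 ⟨y.1, hY y.2⟩ = (P F' G').1 ⟨y.1, hY y.2⟩ := by
  have h1 := hP.left (F - F') G g (fun y => by
    change F.1 _ - F'.1 _ = 0
    rw [hF, hF', sub_self]) hG y
  have h2 := hP.left (G - G') F' f (fun y => by
    change G.1 _ - G'.1 _ = 0
    rw [hG, hG', sub_self]) hF' y
  rw [hP.bivector.antisymm] at h2
  simp only [map_sub, Derivation.sub_apply] at h1 h2
  have h1' : (P F G).1 ⟨y.1, hY y.2⟩ - (P F' G).1 ⟨y.1, hY y.2⟩ = 0 := h1
  have h2' : -((P F' G).1 ⟨y.1, hY y.2⟩ - (P F' G').1 ⟨y.1, hY y.2⟩) = 0 := h2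
  linear_combination h1' - h2'

theorem IsLift.add {F F' : Reg U} {f f' : RegQuot Y rel} (h : IsLift hY rel F f)
    (h' : IsLift hY rel F' f') : IsLift hY rel (F + F') (f + f') := fun y => by
  change F.1 _ + F'.1 _ = f.1 _ + f'.1 _
  rw [h, h']

theorem IsLift.mul {F F' : Reg U} {f f' : RegQuot Y rel} (h : IsLift hY rel F f)
    (h' : IsLift hY rel F' f') : IsLift hY rel (F * F') (f * f') := fun y => by
  change F.1 _ * F'.1 _ = f.1 _ * f'.1 _
  rw [h, h']

theorem IsLift.smul {F : Reg U} {f : RegQuot Y rel} (h : IsLift hY rel F f) (c : ℂ) :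
    IsLift hY rel (c • F) (c • f) := fun y => by
  change c * F.1 _ = c * f.1 _
  rw [h]

theorem restrict_mem (hY : Y ⊆ U) (F : Reg U) : (fun y : Y => F.1 ⟨y.1, hY y.2⟩) ∈ Reg Y := by
  obtain ⟨p, r, h⟩ := F.2
  exact ⟨p, r, fun y => h ⟨y.1, hY y.2⟩⟩

/-- A bracket satisfying the descent conditions induces a bracket on the quotient. -/
theorem Descends.exists_reduction {P : Bider (Reg U)} (hP : Descends hY rel P)
    (hext : ∀ f : RegQuot Y rel, ∃ F : Reg U, IsLift hY rel F f) :
    ∃ B : Bider (RegQuot Y rel), IsReduction hY rel P B := by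
  choose E hE using hext
  let β : RegQuot Y rel → RegQuot Y rel → RegQuot Y rel := fun f g =>
    ⟨Quot.lift (fun y : Y => (P (E f) (E g)).1 ⟨y.1, hY y.2⟩)
      (fun y y' h => hP.inv _ _ _ _ (hE f) (hE g) y y' h), restrict_mem hY (P (E f) (E g))⟩
  have hβ : ∀ {F G : Reg U} {f g : RegQuot Y rel}, IsLift hY rel F f → IsLift hY rel G g →
      ∀ y : Y, (β f g).1 (Quot.mk rel y) = (P F G).1 ⟨y.1, hY y.2⟩ :=
    fun hF hG y => hP.well_defined (hE _) hF (hE _) hG y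
  have hext' : ∀ {a b : RegQuot Y rel}, (∀ y : Y, a.1 (Quot.mk rel y) = b.1 (Quot.mk rel y)) →
      a = b := by
    intro a b h
    apply Subtype.ext
    funext x
    induction x using Quot.ind with
    | mk y => exact h y
  let B₁ : RegQuot Y rel → Der(RegQuot Y rel) := fun f =>
    Derivation.mk'
      { toFun := β f
        map_add' := fun g g' => hext' fun y => by
          rw [hβ (hE f) ((hE g).add (hE g'))]
          change _ = (β f g).1 _ + (β f g').1 _
          rw [hβ (hE f) (hE g), hβ (hE f) (hE g'), map_add]
          rfl
        map_smul' := fun c g => hext' fun y => by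
          rw [hβ (hE f) ((hE g).smul c)]
          change _ = c * (β f g).1 _
          rw [hβ (hE f) (hE g), Derivation.map_smul]
          rfl }
      (fun g g' => hext' fun y => by
        change (β f (g * g')).1 _ = g.1 _ * (β f g').1 _ + g'.1 _ * (β f g).1 _
        rw [hβ (hE f) ((hE g).mul (hE g')), hβ (hE f) (hE g), hβ (hE f) (hE g'),
          Derivation.leibniz, ← hE g, ← hE g']
        rfl)
  have hB₁ : ∀ f g, B₁ f g = β f g := fun f g => rfl
  refine ⟨Derivation.mk'
      { toFun := B₁
        map_add' := fun f f' => Derivation.ext fun g => hext' fun y => by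
          change (β (f + f') g).1 _ = (β f g).1 _ + (β f' g).1 _
          rw [hβ ((hE f).add (hE f')) (hE g), hβ (hE f) (hE g), hβ (hE f') (hE g), map_add]
          rfl
        map_smul' := fun c f => Derivation.ext fun g => hext' fun y => by
          change (β (c • f) g).1 _ = c * (β f g).1 _
          rw [hβ ((hE f).smul c) (hE g), hβ (hE f) (hE g), Derivation.map_smul]
          rfl }
      (fun f f' => Derivation.ext fun g => hext' fun y => by
        change (β (f * f') g).1 _ = f.1 _ * (β f' g).1 _ + f'.1 _ * (β f g).1 _
        rw [hβ ((hE f).mul (hE f')) (hE g), hβ (hE f) (hE g), hβ (hE f') (hE g),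
          Derivation.leibniz, ← hE f, ← hE f']
        rfl), ?_⟩
  intro F G f g hF hG y
  exact (hβ hF hG y).symm

theorem IsReduction.unique {P : Bider (Reg U)} {B B' : Bider (RegQuot Y rel)}
    (hext : ∀ f : RegQuot Y rel, ∃ F : Reg U, IsLift hY rel F f)
    (h : IsReduction hY rel P B) (h' : IsReduction hY rel P B') : B = B' := by
  ext f g x
  obtain ⟨F, hF⟩ := hext f
  obtain ⟨G, hG⟩ := hext g
  induction x using Quot.ind with
  | mk y => exact (h F G f g hF hG y).symm.trans (h' F G f g hF hG y)

theorem IsReduction.add {P P' : Bider (Reg U)} {B B' : Bider (RegQuot Y rel)}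
    (h : IsReduction hY rel P B) (h' : IsReduction hY rel P' B') :
    IsReduction hY rel (P + P') (B + B') := fun F G f g hF hG y =>
  congrArg₂ (· + ·) (h F G f g hF hG y) (h' F G f g hF hG y)

theorem IsReduction.smul {P : Bider (Reg U)} {B : Bider (RegQuot Y rel)}
    (h : IsReduction hY rel P B) (c : ℂ) : IsReduction hY rel (c • P) (c • B) :=
  fun F G f g hF hG y => congrArg (c * ·) (h F G f g hF hG y)

theorem IsReduction.zero : IsReduction hY rel (0 : Bider (Reg U)) 0 := fun _ _ _ _ _ _ _ => rfl

theorem IsReduction.sum {J : Type} {P : J → Bider (Reg U)} {B : J → Bider (RegQuot Y rel)}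
    (s : Finset J) (h : ∀ j ∈ s, IsReduction hY rel (P j) (B j)) :
    IsReduction hY rel (∑ j ∈ s, P j) (∑ j ∈ s, B j) := by
  classical
  induction s using Finset.induction_on with
  | empty => exact IsReduction.zero
  | insert j s hj ih =>
    rw [sum_insert hj, sum_insert hj]
    exact (h j (mem_insert_self _ _)).add (ih fun k hk => h k (mem_insert_of_mem hk))

/-- The reduced bracket is Poisson when the jacobiator vanishes on lifts of functions on the
quotient. -/
theorem IsReduction.isPoisson {P : Bider (Reg U)} {B : Bider (RegQuot Y rel)}
    (hext : ∀ f : RegQuot Y rel, ∃ F : Reg U, IsLift hY rel F f)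
    (h : IsReduction hY rel P B) (hP : IsBivector P)
    (hJ : ∀ (F G H : Reg U) (f g k : RegQuot Y rel), IsLift hY rel F f → IsLift hY rel G g →
      IsLift hY rel H k → ∀ y : Y, (jac P F G H).1 ⟨y.1, hY y.2⟩ = 0) : IsPoisson B := by
  constructor
  · intro f
    ext x
    obtain ⟨F, hF⟩ := hext f
    induction x using Quot.ind with
    | mk y =>
      rw [← h F F f f hF hF y, hP F]
      rfl
  · intro f g k
    ext x
    obtain ⟨F, hF⟩ := hext f
    obtain ⟨G, hG⟩ := hext g
    obtain ⟨K, hK⟩ := hext k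
    induction x using Quot.ind with
    | mk y =>
      have h1 := h F (P G K) f (B g k) hF (h G K g k hG hK) y
      have h2 := h G (P K F) g (B k f) hG (h K F k f hK hF) y
      have h3 := h K (P F G) k (B f g) hK (h F G f g hF hG) y
      change (B f (B g k)).1 _ + (B g (B k f)).1 _ + (B k (B f g)).1 _ = 0
      rw [← h1, ← h2, ← h3]
      exact hJ F G K f g k hF hG hK y

end Reduction

/-! ### The order of a pencil -/

section Order

theorem card_pairs_lt (m : ℕ) :
    Fintype.card {p : Fin m × Fin m // p.1 < p.2} = m * (m - 1) / 2 := by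
  rw [Fintype.card_subtype]
  have h : (univ.filter fun p : Fin m × Fin m => p.1 < p.2) =
      (univ.sigma fun b : Fin m => Finset.Iio b).map ⟨fun s => (s.2, s.1), fun s t h => by
          obtain ⟨a, b⟩ := s
          obtain ⟨a', b'⟩ := t
          simp only [Prod.mk.injEq] at h
          obtain ⟨rfl, rfl⟩ := h
          rfl⟩ := by
    ext ⟨a, b⟩
    simp only [mem_filter, mem_univ, true_and, Finset.mem_map, Finset.mem_sigma, Finset.mem_Iio]
    constructor
    · intro h
      exact ⟨⟨b, a⟩, h, rfl⟩
    · rintro ⟨⟨b', a'⟩, h, h'⟩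
      obtain ⟨rfl, rfl⟩ := Prod.mk.inj h'
      exact h
  rw [h, Finset.card_map, Finset.card_sigma]
  simp only [Fin.card_Iio]
  rw [Fin.sum_univ_eq_sum_range (fun i => i) m, Finset.sum_range_id]

variable {X : Type} {A : Subalgebra ℂ (X → ℂ)}

/-- The value of brackets at a point, as a linear map. -/
def valueAtL (x : X) : Bider A →ₗ[ℂ] (A → A → ℂ) where
  toFun P := valueAt x P
  map_add' P Q := by funext f g; rfl
  map_smul' c P := by funext f g; rfl

/-- If `Ψ` is linear in its parameters, the pencil has an order, and this order is at least the
number of members that are independent at some point. -/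
theorem exists_order {d : ℕ} (B₀ : Bider A) (Ψ : Param d → Bider A)
    (hlin : ∀ z, Ψ z = ∑ p, z p • Ψ (Pi.single p 1)) {k : ℕ} (hk : 1 ≤ k)
    (j : Fin k → Option (Param d)) (x : X)
    (hj : LinearIndependent ℂ fun i => valueAt x (pencil B₀ Ψ (j i))) :
    ∃ r, HasPencilOrder (pencil B₀ Ψ) r ∧ k ≤ r := by
  classical
  set S : Set ℕ := {k : ℕ | ∃ (j : Fin k → Option (Param d)) (x : X),
    LinearIndependent ℂ (fun i : Fin k => valueAt x (pencil B₀ Ψ (j i)))} with hS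
  have hkS : k ∈ S := ⟨j, x, hj⟩
  have hbdd : BddAbove S := by
    refine ⟨Fintype.card (Option {p : Fin d × Fin d // p.1 < p.2}), ?_⟩
    rintro l ⟨j, x, hli⟩
    let w : Option {p : Fin d × Fin d // p.1 < p.2} → (A → A → ℂ) := fun o =>
      o.elim (valueAt x B₀) fun p => valueAt x (Ψ (Pi.single p 1))
    have hmem : ∀ i, valueAt x (pencil B₀ Ψ (j i)) ∈ Submodule.span ℂ (Set.range w) := by
      intro i
      cases j i with
      | none => exact Submodule.subset_span ⟨none, rfl⟩
      | some z =>
        have : valueAt x (pencil B₀ Ψ (some z)) = ∑ p, z p • valueAt x (Ψ (Pi.single p 1)) := by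
          change valueAtL x (Ψ z) = _
          rw [hlin z, map_sum]
          exact sum_congr rfl fun p _ => map_smul _ _ _
        rw [this]
        exact Submodule.sum_mem _ fun p _ => Submodule.smul_mem _ _
          (Submodule.subset_span ⟨some p, rfl⟩)
    have hle : Submodule.span ℂ (Set.range fun i => valueAt x (pencil B₀ Ψ (j i))) ≤
        Submodule.span ℂ (Set.range w) := by
      rw [Submodule.span_le]
      rintro _ ⟨i, rfl⟩
      exact hmem i
    have h1 := finrank_span_eq_card hli
    have h2 : (Set.range w).finrank ℂ ≤ _ := finrank_range_le_card w
    have := FiniteDimensional.span_of_finite ℂ (Set.finite_range w)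
    have h3 := Submodule.finrank_mono hle
    rw [h1, Fintype.card_fin] at h3
    exact h3.trans h2
  exact ⟨sSup S, ⟨hk.trans (le_csSup hbdd hkS), Nat.sSup_mem ⟨k, hkS⟩ hbdd,
    fun l hl => le_csSup hbdd hl⟩, le_csSup hbdd hkS⟩

/-- A lower bound for the number of independent members at the point `x`, where the brackets `Ψ z` are
built from vectors `D α`: all but the first one are separated by the functions `φ β`, while `B₀` does
not vanish on two functions, one of which is killed by all the `D α`. -/
theorem exists_linearIndependent {m : ℕ} (B₀ : Bider A) (Ψ : Param (m + 1) → Bider A) (x : X)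
    (D : Fin (m + 1) → A → ℂ) (hΨ : ∀ z f g, valueAt x (Ψ z) f g =
      ∑ p, z p * (D p.1.1 f * D p.1.2 g - D p.1.1 g * D p.1.2 f))
    (φ : Fin m → A) {lam : ℂ} (hlam : lam ≠ 0)
    (hφ : ∀ γ α : Fin m, D γ.succ (φ α) = if γ = α then lam else 0)
    (t t' : A) (ht : ∀ γ, D γ t = 0) (htt : valueAt x B₀ t t' ≠ 0) :
    ∃ J : Fin ((m + 1 - 1) * (m + 1 - 2) / 2 + 1) → Option (Param (m + 1)),
      LinearIndependent ℂ fun i => valueAt x (pencil B₀ Ψ (J i)) := by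
  classical
  let K := Option {p : Fin m × Fin m // p.1 < p.2}
  have hcard : Fintype.card K = (m + 1 - 1) * (m + 1 - 2) / 2 + 1 := by
    rw [Fintype.card_option, card_pairs_lt]
    rfl
  let up : {p : Fin m × Fin m // p.1 < p.2} → {p : Fin (m + 1) × Fin (m + 1) // p.1 < p.2} :=
    fun p => ⟨(p.1.1.succ, p.1.2.succ), Fin.succ_lt_succ_iff.2 p.2⟩
  let J : K → Option (Param (m + 1)) := fun o => o.map fun p => Pi.single (up p) 1
  have hval : ∀ p : {p : Fin m × Fin m // p.1 < p.2}, ∀ f g,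
      valueAt x (pencil B₀ Ψ (J (some p))) f g =
        D p.1.1.succ f * D p.1.2.succ g - D p.1.1.succ g * D p.1.2.succ f := by
    intro p f g
    change valueAt x (Ψ (Pi.single (up p) 1)) f g = _
    rw [hΨ, sum_eq_single (up p)]
    · simp [up]
    · intro b _ hb; simp [hb]
    · simp
  have hli : LinearIndependent ℂ fun i : K => valueAt x (pencil B₀ Ψ (J i)) := by
    rw [Fintype.linearIndependent_iff]
    intro c hc
    have happ : ∀ f g, ∑ i : K, c i * valueAt x (pencil B₀ Ψ (J i)) f g = 0 := by
      intro f g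
      have := congrFun (congrFun hc f) g
      simpa [Finset.sum_apply] using this
    have hnone : c none = 0 := by
      have h := happ t t'
      rw [Fintype.sum_option] at h
      rw [sum_eq_zero (fun p _ => by rw [hval]; simp [ht]), add_zero] at h
      exact (mul_eq_zero.1 h).resolve_right htt
    intro i
    cases i with
    | none => exact hnone
    | some p =>
      have h := happ (φ p.1.1) (φ p.1.2)
      rw [Fintype.sum_option, hnone, zero_mul, zero_add, sum_eq_single p] at h
      · rw [hval] at h
        simp only [hφ] at h
        have hne : p.1.2 ≠ p.1.1 := p.2.ne'
        simp only [if_true, if_neg hne, if_neg p.2.ne, mul_zero, sub_zero] at h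
        exact (mul_eq_zero.1 h).resolve_right (mul_ne_zero hlam hlam)
      · intro b _ hb
        rw [hval]
        simp only [hφ]
        have hb1 := b.2
        have hp1 := p.2
        have : ¬ (b.1.1 = p.1.1 ∧ b.1.2 = p.1.2) := fun ⟨h1, h2⟩ => hb (Subtype.ext (Prod.ext h1 h2))
        by_cases h1 : b.1.1 = p.1.1
        · have h2 : b.1.2 ≠ p.1.2 := fun h2 => this ⟨h1, h2⟩
          have h3 : b.1.2 ≠ p.1.1 := fun h3 => by rw [h3, h1] at hb1; exact lt_irrefl _ hb1
          simp [h2, h3]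
        · by_cases h4 : b.1.1 = p.1.2
          · have h5 : b.1.2 ≠ p.1.1 := fun h5 => by rw [h4, h5] at hb1; exact lt_asymm hb1 hp1
            simp [h1, h5]
          · simp [h1, h4]
      · simp
  let e : Fin ((m + 1 - 1) * (m + 1 - 2) / 2 + 1) ≃ K := (Fintype.equivFinOfCardEq hcard).symm
  exact ⟨J ∘ e, hli.comp e e.injective⟩

end Order

/-! ### Fusion of quasi-Poisson brackets -/

section Fusion

open Matrix

variable {A : Type} [CommRing A] [Algebra ℂ A] {n : ℕ}

/-- The mixed term of the jacobiator of `P + Q`. -/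
def jacMixed (P Q : Bider A) (f g h : A) : A :=
  P f (Q g h) + P g (Q h f) + P h (Q f g) + (Q f (P g h) + Q g (P h f) + Q h (P f g))

theorem jac_add (P Q : Bider A) (f g h : A) :
    jac (P + Q) f g h = jac P f g h + jac Q f g h + jacMixed P Q f g h := by
  simp only [jac, jacMixed, Derivation.add_apply, map_add]
  ring

theorem jac_smul (c : ℂ) (P : Bider A) (f g h : A) : jac (c • P) f g h = c ^ 2 • jac P f g h := by
  simp only [jac, Derivation.smul_apply, Derivation.map_smul, smul_add, smul_smul, pow_two]

theorem jacMixed_add_right (P Q R : Bider A) (f g h : A) :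
    jacMixed P (Q + R) f g h = jacMixed P Q f g h + jacMixed P R f g h := by
  simp only [jacMixed, Derivation.add_apply, map_add]
  ring

theorem jacMixed_self (P : Bider A) (f g h : A) : jacMixed P P f g h = 2 * jac P f g h := by
  simp only [jacMixed, jac]; ring

theorem jacMixed_smul_right (c : ℂ) (P Q : Bider A) (f g h : A) :
    jacMixed P (c • Q) f g h = c • jacMixed P Q f g h := by
  simp only [jacMixed, Derivation.smul_apply, Derivation.map_smul, smul_add]

theorem jacMixed_sum_right {J : Type} (P : Bider A) (Q : J → Bider A) (s : Finset J) (f g h : A) :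
    jacMixed P (∑ j ∈ s, Q j) f g h = ∑ j ∈ s, jacMixed P (Q j) f g h := by
  classical
  induction s using Finset.induction_on with
  | empty => simp [jacMixed]
  | insert j s hj ih => rw [sum_insert hj, sum_insert hj, jacMixed_add_right, ih]

/-- The failure of a derivation to preserve a bracket. -/
def lieDefect (D : Der(A)) (P : Bider A) (f g : A) : A :=
  D (P f g) - P (D f) g - P f (D g)

/-- The derivation `D` preserves the bracket `P`. -/
def Preserves (D : Der(A)) (P : Bider A) : Prop :=
  ∀ f g, D (P f g) = P (D f) g + P f (D g)

theorem Preserves.lieDefect_eq {D : Der(A)} {P : Bider A} (h : Preserves D P) (f g : A) :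
    lieDefect D P f g = 0 := by
  rw [lieDefect, h]; ring

theorem jacMixed_wedge {P : Bider A} (hP : IsBivector P) (D E : Der(A)) (f g h : A) :
    jacMixed P (wedge D E) f g h = (D f * lieDefect E P g h - lieDefect D P g h * E f) +
      (D g * lieDefect E P h f - lieDefect D P h f * E g) +
      (D h * lieDefect E P f g - lieDefect D P f g * E h) := by
  simp only [jacMixed, wedge_apply, lieDefect, map_sub, Derivation.leibniz, smul_eq_mul]
  rw [hP.antisymm (D f) g, hP.antisymm (D g) h, hP.antisymm (D h) f, hP.antisymm (E f) g,
    hP.antisymm (E g) h, hP.antisymm (E h) f]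
  ring

theorem jacMixed_wedge_eq_zero {P : Bider A} (hP : IsBivector P) {D E : Der(A)}
    (hD : Preserves D P) (hE : Preserves E P) (f g h : A) : jacMixed P (wedge D E) f g h = 0 := by
  rw [jacMixed_wedge hP]
  simp only [hD.lieDefect_eq, hE.lieDefect_eq]
  ring

/-- Commuting derivations. -/
def DerComm (D E : Der(A)) : Prop := ∀ f, D (E f) = E (D f)

theorem DerComm.symm {D E : Der(A)} (h : DerComm D E) : DerComm E D := fun f => (h f).symm

theorem Preserves.wedge {D E F : Der(A)} (h : DerComm D E) (h' : DerComm D F) :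
    Preserves D (wedge E F) := by
  intro f g
  simp only [wedge_apply, map_sub, Derivation.leibniz, smul_eq_mul, h f, h g, h' f, h' g]
  ring

theorem Preserves.add {D : Der(A)} {P Q : Bider A} (h : Preserves D P)
    (h' : Preserves D Q) : Preserves D (P + Q) := by
  intro f g
  simp only [Derivation.add_apply, map_add, h f g, h' f g]
  ring

theorem Preserves.smul {D : Der(A)} {P : Bider A} (h : Preserves D P) (c : ℂ) :
    Preserves D (c • P) := by
  intro f g
  simp only [Derivation.smul_apply, Derivation.map_smul, h f g, smul_add]

theorem Preserves.sum {J : Type} {D : Der(A)} {P : J → Bider A} (s : Finset J)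
    (h : ∀ j ∈ s, Preserves D (P j)) : Preserves D (∑ j ∈ s, P j) := by
  classical
  induction s using Finset.induction_on with
  | empty => intro f g; simp
  | insert j s hj ih =>
    rw [sum_insert hj]
    exact (h j (mem_insert_self _ _)).add (ih fun k hk => h k (mem_insert_of_mem hk))

theorem Preserves.sum_left {J : Type} {D : J → Der(A)} {P : Bider A} (s : Finset J)
    (h : ∀ j ∈ s, Preserves (D j) P) : Preserves (∑ j ∈ s, D j) P := by
  intro f g
  simp only [derivation_sum_apply, map_sum, ← sum_add_distrib]
  exact sum_congr rfl fun j hj => h j hj f g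

/-- A matrix of derivations. -/
abbrev MatDer (A : Type) [CommRing A] [Algebra ℂ A] (n : ℕ) : Type :=
  Fin n → Fin n → Der(A)

/-- The matrix of derivatives of a function. -/
def matDer (E : MatDer A n) (f : A) : Matrix (Fin n) (Fin n) A := Matrix.of fun i j => E i j f

/-- The bivector `tr (E ∧ F)`. -/
def traceWedge (E F : MatDer A n) : Bider A := ∑ i, ∑ j, wedge (E i j) (F j i)

theorem traceWedge_apply (E F : MatDer A n) (f g : A) : traceWedge E F f g =
    trace (matDer E f * matDer F g) - trace (matDer E g * matDer F f) := by
  simp only [traceWedge, bider_sum_apply, wedge_apply, trace, diag_apply, mul_apply, matDer,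
    of_apply, sum_sub_distrib]
  congr 1
  exact sum_congr rfl fun i _ => sum_congr rfl fun j _ => mul_comm _ _

theorem traceWedge_isBivector (E F : MatDer A n) : IsBivector (traceWedge E F) := by
  intro f; rw [traceWedge_apply, sub_self]

theorem traceWedge_sum_left {J : Type} (s : Finset J) (E : J → MatDer A n) (F : MatDer A n) :
    traceWedge (∑ k ∈ s, E k) F = ∑ k ∈ s, traceWedge (E k) F := by
  ext f g
  have h : ∀ f, matDer (∑ k ∈ s, E k) f = ∑ k ∈ s, matDer (E k) f := by
    intro f
    ext i j
    simp [matDer, Matrix.sum_apply, derivation_sum_apply]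
  simp only [bider_sum_apply, traceWedge_apply, h, sum_mul, trace_sum, sum_sub_distrib]

/-- The commutation relations of the general linear Lie algebra. -/
def IsGL (E : MatDer A n) : Prop := ∀ i j k l f, E i j (E k l f) =
  E k l (E i j f) + ((if j = k then E i l f else 0) - (if i = l then E k j f else 0))

/-- All entries of two matrices of derivations commute. -/
def MatComm (E F : MatDer A n) : Prop := ∀ i j k l, DerComm (E i j) (F k l)

theorem MatComm.symm {E F : MatDer A n} (h : MatComm E F) : MatComm F E :=
  fun i j k l => (h k l i j).symm

theorem MatComm.sum_left {J : Type} (s : Finset J) {E : J → MatDer A n} {F : MatDer A n}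
    (h : ∀ k ∈ s, MatComm (E k) F) : MatComm (∑ k ∈ s, E k) F := by
  intro i j k l f
  simp only [Finset.sum_apply, derivation_sum_apply, map_sum]
  exact sum_congr rfl fun m hm => h m hm i j k l f

theorem IsGL.add {E F : MatDer A n} (hE : IsGL E) (hF : IsGL F) (h : MatComm E F) :
    IsGL (E + F) := by
  intro i j k l f
  simp only [Pi.add_apply, Derivation.add_apply, map_add]
  rw [hE i j k l f, hF i j k l f, h i j k l f, ← h k l i j f]
  split_ifs <;> ring

/-- The Cartan trivector field `tr (Ef [Eg, Eh])`. -/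
def cartan (E : MatDer A n) (f g h : A) : A :=
  trace (matDer E f * matDer E g * matDer E h) - trace (matDer E f * matDer E h * matDer E g)

/-- The defect with which the action of a factor fails to preserve a fusion term. -/
theorem lieDefect_traceWedge {E F : MatDer A n} (hE : IsGL E) (h : MatComm E F) (i j : Fin n)
    (f g : A) : lieDefect (E i j) (traceWedge E F) f g =
      (matDer E f * matDer F g - matDer F g * matDer E f
        - (matDer E g * matDer F f - matDer F f * matDer E g)) i j := by
  have key : ∀ f g : A, E i j (trace (matDer E f * matDer F g)) =
      trace (matDer E (E i j f) * matDer F g) + trace (matDer E f * matDer F (E i j g)) +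
        (matDer E f * matDer F g - matDer F g * matDer E f) i j := by
    intro f g
    simp only [trace, diag_apply, mul_apply, matDer, of_apply, map_sum, Derivation.leibniz,
      smul_eq_mul, Matrix.sub_apply]
    have h1 : ∀ k l, E k l f * E i j (F l k g) + F l k g * E i j (E k l f) =
        E k l (E i j f) * F l k g + E k l f * F l k (E i j g) +
          ((if j = k then E i l f * F l k g else 0) - (if i = l then E k j f * F l k g else 0)) := by
      intro k l
      rw [h i j l k g, hE i j k l f]
      split_ifs <;> ring
    simp only [h1, sum_add_distrib, sum_sub_distrib]
    congr 1
    congr 1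
    · rw [sum_eq_single j]
      · simp
      · intro b _ hb; simp [hb.symm]
      · simp
    · refine sum_congr rfl fun k _ => ?_
      simp [mul_comm]
  rw [lieDefect, traceWedge_apply, traceWedge_apply, traceWedge_apply, map_sub, key f g, key g f]
  simp only [Matrix.sub_apply]
  ring

theorem traceWedge_neg_swap (E F : MatDer A n) : traceWedge F E = -traceWedge E F := by
  ext f g
  rw [Derivation.neg_apply, Derivation.neg_apply, traceWedge_apply, traceWedge_apply,
    trace_mul_comm (matDer F f), trace_mul_comm (matDer F g)]
  ring

theorem lieDefect_neg (D : Der(A)) (P : Bider A) (f g : A) :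
    lieDefect D (-P) f g = -lieDefect D P f g := by
  simp only [lieDefect, Derivation.neg_apply, map_neg]; ring

theorem lieDefect_traceWedge_right {E F : MatDer A n} (hF : IsGL F) (h : MatComm E F) (i j : Fin n)
    (f g : A) : lieDefect (F i j) (traceWedge E F) f g =
      -(matDer E f * matDer F g - matDer F g * matDer E f
        - (matDer E g * matDer F f - matDer F f * matDer E g)) i j := by
  rw [traceWedge_neg_swap, lieDefect_neg, lieDefect_traceWedge hF h.symm]
  simp only [Matrix.sub_apply]
  ring

theorem preserves_traceWedge {E F : MatDer A n} (hE : IsGL E) (hF : IsGL F) (h : MatComm E F)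
    (i j : Fin n) : Preserves ((E + F) i j) (traceWedge E F) := by
  intro f g
  have h1 := lieDefect_traceWedge hE h i j f g
  have h2 := lieDefect_traceWedge_right hF h i j f g
  simp only [lieDefect] at h1 h2
  simp only [Pi.add_apply, Derivation.add_apply, map_add]
  linear_combination h1 + h2

theorem Preserves.traceWedge {D : Der(A)} {E F : MatDer A n}
    (h : ∀ i j, DerComm D (E i j)) (h' : ∀ i j, DerComm D (F i j)) :
    Preserves D (traceWedge E F) :=
  Preserves.sum _ fun i _ => Preserves.sum _ fun j _ => Preserves.wedge (h i j) (h' j i)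

theorem jacMixed_traceWedge_eq_zero {P : Bider A} (hP : IsBivector P) {E F : MatDer A n}
    (hE : ∀ i j, Preserves (E i j) P) (hF : ∀ i j, Preserves (F i j) P) (f g h : A) :
    jacMixed P (traceWedge E F) f g h = 0 := by
  rw [SpinRS.traceWedge, jacMixed_sum_right]
  refine sum_eq_zero fun i _ => ?_
  rw [jacMixed_sum_right]
  exact sum_eq_zero fun j _ => jacMixed_wedge_eq_zero hP (hE i j) (hF j i) f g h

/-- The jacobiator of `tr (E ∧ F)`, for two commuting actions of the general linear Lie algebra. -/
theorem jac_traceWedge {E F : MatDer A n} (hE : IsGL E) (hF : IsGL F) (hEF : MatComm E F)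
    (f g h : A) : jac (traceWedge E F) f g h =
      -(cartan (E + F) f g h - cartan E f g h - cartan F f g h) := by
  have h2 : (2 : A) * jac (traceWedge E F) f g h =
      2 * -(cartan (E + F) f g h - cartan E f g h - cartan F f g h) := by
    rw [← jacMixed_self]
    set P := traceWedge E F with hP
    have hB : IsBivector P := traceWedge_isBivector E F
    have e1 : jacMixed P P f g h = ∑ i, ∑ j, jacMixed P (wedge (E i j) (F j i)) f g h := by
      change jacMixed P (∑ i, ∑ j, wedge (E i j) (F j i)) f g h = _
      rw [jacMixed_sum_right]
      exact sum_congr rfl fun i _ => jacMixed_sum_right _ _ _ _ _ _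
    let C : A → A → Matrix (Fin n) (Fin n) A := fun f g =>
      matDer E f * matDer F g - matDer F g * matDer E f
        - (matDer E g * matDer F f - matDer F f * matDer E g)
    have e2 : jacMixed P P f g h = -(trace (matDer E f * C g h) + trace (matDer F f * C g h)) -
        (trace (matDer E g * C h f) + trace (matDer F g * C h f)) -
        (trace (matDer E h * C f g) + trace (matDer F h * C f g)) := by
      have e3 : ∀ f g h : A, ∑ i, ∑ j, (E i j f * lieDefect (F j i) P g h -
          lieDefect (E i j) P g h * F j i f) =
          -(trace (matDer E f * C g h) + trace (matDer F f * C g h)) := by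
        intro f g h
        rw [trace_mul_comm (matDer F f)]
        simp only [hP, lieDefect_traceWedge hE hEF, lieDefect_traceWedge_right hF hEF, trace,
          diag_apply, mul_apply, ← sum_add_distrib, ← sum_neg_distrib]
        refine sum_congr rfl fun i _ => sum_congr rfl fun j _ => ?_
        simp only [matDer, of_apply, C]
        ring
      rw [e1]
      simp only [jacMixed_wedge hB, sum_add_distrib, e3]
      ring
    have hadd : ∀ f, matDer (E + F) f = matDer E f + matDer F f := by
      intro f; ext i j; simp [matDer]
    rw [e2]
    simp only [cartan, hadd, C]
    generalize matDer E f = a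
    generalize matDer E g = b
    generalize matDer E h = c
    generalize matDer F f = a'
    generalize matDer F g = b'
    generalize matDer F h = c'
    simp only [mul_sub, mul_add, add_mul, trace_add, trace_sub, ← mul_assoc]
    simp only [trace_mul_cycle b c a', trace_mul_cycle b' c a', trace_mul_cycle b c' a,
      trace_mul_cycle b' c' a, ← trace_mul_cycle a' c b, ← trace_mul_cycle a' c b',
      ← trace_mul_cycle a c' b, ← trace_mul_cycle a c' b',
      ← trace_mul_cycle a b' c, ← trace_mul_cycle a b' c', ← trace_mul_cycle a' b c,
      ← trace_mul_cycle a' b c', trace_mul_cycle c b' a, trace_mul_cycle c' b' a,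
      trace_mul_cycle c b a', trace_mul_cycle c' b a']
    ring
  have hinj : Function.Injective fun x : A => (2 : A) * x := by
    intro x y hxy
    have := congrArg (fun x : A => (1 / 2 : ℂ) • x) hxy
    have e : ∀ x : A, (1 / 2 : ℂ) • ((2 : A) * x) = x := by
      intro x
      rw [two_mul, smul_add, ← add_smul]
      norm_num
    simpa only [e] using this
  exact hinj h2

/-- The bivector `∑_{k < l < m} tr (e_k ∧ e_l)` of the fusion of `m` actions. -/
def fusion (e : ℕ → MatDer A n) (m : ℕ) : Bider A :=
  ∑ l ∈ range m, traceWedge (∑ k ∈ range l, e k) (e l)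

theorem fusion_isBivector (e : ℕ → MatDer A n) (m : ℕ) : IsBivector (fusion e m) :=
  IsBivector.sum _ fun _ _ => traceWedge_isBivector _ _

theorem isGL_sum {e : ℕ → MatDer A n} (hGL : ∀ k, IsGL (e k))
    (hc : ∀ k l, k < l → MatComm (e k) (e l)) (m : ℕ) :
    IsGL (∑ k ∈ range m, e k) := by
  induction m with
  | zero => intro i j k l f; simp
  | succ m ih =>
    rw [sum_range_succ]
    exact ih.add (hGL m) (MatComm.sum_left _ fun k hk => hc k m (mem_range.1 hk))

theorem preserves_fusion_of_comm {D : Der(A)} {e : ℕ → MatDer A n} {m : ℕ}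
    (h : ∀ k < m, ∀ i j, DerComm D (e k i j)) : Preserves D (fusion e m) := by
  refine Preserves.sum _ fun l hl => Preserves.traceWedge (fun i j f => ?_) (h l (mem_range.1 hl))
  simp only [Finset.sum_apply, derivation_sum_apply, map_sum]
  exact sum_congr rfl fun k hk => h k ((mem_range.1 hk).trans (mem_range.1 hl)) i j f

theorem fusion_succ (e : ℕ → MatDer A n) (m : ℕ) :
    fusion e (m + 1) = fusion e m + traceWedge (∑ k ∈ range m, e k) (e m) :=
  sum_range_succ _ _

/-- The diagonal action preserves the fusion term, although its factors do not. -/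
theorem preserves_fusion {e : ℕ → MatDer A n} (hGL : ∀ k, IsGL (e k))
    (hc : ∀ k l, k < l → MatComm (e k) (e l)) (m : ℕ) (i j : Fin n) :
    Preserves ((∑ k ∈ range m, e k) i j) (fusion e m) := by
  induction m with
  | zero => intro f g; simp [fusion]
  | succ m ih =>
    have h1 := isGL_sum hGL hc m
    have h2 : MatComm (∑ k ∈ range m, e k) (e m) :=
      MatComm.sum_left _ fun k hk => hc k m (mem_range.1 hk)
    rw [sum_range_succ, fusion_succ]
    refine Preserves.add ?_ (preserves_traceWedge h1 (hGL m) h2 i j)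
    have h3 : Preserves (e m i j) (fusion e m) :=
      preserves_fusion_of_comm fun k hk i' j' => (hc k m hk i' j' i j).symm
    intro f g
    simp only [Pi.add_apply, Derivation.add_apply, map_add, ih f g, h3 f g]
    ring

/-- The jacobiator of a fusion is the Cartan trivector of the total action, minus those of its
factors. -/
theorem jac_fusion {e : ℕ → MatDer A n} (hGL : ∀ k, IsGL (e k))
    (hc : ∀ k l, k < l → MatComm (e k) (e l)) (m : ℕ) (f g h : A) :
    jac (fusion e m) f g h =
      -(cartan (∑ k ∈ range m, e k) f g h - ∑ k ∈ range m, cartan (e k) f g h) := by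
  induction m with
  | zero => simp [jac, fusion, cartan, matDer, trace]
  | succ m ih =>
    have h1 := isGL_sum hGL hc m
    have h2 : MatComm (∑ k ∈ range m, e k) (e m) :=
      MatComm.sum_left _ fun k hk => hc k m (mem_range.1 hk)
    rw [fusion_succ, jac_add, ih, jac_traceWedge h1 (hGL m) h2,
      jacMixed_traceWedge_eq_zero (fusion_isBivector e m) (preserves_fusion hGL hc m)
        (fun i j => preserves_fusion_of_comm fun k hk i' j' => (hc k m hk i' j' i j).symm),
      sum_range_succ, sum_range_succ]
    ring

theorem jacMixed_fusion_eq_zero {Q : Bider A} (hQ : IsBivector Q) {e : ℕ → MatDer A n} {m : ℕ}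
    (h : ∀ k < m, ∀ i j, Preserves (e k i j) Q) (f g k : A) :
    jacMixed Q (fusion e m) f g k = 0 := by
  rw [fusion, jacMixed_sum_right]
  refine sum_eq_zero fun l hl => jacMixed_traceWedge_eq_zero hQ (fun i j => ?_)
    (h l (mem_range.1 hl)) f g k
  rw [Finset.sum_apply, Finset.sum_apply]
  exact Preserves.sum_left _ fun k hk => h k ((mem_range.1 hk).trans (mem_range.1 hl)) i j

/-- The jacobiator of a bracket `Q - ½ ∑_{k<l} tr (e_k ∧ e_l)` with `Q` invariant. -/
theorem jac_sub_fusion {Q : Bider A} (hQ : IsBivector Q) {e : ℕ → MatDer A n}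
    (hGL : ∀ k, IsGL (e k)) (hc : ∀ k l, k < l → MatComm (e k) (e l)) {m : ℕ}
    (hQe : ∀ k < m, ∀ i j, Preserves (e k i j) Q) (f g h : A) :
    jac (Q + (-(1 / 2) : ℂ) • fusion e m) f g h = jac Q f g h - (1 / 4 : ℂ) •
      (cartan (∑ k ∈ range m, e k) f g h - ∑ k ∈ range m, cartan (e k) f g h) := by
  rw [jac_add, jac_smul, jacMixed_smul_right, jacMixed_fusion_eq_zero hQ hQe, jac_fusion hGL hc]
  norm_num [smul_neg, sub_eq_add_neg]

/-- Adding a combination of wedges of commuting symmetries to a bracket does not change its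
jacobiator. -/
theorem jac_add_wedges {J : Type} {P : Bider A} (hP : IsBivector P) (s : Finset J) (c : J → ℂ)
    (D E : J → Der(A)) (hD : ∀ j ∈ s, Preserves (D j) P) (hE : ∀ j ∈ s, Preserves (E j) P)
    (hDD : ∀ i ∈ s, ∀ j ∈ s, DerComm (D i) (D j)) (hDE : ∀ i ∈ s, ∀ j ∈ s, DerComm (D i) (E j))
    (hEE : ∀ i ∈ s, ∀ j ∈ s, DerComm (E i) (E j)) (f g h : A) :
    jac (P + ∑ j ∈ s, c j • wedge (D j) (E j)) f g h = jac P f g h := by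
  classical
  induction s using Finset.induction_on with
  | empty => simp
  | insert k s hk ih =>
    have hs : ∀ j ∈ s, j ∈ insert k s := fun j => mem_insert_of_mem
    have hk' := mem_insert_self k s
    rw [sum_insert hk, add_left_comm, add_comm, jac_add,
      ih (fun j hj => hD j (hs j hj)) (fun j hj => hE j (hs j hj))
        (fun i hi j hj => hDD i (hs i hi) j (hs j hj))
        (fun i hi j hj => hDE i (hs i hi) j (hs j hj))
        (fun i hi j hj => hEE i (hs i hi) j (hs j hj)), jacMixed_smul_right, jac_smul]
    have hB : IsBivector (P + ∑ j ∈ s, c j • wedge (D j) (E j)) :=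
      hP.add (IsBivector.sum _ fun j _ => (wedge_isBivector _ _).smul _)
    rw [jacMixed_wedge_eq_zero hB]
    · have h1 := jacMixed_self (wedge (D k) (E k)) f g h
      rw [jacMixed_wedge_eq_zero (wedge_isBivector _ _)
        (Preserves.wedge (hDD k hk' k hk') (hDE k hk' k hk'))
        (Preserves.wedge (hDE k hk' k hk').symm (hEE k hk' k hk'))] at h1
      have h2 : (1 / 2 : ℂ) • ((2 : A) * jac (wedge (D k) (E k)) f g h) =
          jac (wedge (D k) (E k)) f g h := by
        rw [two_mul, smul_add, ← add_smul]; norm_num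
      rw [← h1, smul_zero] at h2
      rw [← h2]
      simp
    · exact (hD k hk').add (Preserves.sum _ fun j hj => (Preserves.wedge
        (hDD k hk' j (hs j hj)) (hDE k hk' j (hs j hj))).smul _)
    · exact (hE k hk').add (Preserves.sum _ fun j hj => (Preserves.wedge
        (hDE j (hs j hj) k hk').symm (hEE k hk' j (hs j hj))).smul _)

end Fusion

/-! ### The representation space and its symmetries -/

section QuasiPoisson

open Matrix

variable {n d : ℕ}

instance : DecidableEq (RSCoord n d) := Classical.decEq _

/-- The coordinate ring of the representation space. -/
abbrev RepRing (n d : ℕ) : Subalgebra ℂ (repSpace n d → ℂ) := Reg (repSpace n d)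

/-- `F` restricts on the level set to the pullback of `f`. -/
abbrev LiftRS {q : ℂ} (F : RepRing n d) (f : RSRing n d q) : Prop :=
  IsLift (levelSet_subset n d q) (glRel n d q) F f

/-- A coordinate function on the representation space. -/
abbrev cf (c : RSCoord n d) : RepRing n d := coordFn (repSpace n d) c

/-- A coordinate vector field on the representation space. -/
abbrev cD (c : RSCoord n d) : Der(RepRing n d) :=
  partialD (isOpen_repSpace n d) c

theorem cD_cf (e c : RSCoord n d) : cD e (cf c) = if c = e then 1 else 0 := by
  rw [cD, cf, partialD_coordFn]
  by_cases h : c = e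
  · subst h; simp [dirVec]
  · simp [dirVec, h]

/-- Left multiplication of `X`: the matrix of vector fields `X ∂_X`. -/
def leftX (n d : ℕ) : MatDer (RepRing n d) n := fun i j =>
  ∑ k, cf (.X i k : RSCoord n d) • cD (.X j k : RSCoord n d)

/-- Right multiplication of `X`: the matrix of vector fields `-∂_X X`. -/
def rightX (n d : ℕ) : MatDer (RepRing n d) n := fun i j =>
  -∑ k, cf (.X k j : RSCoord n d) • cD (.X k i : RSCoord n d)

/-- Left multiplication of `Z`: the matrix of vector fields `Z ∂_Z`. -/
def leftZ (n d : ℕ) : MatDer (RepRing n d) n := fun i j =>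
  ∑ k, cf (.Z i k : RSCoord n d) • cD (.Z j k : RSCoord n d)

/-- Right multiplication of `Z`: the matrix of vector fields `-∂_Z Z`. -/
def rightZ (n d : ℕ) : MatDer (RepRing n d) n := fun i j =>
  -∑ k, cf (.Z k j : RSCoord n d) • cD (.Z k i : RSCoord n d)

/-- The action on `(V_α, W_α)`: the matrix of vector fields `W_α ∂_{W_α} - ∂_{V_α} V_α`. -/
def spinDer (n : ℕ) {d : ℕ} (α : Fin d) : MatDer (RepRing n d) n := fun i j =>
  cf (.W α i) • cD (.W α j) - cf (.V α j) • cD (.V α i)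

theorem leftX_cf (i j : Fin n) (c : RSCoord n d) : leftX n d i j (cf c) = match c with
    | .X p q => if p = j then cf (.X i q) else 0
    | _ => 0 := by
  cases c <;> simp [leftX, derivation_sum_apply, cD_cf, ite_and]

theorem rightX_cf (i j : Fin n) (c : RSCoord n d) : rightX n d i j (cf c) = match c with
    | .X p q => if q = i then -cf (.X p j) else 0
    | _ => 0 := by
  cases c with
  | X p q => by_cases h : q = i <;> simp [rightX, derivation_sum_apply, cD_cf, h]
  | _ => simp [rightX, derivation_sum_apply, cD_cf]

theorem leftZ_cf (i j : Fin n) (c : RSCoord n d) : leftZ n d i j (cf c) = match c with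
    | .Z p q => if p = j then cf (.Z i q) else 0
    | _ => 0 := by
  cases c <;> simp [leftZ, derivation_sum_apply, cD_cf, ite_and]

theorem rightZ_cf (i j : Fin n) (c : RSCoord n d) : rightZ n d i j (cf c) = match c with
    | .Z p q => if q = i then -cf (.Z p j) else 0
    | _ => 0 := by
  cases c with
  | Z p q => by_cases h : q = i <;> simp [rightZ, derivation_sum_apply, cD_cf, h]
  | _ => simp [rightZ, derivation_sum_apply, cD_cf]

theorem spinDer_cf (α : Fin d) (i j : Fin n) (c : RSCoord n d) : spinDer n α i j (cf c) =
    match c with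
    | .V β p => if β = α ∧ p = i then -cf (.V α j) else 0
    | .W β p => if β = α ∧ p = j then cf (.W α i) else 0
    | _ => 0 := by
  cases c with
  | V β p => by_cases h : β = α ∧ p = i <;> simp [spinDer, cD_cf, h]
  | W β p => by_cases h : β = α ∧ p = j <;> simp [spinDer, cD_cf, h]
  | _ => simp [spinDer, cD_cf]

theorem derComm_of_coord {D E : Der(RepRing n d)}
    (h : ∀ c, D (E (cf c)) = E (D (cf c))) : DerComm D E := by
  have : ⁅D, E⁆ = 0 := derivation_ext_coord fun c => by
    rw [Derivation.commutator_apply, h c, sub_self]; rfl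
  intro f
  have h1 := DFunLike.congr_fun this f
  rw [Derivation.commutator_apply] at h1
  exact sub_eq_zero.1 h1

theorem isGL_of_coord {E : MatDer (RepRing n d) n} (h : ∀ i j k l c, E i j (E k l (cf c)) =
    E k l (E i j (cf c)) + ((if j = k then E i l (cf c) else 0) -
      (if i = l then E k j (cf c) else 0))) : IsGL E := by
  intro i j k l f
  have : ⁅E i j, E k l⁆ = (if j = k then E i l else 0) - (if i = l then E k j else 0) :=
    derivation_ext_coord fun c => by
      rw [Derivation.commutator_apply, Derivation.sub_apply, h i j k l c]
      split_ifs <;> simp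
  have h1 := DFunLike.congr_fun this f
  rw [Derivation.commutator_apply, Derivation.sub_apply] at h1
  rw [← sub_eq_iff_eq_add', h1]
  split_ifs <;> simp

/-- The commuting actions of the general linear Lie algebra, in the order of their fusion. -/
def actSeq (n d : ℕ) : ℕ → MatDer (RepRing n d) n
  | 0 => leftX n d
  | 1 => rightZ n d
  | 2 => rightX n d
  | 3 => leftZ n d
  | k + 4 => if h : k < d then spinDer n ⟨k, h⟩ else 0

theorem actSeq_isGL (k : ℕ) : IsGL (actSeq n d k) := by
  match k with
  | 0 | 1 | 2 | 3 =>
    refine isGL_of_coord fun i j k l c => ?_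
    cases c <;> simp only [actSeq, leftX_cf, rightX_cf, leftZ_cf, rightZ_cf, map_zero, apply_ite,
      map_neg] <;> split_ifs <;> subst_vars <;> simp_all
  | k + 4 =>
    by_cases h : k < d
    · simp only [actSeq, dif_pos h]
      refine isGL_of_coord fun i j k l c => ?_
      cases c <;> simp only [spinDer_cf, ite_and, map_zero, apply_ite, map_neg] <;> split_ifs <;> subst_vars <;> simp_all
    · simp only [actSeq, dif_neg h]
      intro i j k l f
      simp

theorem actSeq_comm (k l : ℕ) (hkl : k < l) : MatComm (actSeq n d k) (actSeq n d l) := by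
  have key : ∀ k l, k < l → ∀ c : RSCoord n d, ∀ i j p q, actSeq n d k i j (actSeq n d l p q (cf c)) =
      actSeq n d l p q (actSeq n d k i j (cf c)) := by
    intro k l hkl c i j p q
    match k, l with
    | 0, 0 | 1, 1 | 2, 2 | 3, 3 | 1, 0 | 2, 0 | 3, 0 | 2, 1 | 3, 1 | 3, 2 => omega
    | 0, 1 | 0, 2 | 0, 3 | 1, 2 | 1, 3 | 2, 3 =>
      cases c <;> simp only [actSeq, leftX_cf, rightX_cf, leftZ_cf, rightZ_cf, map_zero, apply_ite,
        map_neg] <;> split_ifs <;> subst_vars <;> simp_all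
    | k + 4, 0 | k + 4, 1 | k + 4, 2 | k + 4, 3 => omega
    | 0, l + 4 | 1, l + 4 | 2, l + 4 | 3, l + 4 =>
      by_cases h : l < d
      · cases c <;> simp only [actSeq, dif_pos h, leftX_cf, rightX_cf, leftZ_cf, rightZ_cf,
          spinDer_cf, ite_and, map_zero, apply_ite, map_neg] <;> split_ifs <;> subst_vars <;> simp_all
      · simp [actSeq, dif_neg h]
    | k + 4, l + 4 =>
      by_cases h : l < d
      · have h' : k < d := by omega
        have hne : (⟨k, h'⟩ : Fin d) ≠ ⟨l, h⟩ := fun h => by simp at h; omega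
        cases c with
        | V γ r | W γ r =>
          by_cases h1 : γ = ⟨k, h'⟩
          · subst h1
            simp [actSeq, dif_pos h, dif_pos h', spinDer_cf, apply_ite, hne]
          · simp [actSeq, dif_pos h, dif_pos h', spinDer_cf, ite_and, apply_ite, hne.symm, h1]
        | _ => simp [actSeq, dif_pos h, dif_pos h', spinDer_cf]
      · simp [actSeq, dif_neg h]
  exact fun i j p q => derComm_of_coord fun c => key k l hkl c i j p q

/-- The scalar product `V_α W_α`. -/
def dotVW (n : ℕ) {d : ℕ} (α : Fin d) : RepRing n d := ∑ j, cf (.V α j) * cf (.W α j)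

/-- The vector field scaling `V_α`. -/
def eulerV (n : ℕ) {d : ℕ} (α : Fin d) : Der(RepRing n d) :=
  ∑ j, cf (.V α j) • cD (.V α j)

/-- The vector field scaling `W_α`. -/
def eulerW (n : ℕ) {d : ℕ} (α : Fin d) : Der(RepRing n d) :=
  ∑ j, cf (.W α j) • cD (.W α j)

/-- The function `1 + ½ V_α W_α`. -/
def spinH (n : ℕ) {d : ℕ} (α : Fin d) : RepRing n d := 1 + (1 / 2 : ℂ) • dotVW n α

/-- The bracket of the pair `(V_α, W_α)`. -/
def spinBracket (n : ℕ) {d : ℕ} (α : Fin d) : Bider (RepRing n d) :=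
  let R : Bider (RepRing n d) :=
    ∑ j : Fin n, wedge ((spinH n α : RepRing n d) • cD (.V α j)) (cD (.W α j))
  let S : Bider (RepRing n d) := wedge (eulerV n α) (eulerW n α)
  R + (1 / 2 : ℂ) • S

theorem fusField_apply (a : Arrow d) (i j : BIdx n) (f : RepRing n d) : fusField a i j f =
    ∑ k, (entry a.star k j * del a.star i k f - entry a i k * del a k j f) := by
  simp only [fusField, derivation_sum_apply, Derivation.sub_apply, Derivation.smul_apply,
    smul_eq_mul]

theorem fusField_x (i j : BIdx n) : fusField (d := d) (none, false) i j = match i, j with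
    | .inl i, .inl j => -(leftX n d + rightZ n d) i j
    | _, _ => 0 := by
  ext1 f
  rw [fusField_apply]
  rcases i with i | i <;> rcases j with j | j <;>
    simp [Fintype.sum_sum_type, entry, del, blockCoord, Arrow.star, leftX, rightZ,
      derivation_sum_apply, sub_eq_add_neg, add_comm, sum_add_distrib]

theorem fusField_z (i j : BIdx n) : fusField (d := d) (none, true) i j = match i, j with
    | .inl i, .inl j => -(rightX n d + leftZ n d) i j
    | _, _ => 0 := by
  ext1 f
  rw [fusField_apply]
  rcases i with i | i <;> rcases j with j | j <;>
    simp [Fintype.sum_sum_type, entry, del, blockCoord, Arrow.star, rightX, leftZ,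
      derivation_sum_apply, sub_eq_add_neg, add_comm, sum_add_distrib]

theorem scaleField_eq (α : Fin d) : scaleField n α = eulerW n α - eulerV n α := by
  ext1 f
  simp only [scaleField, derivation_sum_apply, Derivation.sub_apply, Derivation.smul_apply,
    smul_eq_mul]
  simp [Fintype.sum_sum_type, entry, del, blockCoord, eulerV, eulerW,
      derivation_sum_apply, sub_eq_add_neg, add_comm, sum_add_distrib]

theorem fusField_v (α : Fin d) (i j : BIdx n) : fusField (d := d) (some α, false) i j =
    match i, j with
    | .inr _, .inr _ => eulerW n α - eulerV n α
    | _, _ => 0 := by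
  ext1 f
  rw [fusField_apply]
  rcases i with i | i <;> rcases j with j | j <;>
    simp [Fintype.sum_sum_type, entry, del, blockCoord, Arrow.star, eulerV, eulerW,
      derivation_sum_apply, sub_eq_add_neg, add_comm, sum_add_distrib]

theorem fusField_w (α : Fin d) (i j : BIdx n) : fusField (d := d) (some α, true) i j =
    match i, j with
    | .inl i, .inl j => -spinDer n α i j
    | _, _ => 0 := by
  ext1 f
  rw [fusField_apply]
  rcases i with i | i <;> rcases j with j | j <;>
    simp [Fintype.sum_sum_type, entry, del, blockCoord, Arrow.star, spinDer, sub_eq_add_neg]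

end QuasiPoisson

/-! ### The jacobiator of the quasi-Poisson bracket -/

section Jacobiator

open Matrix

variable {n d : ℕ} {A : Type} [CommRing A] [Algebra ℂ A]

theorem preserves_of_coord {ι : Type} {U : Set (ι → ℂ)} {D : Der(Reg U)}
    {P : Bider (Reg U)} (h : ∀ a b, D (P (coordFn U a) (coordFn U b)) =
      P (D (coordFn U a)) (coordFn U b) + P (coordFn U a) (D (coordFn U b))) : Preserves D P := by
  have h1 : ∀ a, ⁅D, P (coordFn U a)⁆ = P (D (coordFn U a)) := fun a =>
    derivation_ext_coord fun b => by rw [Derivation.commutator_apply, h, add_sub_cancel_right]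
  -- both sides, as functions of the first argument, are derivations
  intro f g
  let L : Der(Reg U) := Derivation.mk'
    { toFun := fun f => D (P f g) - P (D f) g - P f (D g)
      map_add' := fun f f' => by simp only [map_add, Derivation.add_apply]; ring
      map_smul' := fun c f => by
        simp only [Derivation.map_smul, Derivation.smul_apply, RingHom.id_apply, smul_sub] }
    (fun f f' => by
      simp only [LinearMap.coe_mk, AddHom.coe_mk, Derivation.leibniz, Derivation.add_apply,
        Derivation.smul_apply, map_add, smul_eq_mul]
      ring)
  have h2 : L = 0 := derivation_ext_coord fun a => by
    have h3 := DFunLike.congr_fun (h1 a) g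
    rw [Derivation.commutator_apply] at h3
    change D (P (coordFn U a) g) - P (D (coordFn U a)) g - P (coordFn U a) (D g) = 0
    rw [← h3]; ring
  have h3 : D (P f g) - P (D f) g - P f (D g) = 0 := DFunLike.congr_fun h2 f
  linear_combination h3

/-- The jacobiator as a derivation in its last argument. -/
def jacDer (P : Bider A) (f g : A) : Der(A) := ⁅P f, P g⁆ - P (P f g)

theorem jacDer_apply {P : Bider A} (hP : IsBivector P)
    (f g h : A) : jacDer P f g h = jac P f g h := by
  rw [jacDer, Derivation.sub_apply, Derivation.commutator_apply, jac, hP.antisymm h f, map_neg,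
    hP.antisymm h (P f g)]
  ring

theorem jac_rotate (P : Bider A) (f g h : A) : jac P f g h = jac P g h f := by rw [jac, jac]; ring

/-- The Cartan trivector field as a derivation in its last argument. -/
def cartanDer (E : MatDer A n) (f g : A) : Der(A) :=
  ∑ i, ∑ j, (matDer E f * matDer E g - matDer E g * matDer E f) i j • E j i

theorem cartanDer_apply (E : MatDer A n) (f g h : A) : cartanDer E f g h = cartan E f g h := by
  have : cartanDer E f g h =
      trace ((matDer E f * matDer E g - matDer E g * matDer E f) * matDer E h) := by
    simp only [cartanDer, derivation_sum_apply, Derivation.smul_apply, smul_eq_mul, trace,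
      diag_apply, mul_apply (N := matDer E h)]
    rfl
  rw [this, cartan, sub_mul, trace_sub, trace_mul_cycle (matDer E f) (matDer E h)]

theorem cartan_rotate (E : MatDer A n) (f g h : A) : cartan E f g h = cartan E g h f := by
  rw [cartan, cartan, trace_mul_cycle (matDer E g) (matDer E h),
    trace_mul_cycle (matDer E g) (matDer E f), trace_mul_cycle (matDer E h) (matDer E g)]

/-- An identity between the jacobiator and Cartan trivectors may be checked on coordinates. -/
theorem jac_eq_of_coord {ι : Type} {U : Set (ι → ℂ)} {J : Type} (s : Finset J) {P : Bider (Reg U)}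
    (hP : IsBivector P) (E : J → MatDer (Reg U) n) (c : ℂ)
    (h : ∀ a b e, jac P (coordFn U a) (coordFn U b) (coordFn U e) =
      c • ∑ k ∈ s, cartan (E k) (coordFn U a) (coordFn U b) (coordFn U e)) (f g k : Reg U) :
    jac P f g k = c • ∑ j ∈ s, cartan (E j) f g k := by
  let T : Reg U → Reg U → Der(Reg U) := fun f g =>
    jacDer P f g - c • ∑ j ∈ s, cartanDer (E j) f g
  have hT : ∀ f g k, T f g k = jac P f g k - c • ∑ j ∈ s, cartan (E j) f g k := by
    intro f g k
    simp only [T, Derivation.sub_apply, Derivation.smul_apply, derivation_sum_apply,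
      jacDer_apply hP, cartanDer_apply]
  have hrot : ∀ f g k, T f g k = T g k f := by
    intro f g k
    rw [hT, hT, jac_rotate]
    simp only [cartan_rotate (E _) f g k]
  have h1 : ∀ a b, T (coordFn U a) (coordFn U b) = 0 := fun a b => derivation_ext_coord fun e => by
    rw [hT, h, sub_self]; rfl
  have h2 : ∀ a k, T k (coordFn U a) = 0 := fun a k => derivation_ext_coord fun e => by
    rw [hrot, h1]; rfl
  have h3 : ∀ g k, T g k = 0 := fun g k => derivation_ext_coord fun e => by rw [hrot, h2]; rfl
  have := hT f g k
  rw [h3] at this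
  exact (sub_eq_zero.1 this.symm)

/-- The row `V_α`. -/
def vV (α : Fin d) : Fin n → RepRing n d := fun j => cf (.V α j)

/-- The column `W_α`. -/
def vW (α : Fin d) : Fin n → RepRing n d := fun j => cf (.W α j)

/-- The derivatives with respect to `V_α`. -/
def gV (α : Fin d) (f : RepRing n d) : Fin n → RepRing n d := fun j => cD (.V α j) f

/-- The derivatives with respect to `W_α`. -/
def gW (α : Fin d) (f : RepRing n d) : Fin n → RepRing n d := fun j => cD (.W α j) f

/-- The constant `1 / 2`. -/
def half (n d : ℕ) : RepRing n d := algebraMap ℂ _ (1 / 2)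

theorem two_half : 2 * half n d = 1 := by
  have : (2 : RepRing n d) = algebraMap ℂ _ 2 := (map_ofNat (algebraMap ℂ (RepRing n d)) 2).symm
  rw [this, half, ← map_mul]
  norm_num

theorem der_half (D : Der(RepRing n d)) : D (half n d) = 0 :=
  D.map_algebraMap _

theorem half_smul (f : RepRing n d) : (1 / 2 : ℂ) • f = half n d * f := Algebra.smul_def _ _

theorem eulerV_apply (α : Fin d) (f : RepRing n d) : eulerV n α f = vV α ⬝ᵥ gV α f := by
  simp only [eulerV, derivation_sum_apply, Derivation.smul_apply, smul_eq_mul, dotProduct, vV, gV]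

theorem eulerW_apply (α : Fin d) (f : RepRing n d) : eulerW n α f = vW α ⬝ᵥ gW α f := by
  simp only [eulerW, derivation_sum_apply, Derivation.smul_apply, smul_eq_mul, dotProduct, vW, gW]

theorem spinH_eq (α : Fin d) : (spinH n α : RepRing n d) = 1 + half n d * (vV α ⬝ᵥ vW α) := by
  rw [spinH, half_smul]; rfl

theorem spinBracket_apply (α : Fin d) (f g : RepRing n d) : spinBracket n α f g =
    (1 + half n d * (vV α ⬝ᵥ vW α)) * (gV α f ⬝ᵥ gW α g - gV α g ⬝ᵥ gW α f) +
      half n d * ((vV α ⬝ᵥ gV α f) * (vW α ⬝ᵥ gW α g) - (vV α ⬝ᵥ gV α g) * (vW α ⬝ᵥ gW α f)) := by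
  have h : ∀ j : Fin n, wedge ((spinH n α : RepRing n d) • cD (RSCoord.V α j))
      (cD (RSCoord.W α j)) f g = spinH n α * (gV α f j * gW α g j - gV α g j * gW α f j) := fun j => by
    rw [wedge_apply, Derivation.smul_apply, Derivation.smul_apply, smul_eq_mul, smul_eq_mul]
    simp only [gV, gW]; ring
  simp only [spinBracket, Derivation.add_apply, Derivation.smul_apply, bider_sum_apply, h]
  rw [wedge_apply, half_smul, eulerV_apply, eulerW_apply, eulerV_apply, eulerW_apply, spinH_eq,
    ← mul_sum, sum_sub_distrib]
  simp only [dotProduct]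
  ring

theorem spinBracket_isBivector (α : Fin d) : IsBivector (spinBracket n α) := by
  intro f; rw [spinBracket_apply]; ring

theorem der_dotProduct (D : Der(A))
    (u v : Fin n → A) : D (u ⬝ᵥ v) = (fun j => D (u j)) ⬝ᵥ v + u ⬝ᵥ fun j => D (v j) := by
  simp only [dotProduct, map_sum, Derivation.leibniz, smul_eq_mul, ← sum_add_distrib]
  exact sum_congr rfl fun j _ => by ring

theorem der_gV (D : Der(RepRing n d)) (α : Fin d) (c : RSCoord n d) :
    (fun j => D (gV α (cf c) j)) = 0 := by
  funext j
  simp only [gV, cD_cf]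
  split_ifs <;> simp

theorem der_gW (D : Der(RepRing n d)) (α : Fin d) (c : RSCoord n d) :
    (fun j => D (gW α (cf c) j)) = 0 := by
  funext j
  simp only [gW, cD_cf]
  split_ifs <;> simp

/-- The derivative of the bracket of two coordinates. -/
theorem der_spinBracket (D : Der(RepRing n d)) (α : Fin d)
    (a b : RSCoord n d) (DV DW : Fin n → RepRing n d) (hV : ∀ j, D (vV α j) = DV j)
    (hW : ∀ j, D (vW α j) = DW j) : D (spinBracket n α (cf a) (cf b)) =
    half n d * (DV ⬝ᵥ vW α + vV α ⬝ᵥ DW) *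
      (gV α (cf a) ⬝ᵥ gW α (cf b) - gV α (cf b) ⬝ᵥ gW α (cf a)) +
    half n d * ((DV ⬝ᵥ gV α (cf a)) * (vW α ⬝ᵥ gW α (cf b)) +
      (vV α ⬝ᵥ gV α (cf a)) * (DW ⬝ᵥ gW α (cf b)) -
      (DV ⬝ᵥ gV α (cf b)) * (vW α ⬝ᵥ gW α (cf a)) -
      (vV α ⬝ᵥ gV α (cf b)) * (DW ⬝ᵥ gW α (cf a))) := by
  rw [spinBracket_apply]
  have hV' : (fun j => D (vV α j)) = DV := funext hV
  have hW' : (fun j => D (vW α j)) = DW := funext hW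
  simp only [map_add, map_sub, Derivation.leibniz, der_dotProduct, der_gV, der_gW, hV', hW',
    der_half, Derivation.map_one_eq_zero, smul_eq_mul, dotProduct_zero, zero_dotProduct]
  ring

theorem gV_spinBracket (α : Fin d) (a b : RSCoord n d) : gV α (spinBracket n α (cf a) (cf b)) =
    (half n d * (gV α (cf a) ⬝ᵥ gW α (cf b) - gV α (cf b) ⬝ᵥ gW α (cf a))) • vW α +
      (half n d * (vW α ⬝ᵥ gW α (cf b))) • gV α (cf a) -
      (half n d * (vW α ⬝ᵥ gW α (cf a))) • gV α (cf b) := by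
  funext j
  rw [gV, der_spinBracket _ α a b (Pi.single j 1) 0]
  · simp only [single_one_dotProduct, zero_dotProduct, dotProduct_zero, Pi.add_apply, Pi.sub_apply,
      Pi.smul_apply, smul_eq_mul]
    ring
  · intro k; simp [vV, cD_cf, Pi.single_apply]
  · intro k; simp [vW, cD_cf]

theorem gW_spinBracket (α : Fin d) (a b : RSCoord n d) : gW α (spinBracket n α (cf a) (cf b)) =
    (half n d * (gV α (cf a) ⬝ᵥ gW α (cf b) - gV α (cf b) ⬝ᵥ gW α (cf a))) • vV α +
      (half n d * (vV α ⬝ᵥ gV α (cf a))) • gW α (cf b) -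
      (half n d * (vV α ⬝ᵥ gV α (cf b))) • gW α (cf a) := by
  funext j
  rw [gW, der_spinBracket _ α a b 0 (Pi.single j 1)]
  · simp only [single_one_dotProduct, dotProduct_single_one, zero_dotProduct, Pi.add_apply,
      Pi.sub_apply, Pi.smul_apply, smul_eq_mul]
    ring
  · intro k; simp [vV, cD_cf]
  · intro k; simp [vW, cD_cf, Pi.single_apply]

theorem g_spinBracket_of_ne {α β : Fin d} (h : β ≠ α) (a b : RSCoord n d) :
    gV α (spinBracket n β (cf a) (cf b)) = 0 ∧ gW α (spinBracket n β (cf a) (cf b)) = 0 := by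
  constructor <;> funext j
  · rw [gV, der_spinBracket _ β a b 0 0]
    · simp
    · intro k; simp [vV, cD_cf, h]
    · intro k; simp [vW, cD_cf]
  · rw [gW, der_spinBracket _ β a b 0 0]
    · simp
    · intro k; simp [vV, cD_cf]
    · intro k; simp [vW, cD_cf, h]

theorem matDer_spinDer (α : Fin d) (f : RepRing n d) :
    matDer (spinDer n α) f = vecMulVec (vW α) (gW α f) - vecMulVec (gV α f) (vV α) := by
  ext1 i j
  simp only [matDer, spinDer, of_apply, Derivation.sub_apply, Derivation.smul_apply, smul_eq_mul,
    Matrix.sub_apply, vecMulVec_apply, vV, vW, gV, gW]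
  ring

/-- The sum of the brackets of all pairs `(V_α, W_α)`. -/
def spinTotal (n d : ℕ) : Bider (RepRing n d) := ∑ α, spinBracket n α

theorem spinTotal_isBivector (n d : ℕ) : IsBivector (spinTotal n d) :=
  IsBivector.sum _ fun α _ => spinBracket_isBivector α

/-- The algebraic identity behind the jacobiator of `spinBracket`: here `p` and `r` are the
derivatives of the three arguments with respect to the row `v` and the column `w`. -/
theorem spin_jac_identity {A : Type} [CommRing A] (t : A)
    (v w : Fin n → A) (p r : Fin 3 → Fin n → A) (S : (Fin n → A) → (Fin n → A) → (Fin n → A) →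
      (Fin n → A) → A) (hS : ∀ p r p' r', S p r p' r' = (1 + t * (v ⬝ᵥ w)) * (p ⬝ᵥ r' - p' ⬝ᵥ r) +
      t * ((v ⬝ᵥ p) * (w ⬝ᵥ r') - (v ⬝ᵥ p') * (w ⬝ᵥ r))) (k : Fin 3 → Fin 3 → Fin n → A)
    (hk : ∀ a b, k a b = (t * (p a ⬝ᵥ r b - p b ⬝ᵥ r a)) • w + (t * (w ⬝ᵥ r b)) • p a -
      (t * (w ⬝ᵥ r a)) • p b) (l : Fin 3 → Fin 3 → Fin n → A)
    (hl : ∀ a b, l a b = (t * (p a ⬝ᵥ r b - p b ⬝ᵥ r a)) • v + (t * (v ⬝ᵥ p a)) • r b -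
      (t * (v ⬝ᵥ p b)) • r a) (M : Fin 3 → Matrix (Fin n) (Fin n) A)
    (hM : ∀ a, M a = vecMulVec w (r a) - vecMulVec (p a) v) :
    S (p 0) (r 0) (k 1 2) (l 1 2) + S (p 1) (r 1) (k 2 0) (l 2 0) + S (p 2) (r 2) (k 0 1) (l 0 1) =
    -(t * (t * (trace (M 0 * M 1 * M 2) - trace (M 0 * M 2 * M 1)))) := by
  simp only [hS, hk, hl, hM, sub_mul, mul_sub, vecMulVec_mul_vecMulVec, vecMulVec_smul, smul_mul,
    mul_smul, trace_sub, trace_smul, trace_vecMulVec, smul_eq_mul,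
    dotProduct_add, dotProduct_sub, dotProduct_smul, add_dotProduct, sub_dotProduct, smul_dotProduct]
  simp only [dotProduct_comm (r _) (p _), dotProduct_comm (r _) w,
    dotProduct_comm (p _) v, dotProduct_comm w v]
  generalize v ⬝ᵥ w = q
  generalize v ⬝ᵥ p 0 = pa
  generalize v ⬝ᵥ p 1 = pb
  generalize v ⬝ᵥ p 2 = pe
  generalize w ⬝ᵥ r 0 = wa
  generalize w ⬝ᵥ r 1 = wb
  generalize w ⬝ᵥ r 2 = we
  generalize p 0 ⬝ᵥ r 1 = mab
  generalize p 0 ⬝ᵥ r 2 = mae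
  generalize p 1 ⬝ᵥ r 0 = mba
  generalize p 1 ⬝ᵥ r 2 = mbe
  generalize p 2 ⬝ᵥ r 0 = mea
  generalize p 2 ⬝ᵥ r 1 = meb
  ring

theorem spinTotal_spinBracket (a b e : RSCoord n d) :
    spinTotal n d (cf a) (spinTotal n d (cf b) (cf e)) =
      ∑ α, spinBracket n α (cf a) (spinBracket n α (cf b) (cf e)) := by
  have h1 : ∀ α, gV α (spinTotal n d (cf b) (cf e)) = gV α (spinBracket n α (cf b) (cf e)) := by
    intro α
    funext j
    rw [spinTotal, bider_sum_apply, gV, map_sum, sum_eq_single α]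
    · rfl
    · intro β _ hβ; exact congrFun (g_spinBracket_of_ne hβ b e).1 j
    · intro h; exact absurd (mem_univ α) h
  have h2 : ∀ α, gW α (spinTotal n d (cf b) (cf e)) = gW α (spinBracket n α (cf b) (cf e)) := by
    intro α
    funext j
    rw [spinTotal, bider_sum_apply, gW, map_sum, sum_eq_single α]
    · rfl
    · intro β _ hβ; exact congrFun (g_spinBracket_of_ne hβ b e).2 j
    · intro h; exact absurd (mem_univ α) h
  calc spinTotal n d (cf a) (spinTotal n d (cf b) (cf e))
      = ∑ α, spinBracket n α (cf a) (spinTotal n d (cf b) (cf e)) := bider_sum_apply _ _ _ _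
    _ = _ := sum_congr rfl fun α _ => by rw [spinBracket_apply, h1, h2, ← spinBracket_apply]

theorem quarter_smul (x : RepRing n d) : (-(1 / 4) : ℂ) • x = -(half n d * (half n d * x)) := by
  rw [← half_smul, ← half_smul, smul_smul, ← neg_smul]
  norm_num

theorem spinBracket_cyclic (α : Fin d) (a b e : RSCoord n d) :
    spinBracket n α (cf a) (spinBracket n α (cf b) (cf e)) +
      spinBracket n α (cf b) (spinBracket n α (cf e) (cf a)) +
      spinBracket n α (cf e) (spinBracket n α (cf a) (cf b)) =
    (-(1 / 4) : ℂ) • cartan (spinDer n α) (cf a) (cf b) (cf e) := by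
  rw [quarter_smul, cartan]
  let c : Fin 3 → RSCoord n d := ![a, b, e]
  have := spin_jac_identity (half n d) (vV α) (vW α) (fun i => gV α (cf (c i)))
    (fun i => gW α (cf (c i))) _ (fun _ _ _ _ => rfl)
    (fun i j => gV α (spinBracket n α (cf (c i)) (cf (c j)))) (fun i j => gV_spinBracket α _ _)
    (fun i j => gW α (spinBracket n α (cf (c i)) (cf (c j)))) (fun i j => gW_spinBracket α _ _)
    (fun i => matDer (spinDer n α) (cf (c i))) (fun i => matDer_spinDer α _)
  rw [spinBracket_apply α (cf a) (spinBracket n α _ _), spinBracket_apply α (cf b) (spinBracket n α _ _),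
    spinBracket_apply α (cf e) (spinBracket n α _ _)]
  exact this

/-- The single spins are quasi-Poisson and commute with each other. -/
theorem jac_spinTotal (f g h : RepRing n d) :
    jac (spinTotal n d) f g h = (-(1 / 4) : ℂ) • ∑ α, cartan (spinDer n α) f g h := by
  refine jac_eq_of_coord univ (spinTotal_isBivector n d) (spinDer n) (-(1 / 4))
    (fun a b e => ?_) f g h
  have h1 : jac (spinTotal n d) (cf a) (cf b) (cf e) =
      ∑ α, (-(1 / 4) : ℂ) • cartan (spinDer n α) (cf a) (cf b) (cf e) := by
    rw [jac, spinTotal_spinBracket, spinTotal_spinBracket, spinTotal_spinBracket,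
      ← sum_add_distrib, ← sum_add_distrib]
    exact sum_congr rfl fun α _ => spinBracket_cyclic α a b e
  rw [← smul_sum] at h1
  exact h1

end Jacobiator

/-! ### The quasi-Poisson bracket as a fusion -/

section Decomposition

open Matrix

variable {n d : ℕ} {A : Type} [CommRing A] [Algebra ℂ A]

/-- Extension by zero of a matrix of derivations to the block at the vertex `0`. -/
def blockZero (E : MatDer (RepRing n d) n) : BIdx n → BIdx n → Der(RepRing n d)
  | .inl i, .inl j => E i j
  | _, _ => 0

/-- Extension by zero of a derivation to the block at the vertex `∞`. -/
def blockInf (n : ℕ) {d : ℕ} (D : Der(RepRing n d)) : BIdx n → BIdx n → Der(RepRing n d)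
  | .inr _, .inr _ => D
  | _, _ => 0

/-- The fusion term of two arrows. -/
def crossTerm (F G : BIdx n → BIdx n → Der(RepRing n d)) :
    Bider (RepRing n d) := ∑ i, ∑ j, wedge (F i j) (G j i)

theorem wedge_zero_left (D : Der(A)) : wedge 0 D = 0 := by
  ext f g
  rw [wedge_apply]
  simp only [Derivation.zero_apply, mul_zero, zero_mul, sub_zero]

theorem wedge_zero_right (D : Der(A)) : wedge D 0 = 0 := by
  ext f g
  rw [wedge_apply]
  simp only [Derivation.zero_apply, mul_zero, zero_mul, sub_zero]

theorem crossTerm_zero_zero (E F : MatDer (RepRing n d) n) :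
    crossTerm (blockZero E) (blockZero F) = traceWedge E F := by
  simp only [crossTerm, Fintype.sum_sum_type, blockZero, sum_const_zero,
    add_zero, traceWedge, wedge_zero_right]

theorem crossTerm_inf_inf (D E : Der(RepRing n d)) :
    crossTerm (blockInf n D) (blockInf n E) = wedge D E := by
  simp only [crossTerm, Fintype.sum_sum_type, blockInf, sum_const_zero,
    zero_add, wedge_zero_right, univ_unique, sum_singleton]

theorem crossTerm_zero_inf (E : MatDer (RepRing n d) n) (D : Der(RepRing n d)) :
    crossTerm (blockZero E) (blockInf n D) = 0 ∧ crossTerm (blockInf n D) (blockZero E) = 0 := by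
  constructor <;> simp only [crossTerm, Fintype.sum_sum_type, blockInf, blockZero, wedge_zero_left,
    sum_const_zero, add_zero, wedge_zero_right]

theorem fusField_x_eq : fusField (n := n) (d := d) (none, false) =
    blockZero (-(leftX n d + rightZ n d)) := by
  funext i j
  rw [fusField_x]
  rcases i with i | i <;> rcases j with j | j <;> rfl

theorem fusField_z_eq : fusField (n := n) (d := d) (none, true) =
    blockZero (-(rightX n d + leftZ n d)) := by
  funext i j
  rw [fusField_z]
  rcases i with i | i <;> rcases j with j | j <;> rfl

theorem fusField_v_eq (α : Fin d) : fusField (n := n) (some α, false) =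
    blockInf n (scaleField n α) := by
  funext i j
  rw [fusField_v, ← scaleField_eq]
  rcases i with i | i <;> rcases j with j | j <;> rfl

theorem fusField_w_eq (α : Fin d) : fusField (n := n) (some α, true) =
    blockZero (-spinDer n α) := by
  funext i j
  rw [fusField_w]
  rcases i with i | i <;> rcases j with j | j <;> rfl

theorem traceWedge_neg_neg (E F : MatDer A n) : traceWedge (-E) (-F) = traceWedge E F := by
  ext f g
  have h : ∀ (E : MatDer A n) f, matDer (-E) f = -matDer E f := by intro E f; ext i j; rfl
  simp only [traceWedge_apply, h, neg_mul_neg]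

theorem traceWedge_swap_apply (E F : MatDer A n) (f g : A) :
    traceWedge E F f g = -traceWedge F E f g := by
  rw [traceWedge_neg_swap]
  rfl

theorem traceWedge_add_left (E E' F : MatDer A n) :
    traceWedge (E + E') F = traceWedge E F + traceWedge E' F := by
  simpa using traceWedge_sum_left (univ : Finset (Fin 2)) ![E, E'] F

theorem traceWedge_add_right (E F F' : MatDer A n) :
    traceWedge E (F + F') = traceWedge E F + traceWedge E F' := by
  rw [traceWedge_neg_swap, traceWedge_add_left, neg_add, ← traceWedge_neg_swap,
    ← traceWedge_neg_swap]

/-- The last term comes from the vertex with one-dimensional space. -/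
theorem sum_crossTerm : (∑ a : Arrow d, ∑ b : Arrow d with a.pos < b.pos,
      ∑ i : BIdx n, ∑ j : BIdx n, wedge (fusField a i j) (fusField b j i)) =
    traceWedge (leftX n d + rightZ n d) (rightX n d + leftZ n d) +
    ∑ α, traceWedge (leftX n d + rightZ n d + (rightX n d + leftZ n d)) (spinDer n α) +
    ∑ α : Fin d, ∑ β : Fin d with α < β, traceWedge (spinDer n α) (spinDer n β) +
    ∑ α : Fin d, ∑ β : Fin d with α < β, wedge (scaleField n α) (scaleField n β) := by
  change (∑ a : Arrow d, ∑ b : Arrow d with a.pos < b.pos,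
    crossTerm (n := n) (fusField a) (fusField b)) = _
  have p1 : ∀ α : Fin d, 0 < 2 * (α.1 + 1) := fun α => by omega
  have p2 : ∀ α β : Fin d, (2 * (α.1 + 1) + 1 < 2 * (β.1 + 1) + 1) ↔ α < β := fun α β => by
    rw [Fin.lt_def]; omega
  have p3 : ∀ α β : Fin d, (2 * (α.1 + 1) < 2 * (β.1 + 1)) ↔ α < β := fun α β => by
    rw [Fin.lt_def]; omega
  have p4 : ∀ α : Fin d, 1 < 2 * (α.1 + 1) + 1 := fun α => by omega
  have p5 : ∀ α : Fin d, ¬ 2 * (α.1 + 1) + 1 < 1 := fun α => by omega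
  have p6 : ∀ α : Fin d, ¬ 2 * (α.1 + 1) + 1 < 0 := fun α => by omega
  have p7 : ∀ α : Fin d, 0 < 2 * (α.1 + 1) + 1 := fun α => by omega
  simp only [sum_filter, Fintype.sum_prod_type, Fintype.sum_option, Fintype.sum_bool,
    Arrow.pos, Option.elim, fusField_x_eq, fusField_z_eq, fusField_v_eq, fusField_w_eq,
    crossTerm_zero_zero, crossTerm_inf_inf, (crossTerm_zero_inf _ _).1, (crossTerm_zero_inf _ _).2, ite_self,
    traceWedge_neg_neg, mul_zero, zero_add, add_zero, if_true, if_false, Bool.false_eq_true,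
    p1, p2, p3, p4, p7, Nat.lt_one_iff,
    sum_const_zero, sum_add_distrib,
    traceWedge_add_left, not_lt_zero,
    Nat.add_eq_zero_iff, one_ne_zero, and_false]
  abel

theorem own_sum_aux {A : Type} [CommRing A] (z x p r p' r' : Fin n → Fin n → A) :
    ∑ i, ∑ j, ∑ k, (∑ l, z i l * x l j) * (p k j * r i k - r' i k * p' k j) =
    ∑ l, -∑ k, ((∑ j, x l j * p k j) * (-∑ i, z i l * r i k) -
      (-∑ i, z i l * r' i k) * (∑ j, x l j * p' k j)) := by
  calc _ = ∑ i, ∑ k, ∑ j, ∑ l, z i l * x l j * (p k j * r i k - r' i k * p' k j) :=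
        sum_congr rfl fun i _ => by simp only [sum_mul]; exact sum_comm
    _ = ∑ k, ∑ i, ∑ j, ∑ l, z i l * x l j * (p k j * r i k - r' i k * p' k j) := sum_comm
    _ = ∑ k, ∑ i, ∑ l, ∑ j, z i l * x l j * (p k j * r i k - r' i k * p' k j) :=
        sum_congr rfl fun k _ => sum_congr rfl fun i _ => sum_comm
    _ = ∑ k, ∑ l, ∑ i, ∑ j, z i l * x l j * (p k j * r i k - r' i k * p' k j) :=
        sum_congr rfl fun k _ => sum_comm
    _ = ∑ l, ∑ k, ∑ i, ∑ j, z i l * x l j * (p k j * r i k - r' i k * p' k j) := sum_comm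
    _ = ∑ l, ∑ k, -((∑ j, x l j * p k j) * (-∑ i, z i l * r i k) -
      (-∑ i, z i l * r' i k) * (∑ j, x l j * p' k j)) :=
        sum_congr rfl fun l _ => sum_congr rfl fun k _ => by
        rw [show ∀ a b c e : A, -(a * -b - -c * e) = b * a - c * e from fun a b c e => by ring,
          sum_mul_sum, sum_mul_sum, ← sum_sub_distrib]
        refine sum_congr rfl fun i _ => ?_
        rw [← sum_sub_distrib]
        exact sum_congr rfl fun j _ => by ring
    _ = _ := by simp only [sum_neg_distrib]

theorem own_spin_aux {A : Type} [CommRing A] (v w p r p' r' : Fin n → A) :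
    (∑ i, ∑ j, ((if i = j then 1 else 0) + w i * v j) * (p j * r' i - r i * p' j)) =
      (p ⬝ᵥ r' - p' ⬝ᵥ r) + ((v ⬝ᵥ p) * (w ⬝ᵥ r') - (v ⬝ᵥ p') * (w ⬝ᵥ r)) := by
  simp only [add_mul, sum_add_distrib, ite_mul, one_mul, zero_mul, sum_ite_eq,
    mem_univ, if_true, sum_sub_distrib, dotProduct, sum_mul_sum, mul_sub]
  rw [sum_comm (f := fun i j => w i * v j * (p j * r' i)),
    sum_comm (f := fun i j => w i * v j * (r i * p' j))]
  have e : ∀ a b : Fin n → A, ∑ i, ∑ j, w j * v i * (a i * b j) =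
      ∑ i, ∑ j, v i * a i * (w j * b j) := fun a b =>
    sum_congr rfl fun i _ => sum_congr rfl fun j _ => by ring
  simp only [mul_comm (r _) (p' _), e]
  ring

theorem sum_pairs {M : Type} [AddCommMonoid M] (g : Fin d → Fin d → M) :
    ∑ p : {p : Fin d × Fin d // p.1 < p.2}, g p.1.1 p.1.2 =
      ∑ α : Fin d, ∑ β : Fin d with α < β, g α β := by
  simp only [sum_filter]
  rw [← Fintype.sum_prod_type' (f := fun α β => if α < β then g α β else 0), ← sum_filter]
  exact (sum_subtype _ (fun p => by simp) (fun p : Fin d × Fin d => g p.1 p.2)).symm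

/-- The term of the arrow `a` in the first sum of the quasi-Poisson bracket. -/
def ownTerm (a : Arrow d) (f g : RepRing n d) : RepRing n d :=
  ∑ i : BIdx n, ∑ j : BIdx n, ∑ k : BIdx n, (algebraMap ℂ (RepRing n d) (if i = j then a.gam else 0)
      + ∑ l : BIdx n, entry a.star i l * entry a l j) *
    (del a j k f * del a.star k i g - del a.star k i f * del a j k g)

theorem ownTerm_x (f g : RepRing n d) : ownTerm (none, false) f g =
    -traceWedge (leftX n d) (rightZ n d) f g := by
  have h : ownTerm (none, false) f g = ∑ i, ∑ j, ∑ k, (∑ l, cf (.Z i l) * cf (.X l j)) *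
      (cD (.X k j) f * cD (.Z i k) g - cD (.Z i k) f * cD (.X k j) g) := by
    simp only [ownTerm, Fintype.sum_sum_type, entry, del, blockCoord, Arrow.star, Arrow.gam,
      Option.elim, ite_self, map_zero, Bool.not_false, Derivation.zero_apply, mul_zero, zero_mul,
      sub_zero, sum_const_zero, add_zero, zero_add]
  have h' : traceWedge (leftX n d) (rightZ n d) f g = ∑ l, ∑ k,
      ((∑ j, cf (.X l j) * cD (.X k j) f) * (-∑ i, cf (.Z i l) * cD (.Z i k) g) -
        (-∑ i, cf (.Z i l) * cD (.Z i k) f) * (∑ j, cf (.X l j) * cD (.X k j) g)) := by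
    simp only [traceWedge, bider_sum_apply, wedge_apply, leftX, rightZ, derivation_sum_apply,
      Derivation.smul_apply, Derivation.neg_apply, smul_eq_mul]
  rw [h, h', ← sum_neg_distrib]
  exact own_sum_aux (fun i l => cf (.Z i l)) (fun l j => cf (.X l j)) (fun k j => cD (.X k j) f)
    (fun i k => cD (.Z i k) g) (fun k j => cD (.X k j) g) (fun i k => cD (.Z i k) f)

theorem ownTerm_z (f g : RepRing n d) : ownTerm (none, true) f g =
    traceWedge (rightX n d) (leftZ n d) f g := by
  have h : ownTerm (none, true) f g = ∑ i, ∑ j, ∑ k, (∑ l, cf (.X i l) * cf (.Z l j)) *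
      (cD (.Z k j) f * cD (.X i k) g - cD (.X i k) f * cD (.Z k j) g) := by
    simp only [ownTerm, Fintype.sum_sum_type, entry, del, blockCoord, Arrow.star, Arrow.gam,
      Option.elim, ite_self, map_zero, Bool.not_true, Derivation.zero_apply, mul_zero, zero_mul,
      sub_zero, sum_const_zero, add_zero, zero_add]
  have h' : traceWedge (leftZ n d) (rightX n d) f g = ∑ l, ∑ k,
      ((∑ j, cf (.Z l j) * cD (.Z k j) f) * (-∑ i, cf (.X i l) * cD (.X i k) g) -
        (-∑ i, cf (.X i l) * cD (.X i k) f) * (∑ j, cf (.Z l j) * cD (.Z k j) g)) := by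
    simp only [traceWedge, bider_sum_apply, wedge_apply, leftZ, rightX, derivation_sum_apply,
      Derivation.smul_apply, Derivation.neg_apply, smul_eq_mul]
  rw [traceWedge_swap_apply, h, h', ← sum_neg_distrib]
  exact own_sum_aux (fun i l => cf (.X i l)) (fun l j => cf (.Z l j)) (fun k j => cD (.Z k j) f)
    (fun i k => cD (.X i k) g) (fun k j => cD (.Z k j) g) (fun i k => cD (.X i k) f)

theorem ownTerm_spin (α : Fin d) (f g : RepRing n d) :
    ownTerm (some α, false) f g - ownTerm (some α, true) f g = 2 * spinBracket n α f g := by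
  have h : ownTerm (some α, false) f g = ∑ i, ∑ j, ((if i = j then 1 else 0) + vW α i * vV α j) *
      (gV α f j * gW α g i - gW α f i * gV α g j) := by
    simp only [ownTerm, Fintype.sum_sum_type, entry, del, blockCoord, Arrow.star, Arrow.gam,
      Option.elim, map_zero, Bool.not_false, Derivation.zero_apply, mul_zero, zero_mul,
      sub_zero, sum_const_zero, add_zero, zero_add, univ_unique, sum_singleton,
      Sum.inl.injEq, apply_ite (algebraMap ℂ (RepRing n d)), map_one, gV, gW, vV, vW]
  have h' : ownTerm (some α, true) f g = ∑ k, (1 + ∑ l, vV α l * vW α l) *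
      (gW α f k * gV α g k - gV α f k * gW α g k) := by
    simp only [ownTerm, Fintype.sum_sum_type, entry, del, blockCoord, Arrow.star, Arrow.gam,
      Option.elim, Bool.not_true, Derivation.zero_apply, mul_zero, zero_mul,
      sub_zero, sum_const_zero, add_zero, zero_add, univ_unique, sum_singleton,
      if_true, map_one, gV, gW, vV, vW]
  rw [h, h', spinBracket_apply]
  have e1 : (∑ i, ∑ j, ((if i = j then 1 else 0) + vW α i * vV α j) *
      (gV α f j * gW α g i - gW α f i * gV α g j)) = (gV α f ⬝ᵥ gW α g - gV α g ⬝ᵥ gW α f) +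
      ((vV α ⬝ᵥ gV α f) * (vW α ⬝ᵥ gW α g) - (vV α ⬝ᵥ gV α g) * (vW α ⬝ᵥ gW α f)) :=
    own_spin_aux _ _ _ _ _ _
  have e2 : (∑ k, (1 + ∑ l, vV α l * vW α l) *
      (gW α f k * gV α g k - gV α f k * gW α g k)) = -((1 + vV α ⬝ᵥ vW α) *
        (gV α f ⬝ᵥ gW α g - gV α g ⬝ᵥ gW α f)) := by
    rw [← mul_sum, sum_sub_distrib]
    simp only [dotProduct, mul_comm (gW α f _)]
    ring
  rw [e1, e2]
  have h2 := two_half (n := n) (d := d)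
  linear_combination (-(vV α ⬝ᵥ vW α) * (gV α f ⬝ᵥ gW α g - gV α g ⬝ᵥ gW α f) -
    ((vV α ⬝ᵥ gV α f) * (vW α ⬝ᵥ gW α g) - (vV α ⬝ᵥ gV α g) * (vW α ⬝ᵥ gW α f))) * h2

theorem spinBracket_eq_ownTerm (α : Fin d) (f g : RepRing n d) : spinBracket n α f g =
    half n d * (ownTerm (some α, false) f g - ownTerm (some α, true) f g) := by
  rw [ownTerm_spin]
  have h2 := two_half (n := n) (d := d)
  generalize spinBracket n α f g = x
  linear_combination (-x) * h2

theorem quasiP_apply (f g : RepRing n d) : quasiP n d f g =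
    (1 / 2 : ℂ) • ∑ a : Arrow d, a.eps • ownTerm a f g + (-(1 / 2) : ℂ) •
    (∑ a : Arrow d, ∑ b : Arrow d with a.pos < b.pos,
      ∑ i : BIdx n, ∑ j : BIdx n, wedge (fusField a i j) (fusField b j i)) f g := by
  simp only [quasiP, Derivation.add_apply, Derivation.smul_apply, bider_sum_apply, ownTerm,
    wedge_apply, smul_eq_mul]

theorem sum_range_fin_lt {M : Type} [AddCommMonoid M] (m : ℕ) (hm : m ≤ d) (g : ℕ → M) :
    ∑ k ∈ range m, g k = ∑ β : Fin d with β.1 < m, g β := by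
  rw [sum_filter, Fin.sum_univ_eq_sum_range (fun k => if k < m then g k else 0), ← sum_filter]
  congr 1
  ext k
  simp only [mem_filter, mem_range]
  omega

theorem actSeq_spin (α : Fin d) : actSeq n d (4 + α.1) = spinDer n α := by
  rw [add_comm, actSeq, dif_pos α.2]

theorem fusion_actSeq : fusion (actSeq n d) (4 + d) =
    traceWedge (leftX n d) (rightZ n d) + traceWedge (rightX n d) (leftZ n d) +
    (traceWedge (leftX n d + rightZ n d) (rightX n d + leftZ n d) +
    ∑ α, traceWedge (leftX n d + rightZ n d + (rightX n d + leftZ n d)) (spinDer n α) +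
    ∑ α : Fin d, ∑ β : Fin d with α < β, traceWedge (spinDer n α) (spinDer n β)) := by
  have h4 : ∑ k ∈ range 4, actSeq n d k = leftX n d + rightZ n d + (rightX n d + leftZ n d) := by
    simp only [sum_range_succ, range_zero, sum_empty, actSeq]
    abel
  have h0 : traceWedge (0 : MatDer (RepRing n d) n) (leftX n d) = 0 := by
    simpa using traceWedge_sum_left (∅ : Finset ℕ) (fun _ => (0 : MatDer (RepRing n d) n)) (leftX n d)
  have h1 : ∑ l ∈ range 4, traceWedge (∑ k ∈ range l, actSeq n d k) (actSeq n d l) =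
      traceWedge (leftX n d) (rightZ n d) + traceWedge (rightX n d) (leftZ n d) +
      traceWedge (leftX n d + rightZ n d) (rightX n d + leftZ n d) := by
    simp only [sum_range_succ, range_zero, sum_empty, actSeq, zero_add, h0,
      traceWedge_add_left, traceWedge_add_right]
    abel
  have h2 : ∀ α : Fin d, traceWedge (∑ k ∈ range (4 + α.1), actSeq n d k) (actSeq n d (4 + α.1)) =
      traceWedge (leftX n d + rightZ n d + (rightX n d + leftZ n d)) (spinDer n α) +
      ∑ β, if β < α then traceWedge (spinDer n β) (spinDer n α) else 0 := by
    intro α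
    rw [actSeq_spin, sum_range_add, h4, traceWedge_add_left, traceWedge_sum_left,
      sum_range_fin_lt α.1 α.2.le, sum_filter]
    simp only [actSeq_spin, Fin.lt_def]
  rw [fusion, sum_range_add, h1, sum_range]
  simp only [h2, sum_add_distrib]
  rw [sum_comm]
  simp only [sum_filter]
  abel

theorem sum_ownTerm (f g : RepRing n d) : ∑ a : Arrow d, a.eps • ownTerm a f g =
    -traceWedge (leftX n d) (rightZ n d) f g - traceWedge (rightX n d) (leftZ n d) f g +
      ∑ α, (ownTerm (some α, false) f g - ownTerm (some α, true) f g) := by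
  rw [Fintype.sum_prod_type, Fintype.sum_option]
  simp only [Fintype.sum_bool, ownTerm_x, ownTerm_z, Arrow.eps, if_true, Bool.false_eq_true,
    if_false, one_smul, neg_smul, sum_add_distrib, sum_sub_distrib,
    sum_neg_distrib]
  ring

theorem spinTotal_apply (f g : RepRing n d) : spinTotal n d f g =
    half n d * ∑ α, (ownTerm (some α, false) f g - ownTerm (some α, true) f g) := by
  rw [spinTotal, bider_sum_apply, mul_sum]
  exact sum_congr rfl fun α _ => spinBracket_eq_ownTerm α f g

theorem quasiP_apply_eq (f g : RepRing n d) : quasiP n d f g =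
    spinTotal n d f g + (-(1 / 2) : ℂ) • fusion (actSeq n d) (4 + d) f g +
    (-(1 / 2) : ℂ) • (∑ α : Fin d, ∑ β : Fin d with α < β,
      wedge (scaleField n α) (scaleField n β)) f g := by
  rw [quasiP_apply, sum_crossTerm, fusion_actSeq, sum_ownTerm, spinTotal_apply]
  simp only [Derivation.add_apply, half_smul, neg_smul]
  ring

theorem wedge_pairs_apply (c : ℂ) (D : Fin d → Der(A)) (f g : A) :
    (∑ p : {p : Fin d × Fin d // p.1 < p.2}, c • wedge (D p.1.1) (D p.1.2)) f g =
    c • (∑ α : Fin d, ∑ β : Fin d with α < β, wedge (D α) (D β)) f g := by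
  rw [← smul_sum, sum_pairs (fun α β => wedge (D α) (D β))]
  rfl

/-- The quasi-Poisson bracket is obtained by fusion from the brackets of the pairs `(V_α, W_α)`. -/
theorem quasiP_eq : quasiP n d = spinTotal n d + (-(1 / 2) : ℂ) • fusion (actSeq n d) (4 + d) +
    ∑ p : {p : Fin d × Fin d // p.1 < p.2},
      (-(1 / 2) : ℂ) • wedge (scaleField n p.1.1) (scaleField n p.1.2) := by
  refine Derivation.ext fun f => Derivation.ext fun g => ?_
  rw [quasiP_apply_eq f g, ← wedge_pairs_apply]
  rfl

end Decomposition

/-! ### The jacobiator of the pencil -/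

section PencilJacobi

open Matrix

variable {n d : ℕ}

theorem preserves_spinBracket {D : Der(RepRing n d)} {α : Fin d}
    (M : Matrix (Fin n) (Fin n) (RepRing n d)) (hV : ∀ j, D (vV α j) = (-(vV α ᵥ* M)) j)
    (hW : ∀ j, D (vW α j) = (M *ᵥ vW α) j) (hgV : ∀ c, gV α (D (cf c)) = -(M *ᵥ gV α (cf c)))
    (hgW : ∀ c, gW α (D (cf c)) = gW α (cf c) ᵥ* M) : Preserves D (spinBracket n α) := by
  refine preserves_of_coord fun a b => ?_
  refine (der_spinBracket D α a b _ _ hV hW).trans ?_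
  have h1 := spinBracket_apply α (D (cf a)) (cf b)
  have h2 := spinBracket_apply α (cf a) (D (cf b))
  refine Eq.trans ?_ (congrArg₂ (· + ·) h1 h2).symm
  rw [hgV, hgV, hgW, hgW]
  have key : ∀ x y : Fin n → RepRing n d, (M *ᵥ x) ⬝ᵥ y = (y ᵥ* M) ⬝ᵥ x := fun x y => by
    rw [dotProduct_comm, dotProduct_mulVec]
  have key' : ∀ x y : Fin n → RepRing n d, x ⬝ᵥ (y ᵥ* M) = (y ᵥ* M) ⬝ᵥ x := fun x y =>
    dotProduct_comm _ _
  have key2 : ∀ x y : Fin n → RepRing n d, x ⬝ᵥ (M *ᵥ y) = (x ᵥ* M) ⬝ᵥ y := fun x y =>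
    dotProduct_mulVec _ _ _
  simp only [neg_dotProduct, dotProduct_neg, key, key', key2]
  ring

theorem vV_cf (α : Fin d) (j : Fin n) : vV α j = cf (.V α j) := rfl

theorem vW_cf (α : Fin d) (j : Fin n) : vW α j = cf (.W α j) := rfl

theorem preserves_spinBracket_of_zero {D : Der(RepRing n d)} {α : Fin d}
    (hV : ∀ j, D (cf (.V α j)) = 0) (hW : ∀ j, D (cf (.W α j)) = 0)
    (hgV : ∀ c j, cD (.V α j) (D (cf c)) = 0) (hgW : ∀ c j, cD (.W α j) (D (cf c)) = 0) :
    Preserves D (spinBracket n α) := by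
  refine preserves_spinBracket 0 (fun j => ?_) (fun j => ?_) (fun c => ?_) (fun c => ?_)
  · rw [vV_cf, hV, vecMul_zero, neg_zero]; rfl
  · rw [vW_cf, hW, zero_mulVec]; rfl
  · funext j; rw [gV, hgV, zero_mulVec, neg_zero]; rfl
  · funext j; rw [gW, hgW, vecMul_zero]; rfl

theorem leftX_preserves (i j : Fin n) : Preserves (leftX n d i j) (spinTotal n d) :=
  Preserves.sum _ fun α _ => preserves_spinBracket_of_zero (fun k => by simp [leftX_cf])
    (fun k => by simp [leftX_cf]) (fun c k => by cases c <;> simp [leftX_cf, apply_ite, cD_cf])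
    (fun c k => by cases c <;> simp [leftX_cf, apply_ite, cD_cf])

theorem rightX_preserves (i j : Fin n) : Preserves (rightX n d i j) (spinTotal n d) :=
  Preserves.sum _ fun α _ => preserves_spinBracket_of_zero (fun k => by simp [rightX_cf])
    (fun k => by simp [rightX_cf]) (fun c k => by cases c <;> simp [rightX_cf, apply_ite, cD_cf])
    (fun c k => by cases c <;> simp [rightX_cf, apply_ite, cD_cf])

theorem leftZ_preserves (i j : Fin n) : Preserves (leftZ n d i j) (spinTotal n d) :=
  Preserves.sum _ fun α _ => preserves_spinBracket_of_zero (fun k => by simp [leftZ_cf])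
    (fun k => by simp [leftZ_cf]) (fun c k => by cases c <;> simp [leftZ_cf, apply_ite, cD_cf])
    (fun c k => by cases c <;> simp [leftZ_cf, apply_ite, cD_cf])

theorem rightZ_preserves (i j : Fin n) : Preserves (rightZ n d i j) (spinTotal n d) :=
  Preserves.sum _ fun α _ => preserves_spinBracket_of_zero (fun k => by simp [rightZ_cf])
    (fun k => by simp [rightZ_cf]) (fun c k => by cases c <;> simp [rightZ_cf, apply_ite, cD_cf])
    (fun c k => by cases c <;> simp [rightZ_cf, apply_ite, cD_cf])

/-- Spins with different labels are independent, and the own action preserves each spin bracket. -/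
theorem spinDer_preserves (β : Fin d) (i j : Fin n) :
    Preserves (spinDer n β i j) (spinTotal n d) := by
  refine Preserves.sum _ fun α _ => ?_
  by_cases h : α = β
  · subst h
    refine preserves_spinBracket (Matrix.single j i 1) (fun k => ?_) (fun k => ?_) (fun c => ?_)
      (fun c => ?_)
    · by_cases hk : k = i
      · subst hk; simp [vV_cf, spinDer_cf, vecMul, dotProduct, Matrix.single_apply]
      · simp [vV_cf, spinDer_cf, vecMul, dotProduct, hk, Ne.symm hk]
    · by_cases hk : k = j
      · subst hk; simp [vW_cf, spinDer_cf, mulVec, dotProduct, Matrix.single_apply]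
      · simp [vW_cf, spinDer_cf, mulVec, dotProduct, hk, Ne.symm hk]
    · funext k
      cases c with
      | V γ l =>
        by_cases h1 : γ = α <;> by_cases h2 : l = i <;> by_cases h3 : j = k <;>
          simp [gV, spinDer_cf, mulVec, dotProduct, Matrix.single_apply, cD_cf, h1, h2, h3] <;>
          intro h4 <;> exact absurd h4.symm h2
      | _ => simp [gV, spinDer_cf, mulVec, dotProduct, Matrix.single_apply, cD_cf, apply_ite]
    · funext k
      cases c with
      | W γ l =>
        by_cases h1 : γ = α <;> by_cases h2 : l = j <;> by_cases h3 : i = k <;>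
          simp [gW, spinDer_cf, vecMul, dotProduct, Matrix.single_apply, cD_cf, h1, h2, h3]
      | _ => simp [gW, spinDer_cf, vecMul, dotProduct, Matrix.single_apply, cD_cf, apply_ite]
  · refine preserves_spinBracket_of_zero (fun k => by simp [spinDer_cf, h])
      (fun k => by simp [spinDer_cf, h]) (fun c k => ?_) (fun c k => ?_) <;>
    cases c <;> simp [spinDer_cf, apply_ite, cD_cf, ite_and, Ne.symm h]

theorem actSeq_preserves (k : ℕ) (i j : Fin n) : Preserves (actSeq n d k i j) (spinTotal n d) := by
  match k with
  | 0 => exact leftX_preserves i j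
  | 1 => exact rightZ_preserves i j
  | 2 => exact rightX_preserves i j
  | 3 => exact leftZ_preserves i j
  | k + 4 =>
    by_cases h : k < d
    · simp only [actSeq, dif_pos h]; exact spinDer_preserves _ i j
    · simp only [actSeq, dif_neg h]; intro f g; simp

theorem scaleField_cf (α : Fin d) (c : RSCoord n d) : scaleField n α (cf c) = match c with
    | .V β j => if β = α then -cf (.V β j) else 0
    | .W β j => if β = α then cf (.W β j) else 0
    | _ => 0 := by
  rw [scaleField_eq, Derivation.sub_apply]
  cases c with
  | V β j => by_cases h : β = α <;> simp [eulerV, eulerW, derivation_sum_apply, cD_cf, h]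
  | W β j => by_cases h : β = α <;> simp [eulerV, eulerW, derivation_sum_apply, cD_cf, h]
  | _ => simp [eulerV, eulerW, derivation_sum_apply, cD_cf]

theorem scaleField_preserves (β : Fin d) : Preserves (scaleField n β) (spinTotal n d) := by
  refine Preserves.sum _ fun α _ => ?_
  by_cases h : α = β
  · subst h
    refine preserves_spinBracket 1 (fun k => ?_) (fun k => ?_) (fun c => ?_) (fun c => ?_)
    · simp [vV_cf, scaleField_cf]
    · simp [vW_cf, scaleField_cf]
    · funext k
      cases c with
      | V γ l => by_cases h1 : γ = α <;> by_cases h2 : l = k <;>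
          simp [gV, scaleField_cf, cD_cf, h1, h2]
      | W γ l => by_cases h1 : γ = α <;> simp [gV, scaleField_cf, cD_cf, h1]
      | _ => simp [gV, scaleField_cf, cD_cf]
    · funext k
      cases c with
      | W γ l => by_cases h1 : γ = α <;> simp [gW, scaleField_cf, cD_cf, h1]
      | V γ l => by_cases h1 : γ = α <;> simp [gW, scaleField_cf, cD_cf, h1]
      | _ => simp [gW, scaleField_cf, cD_cf]
  · refine preserves_spinBracket_of_zero (fun k => by simp [scaleField_cf, h])
      (fun k => by simp [scaleField_cf, h]) (fun c k => ?_) (fun c k => ?_) <;>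
    cases c <;> simp [scaleField_cf, apply_ite, cD_cf] <;> grind

theorem scaleField_comm (α β : Fin d) : DerComm (scaleField n α) (scaleField n β) :=
  derComm_of_coord fun c => by
    cases c <;> simp only [scaleField_cf, apply_ite, map_neg, map_zero] <;> split_ifs <;> simp

theorem scaleField_comm_actSeq (α : Fin d) (k : ℕ) (i j : Fin n) :
    DerComm (scaleField n α) (actSeq n d k i j) := by
  refine derComm_of_coord fun c => ?_
  match k with
  | 0 | 1 | 2 | 3 =>
    cases c <;> simp [actSeq, leftX_cf, rightX_cf, leftZ_cf, rightZ_cf, scaleField_cf, apply_ite]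
  | k + 4 =>
    by_cases h : k < d
    · simp only [actSeq, dif_pos h]
      cases c with
      | V γ l | W γ l =>
        simp only [spinDer_cf, scaleField_cf, ite_and, map_zero, apply_ite, map_neg]
        split_ifs <;> subst_vars <;> simp_all
      | _ => simp [spinDer_cf, scaleField_cf]
    · simp [actSeq, dif_neg h]

theorem cartan_swap_mul {A : Type} [CommRing A] [Algebra ℂ A] {E F : MatDer A n}
    (X : Matrix (Fin n) (Fin n) A) (G : A → Matrix (Fin n) (Fin n) A)
    (hE : ∀ f, matDer E f = X * G f) (hF : ∀ f, matDer F f = -(G f * X)) (f g h : A) :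
    cartan E f g h + cartan F f g h = 0 := by
  have key : ∀ a b c : A, trace (X * G a * (X * G b) * (X * G c)) =
      trace (G a * X * (G b * X) * (G c * X)) := fun a b c => by
    rw [show X * G a * (X * G b) * (X * G c) = X * (G a * X * (G b * X) * G c) by
      simp only [mul_assoc], trace_mul_comm]
    simp only [mul_assoc]
  rw [cartan, cartan]
  simp only [hE, hF, neg_mul, mul_neg, neg_neg, trace_neg, key]
  ring

theorem cartan_X (f g h : RepRing n d) : cartan (leftX n d) f g h + cartan (rightX n d) f g h = 0 :=
  cartan_swap_mul (Matrix.of fun i k => cf (.X i k)) (fun f => Matrix.of fun k j => cD (.X j k) f)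
    (fun f => by
      ext1 i j
      simp only [matDer, leftX, of_apply, derivation_sum_apply, Derivation.smul_apply, smul_eq_mul,
        mul_apply])
    (fun f => by
      ext1 i j
      simp only [matDer, rightX, of_apply, derivation_sum_apply, Derivation.smul_apply,
        smul_eq_mul, mul_apply, Matrix.neg_apply, Derivation.neg_apply, mul_comm]) f g h

theorem cartan_Z (f g h : RepRing n d) : cartan (leftZ n d) f g h + cartan (rightZ n d) f g h = 0 :=
  cartan_swap_mul (Matrix.of fun i k => cf (.Z i k)) (fun f => Matrix.of fun k j => cD (.Z j k) f)
    (fun f => by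
      ext1 i j
      simp only [matDer, leftZ, of_apply, derivation_sum_apply, Derivation.smul_apply, smul_eq_mul,
        mul_apply])
    (fun f => by
      ext1 i j
      simp only [matDer, rightZ, of_apply, derivation_sum_apply, Derivation.smul_apply,
        smul_eq_mul, mul_apply, Matrix.neg_apply, Derivation.neg_apply, mul_comm]) f g h

/-- The contributions of the two actions on `X`, and those on `Z`, cancel. -/
theorem sum_cartan (f g h : RepRing n d) : ∑ k ∈ range (4 + d), cartan (actSeq n d k) f g h =
    ∑ α, cartan (spinDer n α) f g h := by
  rw [sum_range_add, sum_range (n := d)]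
  have h4 : ∑ k ∈ range 4, cartan (actSeq n d k) f g h = 0 := by
    simp only [sum_range_succ, range_zero, sum_empty, actSeq]
    linear_combination cartan_X f g h + cartan_Z f g h
  rw [h4, zero_add]
  exact sum_congr rfl fun α _ => by rw [actSeq_spin]

/-- The infinitesimal simultaneous conjugation. -/
def totalAct (n d : ℕ) : MatDer (RepRing n d) n := ∑ k ∈ range (4 + d), actSeq n d k

/-- The part of the quasi-Poisson bracket invariant under all the scalings and fusions. -/
def coreP (n d : ℕ) : Bider (RepRing n d) :=
  spinTotal n d + (-(1 / 2) : ℂ) • fusion (actSeq n d) (4 + d)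

theorem coreP_isBivector : IsBivector (coreP n d) :=
  (spinTotal_isBivector n d).add ((fusion_isBivector _ _).smul _)

theorem scaleField_preserves_coreP (α : Fin d) : Preserves (scaleField n α) (coreP n d) := by
  have h : Preserves (scaleField n α) (fusion (actSeq n d) (4 + d)) :=
    preserves_fusion_of_comm fun k _ i j => scaleField_comm_actSeq α k i j
  have h' := h.smul (-(1 / 2) : ℂ)
  exact (scaleField_preserves α).add h'

theorem jac_coreP (f g h : RepRing n d) : jac (coreP n d) f g h =
    (-(1 / 4) : ℂ) • cartan (totalAct n d) f g h := by
  rw [coreP, jac_sub_fusion (spinTotal_isBivector n d) actSeq_isGL actSeq_comm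
    (fun k _ i j => actSeq_preserves k i j), sum_cartan, jac_spinTotal, totalAct, smul_sub,
    neg_smul, neg_smul]
  abel

theorem quasiP_isBivector : IsBivector (quasiP n d) := by
  rw [quasiP_eq]
  exact coreP_isBivector.add (IsBivector.sum _ fun p _ => (wedge_isBivector _ _).smul _)

theorem psiRep_isBivector (z : Param d) : IsBivector (psiRep n z) :=
  IsBivector.sum _ fun p _ => (wedge_isBivector _ _).smul _

theorem combined_eq (z₀ : ℂ) (z : Param d) : z₀ • quasiP n d + psiRep n z = z₀ • coreP n d +
    ∑ p : {p : Fin d × Fin d // p.1 < p.2},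
      (z₀ * -(1 / 2) + z p) • wedge (scaleField n p.1.1) (scaleField n p.1.2) := by
  rw [quasiP_eq, psiRep, coreP]
  simp only [add_smul, sum_add_distrib, smul_add, smul_sum, mul_smul]
  abel

set_option maxHeartbeats 1000000 in
/-- The jacobiator of the brackets of the pencil is a multiple of the Cartan trivector of the
conjugation action; in particular it vanishes on invariant functions. -/
theorem jac_combined (z₀ : ℂ) (z : Param d) (f g h : RepRing n d) :
    jac (z₀ • quasiP n d + psiRep n z) f g h =
      (z₀ ^ 2 * -(1 / 4)) • cartan (totalAct n d) f g h := by
  have hP : ∀ α, Preserves (scaleField n α) (z₀ • coreP n d) := fun α =>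
    (scaleField_preserves_coreP α).smul z₀
  have h := jac_add_wedges (coreP_isBivector.smul z₀)
    (univ : Finset {p : Fin d × Fin d // p.1 < p.2}) (fun p => z₀ * -(1 / 2) + z p)
    (fun p => scaleField n p.1.1) (fun p => scaleField n p.1.2) (fun p _ => hP p.1.1)
    (fun p _ => hP p.1.2) (fun p _ p' _ => scaleField_comm p.1.1 p'.1.1)
    (fun p _ p' _ => scaleField_comm p.1.1 p'.1.2) (fun p _ p' _ => scaleField_comm p.1.2 p'.1.2)
    f g h
  rw [combined_eq]
  exact h.trans ((jac_smul _ _ _ _ _).trans (by rw [jac_coreP, smul_smul]))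

end PencilJacobi

/-! ### Smooth complete intersections -/

section CompleteIntersection

open MvPolynomial

variable {ι κ : Type} [Fintype ι] {U Y : Set (ι → ℂ)}

/-- Regular functions on a closed subset of a principal open subset extend: by the Nullstellensatz the
denominator divides a power of `Δ` modulo the equations. -/
theorem exists_extension {p : κ → MvPolynomial ι ℂ} {Δ : MvPolynomial ι ℂ}
    (hU : ∀ v ∈ U, eval v Δ ≠ 0) (hY : ∀ v, eval v Δ ≠ 0 → (∀ k, eval v (p k) = 0) → v ∈ Y)
    (hYU : Y ⊆ U) (hp : ∀ v ∈ Y, ∀ k, eval v (p k) = 0) (f : Y → ℂ) (hf : f ∈ Reg Y) :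
    ∃ F : Reg U, ∀ y : Y, F.1 ⟨y.1, hYU y.2⟩ = f y := by
  obtain ⟨s, r, h⟩ := hf
  have hΔ : Δ ∈ (Ideal.span (Set.range p) ⊔ Ideal.span {r}).radical := by
    rw [← vanishingIdeal_zeroLocus_eq_radical (K := ℂ), mem_vanishingIdeal_iff]
    intro v hv
    rw [mem_zeroLocus_iff] at hv
    have h1 : ∀ k, eval v (p k) = 0 := fun k => by
      have := hv (p k) (Ideal.mem_sup_left (Ideal.subset_span ⟨k, rfl⟩))
      rwa [MvPolynomial.aeval_eq_eval] at this
    have h2 : eval v r = 0 := by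
      have := hv r (Ideal.mem_sup_right (Ideal.subset_span rfl))
      rwa [MvPolynomial.aeval_eq_eval] at this
    by_contra h3
    rw [MvPolynomial.aeval_eq_eval] at h3
    exact (h ⟨v, hY v h3 h1⟩).1 h2
  obtain ⟨N, hN⟩ := hΔ
  obtain ⟨a, ha, b, hb, hab⟩ := Submodule.mem_sup.1 hN
  obtain ⟨c, rfl⟩ := Ideal.mem_span_singleton'.1 hb
  refine ⟨⟨fun u => eval u.1 (s * c) / eval u.1 (Δ ^ N), s * c, Δ ^ N, fun u => ⟨?_, rfl⟩⟩,
    fun y => ?_⟩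
  · rw [map_pow]; exact pow_ne_zero _ (hU _ u.2)
  · have ha0 : eval y.1 a = 0 := by
      have : Ideal.span (Set.range p) ≤ RingHom.ker (eval y.1) := by
        rw [Ideal.span_le]
        rintro _ ⟨k, rfl⟩
        exact hp y.1 y.2 k
      exact this ha
    have h1 : eval y.1 (Δ ^ N) = eval y.1 c * eval y.1 r := by
      rw [← hab, map_add, ha0, zero_add, map_mul]
    have h2 : eval y.1 (Δ ^ N) ≠ 0 := by rw [map_pow]; exact pow_ne_zero _ (hU _ (hYU y.2))
    change eval y.1 (s * c) / eval y.1 (Δ ^ N) = f y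
    rw [(h y).2, div_eq_div_iff h2 (h y).1, h1, map_mul]
    ring

/-- A regular function vanishing on a smooth complete intersection has a differential vanishing on
its tangent vectors. -/
theorem dirAt_eq_zero_of_tangent [Fintype κ] (hU : IsOpen U) {p : κ → MvPolynomial ι ℂ}
    (hY : ∀ v ∈ U, (∀ k, eval v (p k) = 0) → v ∈ Y) (hYU : Y ⊆ U) (u : U)
    (hu : ∀ k, eval u.1 (p k) = 0) (hsurj : ∀ c : κ → ℂ, ∃ δ, ∀ k, dd u.1 δ (p k) = c k)
    (F : Reg U) (hF : ∀ y : Y, F.1 ⟨y.1, hYU y.2⟩ = 0) (δ : ι → ℂ)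
    (hδ : ∀ k, dd u.1 δ (p k) = 0) : dirAt hU u δ F = 0 := by
  let f : (ι → ℂ) → (κ → ℂ) := fun v k => eval v (p k)
  let f' : (ι → ℂ) →L[ℂ] (κ → ℂ) := ContinuousLinearMap.pi fun k => ddL u.1 (p k)
  have hf : HasStrictFDerivAt f f' u.1 :=
    hasStrictFDerivAt_pi.2 fun k => hasStrictFDerivAt_poly u.1 (p k)
  have hr : f'.range = ⊤ := by
    rw [LinearMap.range_eq_top]
    intro c
    obtain ⟨δ, h⟩ := hsurj c
    exact ⟨δ, funext fun k => (ddL_apply _ _ _).trans (h k)⟩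
  have hk : δ ∈ f'.ker := by
    rw [LinearMap.mem_ker]
    exact funext fun k => (ddL_apply _ _ _).trans (hδ k)
  have hfu : f u.1 = 0 := funext hu
  -- the curve in the level set with derivative `δ`
  let φ := hf.implicitFunction f f' hr
  have hφ : HasStrictFDerivAt (φ (f u.1)) f'.ker.subtypeL 0 := hf.to_implicitFunction hr
  have hline : HasDerivAt (fun t : ℂ => t • (⟨δ, hk⟩ : f'.ker)) ⟨δ, hk⟩ 0 := by
    simpa using (hasDerivAt_id (0 : ℂ)).smul_const (⟨δ, hk⟩ : f'.ker)
  have hφ' : HasFDerivAt (φ (f u.1)) f'.ker.subtypeL ((0 : ℂ) • (⟨δ, hk⟩ : f'.ker)) := by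
    rw [zero_smul]; exact hφ.hasFDerivAt
  have hγ := hφ'.comp_hasDerivAt (0 : ℂ) hline
  have h0 : φ (f u.1) ((0 : ℂ) • (⟨δ, hk⟩ : f'.ker)) = u.1 := by
    rw [zero_smul]
    exact (hf.implicitFunction_apply_image hr)
  have hγ' : HasDerivAt (fun t : ℂ => φ (f u.1) (t • (⟨δ, hk⟩ : f'.ker))) δ 0 := hγ
  refine dirAt_eq_zero_of_curve hU u δ _ h0 hγ' F 0 ?_
  have hcont : Filter.Tendsto (fun t : ℂ => (f u.1, t • (⟨δ, hk⟩ : f'.ker))) (nhds 0)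
      (nhds (f u.1, 0)) := by
    have : Continuous fun t : ℂ => (f u.1, t • (⟨δ, hk⟩ : f'.ker)) := by fun_prop
    simpa using this.tendsto 0
  have h1 := hcont.eventually (hf.map_implicitFunction_eq hr)
  have h2 : ∀ᶠ t in nhds (0 : ℂ), φ (f u.1) (t • ⟨δ, hk⟩) ∈ U := by
    refine hγ.continuousAt.eventually_mem (hU.mem_nhds ?_)
    rw [Function.comp_apply, h0]
    exact u.2
  filter_upwards [h1, h2] with t ht ht'
  refine ⟨ht', ?_⟩
  have hy : φ (f u.1) (t • ⟨δ, hk⟩) ∈ Y := by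
    refine hY _ ht' fun k => ?_
    have := congrFun ht k
    rw [hfu] at this
    simpa [f, φ, hfu] using this
  exact hF ⟨_, hy⟩

end CompleteIntersection

/-! ### The equation of the level set -/

section LevelSet

open Matrix

variable {n d : ℕ}

/-- The labels of the entries, as a disjoint union. -/
def rsEquiv (n d : ℕ) : RSCoord n d ≃
    ((Fin n × Fin n) ⊕ (Fin n × Fin n)) ⊕ ((Fin d × Fin n) ⊕ (Fin d × Fin n)) where
  toFun
    | .X i j => .inl (.inl (i, j))
    | .Z i j => .inl (.inr (i, j))
    | .V α j => .inr (.inl (α, j))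
    | .W α i => .inr (.inr (α, i))
  invFun
    | .inl (.inl (i, j)) => .X i j
    | .inl (.inr (i, j)) => .Z i j
    | .inr (.inl (α, j)) => .V α j
    | .inr (.inr (α, i)) => .W α i
  left_inv c := by cases c <;> rfl
  right_inv c := by rcases c with ((c | c) | (c | c)) <;> rfl

instance : Fintype (RSCoord n d) := Fintype.ofEquiv _ (rsEquiv n d).symm

theorem sum_RSCoord {M : Type} [AddCommMonoid M] (f : RSCoord n d → M) : ∑ c, f c =
    (∑ i, ∑ j, f (.X i j)) + (∑ i, ∑ j, f (.Z i j)) +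
      ((∑ α, ∑ j, f (.V α j)) + ∑ α, ∑ j, f (.W α j)) := by
  rw [← Equiv.sum_comp (rsEquiv n d).symm]
  simp only [Fintype.sum_sum_type, Fintype.sum_prod_type]
  rfl

/-- The row `V_α` of a point. -/
def rowV (u : RVec n d) (α : Fin d) : Fin n → ℂ := fun j => u (.V α j)

/-- The column `W_α` of a point. -/
def colW (u : RVec n d) (α : Fin d) : Fin n → ℂ := fun i => u (.W α i)

/-- The matrix `Id + W_α V_α`, indexed by natural numbers, and equal to the identity if
`α` is out of range. -/
def muN (u : RVec n d) (k : ℕ) : Mat n := if h : k < d then matWV u ⟨k, h⟩ else 1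

/-- The product `ν_{k-1} ⋯ ν_0`. -/
def kprod {R : Type} [Monoid R] (ν : ℕ → R) : ℕ → R
  | 0 => 1
  | k + 1 => ν k * kprod ν k

theorem prod_inv_kprod (ν : ℕ → Mat n) (hν : ∀ k, IsUnit (ν k).det) (m : ℕ) :
    (List.ofFn fun α : Fin m => (ν α)⁻¹).prod * kprod ν m = 1 := by
  induction m with
  | zero => simp [kprod]
  | succ m ih =>
    rw [List.ofFn_succ', List.concat_eq_append, List.prod_append, kprod, List.prod_singleton]
    simp only [Fin.val_last, Fin.val_castSucc]
    rw [mul_assoc, ← mul_assoc _ (ν m), nonsing_inv_mul _ (hν m), one_mul, ih]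

theorem isUnit_muN {u : RVec n d} (hu : u ∈ repSpace n d) (k : ℕ) : IsUnit (muN u k).det := by
  rw [muN]
  split_ifs with h
  · exact (hu.2.2 _).isUnit
  · simp

theorem isUnit_kprod {ν : ℕ → Mat n} (hν : ∀ k, IsUnit (ν k).det) (m : ℕ) :
    IsUnit (kprod ν m).det := by
  induction m with
  | zero => simp [kprod]
  | succ m ih => rw [kprod, det_mul]; exact (hν m).mul ih

/-- The matrix `X Z - q (Id + W_d V_d) ⋯ (Id + W_1 V_1) Z X`, whose vanishing defines the level set. -/
def levelEq (q : ℂ) (u : RVec n d) : Mat n :=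
  matX u * matZ u - q • (kprod (muN u) d * matZ u * matX u)

theorem momentMap_eq_iff (q : ℂ) {u : RVec n d} (hu : u ∈ repSpace n d) :
    momentMap u = q • 1 ↔ levelEq q u = 0 := by
  have hX : IsUnit (matX u).det := hu.1.isUnit
  have hZ : IsUnit (matZ u).det := hu.2.1.isUnit
  have hK := prod_inv_kprod (muN u) (isUnit_muN hu) d
  have hL : (List.ofFn fun α : Fin d => (muN u α)⁻¹) = List.ofFn fun α : Fin d => (matWV u α)⁻¹ := by
    congr 1
    funext α
    rw [muN, dif_pos α.2]
  rw [hL] at hK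
  have hK' := mul_eq_one_comm.1 hK
  have e1 : momentMap u * kprod (muN u) d * matZ u * matX u = matX u * matZ u := by
    rw [momentMap, mul_assoc _ (List.prod _), hK, mul_one, nonsing_inv_mul_cancel_right _ _ hZ,
      nonsing_inv_mul_cancel_right _ _ hX]
  rw [levelEq, sub_eq_zero]
  constructor
  · intro h
    rw [← e1, h]
    simp only [smul_mul, one_mul]
  · intro h
    rw [momentMap, h]
    simp only [smul_mul]
    rw [mul_nonsing_inv_cancel_right _ _ hX, mul_nonsing_inv_cancel_right _ _ hZ, hK']

theorem mem_levelSet_iff (q : ℂ) (u : RVec n d) :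
    u ∈ levelSet n d q ↔ u ∈ repSpace n d ∧ levelEq q u = 0 := by
  constructor
  · exact fun h => ⟨h.1, (momentMap_eq_iff q h.1).1 h.2⟩
  · exact fun h => ⟨h.1, (momentMap_eq_iff q h.1).2 h.2⟩

/-! The same equation over the polynomial ring. -/

open MvPolynomial in
/-- The generic matrix `X`. -/
def polX (n d : ℕ) : Matrix (Fin n) (Fin n) (MvPolynomial (RSCoord n d) ℂ) :=
  Matrix.of fun i j => X (.X i j)

open MvPolynomial in
/-- The generic matrix `Z`. -/
def polZ (n d : ℕ) : Matrix (Fin n) (Fin n) (MvPolynomial (RSCoord n d) ℂ) :=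
  Matrix.of fun i j => X (.Z i j)

open MvPolynomial in
/-- The generic matrix `Id + W_α V_α`. -/
def polMu (n d : ℕ) (k : ℕ) : Matrix (Fin n) (Fin n) (MvPolynomial (RSCoord n d) ℂ) :=
  if h : k < d then 1 + vecMulVec (fun i => X (.W ⟨k, h⟩ i)) (fun j => X (.V ⟨k, h⟩ j)) else 1

/-- The equations of the level set. -/
def polEq (n d : ℕ) (q : ℂ) : Matrix (Fin n) (Fin n) (MvPolynomial (RSCoord n d) ℂ) :=
  polX n d * polZ n d - (MvPolynomial.C q : MvPolynomial (RSCoord n d) ℂ) • (kprod (polMu n d) d * polZ n d * polX n d)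

/-- Evaluation of matrices of polynomials. -/
def evM {ι : Type} (y : ι → ℂ) (A : Matrix (Fin n) (Fin n) (MvPolynomial ι ℂ)) :
    Mat n := A.map (eval y)

/-- The directional derivative of matrices of polynomials. -/
def ddM {ι : Type} [Fintype ι] (y δ : ι → ℂ) (A : Matrix (Fin n) (Fin n) (MvPolynomial ι ℂ)) :
    Mat n := A.map (dd y δ)

theorem ddM_mul {ι : Type} [Fintype ι] (y δ : ι → ℂ)
    (A B : Matrix (Fin n) (Fin n) (MvPolynomial ι ℂ)) :
    ddM y δ (A * B) = ddM y δ A * evM y B + evM y A * ddM y δ B := by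
  ext i j
  simp only [ddM, evM, map_apply, mul_apply, dd_sum, dd_mul, Matrix.add_apply, ← sum_add_distrib]

theorem evM_mul {ι : Type} (y : ι → ℂ) (A B : Matrix (Fin n) (Fin n) (MvPolynomial ι ℂ)) :
    evM y (A * B) = evM y A * evM y B := by
  rw [evM, Matrix.map_mul]; rfl

theorem evM_polX (y : RVec n d) : evM y (polX n d) = matX y := by ext i j; simp [evM, polX, matX]

theorem evM_polZ (y : RVec n d) : evM y (polZ n d) = matZ y := by ext i j; simp [evM, polZ, matZ]

theorem evM_polMu (y : RVec n d) (k : ℕ) : evM y (polMu n d k) = muN y k := by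
  rw [polMu, muN]
  split_ifs with h
  · ext i j
    by_cases hij : i = j <;> simp [evM, matWV, vecMulVec_apply, hij]
  · ext i j
    by_cases hij : i = j <;> simp [evM, Matrix.one_apply, hij]

theorem evM_one {ι : Type} (y : ι → ℂ) :
    evM y (1 : Matrix (Fin n) (Fin n) (MvPolynomial ι ℂ)) = 1 := by
  rw [evM, Matrix.map_one] <;> simp

theorem evM_kprod (y : RVec n d) (k : ℕ) : evM y (kprod (polMu n d) k) = kprod (muN y) k := by
  induction k with
  | zero => exact evM_one y
  | succ k ih => rw [kprod, evM_mul, ih, evM_polMu, kprod]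

theorem evM_polEq (q : ℂ) (y : RVec n d) : evM y (polEq n d q) = levelEq q y := by
  have : evM y (polEq n d q) = evM y (polX n d * polZ n d) -
      q • evM y (kprod (polMu n d) d * polZ n d * polX n d) := by
    ext i j
    simp only [evM, polEq, map_apply, Matrix.sub_apply, Matrix.smul_apply, smul_eq_mul, map_sub,
      map_mul, MvPolynomial.eval_C]
  rw [this]
  simp only [evM_mul, evM_polX, evM_polZ, evM_kprod, levelEq]

theorem ddM_polX (y δ : RVec n d) : ddM y δ (polX n d) = matX δ := by
  ext i j; simp [ddM, polX, matX, dd_X]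

theorem ddM_polZ (y δ : RVec n d) : ddM y δ (polZ n d) = matZ δ := by
  ext i j; simp [ddM, polZ, matZ, dd_X]

theorem dd_one {ι : Type} [Fintype ι] (y δ : ι → ℂ) : dd y δ 1 = 0 := by
  rw [← MvPolynomial.C_1]; exact dd_C _ _ _

theorem dd_zero {ι : Type} [Fintype ι] (y δ : ι → ℂ) : dd y δ 0 = 0 := by
  rw [← MvPolynomial.C_0]; exact dd_C _ _ _

theorem ddM_one {ι : Type} [Fintype ι] (y δ : ι → ℂ) :
    ddM y δ (1 : Matrix (Fin n) (Fin n) (MvPolynomial ι ℂ)) = 0 := by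
  ext i j
  by_cases hij : i = j <;> simp [ddM, hij, dd_one, dd_zero]

/-- The derivative of `Id + W_k V_k`. -/
def dmu (y δ : RVec n d) (k : ℕ) : Mat n :=
  if h : k < d then vecMulVec (colW δ ⟨k, h⟩) (rowV y ⟨k, h⟩) +
    vecMulVec (colW y ⟨k, h⟩) (rowV δ ⟨k, h⟩) else 0

theorem ddM_polMu (y δ : RVec n d) (k : ℕ) : ddM y δ (polMu n d k) = dmu y δ k := by
  rw [polMu, dmu]
  split_ifs with h
  · ext i j
    by_cases hij : i = j <;>
      simp [ddM, vecMulVec_apply, hij, dd_add, dd_mul, dd_one, dd_X, colW, rowV]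
  · exact ddM_one y δ

/-- The derivative of the product of the matrices `Id + W_α V_α`. -/
def dK (y δ : RVec n d) : ℕ → Mat n
  | 0 => 0
  | k + 1 => dmu y δ k * kprod (muN y) k + muN y k * dK y δ k

theorem ddM_kprod (y δ : RVec n d) (k : ℕ) : ddM y δ (kprod (polMu n d) k) = dK y δ k := by
  induction k with
  | zero => exact ddM_one y δ
  | succ k ih => rw [kprod, ddM_mul, ih, ddM_polMu, evM_kprod, evM_polMu, dK]

/-- The derivative of the equation of the level set. -/
def dLevel (q : ℂ) (y δ : RVec n d) : Mat n :=
  matX δ * matZ y + matX y * matZ δ - q • (dK y δ d * matZ y * matX y +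
    kprod (muN y) d * matZ δ * matX y + kprod (muN y) d * matZ y * matX δ)

theorem ddM_polEq (q : ℂ) (y δ : RVec n d) : ddM y δ (polEq n d q) = dLevel q y δ := by
  have : ddM y δ (polEq n d q) = ddM y δ (polX n d * polZ n d) -
      q • ddM y δ (kprod (polMu n d) d * polZ n d * polX n d) := by
    ext i j
    simp only [ddM, polEq, map_apply, Matrix.sub_apply, Matrix.smul_apply, smul_eq_mul]
    rw [sub_eq_add_neg, ← neg_mul, ← map_neg, dd_add, dd_mul, dd_C, MvPolynomial.eval_C]
    ring
  rw [this]
  simp only [ddM_mul, ddM_polX, ddM_polZ, ddM_kprod, evM_mul, evM_polX, evM_polZ, evM_kprod, dLevel,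
    add_mul]

end LevelSet

/-! ### Smoothness of the level set -/

section Smooth

open Matrix

variable {n d : ℕ}

/-- Two invertible matrices which `q`-commute on the range of a matrix commuting with both force this
matrix to vanish, by comparison of determinants on the range. -/
theorem eq_zero_of_q_commute {q : ℂ} (hq : ∀ k : ℕ, 1 ≤ k → k ≤ n → q ^ k ≠ 1)
    {X Z φ : Mat n} (hX : IsUnit X.det) (hZ : IsUnit Z.det)
    (hXφ : X * φ = φ * X) (hZφ : Z * φ = φ * Z) (h : X * Z * φ = q • (Z * X * φ)) : φ = 0 := by
  set V := LinearMap.range φ.mulVecLin with hV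
  have hmem : ∀ {A : Mat n}, A * φ = φ * A → ∀ v ∈ V, A.mulVecLin v ∈ V := by
    rintro A hA _ ⟨w, rfl⟩
    refine ⟨A *ᵥ w, ?_⟩
    simp only [mulVecLin_apply, mulVec_mulVec, hA]
  let f : V →ₗ[ℂ] V := X.mulVecLin.restrict (hmem hXφ)
  let g : V →ₗ[ℂ] V := Z.mulVecLin.restrict (hmem hZφ)
  have hfg : f ∘ₗ g = q • (g ∘ₗ f) := by
    ext v : 2
    obtain ⟨_, w, rfl⟩ := v
    change X *ᵥ (Z *ᵥ (φ *ᵥ w)) = q • (Z *ᵥ (X *ᵥ (φ *ᵥ w)))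
    simp only [mulVec_mulVec, ← smul_mulVec]
    rw [← mul_assoc, h, mul_assoc]
  have hinj : ∀ {A : Mat n} (_ : IsUnit A.det) (hA : A * φ = φ * A),
      LinearMap.det (A.mulVecLin.restrict (hmem hA) : V →ₗ[ℂ] V) ≠ 0 := by
    intro A hu hA
    have hi : Function.Injective (A.mulVecLin.restrict (hmem hA) : V →ₗ[ℂ] V) := by
      intro v w hvw
      have h1 : A *ᵥ v.1 = A *ᵥ w.1 := congrArg Subtype.val hvw
      exact Subtype.ext (mulVec_injective_of_isUnit ((isUnit_iff_isUnit_det A).2 hu) h1)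
    have := LinearEquiv.isUnit_det' (LinearEquiv.ofInjectiveEndo _ hi)
    exact this.ne_zero
  have hdet := congrArg LinearMap.det hfg
  rw [LinearMap.det_comp, LinearMap.det_smul, LinearMap.det_comp] at hdet
  have hf : LinearMap.det f ≠ 0 := hinj hX hXφ
  have hg : LinearMap.det g ≠ 0 := hinj hZ hZφ
  have hqV : q ^ Module.finrank ℂ V = 1 := by
    have h2 : (q ^ Module.finrank ℂ V - 1) * (LinearMap.det f * LinearMap.det g) = 0 := by
      linear_combination -hdet
    exact sub_eq_zero.1 ((mul_eq_zero.1 h2).resolve_right (mul_ne_zero hf hg))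
  have hle : Module.finrank ℂ V ≤ n := by simpa using Submodule.finrank_le V
  have h0 : Module.finrank ℂ V = 0 := by
    by_contra hne
    exact hq _ (Nat.one_le_iff_ne_zero.2 hne) hle hqV
  have hbot : V = ⊥ := Submodule.finrank_eq_zero.1 h0
  have : φ.mulVecLin = 0 := LinearMap.range_eq_bot.1 hbot
  ext i j
  have h1 := congrFun (congrArg (fun L : (Fin n → ℂ) →ₗ[ℂ] (Fin n → ℂ) => L (Pi.single j 1)) this) i
  simpa using h1

theorem eq_zero_of_trace {A : Mat n} (h : ∀ B, trace (A * B) = 0) : A = 0 := by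
  ext i j
  have := h (Matrix.single j i 1)
  simpa [Matrix.trace_mul_single] using this

theorem dK_eq {y δ : RVec n d} (hy : y ∈ repSpace n d) (m : ℕ) : dK y δ m = kprod (muN y) m *
      ∑ k ∈ range m, (kprod (muN y) (k + 1))⁻¹ * dmu y δ k * kprod (muN y) k := by
  induction m with
  | zero => simp [dK]
  | succ m ih =>
    have h := isUnit_kprod (isUnit_muN hy) (m + 1)
    rw [dK, sum_range_succ, mul_add, ← mul_assoc, ← mul_assoc, mul_nonsing_inv _ h, one_mul, ih,
      kprod, mul_assoc, add_comm]

/-- The vector with given components. -/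
def mkVec (A B : Mat n) (v w : Fin d → Fin n → ℂ) : RVec n d
  | .X i j => A i j
  | .Z i j => B i j
  | .V α j => v α j
  | .W α i => w α i

theorem dmu_mkVec_zero (y : RVec n d) (A B : Mat n) (k : ℕ) : dmu y (mkVec A B 0 0) k = 0 := by
  rw [dmu]
  split_ifs with h
  · have h1 : colW (mkVec A B 0 0) (⟨k, h⟩ : Fin d) = 0 := rfl
    have h2 : rowV (mkVec A B 0 0) (⟨k, h⟩ : Fin d) = 0 := rfl
    rw [h1, h2]
    simp
  · rfl

theorem dK_mkVec_zero (y : RVec n d) (A B : Mat n) (k : ℕ) : dK y (mkVec A B 0 0) k = 0 := by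
  induction k with
  | zero => rfl
  | succ k ih => rw [dK, ih, dmu_mkVec_zero, zero_mul, mul_zero, add_zero]

theorem dK_mkVec_single {y : RVec n d} (hy : y ∈ repSpace n d) (α : Fin d)
    (v w : Fin n → ℂ) : dK y (mkVec 0 0 (Pi.single α v) (Pi.single α w)) d =
      kprod (muN y) d * ((kprod (muN y) (α + 1))⁻¹ * (vecMulVec w (rowV y α) +
        vecMulVec (colW y α) v) * kprod (muN y) α) := by
  rw [dK_eq hy, sum_eq_single α.1]
  · congr 3
    rw [dmu, dif_pos α.2]
    have h1 : colW (mkVec 0 0 (Pi.single α v) (Pi.single α w)) α = w := by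
      funext i; simp [colW, mkVec]
    have h2 : rowV (mkVec 0 0 (Pi.single α v) (Pi.single α w)) α = v := by
      funext i; simp [rowV, mkVec]
    rw [Fin.eta, h1, h2]
  · intro k hk hkα
    have hk' := mem_range.1 hk
    have hne : (⟨k, hk'⟩ : Fin d) ≠ α := fun h => hkα (congrArg Fin.val h)
    have : dmu y (mkVec 0 0 (Pi.single α v) (Pi.single α w)) k = 0 := by
      rw [dmu, dif_pos hk']
      have h1 : colW (mkVec 0 0 (Pi.single α v) (Pi.single α w)) ⟨k, hk'⟩ = 0 := by
        funext i; simp [colW, mkVec, hne]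
      have h2 : rowV (mkVec 0 0 (Pi.single α v) (Pi.single α w)) ⟨k, hk'⟩ = 0 := by
        funext i; simp [rowV, mkVec, hne]
      rw [h1, h2]
      simp
    rw [this, mul_zero, zero_mul]
  · intro h; exact absurd (mem_range.2 α.2) h

/-- The infinitesimal stabilizers vanish, so that no covector is conormal to all the directions. -/
theorem eq_zero_of_conormal {q : ℂ} (hq : ∀ k : ℕ, 1 ≤ k → k ≤ n → q ^ k ≠ 1)
    {y : RVec n d} (hy : y ∈ levelSet n d q) {η : Mat n}
    (h : ∀ δ, trace (η * dLevel q y δ) = 0) : η = 0 := by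
  have hy1 := hy.1
  have hX : IsUnit (matX y).det := hy1.1.isUnit
  have hZ : IsUnit (matZ y).det := hy1.2.1.isUnit
  have hE : matX y * matZ y = q • (kprod (muN y) d * matZ y * matX y) :=
    sub_eq_zero.1 ((mem_levelSet_iff q y).1 hy).2
  set X := matX y
  set Z := matZ y
  set K := kprod (muN y) with hK
  have hKu : ∀ k, IsUnit (K k).det := isUnit_kprod (isUnit_muN hy1)
  -- the variations of `X` and of `Z`
  have hA : Z * η = q • (η * K d * Z) := by
    rw [← sub_eq_zero]
    refine eq_zero_of_trace fun A => ?_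
    have := h (mkVec A 0 0 0)
    rw [dLevel, dK_mkVec_zero] at this
    have e1 : matX (mkVec A 0 0 0 : RVec n d) = A := rfl
    have e2 : matZ (mkVec A 0 0 0 : RVec n d) = 0 := rfl
    rw [e1, e2] at this
    simp only [mul_zero, zero_mul, add_zero, zero_add, mul_sub, trace_sub, Matrix.mul_smul,
      trace_smul] at this
    rw [sub_mul, trace_sub, smul_mul, trace_smul, mul_assoc Z, trace_mul_comm Z, mul_assoc η A]
    simp only [mul_assoc] at this ⊢
    exact this
  have hB : η * X = q • (X * η * K d) := by
    rw [← sub_eq_zero]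
    refine eq_zero_of_trace fun A => ?_
    have := h (mkVec 0 A 0 0)
    rw [dLevel, dK_mkVec_zero] at this
    have e1 : matX (mkVec 0 A 0 0 : RVec n d) = 0 := rfl
    have e2 : matZ (mkVec 0 A 0 0 : RVec n d) = A := rfl
    rw [e1, e2] at this
    simp only [mul_zero, zero_mul, add_zero, zero_add, mul_sub, trace_sub, Matrix.mul_smul,
      trace_smul] at this
    rw [sub_mul, trace_sub, smul_mul, trace_smul,
      show X * η * K d * A = X * (η * (K d * A)) by simp only [mul_assoc], trace_mul_comm X]
    simp only [mul_assoc] at this ⊢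
    exact this
  -- `φ` commutes with `X` and `Z`; by the spin variations, `K k * φ = φ`, so that the equation of
  -- the level set makes `X` and `Z` `q`-commute on the range of `φ`
  set φ := η * X * Z with hφ
  have hφ' : φ = q • (η * K d * Z * X) := by
    rw [hφ, mul_assoc, hE, Matrix.mul_smul]; simp only [mul_assoc, K]
  have hZφ : Z * φ = φ * Z := by
    conv_rhs => rw [hφ']
    rw [hφ, ← mul_assoc, ← mul_assoc, hA]
    simp only [smul_mul, mul_assoc]
  have hXφ : X * φ = φ * X := by
    conv_lhs => rw [hφ']
    rw [hφ, hB]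
    simp only [smul_mul, Matrix.mul_smul, mul_assoc]
  have hθ : q • (Z * X * η * K d) = φ := by
    have hu : IsUnit (Z * X).det := by rw [det_mul]; exact hZ.mul hX
    have e : q • (Z * X * η * K d) * (Z * X) = φ * (Z * X) := by
      have e1 : q • (Z * X * η * K d) * (Z * X) = Z * X * φ := by
        rw [hφ']; simp only [smul_mul, Matrix.mul_smul, mul_assoc]
      rw [e1, mul_assoc, hXφ, ← mul_assoc, hZφ, mul_assoc]
    calc q • (Z * X * η * K d) = q • (Z * X * η * K d) * (Z * X) * (Z * X)⁻¹ :=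
          (mul_nonsing_inv_cancel_right _ _ hu).symm
      _ = φ := by rw [e, mul_nonsing_inv_cancel_right _ _ hu]
  have hspin : ∀ (α : Fin d) (v w : Fin n → ℂ), trace ((vecMulVec w (rowV y α) +
      vecMulVec (colW y α) v) * (K α * φ * (K (α + 1))⁻¹)) = 0 := by
    intro α v w
    have := h (mkVec 0 0 (Pi.single α v) (Pi.single α w))
    rw [dLevel, dK_mkVec_single hy1] at this
    have e1 : matX (mkVec 0 0 (Pi.single α v) (Pi.single α w) : RVec n d) = 0 := rfl
    have e2 : matZ (mkVec 0 0 (Pi.single α v) (Pi.single α w) : RVec n d) = 0 := rfl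
    rw [e1, e2] at this
    simp only [mul_zero, zero_mul, add_zero, zero_sub, mul_neg, trace_neg, neg_eq_zero] at this
    rw [← hθ]
    set D := vecMulVec w (rowV y α) + vecMulVec (colW y α) v
    have e3 : D * (K α * q • (Z * X * η * K d) * (K (α + 1))⁻¹) =
        D * (K α * Z * X) * (q • (η * K d * (K (α + 1))⁻¹)) := by
      simp only [smul_mul, Matrix.mul_smul, mul_assoc]
    rw [e3, trace_mul_comm]
    simp only [smul_mul, Matrix.mul_smul, mul_assoc] at this ⊢
    exact this
  have hstep : ∀ k ≤ d, K k * φ * (K k)⁻¹ = φ ∧ K k * φ = φ := by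
    intro k
    induction k with
    | zero => intro _; simp [hK, kprod]
    | succ k ih =>
      intro hk
      obtain ⟨ih1, ih2⟩ := ih (by omega)
      let α : Fin d := ⟨k, by omega⟩
      set ψ := K k * φ * (K (k + 1))⁻¹ with hψ
      have hmu : muN y k = 1 + vecMulVec (colW y α) (rowV y α) := by
        rw [muN, dif_pos (by omega)]; rfl
      have hW : ψ *ᵥ colW y α = 0 := by
        refine dotProduct_eq_zero _ fun v => ?_
        have := hspin α v 0
        rw [zero_vecMulVec, zero_add, trace_mul_comm, mul_vecMulVec, trace_vecMulVec] at this
        exact this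
      have hV : rowV y α ᵥ* ψ = 0 := by
        refine dotProduct_eq_zero _ fun w => ?_
        have := hspin α 0 w
        rw [vecMulVec_zero, add_zero, vecMulVec_mul, trace_vecMulVec] at this
        rw [dotProduct_comm]; exact this
      have e1 : ψ * muN y k = ψ := by
        rw [hmu, mul_add, mul_one, mul_vecMulVec, hW, zero_vecMulVec, add_zero]
      have e2 : muN y k * ψ = ψ := by
        rw [hmu, add_mul, one_mul, vecMulVec_mul, hV, vecMulVec_zero, add_zero]
      have hK1 : K (k + 1) = muN y k * K k := rfl
      have e3 : ψ = φ := by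
        have : ψ * muN y k = φ := by
          rw [hψ, hK1, Matrix.mul_inv_rev, ← mul_assoc, ih1, mul_assoc,
            nonsing_inv_mul _ (isUnit_muN hy1 k), mul_one]
        rw [← e1, this]
      rw [e3] at e2
      have e4 : K (k + 1) * φ = φ := by rw [hK1, mul_assoc, ih2, e2]
      refine ⟨?_, e4⟩
      calc K (k + 1) * φ * (K (k + 1))⁻¹ = K k * φ * (K (k + 1))⁻¹ := by rw [e4, ih2]
        _ = φ := e3
  have hKφ := (hstep d le_rfl).2
  have hφ0 : φ = 0 := by
    refine eq_zero_of_q_commute hq hX hZ hXφ hZφ ?_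
    have hc : Z * X * φ = φ * (Z * X) := by rw [mul_assoc, hXφ, ← mul_assoc, hZφ, mul_assoc]
    rw [hE, smul_mul, mul_assoc, mul_assoc, ← mul_assoc Z, hc, ← mul_assoc, hKφ]
  have hu : IsUnit (X * Z).det := by rw [det_mul]; exact hX.mul hZ
  rw [hφ, mul_assoc] at hφ0
  calc η = η * (X * Z) * (X * Z)⁻¹ := (mul_nonsing_inv_cancel_right _ _ hu).symm
    _ = 0 := by rw [hφ0, zero_mul]

theorem evM_eq_zero_iff {ι : Type} (v : ι → ℂ) (A : Matrix (Fin n) (Fin n) (MvPolynomial ι ℂ)) :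
    evM v A = 0 ↔ ∀ k : Fin n × Fin n, eval v (A k.1 k.2) = 0 :=
  ⟨fun h k => congrFun (congrFun h k.1) k.2, fun h => Matrix.ext fun i j => h (i, j)⟩

theorem eval_polEq_eq_zero_iff (q : ℂ) (v : RVec n d) :
    (∀ k : Fin n × Fin n, eval v (polEq n d q k.1 k.2) = 0) ↔ levelEq q v = 0 := by
  rw [← evM_polEq, evM_eq_zero_iff]

/-- The level set is smooth: by duality, from the vanishing of conormal covectors. -/
theorem dLevel_surjective {q : ℂ} (hq : ∀ k : ℕ, 1 ≤ k → k ≤ n → q ^ k ≠ 1)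
    {y : RVec n d} (hy : y ∈ levelSet n d q) (c : Fin n × Fin n → ℂ) :
    ∃ δ, ∀ k, dd y δ (polEq n d q k.1 k.2) = c k := by
  let L : (RVec n d) →ₗ[ℂ] (Fin n × Fin n → ℂ) :=
    LinearMap.pi fun k => (ddL y (polEq n d q k.1 k.2)).toLinearMap
  have hL : ∀ δ k, L δ k = dLevel q y δ k.1 k.2 := fun δ k => by
    rw [← ddM_polEq]; exact ddL_apply _ _ _
  have hr : LinearMap.range L = ⊤ := by
    by_contra hne
    obtain ⟨f, hf0, hf⟩ := Submodule.exists_le_ker_of_lt_top _ (lt_top_iff_ne_top.2 hne)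
    let η : Mat n := Matrix.of fun j i => f (Pi.single (i, j) 1)
    have hfη : ∀ c, f c = ∑ k, c k * η k.2 k.1 := by
      intro c
      conv_lhs => rw [pi_eq_sum_univ' c, map_sum]
      exact sum_congr rfl fun k _ => by
        rw [map_smul, smul_eq_mul]
        congr 2
    have hη : η = 0 := eq_zero_of_conormal hq hy fun δ => by
      have h1 : f (L δ) = 0 := hf ⟨δ, rfl⟩
      rw [hfη, Fintype.sum_prod_type] at h1
      rw [trace_mul_comm, trace, ← h1]
      exact sum_congr rfl fun i _ => by simp [diag_apply, mul_apply, hL]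
    refine hf0 (LinearMap.ext fun c => ?_)
    rw [hfη, hη]
    simp
  obtain ⟨δ, hδ⟩ := LinearMap.range_eq_top.1 hr c
  exact ⟨δ, fun k => (ddL_apply y δ _).symm.trans (congrFun hδ k)⟩

/-- Regular functions vanishing on the level set have differentials vanishing on the kernel of the
differential of its equation. -/
theorem dirAt_eq_zero_of_levelSet {q : ℂ} (hq : ∀ k : ℕ, 1 ≤ k → k ≤ n → q ^ k ≠ 1)
    (F : Reg (repSpace n d))
    (hF : ∀ y : levelSet n d q, F.1 ⟨y.1, levelSet_subset n d q y.2⟩ = 0) (y : levelSet n d q)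
    {δ : RVec n d} (hδ : dLevel q y.1 δ = 0) :
    dirAt (isOpen_repSpace n d) ⟨y.1, levelSet_subset n d q y.2⟩ δ F = 0 := by
  have hu := (eval_polEq_eq_zero_iff q y.1).2 ((mem_levelSet_iff q y.1).1 y.2).2
  have hs := dLevel_surjective hq y.2
  have hδ' : ∀ k : Fin n × Fin n, dd y.1 δ (polEq n d q k.1 k.2) = 0 := fun k => by
    have := ddM_polEq q y.1 δ
    rw [hδ] at this
    exact congrFun (congrFun this k.1) k.2
  have hY : ∀ v ∈ repSpace n d, (∀ k : Fin n × Fin n,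
      eval v (polEq n d q k.1 k.2) = 0) → v ∈ levelSet n d q :=
    fun v hv h => (mem_levelSet_iff q v).2 ⟨hv, (eval_polEq_eq_zero_iff q v).1 h⟩
  generalize polEq n d q = p at hu hs hδ' hY
  exact dirAt_eq_zero_of_tangent (p := fun k : Fin n × Fin n => p k.1 k.2) (isOpen_repSpace n d) hY
    (levelSet_subset n d q) ⟨y.1, levelSet_subset n d q y.2⟩ hu hs F hF δ hδ'

/-- A polynomial vanishing nowhere on the representation space, with principal open subset equal to it. -/
def polDet (n d : ℕ) : MvPolynomial (RSCoord n d) ℂ :=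
  (polX n d).det * (polZ n d).det * ∏ α : Fin d, (polMu n d α).det

theorem eval_polDet (u : RVec n d) : eval u (polDet n d) ≠ 0 ↔ u ∈ repSpace n d := by
  have h : ∀ A : Matrix (Fin n) (Fin n) (MvPolynomial (RSCoord n d) ℂ),
      eval u A.det = (evM u A).det := fun A => RingHom.map_det _ _
  have hmu : ∀ α : Fin d, muN u α = matWV u α := fun α => by rw [muN, dif_pos α.2]
  simp only [polDet, map_mul, map_prod, h, evM_polX, evM_polZ, evM_polMu, mul_ne_zero_iff,
    prod_ne_zero_iff, mem_univ, true_imp_iff, hmu, repSpace, Set.mem_ofPred_eq, and_assoc]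

/-- Functions on the phase space extend to the representation space. -/
theorem exists_lift_RS (q : ℂ) (f : RSRing n d q) : ∃ F : Reg (repSpace n d), LiftRS F f := by
  exact exists_extension (p := fun k : Fin n × Fin n => polEq n d q k.1 k.2) (Δ := polDet n d)
    (fun v hv => (eval_polDet v).2 hv)
    (fun v hv h => (mem_levelSet_iff q v).2 ⟨(eval_polDet v).1 hv, (eval_polEq_eq_zero_iff q v).1 h⟩)
    (levelSet_subset n d q) (fun v hv => (eval_polEq_eq_zero_iff q v).2 ((mem_levelSet_iff q v).1 hv).2) _ f.2

end Smooth

/-! ### Hamiltonian vectors of invariant functions -/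

section Hamiltonian

open Matrix

variable {n d : ℕ}

/-- Partial summation for fusion brackets: if the total moment of the second argument vanishes, each
term pairs with the partial sums. -/
theorem fusion_abel {R : Type} [CommRing R] (a b : ℕ → Matrix (Fin n) (Fin n) R) (m : ℕ)
    (hb : ∑ k ∈ range m, b k = 0) :
    ∑ l ∈ range m, (trace ((∑ k ∈ range l, a k) * b l) - trace ((∑ k ∈ range l, b k) * a l)) =
    -∑ l ∈ range m, trace (a l * (2 * (∑ k ∈ range l, b k) + b l)) := by
  have key : ∀ m, ∑ l ∈ range m, (trace ((∑ k ∈ range l, a k) * b l) -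
      trace ((∑ k ∈ range l, b k) * a l)) =
      trace ((∑ k ∈ range m, a k) * ∑ k ∈ range m, b k) -
      ∑ l ∈ range m, trace (a l * (2 * (∑ k ∈ range l, b k) + b l)) := by
    intro m
    induction m with
    | zero => simp
    | succ m ih =>
      rw [sum_range_succ, sum_range_succ, sum_range_succ, sum_range_succ,
        ih, trace_mul_comm (∑ k ∈ range m, b k)]
      simp only [add_mul, mul_add, trace_add, two_mul]
      ring
  rw [key, hb, mul_zero, trace_zero, zero_sub]

theorem sum_pairs_abel {R : Type} [CommRing R] (x y : Fin d → R) (hy : ∑ β, y β = 0) :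
    ∑ α : Fin d, ∑ β : Fin d with α < β, (x α * y β - x β * y α) =
      -∑ α, x α * (2 * (∑ β : Fin d with β < α, y β) + y α) := by
  have h1 : ∀ α : Fin d, (∑ β : Fin d with β < α, y β) + y α +
      (∑ β : Fin d with α < β, y β) = 0 := by
    intro α
    rw [← hy, sum_filter, sum_filter,
      show y α = ∑ β, if β = α then y β else 0 by simp, ← sum_add_distrib,
      ← sum_add_distrib]
    refine sum_congr rfl fun β _ => ?_
    rcases lt_trichotomy β α with h | h | h
    · simp [h, h.ne, h.not_gt]
    · simp [h]
    · simp [h, h.ne', h.not_gt]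
  have h2 : ∑ α : Fin d, ∑ β : Fin d with α < β, x β * y α =
      ∑ α, x α * ∑ β : Fin d with β < α, y β := by
    simp only [sum_filter, mul_sum, mul_ite, mul_zero]
    exact sum_comm
  simp only [sum_sub_distrib]
  rw [h2, ← sum_sub_distrib, ← sum_neg_distrib]
  refine sum_congr rfl fun α _ => ?_
  rw [← mul_sum]
  linear_combination x α * h1 α

/-- The matrix of derivatives with respect to `X`, transposed. -/
def gradX (ζ : RVec n d) : Mat n := Matrix.of fun k j => ζ (.X j k)

/-- The matrix of derivatives with respect to `Z`, transposed. -/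
def gradZ (ζ : RVec n d) : Mat n := Matrix.of fun k j => ζ (.Z j k)

theorem pair_RSCoord (ζ δ : RVec n d) : pair ζ δ =
    trace (gradX ζ * matX δ) + trace (gradZ ζ * matZ δ) +
      ∑ α, (rowV ζ α ⬝ᵥ rowV δ α + colW ζ α ⬝ᵥ colW δ α) := by
  rw [pair, sum_RSCoord, sum_add_distrib]
  have h : ∀ A B : Fin n → Fin n → ℂ, ∑ i, ∑ j, A i j * B i j =
      trace ((Matrix.of fun k j => A j k) * of B) := by
    intro A B
    rw [trace, sum_comm]
    exact sum_congr rfl fun i _ => by simp only [diag_apply, mul_apply, of_apply]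
  have hx := h (fun i j => ζ (.X i j)) fun i j => δ (.X i j)
  have hz := h (fun i j => ζ (.Z i j)) fun i j => δ (.Z i j)
  simp only [add_assoc] at hx hz ⊢
  rw [hx, hz]
  rfl

/-- The value at a point, on a covector, of the moments of the commuting actions. -/
def actPt (u ζ : RVec n d) : ℕ → Mat n
  | 0 => matX u * gradX ζ
  | 1 => -(gradZ ζ * matZ u)
  | 2 => -(gradX ζ * matX u)
  | 3 => matZ u * gradZ ζ
  | k + 4 => if h : k < d then vecMulVec (colW u ⟨k, h⟩) (colW ζ ⟨k, h⟩) -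
      vecMulVec (rowV ζ ⟨k, h⟩) (rowV u ⟨k, h⟩) else 0

/-- Covectors vanishing on the infinitesimal orbits. -/
def IsBasic (u ζ : RVec n d) : Prop := ∑ k ∈ range (4 + d), actPt u ζ k = 0

/-- Evaluation of matrices of regular functions. -/
def valM (u : repSpace n d) (A : Matrix (Fin n) (Fin n) (RepRing n d)) : Mat n := A.map (evalReg u)

theorem valM_mul (u : repSpace n d) (A B : Matrix (Fin n) (Fin n) (RepRing n d)) :
    valM u (A * B) = valM u A * valM u B := by
  rw [valM, Matrix.map_mul]; rfl

theorem valM_trace (u : repSpace n d) (A : Matrix (Fin n) (Fin n) (RepRing n d)) :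
    evalReg u (trace A) = trace (valM u A) := by
  simp only [trace, map_sum]; rfl

/-- The gradient of a regular function on the representation space. -/
abbrev gr (F : RepRing n d) (u : repSpace n d) : RVec n d := grad (isOpen_repSpace n d) F u

theorem evalReg_cD (u : repSpace n d) (c : RSCoord n d) (F : RepRing n d) :
    evalReg u (cD c F) = gr F u c := rfl

theorem evalReg_cf (u : repSpace n d) (c : RSCoord n d) : evalReg u (cf c) = u.1 c := rfl

theorem valM_actSeq (u : repSpace n d) (F : RepRing n d) (k : ℕ) :
    valM u (matDer (actSeq n d k) F) = actPt u.1 (gr F u) k := by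
  match k with
  | 0 | 1 | 2 | 3 =>
    ext i j
    simp only [valM, map_apply, matDer, of_apply, actSeq, leftX, rightZ, rightX, leftZ, mul_comm,
      derivation_sum_apply, Derivation.smul_apply, smul_eq_mul, map_sum, map_mul, evalReg_cD, evalReg_cf,
      actPt, mul_apply, matX, gradX, matZ, gradZ, Derivation.neg_apply, map_neg, Matrix.neg_apply]
  | k + 4 =>
    ext i j
    rw [actPt, actSeq]
    split_ifs with h
    · simp only [valM, map_apply, matDer, of_apply, spinDer, Derivation.sub_apply,
        Derivation.smul_apply, smul_eq_mul, map_sub, map_mul, evalReg_cD, evalReg_cf,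
        Matrix.sub_apply, vecMulVec_apply, colW, rowV]
      ring
    · simp [valM, matDer]

theorem valM_sum (u : repSpace n d) (e : ℕ → MatDer (RepRing n d) n) (F : RepRing n d) (s : Finset ℕ) :
    valM u (matDer (∑ k ∈ s, e k) F) = ∑ k ∈ s, valM u (matDer (e k) F) := by
  ext i j
  simp only [valM, map_apply, matDer, of_apply, Finset.sum_apply, derivation_sum_apply, map_sum,
    Matrix.sum_apply]

theorem fusion_at (u : repSpace n d) (F G : RepRing n d) (hG : IsBasic u.1 (gr G u)) :
    evalReg u (fusion (actSeq n d) (4 + d) F G) = -∑ l ∈ range (4 + d),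
      trace (actPt u.1 (gr F u) l * (2 * (∑ k ∈ range l, actPt u.1 (gr G u) k) +
        actPt u.1 (gr G u) l)) := by
  rw [← fusion_abel _ _ _ hG]
  rw [fusion, bider_sum_apply, map_sum]
  refine sum_congr rfl fun l _ => ?_
  rw [traceWedge_apply, map_sub, valM_trace, valM_trace, valM_mul, valM_mul, valM_sum, valM_sum,
    valM_actSeq, valM_actSeq]
  simp only [valM_actSeq]

/-- The partial sums of the moments. -/
def momSum (u ζ : RVec n d) (k : ℕ) : Mat n := ∑ j ∈ range k, actPt u ζ j

/-- The value on a covector of the vector field scaling `W_α` and `V_α`. -/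
def scalePt (u ζ : RVec n d) (α : Fin d) : ℂ := colW u α ⬝ᵥ colW ζ α - rowV u α ⬝ᵥ rowV ζ α

/-- The Hamiltonian vector of an invariant function with differential `ζ`. -/
def hamVec (u ζ : RVec n d) : RVec n d :=
  mkVec (-(matX u * momSum u ζ 3)) (momSum u ζ 3 * matZ u - matZ u * momSum u ζ 2)
    (fun α => colW ζ α + (rowV u α ⬝ᵥ rowV ζ α) • rowV u α - rowV u α ᵥ* momSum u ζ (4 + α) -
      trace (momSum u ζ (4 + α)) • rowV u α)
    (fun α => -((1 + rowV u α ⬝ᵥ colW u α) • rowV ζ α) - (rowV u α ⬝ᵥ rowV ζ α) • colW u α +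
      momSum u ζ (4 + α) *ᵥ colW u α + (colW ζ α ⬝ᵥ colW u α) • colW u α +
      trace (momSum u ζ (4 + α)) • colW u α)

theorem matX_hamVec (u ζ : RVec n d) : matX (hamVec u ζ) = -(matX u * momSum u ζ 3) := rfl

theorem matZ_hamVec (u ζ : RVec n d) :
    matZ (hamVec u ζ) = momSum u ζ 3 * matZ u - matZ u * momSum u ζ 2 := rfl

theorem rowV_hamVec (u ζ : RVec n d) (α : Fin d) : rowV (hamVec u ζ) α =
    colW ζ α + (rowV u α ⬝ᵥ rowV ζ α) • rowV u α - rowV u α ᵥ* momSum u ζ (4 + α) -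
      trace (momSum u ζ (4 + α)) • rowV u α := rfl

theorem colW_hamVec (u ζ : RVec n d) (α : Fin d) : colW (hamVec u ζ) α =
    -((1 + rowV u α ⬝ᵥ colW u α) • rowV ζ α) - (rowV u α ⬝ᵥ rowV ζ α) • colW u α +
      momSum u ζ (4 + α) *ᵥ colW u α + (colW ζ α ⬝ᵥ colW u α) • colW u α +
      trace (momSum u ζ (4 + α)) • colW u α := rfl

theorem actPt_spin (u ζ : RVec n d) (α : Fin d) : actPt u ζ (4 + α) =
    vecMulVec (colW u α) (colW ζ α) - vecMulVec (rowV ζ α) (rowV u α) := by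
  rw [add_comm, actPt, dif_pos α.2]

theorem trace_actPt_spin (u ζ : RVec n d) (α : Fin d) :
    trace (actPt u ζ (4 + α)) = scalePt u ζ α := by
  rw [actPt_spin, trace_sub, trace_vecMulVec, trace_vecMulVec, scalePt, dotProduct_comm (rowV ζ α)]

theorem momSum_three (y ζ : RVec n d) : momSum y ζ 3 =
    matX y * gradX ζ - gradZ ζ * matZ y - gradX ζ * matX y := by
  simp only [momSum, sum_range_succ, range_zero, sum_empty, zero_add, actPt, sub_eq_add_neg]

theorem momSum_two (y ζ : RVec n d) : momSum y ζ 2 = matX y * gradX ζ - gradZ ζ * matZ y := by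
  simp only [momSum, sum_range_succ, range_zero, sum_empty, zero_add, actPt, sub_eq_add_neg]

theorem momSum_four (u ζ : RVec n d) : momSum u ζ 4 =
    matX u * gradX ζ - gradZ ζ * matZ u - gradX ζ * matX u + matZ u * gradZ ζ := by
  simp only [momSum, sum_range_succ, range_zero, sum_empty, zero_add, actPt, sub_eq_add_neg]

theorem trace_momSum (u ζ : RVec n d) (m : ℕ) (hm : m ≤ d) : trace (momSum u ζ (4 + m)) =
    ∑ β : Fin d with β.1 < m, scalePt u ζ β := by
  have h4 : trace (momSum u ζ 4) = 0 := by
    rw [momSum_four]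
    simp only [trace_add, trace_sub, trace_mul_comm (gradX ζ), trace_mul_comm (gradZ ζ)]
    ring
  rw [momSum, sum_range_add, trace_add, ← momSum, h4, zero_add,
    sum_range_fin_lt m hm (fun k => actPt u ζ (4 + k)), trace_sum]
  exact sum_congr rfl fun β _ => trace_actPt_spin u ζ β

theorem scaleField_at (u : repSpace n d) (α : Fin d) (F : RepRing n d) :
    evalReg u (scaleField n α F) = scalePt u.1 (gr F u) α := by
  rw [scaleField_eq]
  simp only [eulerW, eulerV, Derivation.sub_apply, derivation_sum_apply, Derivation.smul_apply,
    smul_eq_mul, map_sub, map_sum, map_mul, evalReg_cD, evalReg_cf, scalePt, dotProduct, colW, rowV]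

theorem spinTotal_at (u : repSpace n d) (F G : RepRing n d) : evalReg u (spinTotal n d F G) =
    ∑ α, ((1 + 1 / 2 * (rowV u.1 α ⬝ᵥ colW u.1 α)) * (rowV (gr F u) α ⬝ᵥ colW (gr G u) α -
      rowV (gr G u) α ⬝ᵥ colW (gr F u) α) + 1 / 2 * ((rowV u.1 α ⬝ᵥ rowV (gr F u) α) *
      (colW u.1 α ⬝ᵥ colW (gr G u) α) - (rowV u.1 α ⬝ᵥ rowV (gr G u) α) *
      (colW u.1 α ⬝ᵥ colW (gr F u) α))) := by
  have hd : ∀ v w : Fin n → RepRing n d, evalReg u (v ⬝ᵥ w) =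
      (fun j => evalReg u (v j)) ⬝ᵥ fun j => evalReg u (w j) := fun v w => by
    simp only [dotProduct, map_sum, map_mul]
  have hh : evalReg u (half n d) = 1 / 2 := AlgHom.commutes _ _
  rw [spinTotal, bider_sum_apply, map_sum]
  refine sum_congr rfl fun α _ => ?_
  rw [spinBracket_apply]
  simp only [map_add, map_sub, map_mul, map_one, hd, hh]
  rfl

theorem wedges_at (u : repSpace n d) (F G : RepRing n d) (hG : IsBasic u.1 (gr G u)) :
    evalReg u ((∑ α : Fin d, ∑ β : Fin d with α < β, wedge (scaleField n α) (scaleField n β)) F G) =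
    -∑ α : Fin d, scalePt u.1 (gr F u) α * (2 * trace (momSum u.1 (gr G u) (4 + α)) +
      scalePt u.1 (gr G u) α) := by
  have h0 : ∑ β, scalePt u.1 (gr G u) β = 0 := by
    have := trace_momSum u.1 (gr G u) d le_rfl
    have hG' : momSum u.1 (gr G u) (4 + d) = 0 := hG
    rw [hG', trace_zero, filter_true_of_mem fun β _ => β.2] at this
    exact this.symm
  have h1 := sum_pairs_abel (scalePt u.1 (gr F u)) (scalePt u.1 (gr G u)) h0
  have h2 : ∀ α : Fin d, trace (momSum u.1 (gr G u) (4 + α)) =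
      ∑ β : Fin d with β < α, scalePt u.1 (gr G u) β := fun α =>
    trace_momSum u.1 (gr G u) α α.2.le
  simp only [h2]
  rw [← h1]
  simp only [bider_sum_apply, map_sum, wedge_apply, map_sub, map_mul, scaleField_at]

/-- The bracket with an invariant function is the derivative along its Hamiltonian vector. -/
theorem quasiP_at (u : repSpace n d) (F G : RepRing n d) (hG : IsBasic u.1 (gr G u)) :
    (quasiP n d F G).1 u = pair (gr F u) (hamVec u.1 (gr G u)) := by
  have hsm : ∀ (c : ℂ) (f : RepRing n d), evalReg u (c • f) = c * evalReg u f := fun c f => by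
    rw [map_smul, smul_eq_mul]
  rw [← evalReg_apply, quasiP_apply_eq, map_add, map_add, hsm, hsm, spinTotal_at, fusion_at u F G hG,
    wedges_at u F G hG, sum_range_add, sum_range (n := d)]
  generalize gr F u = φ
  generalize gr G u = ζ
  generalize u.1 = u
  change _ = pair φ (hamVec u ζ)
  rw [pair_RSCoord]
  have hspin : ∀ (α : Fin d) (M : Mat n), trace (actPt u φ (4 + α) * M) =
      colW φ α ⬝ᵥ (M *ᵥ colW u α) - (rowV u α ᵥ* M) ⬝ᵥ rowV φ α := by
    intro α M
    rw [actPt_spin, sub_mul, trace_sub, vecMulVec_mul, vecMulVec_mul, trace_vecMulVec,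
      trace_vecMulVec, dotProduct_mulVec, dotProduct_comm (colW u α),
      dotProduct_comm (rowV φ α)]
  rw [matX_hamVec, matZ_hamVec]
  have h4 : ∑ l ∈ range 4, trace (actPt u φ l * (2 * (∑ k ∈ range l, actPt u ζ k) +
        actPt u ζ l)) = 2 * (trace (gradX φ * -(matX u * momSum u ζ 3)) +
        trace (gradZ φ * (momSum u ζ 3 * matZ u - matZ u * momSum u ζ 2))) := by
    generalize hA : matX u = X
    generalize hB : matZ u = Z
    generalize hC : gradX φ = p
    generalize hD : gradZ φ = r
    generalize hE : gradX ζ = p'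
    generalize hF : gradZ ζ = r'
    have c1 : ∀ A : Mat n, trace (X * (p * A)) = trace (p * (A * X)) := fun A => by
      rw [trace_mul_comm, mul_assoc]
    have c2 : ∀ A : Mat n, trace (Z * (r * A)) = trace (r * (A * Z)) := fun A => by
      rw [trace_mul_comm, mul_assoc]
    simp only [momSum, sum_range_succ, range_zero, sum_empty, zero_add, actPt,
      hA, hB, hC, hD, hE, hF, c1, c2, neg_mul, mul_neg, trace_neg, trace_add, trace_sub, mul_add,
      add_mul, mul_sub, two_mul, mul_assoc, mul_zero, trace_zero]
    ring
  rw [h4]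
  have hα : ∀ α : Fin d, trace (actPt u φ (4 + α) * (2 * momSum u ζ (4 + α) + actPt u ζ (4 + α))) =
      2 * (colW φ α ⬝ᵥ (momSum u ζ (4 + α) *ᵥ colW u α) -
        (rowV u α ᵥ* momSum u ζ (4 + α)) ⬝ᵥ rowV φ α) +
      ((colW φ α ⬝ᵥ colW u α) * (colW ζ α ⬝ᵥ colW u α) -
        (colW φ α ⬝ᵥ rowV ζ α) * (rowV u α ⬝ᵥ colW u α) -
        (rowV u α ⬝ᵥ colW u α) * (colW ζ α ⬝ᵥ rowV φ α) +
        (rowV u α ⬝ᵥ rowV ζ α) * (rowV u α ⬝ᵥ rowV φ α)) := by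
    intro α
    rw [mul_add, two_mul, mul_add, trace_add, trace_add, hspin, hspin, actPt_spin u ζ,
      sub_mulVec, vecMul_sub, vecMulVec_mulVec, vecMulVec_mulVec, vecMul_vecMulVec, vecMul_vecMulVec]
    simp only [dotProduct_sub, sub_dotProduct, dotProduct_smul, smul_dotProduct, smul_eq_mul,
      op_smul_eq_smul]
    ring
  have hm : ∀ α : Fin d, ∑ k ∈ range (4 + α), actPt u ζ k = momSum u ζ (4 + α) := fun _ => rfl
  simp only [hm, hα, rowV_hamVec, colW_hamVec]
  rw [show ∀ A B s1 s2 s3 t : ℂ, s3 + -(1 / 2) * -(2 * (A + B) + s1) + -(1 / 2) * -s2 =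
    A + B + t ↔ s3 + (1 / 2) * s1 + (1 / 2) * s2 = t from fun A B s1 s2 s3 t => by
      constructor <;> intro h <;> linear_combination h]
  rw [mul_sum, mul_sum, ← sum_add_distrib, ← sum_add_distrib]
  refine sum_congr rfl fun α _ => ?_
  simp only [dotProduct_sub, dotProduct_add, dotProduct_neg, dotProduct_smul, smul_eq_mul, scalePt,
    dotProduct_comm (colW u α), dotProduct_comm (rowV φ α) (rowV u α),
    dotProduct_comm (rowV φ α) (rowV u α ᵥ* _), dotProduct_comm (colW ζ α) (rowV φ α),
    dotProduct_comm (colW φ α) (rowV ζ α)]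
  ring

end Hamiltonian

/-! ### Tangency of the Hamiltonian and of the scaling vectors, and gauge vectors -/

section Tangency

open Matrix

variable {n d : ℕ}

theorem dmu_hamVec (y ζ : RVec n d) (k : ℕ) (hk : k < d) : dmu y (hamVec y ζ) k =
    momSum y ζ (4 + (k + 1)) * muN y k - muN y k * momSum y ζ (4 + k) := by
  set α : Fin d := ⟨k, hk⟩ with hα
  have hmu : muN y k = 1 + vecMulVec (colW y α) (rowV y α) := by rw [muN, dif_pos hk]; rfl
  have hm : momSum y ζ (4 + (k + 1)) = momSum y ζ (4 + k) + (vecMulVec (colW y α) (colW ζ α) -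
      vecMulVec (rowV ζ α) (rowV y α)) := by
    rw [← actPt_spin]
    exact sum_range_succ _ _
  rw [hm, hmu, dmu, dif_pos hk]
  rw [← hα, rowV_hamVec, colW_hamVec, show (α : ℕ) = k from rfl]
  generalize momSum y ζ (4 + k) = m
  generalize rowV y α = v
  generalize colW y α = w
  generalize rowV ζ α = a
  generalize colW ζ α = b
  have h1 : vecMulVec w b * vecMulVec w v = (b ⬝ᵥ w) • vecMulVec w v := by
    rw [vecMulVec_mul_vecMulVec, vecMulVec_smul]
  have h2 : vecMulVec a v * vecMulVec w v = (v ⬝ᵥ w) • vecMulVec a v := by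
    rw [vecMulVec_mul_vecMulVec, vecMulVec_smul]
  simp only [mul_add, add_mul, sub_mul, mul_one, one_mul, mul_vecMulVec, vecMulVec_mul, h1, h2]
  ext i j
  simp only [vecMulVec_apply, Matrix.add_apply, Matrix.sub_apply, Pi.add_apply,
    Pi.sub_apply, Pi.neg_apply, Pi.smul_apply, smul_eq_mul, Matrix.smul_apply]
  ring

theorem dK_hamVec (y ζ : RVec n d) (k : ℕ) (hk : k ≤ d) : dK y (hamVec y ζ) k =
    momSum y ζ (4 + k) * kprod (muN y) k - kprod (muN y) k * momSum y ζ 4 := by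
  induction k with
  | zero => simp [dK, kprod]
  | succ k ih =>
    rw [dK, ih (by omega), dmu_hamVec y ζ k (by omega), kprod]
    noncomm_ring

/-- The Hamiltonian vectors of invariant functions are tangent to the level set. -/
theorem dLevel_hamVec {q : ℂ} {y : RVec n d} (hy : levelEq q y = 0) {ζ : RVec n d}
    (hζ : IsBasic y ζ) : dLevel q y (hamVec y ζ) = 0 := by
  have h0 : momSum y ζ (4 + d) = 0 := hζ
  have hE : matX y * matZ y = q • (kprod (muN y) d * matZ y * matX y) := sub_eq_zero.1 hy
  have h2 := momSum_two y ζ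
  have h3 : momSum y ζ 3 = momSum y ζ 2 - gradX ζ * matX y := by rw [momSum_three, h2]
  have h4 : momSum y ζ 4 = momSum y ζ 3 + matZ y * gradZ ζ := by rw [momSum_four, momSum_three]
  have hE' : matX y * matZ y * momSum y ζ 2 =
      q • (kprod (muN y) d * matZ y * matX y * momSum y ζ 2) := by rw [hE, smul_mul]
  rw [dLevel, dK_hamVec y ζ d le_rfl, h0, h4, matX_hamVec, matZ_hamVec, h3]
  have e : kprod (muN y) d * matZ y * matX y * momSum y ζ 2 =
      kprod (muN y) d * matZ y * (matX y * gradX ζ - gradZ ζ * matZ y) * matX y -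
      kprod (muN y) d * matZ y * matX y * (gradX ζ * matX y - momSum y ζ 2) +
      kprod (muN y) d * matZ y * gradZ ζ * matZ y * matX y := by
    noncomm_ring
  rw [← h2] at e
  rw [e] at hE'
  rw [← sub_eq_zero] at hE'
  rw [← neg_eq_zero]
  refine Eq.trans ?_ hE'
  simp only [mul_add, mul_sub, add_mul, sub_mul, neg_mul, mul_neg, smul_add, smul_sub, smul_neg, zero_sub,
    mul_assoc, zero_mul]
  abel

/-- The vector scaling `W_α` and `V_α`. -/
def scaleVec (u : RVec n d) (α : Fin d) : RVec n d :=
  mkVec 0 0 (Pi.single α (-rowV u α)) (Pi.single α (colW u α))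

theorem pair_mkVec (ζ : RVec n d) (A B : Mat n) (v w : Fin d → Fin n → ℂ) :
    pair ζ (mkVec A B v w) = trace (gradX ζ * A) + trace (gradZ ζ * B) +
      ∑ α, (rowV ζ α ⬝ᵥ v α + colW ζ α ⬝ᵥ w α) := pair_RSCoord _ _

theorem pair_scaleVec (u ζ : RVec n d) (α : Fin d) : pair ζ (scaleVec u α) = scalePt u ζ α := by
  rw [scaleVec, pair_mkVec, sum_eq_single α]
  · simp [scalePt, dotProduct_comm]; ring
  · intro β _ h; simp [h]
  · simp

theorem dLevel_scaleVec (q : ℂ) {y : RVec n d} (hy : y ∈ repSpace n d) (α : Fin d) :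
    dLevel q y (scaleVec y α) = 0 := by
  have hX : matX (scaleVec y α) = 0 := rfl
  have hZ : matZ (scaleVec y α) = 0 := rfl
  rw [dLevel, hX, hZ, scaleVec, dK_mkVec_single hy, vecMulVec_neg, add_neg_cancel]
  simp

/-- The infinitesimal action of a matrix. -/
def gaugeVec (u : RVec n d) (ξ : Mat n) : RVec n d :=
  mkVec (ξ * matX u - matX u * ξ) (ξ * matZ u - matZ u * ξ) (fun α => -(rowV u α ᵥ* ξ))
    (fun α => ξ *ᵥ colW u α)

theorem sum_actPt (u ζ : RVec n d) : ∑ k ∈ range (4 + d), actPt u ζ k =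
    matX u * gradX ζ - gradZ ζ * matZ u - gradX ζ * matX u + matZ u * gradZ ζ +
      ∑ α, (vecMulVec (colW u α) (colW ζ α) - vecMulVec (rowV ζ α) (rowV u α)) := by
  rw [sum_range_add, ← momSum_four, sum_range (n := d), momSum]
  congr 1
  exact sum_congr rfl fun α _ => actPt_spin u ζ α

theorem pair_gaugeVec (u ζ : RVec n d) (ξ : Mat n) :
    pair ζ (gaugeVec u ξ) = trace (ξ * ∑ k ∈ range (4 + d), actPt u ζ k) := by
  rw [gaugeVec, pair_mkVec, sum_actPt, mul_add, trace_add, mul_sum, trace_sum]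
  congr 1
  · simp only [mul_add, mul_sub, trace_add, trace_sub]
    rw [trace_mul_comm (gradX ζ), trace_mul_comm (gradZ ζ), ← mul_assoc (gradX ζ),
      trace_mul_comm _ ξ, ← mul_assoc (gradZ ζ), trace_mul_comm _ ξ]
    simp only [mul_assoc]
    ring
  · refine sum_congr rfl fun α _ => ?_
    rw [mul_sub, trace_sub, mul_vecMulVec, mul_vecMulVec, trace_vecMulVec, trace_vecMulVec,
      dotProduct_neg, dotProduct_comm (colW ζ α), dotProduct_comm (rowV ζ α), ← dotProduct_mulVec,
      dotProduct_comm (rowV u α)]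
    ring

theorem isBasic_iff (u ζ : RVec n d) : IsBasic u ζ ↔ ∀ ξ, pair ζ (gaugeVec u ξ) = 0 := by
  constructor
  · intro h ξ
    rw [pair_gaugeVec, show ∑ k ∈ range (4 + d), actPt u ζ k = 0 from h, mul_zero, trace_zero]
  · intro h
    refine eq_zero_of_trace fun B => ?_
    rw [trace_mul_comm, ← pair_gaugeVec, h]

/-! The action of invertible matrices. -/

/-- The action of a matrix `g`, with inverse `h`. -/
def conjVec (g h : Mat n) (u : RVec n d) : RVec n d :=
  mkVec (g * matX u * h) (g * matZ u * h) (fun α => rowV u α ᵥ* h) (fun α => g *ᵥ colW u α)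

theorem glAct_eq_conjVec (g : GL (Fin n) ℂ) (u : RVec n d) : glAct g u = conjVec g.1 (g⁻¹).1 u := by
  funext c; cases c <;> rfl

variable {g h : Mat n}

theorem matX_conjVec (u : RVec n d) : matX (conjVec g h u) = g * matX u * h := rfl

theorem matZ_conjVec (u : RVec n d) : matZ (conjVec g h u) = g * matZ u * h := rfl

theorem rowV_conjVec (u : RVec n d) (α : Fin d) : rowV (conjVec g h u) α = rowV u α ᵥ* h := rfl

theorem colW_conjVec (u : RVec n d) (α : Fin d) : colW (conjVec g h u) α = g *ᵥ colW u α := rfl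

theorem matWV_eq (u : RVec n d) (α : Fin d) : matWV u α = 1 + vecMulVec (colW u α) (rowV u α) := rfl

theorem matWV_conjVec (hgh : g * h = 1) (u : RVec n d) (α : Fin d) :
    matWV (conjVec g h u) α = g * matWV u α * h := by
  rw [matWV_eq, matWV_eq, mul_add, add_mul, mul_one, hgh, rowV_conjVec, colW_conjVec,
    mul_vecMulVec, vecMulVec_mul]

theorem muN_conjVec (hgh : g * h = 1) (u : RVec n d) (k : ℕ) :
    muN (conjVec g h u) k = g * muN u k * h := by
  rw [muN, muN]
  split_ifs
  · exact matWV_conjVec hgh _ _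
  · rw [mul_one, hgh]

theorem kprod_conjVec (hgh : g * h = 1) (u : RVec n d) (k : ℕ) :
    kprod (muN (conjVec g h u)) k = g * kprod (muN u) k * h := by
  have hhg := mul_eq_one_comm.1 hgh
  induction k with
  | zero => simp only [kprod, mul_one, hgh]
  | succ k ih =>
    rw [kprod, kprod, ih, muN_conjVec hgh]
    simp only [mul_assoc]
    rw [← mul_assoc h g, hhg, one_mul]

theorem levelEq_conjVec (hgh : g * h = 1) (q : ℂ) (u : RVec n d) :
    levelEq q (conjVec g h u) = g * levelEq q u * h := by
  have hhg := mul_eq_one_comm.1 hgh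
  have c : ∀ A : Mat n, h * (g * A) = A := fun A => by rw [← mul_assoc, hhg, one_mul]
  rw [levelEq, levelEq, kprod_conjVec hgh, matX_conjVec, matZ_conjVec]
  simp only [mul_sub, sub_mul, mul_assoc, c, Matrix.mul_smul, smul_mul]

theorem det_conj (hgh : g * h = 1) (A : Mat n) : (g * A * h).det = A.det := by
  have : g.det * h.det = 1 := by rw [← det_mul, hgh, det_one]
  rw [det_mul, det_mul]
  linear_combination A.det * this

theorem conjVec_mem_repSpace (hgh : g * h = 1) {u : RVec n d} (hu : u ∈ repSpace n d) :
    conjVec g h u ∈ repSpace n d := by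
  refine ⟨?_, ?_, fun α => ?_⟩
  · rw [matX_conjVec, det_conj hgh]; exact hu.1
  · rw [matZ_conjVec, det_conj hgh]; exact hu.2.1
  · rw [matWV_conjVec hgh, det_conj hgh]; exact hu.2.2 α

theorem conjVec_mem_levelSet (hgh : g * h = 1) {q : ℂ} {u : RVec n d}
    (hu : u ∈ levelSet n d q) : conjVec g h u ∈ levelSet n d q := by
  rw [mem_levelSet_iff] at hu ⊢
  refine ⟨conjVec_mem_repSpace hgh hu.1, ?_⟩
  rw [levelEq_conjVec hgh, hu.2, mul_zero, zero_mul]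

theorem glRel_conjVec (hgh : g * h = 1) {q : ℂ} (y : levelSet n d q) :
    glRel n d q y ⟨conjVec g h y.1, conjVec_mem_levelSet hgh y.2⟩ :=
  ⟨⟨g, h, hgh, mul_eq_one_comm.1 hgh⟩, by rw [glAct_eq_conjVec]; rfl⟩

/-- The value at a point of the level set. -/
abbrev lv {q : ℂ} (y : levelSet n d q) : repSpace n d := ⟨y.1, levelSet_subset n d q y.2⟩

/-- Lifts of functions on the phase space have basic differentials. -/
theorem isBasic_of_lift {q : ℂ} {F : RepRing n d} {f : RSRing n d q}
    (hF : LiftRS F f) (y : levelSet n d q) :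
    IsBasic y.1 (gr F (lv y)) := by
  have hE : ∀ i j : Fin n, pair (gr F (lv y)) (gaugeVec y.1 (Matrix.single i j 1)) = 0 := by
    intro i j
    set E : Mat n := Matrix.single i j 1 with hEdef
    set c : ℂ := if i = j then 1 else 0 with hc
    have hEE : E * E = c • E := by
      rw [hEdef, hc]
      split_ifs with hij
      · subst hij; simp
      · rw [Matrix.single_mul_single_of_ne (h := fun h => hij h.symm)]; simp
    -- `E * E = c • E`, so that `1 + t • E` has the inverse `1 - s t • E`
    let s : ℂ → ℂ := fun t => t / (1 + t * c)
    have hs : HasDerivAt s 1 0 := by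
      have h1 : HasDerivAt (fun t : ℂ => 1 + t * c) c 0 := by
        simpa using ((hasDerivAt_id (0 : ℂ)).mul_const c).const_add 1
      have := (hasDerivAt_id (0 : ℂ)).div h1 (by simp)
      simpa [s] using! this
    have hs0 : s 0 = 0 := by simp [s]
    let γ : ℂ → RVec n d := fun t => conjVec (1 + t • E) (1 - s t • E) y.1
    have hγX : ∀ A : Mat n, ∀ k l, HasDerivAt
        (fun t : ℂ => ((1 + t • E) * A * (1 - s t • E)) k l) ((E * A - A * E) k l) 0 := by
      intro A k l
      have e : (fun t : ℂ => ((1 + t • E) * A * (1 - s t • E)) k l) = fun t =>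
          A k l + t * (E * A) k l - s t * (A * E) k l - (t * s t) * (E * A * E) k l := by
        funext t
        have : (1 + t • E) * A * (1 - s t • E) = A + t • (E * A) - s t • (A * E) -
            (t * s t) • (E * A * E) := by
          simp only [add_mul, mul_sub, one_mul, mul_one, smul_mul, Matrix.mul_smul, smul_smul,
            mul_comm (s t)]
          abel
        rw [this]
        simp only [Matrix.add_apply, Matrix.sub_apply, Matrix.smul_apply, smul_eq_mul]
      rw [e]
      have h1 := ((hasDerivAt_id (0 : ℂ)).mul_const ((E * A) k l)).const_add (A k l)
      have h2 := (h1.sub (hs.mul_const ((A * E) k l))).sub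
        (((hasDerivAt_id (0 : ℂ)).mul hs).mul_const ((E * A * E) k l))
      simpa [hs0] using! h2
    have hγ : HasDerivAt γ (gaugeVec y.1 E) 0 := by
      rw [hasDerivAt_pi]
      intro k
      cases k with
      | X k l => exact hγX (matX y.1) k l
      | Z k l => exact hγX (matZ y.1) k l
      | V α k =>
        change HasDerivAt (fun t => (rowV y.1 α ᵥ* (1 - s t • E)) k) (-(rowV y.1 α ᵥ* E) k) 0
        have e : (fun t => (rowV y.1 α ᵥ* (1 - s t • E)) k) =
            fun t => rowV y.1 α k - s t * (rowV y.1 α ᵥ* E) k := by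
          funext t
          simp [vecMul_sub, vecMul_smul]
        rw [e]
        simpa using (hs.mul_const ((rowV y.1 α ᵥ* E) k)).const_sub (rowV y.1 α k)
      | W α k =>
        change HasDerivAt (fun t : ℂ => ((1 + t • E) *ᵥ colW y.1 α) k) ((E *ᵥ colW y.1 α) k) 0
        have e : (fun t : ℂ => ((1 + t • E) *ᵥ colW y.1 α) k) =
            fun t => colW y.1 α k + t * (E *ᵥ colW y.1 α) k := by
          funext t
          simp [add_mulVec, smul_mulVec]
        rw [e]
        simpa using ((hasDerivAt_id (0 : ℂ)).mul_const ((E *ᵥ colW y.1 α) k)).const_add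
          (colW y.1 α k)
    have h0 : γ 0 = y.1 := by
      have : γ 0 = conjVec 1 1 y.1 := by simp [γ, hs0]
      rw [this]
      funext k
      cases k <;> simp [conjVec, mkVec, matX, matZ, rowV, colW]
    refine dirAt_eq_zero_of_curve (isOpen_repSpace n d) (lv y) _ γ h0 hγ F (F.1 (lv y)) ?_
    have hne : ∀ᶠ t in nhds (0 : ℂ), 1 + t * c ≠ 0 := by
      have : Continuous fun t : ℂ => 1 + t * c := by fun_prop
      exact this.continuousAt.eventually_ne (by simp)
    filter_upwards [hne] with t ht
    have hgh : (1 + t • E) * (1 - s t • E) = 1 := by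
      have : (1 + t • E) * (1 - s t • E) = 1 + (t - s t - t * s t * c) • E := by
        simp only [add_mul, mul_sub, one_mul, mul_one, smul_mul, Matrix.mul_smul, hEE, smul_smul,
          sub_smul]
        rw [show s t * (t * c) = t * s t * c by ring]
        abel
      rw [this, show t - s t - t * s t * c = 0 by simp only [s]; field_simp; ring, zero_smul,
        add_zero]
    refine ⟨levelSet_subset n d q (conjVec_mem_levelSet hgh y.2), ?_⟩
    have h1 := hF ⟨γ t, conjVec_mem_levelSet hgh y.2⟩
    have h2 := hF y
    refine h1.trans (Eq.trans ?_ h2.symm)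
    exact congrArg f.1 (Quot.sound (glRel_conjVec hgh y)).symm
  refine ext fun i j => ?_
  have := hE j i
  rw [pair_gaugeVec] at this
  simpa [Matrix.trace_single_mul] using this

end Tangency

/-! ### Pullbacks of regular functions and derivatives along curves -/

section Pullback

variable {ι κ : Type} {U : Set (ι → ℂ)} {U' : Set (κ → ℂ)}

theorem comap_mem (φ : U' → U) (hφ : ∀ c, (fun u => (φ u).1 c) ∈ Reg U') (F : Reg U) :
    (fun u => F.1 (φ u)) ∈ Reg U' := by
  obtain ⟨p, r, h⟩ := F.2
  let θ : MvPolynomial ι ℂ →ₐ[ℂ] Reg U' := MvPolynomial.aeval fun c => ⟨_, hφ c⟩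
  have hθ : ∀ p u, (θ p).1 u = eval (φ u).1 p := by
    intro p u
    have : (evalReg u).comp θ = MvPolynomial.aeval (φ u).1 := by
      ext c
      simp [θ, evalReg_apply]
    rw [← evalReg_apply]
    exact (DFunLike.congr_fun this p).trans (MvPolynomial.aeval_eq_eval (φ u).1 ▸ rfl)
  have hr : (fun u => ((θ r).1 u)⁻¹) ∈ Reg U' := Reg.inv_mem (θ r).2 fun u => by
    rw [hθ]; exact (h _).1
  have := (Reg U').mul_mem (θ p).2 hr
  convert this using 1
  funext u
  rw [Pi.mul_apply, hθ, hθ, (h _).2, div_eq_mul_inv]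

/-- The pullback of regular functions along a regular map. -/
def comapReg (φ : U' → U) (hφ : ∀ c, (fun u => (φ u).1 c) ∈ Reg U') : Reg U →ₐ[ℂ] Reg U' where
  toFun F := ⟨fun u => F.1 (φ u), comap_mem φ hφ F⟩
  map_one' := rfl
  map_mul' _ _ := rfl
  map_zero' := rfl
  map_add' _ _ := rfl
  commutes' _ := rfl

theorem comapReg_tangent (φ : U' → U) (hφ : ∀ c, (fun u => (φ u).1 c) ∈ Reg U') {u : U'}
    {v : Reg U' →ₗ[ℂ] ℂ} (hv : IsTangentVector (Reg U') u v) :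
    IsTangentVector (Reg U) (φ u) (v ∘ₗ (comapReg φ hφ).toLinearMap) := by
  intro F G
  change v (comapReg φ hφ (F * G)) = _
  rw [map_mul, hv]
  rfl

variable [Fintype ι]

/-- The derivative of a regular function along a curve. -/
theorem hasDerivAt_curve (hU : IsOpen U) (u : U) (δ : ι → ℂ) (γ : ℂ → ι → ℂ) (h0 : γ 0 = u.1)
    (hγ : HasDerivAt γ δ 0) (G : Reg U) :
    HasDerivAt (fun t => extZero G.1 (γ t)) (dirAt hU u δ G) 0 := by
  obtain ⟨p, r, hr, hG⟩ := Reg.exists_poly G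
  have hval : ∀ w : U, G.1 w * eval w.1 r = eval w.1 p := by
    intro w
    have := congrArg (fun f : Reg U => f.1 w) hG
    simpa [polyFn_apply] using this
  have hp := ((hasStrictFDerivAt_poly (γ 0) p).hasFDerivAt.comp_hasDerivAt (0 : ℂ) hγ)
  have hq := ((hasStrictFDerivAt_poly (γ 0) r).hasFDerivAt.comp_hasDerivAt (0 : ℂ) hγ)
  have hr0 : eval (γ 0) r ≠ 0 := by rw [h0]; exact hr u
  have hd := hp.div hq hr0
  have h1 := dirAt_tangent hU u δ G (polyFn U r)
  rw [hG, dirAt_polyFn, dirAt_polyFn, polyFn_apply] at h1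
  have h2 : dirAt hU u δ G = (ddL (γ 0) p δ * eval (γ 0) r -
      eval (γ 0) p * ddL (γ 0) r δ) / eval (γ 0) r ^ 2 := by
    rw [eq_div_iff (pow_ne_zero _ hr0), ddL_apply, ddL_apply, h0]
    have := hval u
    linear_combination (-eval u.1 r) * h1 - dd u.1 δ r * this
  rw [h2]
  refine hd.congr_of_eventuallyEq ?_
  have hm : ∀ᶠ t in nhds (0 : ℂ), γ t ∈ U :=
    hγ.continuousAt.eventually_mem (hU.mem_nhds (by rw [h0]; exact u.2))
  filter_upwards [hm] with t ht
  have := hval ⟨γ t, ht⟩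
  simp only [extZero, dif_pos ht, Pi.div_apply, Function.comp_apply]
  rw [eq_div_iff (hr ⟨γ t, ht⟩)]
  exact this

theorem hasDerivAt_line (u δ : ι → ℂ) : HasDerivAt (fun t : ℂ => u + t • δ) δ 0 := by
  simpa using ((hasDerivAt_id (0 : ℂ)).smul_const δ).const_add u

end Pullback

/-! ### Equivariance and reduction -/

section Equivariance

open Matrix

variable {n d : ℕ}

theorem conjVec_add_smul (g h : Mat n) (u δ : RVec n d) (t : ℂ) :
    conjVec g h (u + t • δ) = conjVec g h u + t • conjVec g h δ := by
  have hX : matX (u + t • δ) = matX u + t • matX δ := rfl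
  have hZ : matZ (u + t • δ) = matZ u + t • matZ δ := rfl
  have hV : ∀ α, rowV (u + t • δ) α = rowV u α + t • rowV δ α := fun _ => rfl
  have hW : ∀ α, colW (u + t • δ) α = colW u α + t • colW δ α := fun _ => rfl
  funext c
  cases c <;>
    simp only [conjVec, mkVec, hX, hZ, hV, hW, mul_add, add_mul, Matrix.mul_smul, smul_mul, add_vecMul,
      smul_vecMul, mulVec_add, mulVec_smul, Pi.add_apply, Pi.smul_apply, Matrix.add_apply,
      Matrix.smul_apply]

/-- The action on covectors. -/
def coAct (g h : Mat n) (ζ : RVec n d) : RVec n d :=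
  mkVec (h * gradX ζ * g)ᵀ (h * gradZ ζ * g)ᵀ (fun α => h *ᵥ rowV ζ α) (fun α => colW ζ α ᵥ* g)

theorem components_coAct (g h : Mat n) (ζ : RVec n d) :
    gradX (coAct g h ζ) = h * gradX ζ * g ∧ gradZ (coAct g h ζ) = h * gradZ ζ * g ∧
      (∀ α, rowV (coAct g h ζ) α = h *ᵥ rowV ζ α) ∧ ∀ α, colW (coAct g h ζ) α = colW ζ α ᵥ* g :=
  ⟨rfl, rfl, fun _ => rfl, fun _ => rfl⟩

theorem pair_coAct (g h : Mat n) (ζ δ : RVec n d) :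
    pair (coAct g h ζ) δ = pair ζ (conjVec g h δ) := by
  rw [pair_RSCoord, conjVec, pair_mkVec]
  obtain ⟨hX, hZ, hV, hW⟩ := components_coAct g h ζ
  simp only [hX, hZ, hV, hW]
  congr 1
  · congr 1
    · rw [mul_assoc, mul_assoc, trace_mul_comm]; simp only [mul_assoc]
    · rw [mul_assoc, mul_assoc, trace_mul_comm]; simp only [mul_assoc]
  · refine sum_congr rfl fun α _ => ?_
    rw [dotProduct_mulVec, dotProduct_comm, dotProduct_mulVec, dotProduct_comm (rowV ζ α)]

theorem actPt_coAct {g h : Mat n} (hgh : g * h = 1) (u ζ : RVec n d) (k : ℕ) :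
    actPt u (coAct g h ζ) k = h * actPt (conjVec g h u) ζ k * g := by
  have hhg := mul_eq_one_comm.1 hgh
  obtain ⟨hX, hZ, hV, hW⟩ := components_coAct g h ζ
  have c : ∀ A : Mat n, h * (g * A) = A := fun A => by rw [← mul_assoc, hhg, one_mul]
  match k with
  | 0 => simp only [actPt, hX, matX_conjVec, mul_assoc, c]
  | 1 => simp only [actPt, hZ, matZ_conjVec, mul_assoc, neg_mul, mul_neg, hhg, mul_one]
  | 2 => simp only [actPt, hX, matX_conjVec, mul_assoc, neg_mul, mul_neg, hhg, mul_one]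
  | 3 => simp only [actPt, hZ, matZ_conjVec, mul_assoc, c]
  | k + 4 =>
    rw [actPt, actPt]
    split_ifs with hk
    · rw [hV, hW, colW_conjVec, rowV_conjVec, mul_sub, sub_mul, mul_vecMulVec, mul_vecMulVec,
        vecMulVec_mul, vecMulVec_mul, mulVec_mulVec, vecMul_vecMul, hhg, one_mulVec, vecMul_one]
    · simp

theorem momSum_coAct {g h : Mat n} (hgh : g * h = 1) (u ζ : RVec n d) (k : ℕ) :
    momSum u (coAct g h ζ) k = h * momSum (conjVec g h u) ζ k * g := by
  simp only [momSum, actPt_coAct hgh, mul_sum, sum_mul]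

/-- Equivariance of Hamiltonian vectors. -/
theorem hamVec_conjVec {g h : Mat n} (hgh : g * h = 1) (u ζ : RVec n d) :
    hamVec (conjVec g h u) ζ = conjVec g h (hamVec u (coAct g h ζ)) := by
  have hhg := mul_eq_one_comm.1 hgh
  have c : ∀ A : Mat n, h * (g * A) = A := fun A => by rw [← mul_assoc, hhg, one_mul]
  have c' : ∀ A : Mat n, g * (h * A) = A := fun A => by rw [← mul_assoc, hgh, one_mul]
  have hm : ∀ k, momSum (conjVec g h u) ζ k = g * momSum u (coAct g h ζ) k * h := fun k => by
    rw [momSum_coAct hgh]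
    simp only [mul_assoc, c', hgh, mul_one]
  have ht : ∀ k, trace (momSum (conjVec g h u) ζ k) = trace (momSum u (coAct g h ζ) k) := fun k => by
    rw [hm, mul_assoc, trace_mul_comm, mul_assoc, hhg, mul_one]
  have hV : ∀ α, rowV ζ α = g *ᵥ rowV (coAct g h ζ) α := fun α => by
    change _ = g *ᵥ (h *ᵥ rowV ζ α)
    rw [mulVec_mulVec, hgh, one_mulVec]
  have hW : ∀ α, colW ζ α = colW (coAct g h ζ) α ᵥ* h := fun α => by
    change _ = (colW ζ α ᵥ* g) ᵥ* h
    rw [vecMul_vecMul, hgh, vecMul_one]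
  have hdot : ∀ v w : Fin n → ℂ, (v ᵥ* h) ⬝ᵥ (g *ᵥ w) = v ⬝ᵥ w := fun v w => by
    rw [dotProduct_mulVec, vecMul_vecMul, hhg, vecMul_one]
  generalize coAct g h ζ = ζ' at *
  have e1 : matX (hamVec (conjVec g h u) ζ) = g * matX (hamVec u ζ') * h := by
    rw [matX_hamVec, matX_hamVec, hm, matX_conjVec]; simp only [mul_assoc, c, mul_neg, neg_mul]
  have e2 : matZ (hamVec (conjVec g h u) ζ) = g * matZ (hamVec u ζ') * h := by
    rw [matZ_hamVec, matZ_hamVec, hm, hm, matZ_conjVec]; simp only [mul_assoc, c, mul_sub, sub_mul]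
  have e3 : ∀ α : Fin d, rowV (hamVec (conjVec g h u) ζ) α = rowV (hamVec u ζ') α ᵥ* h := fun α => by
    rw [rowV_hamVec, rowV_hamVec, ht, hm, hV, hW, rowV_conjVec, hdot]
    simp only [sub_vecMul, add_vecMul, smul_vecMul, vecMul_vecMul, mul_assoc, c]
  have e4 : ∀ α : Fin d, colW (hamVec (conjVec g h u) ζ) α = g *ᵥ colW (hamVec u ζ') α := fun α => by
    rw [colW_hamVec, colW_hamVec, ht, hm, hV, hW, rowV_conjVec, colW_conjVec, hdot, hdot, hdot]
    simp only [mulVec_add, mulVec_sub, mulVec_neg, mulVec_smul, mulVec_mulVec, mul_assoc, hhg, mul_one]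
  funext k
  cases k with
  | X i j => exact congrFun (congrFun e1 i) j
  | Z i j => exact congrFun (congrFun e2 i) j
  | V α j => exact congrFun (e3 α) j
  | W α j => exact congrFun (e4 α) j

theorem scaleVec_conjVec (g h : Mat n) (u : RVec n d) (α : Fin d) :
    scaleVec (conjVec g h u) α = conjVec g h (scaleVec u α) := by
  funext k
  cases k with
  | X i j =>
    have : matX (scaleVec u α) = 0 := rfl
    change 0 = (g * matX (scaleVec u α) * h) i j
    simp [this]
  | Z i j =>
    have : matZ (scaleVec u α) = 0 := rfl
    change 0 = (g * matZ (scaleVec u α) * h) i j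
    simp [this]
  | V β j =>
    have h1 : ∀ u : RVec n d, rowV (scaleVec u α) β =
      (Pi.single α (-rowV u α) : Fin d → Fin n → ℂ) β := fun _ => rfl
    change rowV (scaleVec (conjVec g h u) α) β j = (rowV (scaleVec u α) β ᵥ* h) j
    rw [h1, h1]
    by_cases hb : β = α
    · subst hb; simp [rowV_conjVec, neg_vecMul]
    · simp [hb]
  | W β j =>
    have h1 : ∀ u : RVec n d, colW (scaleVec u α) β =
      (Pi.single α (colW u α) : Fin d → Fin n → ℂ) β := fun _ => rfl
    change colW (scaleVec (conjVec g h u) α) β j = (g *ᵥ colW (scaleVec u α) β) j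
    rw [h1, h1]
    by_cases hb : β = α
    · subst hb; simp [colW_conjVec]
    · simp [hb]

/-- The action of an invertible matrix on the representation space. -/
def conjPt {g h : Mat n} (hgh : g * h = 1) (u : repSpace n d) : repSpace n d :=
  ⟨conjVec g h u.1, conjVec_mem_repSpace hgh u.2⟩

theorem conjPt_mem (g h : Mat n) (c : RSCoord n d) :
    (fun u : repSpace n d => conjVec g h u.1 c) ∈ RepRing n d := by
  have key : ∀ u : RVec n d, conjVec g h u c = ∑ e, u e * conjVec g h (dirVec e) c := by
    intro u
    have h0 := pair_coAct g h (dirVec c) u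
    rw [dirVec_pair] at h0
    rw [← h0, pair]
    refine sum_congr rfl fun e _ => ?_
    have h1 := pair_coAct g h (dirVec c) (dirVec e)
    rw [dirVec_pair, pair_dirVec] at h1
    rw [h1, mul_comm]
  have : (fun u : repSpace n d => conjVec g h u.1 c) =
      (∑ e, coordFn (repSpace n d) e * algebraMap ℂ (RepRing n d) (conjVec g h (dirVec e) c) :
        RepRing n d).1 := by
    funext u
    rw [key, ← evalReg_apply, map_sum]
    exact sum_congr rfl fun e _ => by rw [map_mul, AlgHom.commutes]; rfl
  rw [this]
  exact Subtype.property _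

/-- The pullback of functions under the action. -/
def conjFn {g h : Mat n} (hgh : g * h = 1) (F : RepRing n d) : RepRing n d :=
  comapReg (conjPt hgh) (conjPt_mem g h) F

theorem gr_conjFn {g h : Mat n} (hgh : g * h = 1) (F : RepRing n d)
    (u : repSpace n d) : gr (conjFn hgh F) u = coAct g h (gr F (conjPt hgh u)) := by
  have key : ∀ δ, pair (gr (conjFn hgh F) u) δ = pair (coAct g h (gr F (conjPt hgh u))) δ := by
    intro δ
    rw [pair_coAct]
    have h1 := hasDerivAt_curve (isOpen_repSpace n d) u δ _ (by simp) (hasDerivAt_line u.1 δ)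
      (conjFn hgh F)
    refine h1.unique ((hasDerivAt_curve (isOpen_repSpace n d) (conjPt hgh u) (conjVec g h δ)
      (fun t => (conjPt hgh u).1 + t • conjVec g h δ) (by simp) (hasDerivAt_line _ _) F).congr_of_eventuallyEq ?_)
    have hm : ∀ᶠ t in nhds (0 : ℂ), u.1 + t • δ ∈ repSpace n d :=
      (hasDerivAt_line u.1 δ).continuousAt.eventually_mem
        ((isOpen_repSpace n d).mem_nhds (by simp [u.2]))
    filter_upwards [hm] with t ht
    have ht' : (conjPt hgh u).1 + t • conjVec g h δ ∈ repSpace n d := by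
      have := conjVec_mem_repSpace hgh ht
      rwa [conjVec_add_smul] at this
    simp only [extZero, dif_pos ht, dif_pos ht']
    exact congrArg F.1 (Subtype.ext (conjVec_add_smul g h u.1 δ t))
  funext c
  rw [← pair_dirVec (gr (conjFn hgh F) u), key, pair_dirVec]

variable {q : ℂ}

theorem isLift_conjFn {g h : Mat n} (hgh : g * h = 1) {F : RepRing n d}
    {f : RSRing n d q} (hF : LiftRS F f) :
    LiftRS (conjFn hgh F) f := fun y =>
  (hF ⟨conjVec g h y.1, conjVec_mem_levelSet hgh y.2⟩).trans
    (congrArg f.1 (Quot.sound (glRel_conjVec hgh y)).symm)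

/-- Brackets which are equivariant and for which Hamiltonian vectors are tangent to the level set
descend to the phase space. -/
theorem descends_of_equivariant {P : Bider (RepRing n d)} (hP : IsBivector P)
    (hleft : ∀ (F G : RepRing n d) (g : RSRing n d q),
      (∀ y : levelSet n d q, F.1 (lv y) = 0) → LiftRS G g →
      ∀ y : levelSet n d q, (P F G).1 (lv y) = 0)
    (hequiv : ∀ (F G : RepRing n d) (g : RSRing n d q), LiftRS G g →
      ∀ (a b : Mat n) (hab : a * b = 1) (y : levelSet n d q),
      (P (conjFn hab F) (conjFn hab G)).1 (lv y) = (P F G).1 (conjPt hab (lv y))) :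
    Descends (levelSet_subset n d q) (glRel n d q) P where
  bivector := hP
  left := hleft
  inv := by
    rintro F G f g hF hG y y' ⟨a, ha⟩
    have hab : a.1 * (a⁻¹).1 = 1 := by rw [← Units.val_mul, mul_inv_cancel, Units.val_one]
    have hy' : lv y' = conjPt hab (lv y) := Subtype.ext (by rw [ha, glAct_eq_conjVec]; rfl)
    change (P F G).1 (lv y) = (P F G).1 (lv y')
    rw [hy', ← hequiv F G g hG _ _ hab]
    have e1 := hleft (F - conjFn hab F) G g (fun y => by
      change F.1 _ - (conjFn hab F).1 _ = 0
      rw [hF y, isLift_conjFn hab hF y, sub_self]) hG y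
    have e2 := hleft (G - conjFn hab G) (conjFn hab F) f (fun y => by
      change G.1 _ - (conjFn hab G).1 _ = 0
      rw [hG y, isLift_conjFn hab hG y, sub_self]) (isLift_conjFn hab hF) y
    rw [hP.antisymm] at e2
    rw [map_sub, Derivation.sub_apply] at e1
    rw [map_sub] at e2
    have e1' : (P F G).1 (lv y) - (P (conjFn hab F) G).1 (lv y) = 0 := e1
    have e2' : -((P (conjFn hab F) G).1 (lv y) - (P (conjFn hab F) (conjFn hab G)).1 (lv y)) = 0 := e2
    linear_combination e1' - e2'

theorem quasiP_descends (hq : ∀ k : ℕ, 1 ≤ k → k ≤ n → q ^ k ≠ 1) :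
    Descends (levelSet_subset n d q) (glRel n d q) (quasiP n d) := by
  refine descends_of_equivariant quasiP_isBivector ?_ ?_
  · intro F G g hF hG y
    have hb := isBasic_of_lift hG y
    rw [quasiP_at (lv y) F G hb]
    exact dirAt_eq_zero_of_levelSet hq F hF y (dLevel_hamVec ((mem_levelSet_iff q y.1).1 y.2).2 hb)
  · intro F G g hG a b hab y
    have hb := isBasic_of_lift (isLift_conjFn hab hG) y
    have hb' : IsBasic (conjPt hab (lv y)).1 (gr G (conjPt hab (lv y))) :=
      isBasic_of_lift hG ⟨conjVec a b y.1, conjVec_mem_levelSet hab y.2⟩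
    rw [quasiP_at (lv y) _ _ hb, quasiP_at _ _ _ hb', gr_conjFn, gr_conjFn, pair_coAct]
    congr 1
    exact (hamVec_conjVec hab _ _).symm

theorem psiRep_at (z : Param d) (u : repSpace n d) (F G : RepRing n d) :
    (psiRep n z F G).1 u = ∑ p : {p : Fin d × Fin d // p.1 < p.2},
      z p * (pair (gr F u) (scaleVec u.1 p.1.1) * pair (gr G u) (scaleVec u.1 p.1.2) -
        pair (gr G u) (scaleVec u.1 p.1.1) * pair (gr F u) (scaleVec u.1 p.1.2)) := by
  have hsm : ∀ (c : ℂ) (f : RepRing n d), evalReg u (c • f) = c * evalReg u f := fun c f => by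
    rw [map_smul, smul_eq_mul]
  rw [← evalReg_apply, psiRep, bider_sum_apply, map_sum]
  refine sum_congr rfl fun p _ => ?_
  rw [Derivation.smul_apply, Derivation.smul_apply, hsm, wedge_apply, map_sub, map_mul, map_mul,
    scaleField_at, scaleField_at, scaleField_at, scaleField_at]
  simp only [pair_scaleVec]
  ring

theorem psiRep_descends (hq : ∀ k : ℕ, 1 ≤ k → k ≤ n → q ^ k ≠ 1) (z : Param d) :
    Descends (levelSet_subset n d q) (glRel n d q) (psiRep n z) := by
  refine descends_of_equivariant (psiRep_isBivector z) ?_ ?_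
  · intro F G g hF hG y
    have h0 : ∀ α, pair (gr F (lv y)) (scaleVec y.1 α) = 0 := fun α =>
      dirAt_eq_zero_of_levelSet hq F hF y (dLevel_scaleVec q y.2.1 α)
    rw [psiRep_at]
    simp only [h0, zero_mul, mul_zero, sub_zero, sum_const_zero]
  · intro F G g hG a b hab y
    rw [psiRep_at, psiRep_at]
    have h1 : ∀ (F : RepRing n d) α, pair (gr (conjFn hab F) (lv y)) (scaleVec y.1 α) =
        pair (gr F (conjPt hab (lv y))) (scaleVec (conjPt hab (lv y)).1 α) := fun F α => by
      rw [gr_conjFn, pair_coAct]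
      congr 1
      exact (scaleVec_conjVec a b y.1 α).symm
    simp only [h1]

end Equivariance

/-! ### The pencil on the phase space -/

section PencilGeneric

variable {A : Type} [CommRing A] [Algebra ℂ A]

/-- Finite combinations of members of a pencil with linear parameters. -/
theorem sum_pencil {d : ℕ} (B₀ : Bider A) (Ψ : Param d → Bider A)
    (hadd : ∀ z z', Ψ (z + z') = Ψ z + Ψ z') (hsmul : ∀ (c : ℂ) z, Ψ (c • z) = c • Ψ z)
    (s : Finset (Option (Param d))) (c : Option (Param d) → ℂ) :
    ∃ (z₀ : ℂ) (z : Param d), ∑ j ∈ s, c j • pencil B₀ Ψ j = z₀ • B₀ + Ψ z := by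
  classical
  induction s using Finset.induction_on with
  | empty =>
    refine ⟨0, 0, ?_⟩
    have := hsmul 0 0
    rw [zero_smul, zero_smul] at this
    rw [this, zero_smul, add_zero, sum_empty]
  | insert j s hj ih =>
    obtain ⟨z₀, z, h⟩ := ih
    rw [sum_insert hj, h]
    cases j with
    | none => exact ⟨c none + z₀, z, by rw [pencil, add_smul, add_assoc]⟩
    | some w => exact ⟨z₀, c (some w) • w + z, by rw [pencil, hadd, hsmul, add_left_comm]⟩

theorem param_eq_sum {d : ℕ} (z : Param d) : z = ∑ p, z p • (Pi.single p 1 : Param d) := by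
  classical
  exact pi_eq_sum_univ' z

theorem linear_param {d : ℕ} (Ψ : Param d → Bider A)
    (hadd : ∀ z z', Ψ (z + z') = Ψ z + Ψ z') (hsmul : ∀ (c : ℂ) z, Ψ (c • z) = c • Ψ z) (z : Param d) :
    Ψ z = ∑ p, z p • Ψ (Pi.single p 1) := by
  let L : Param d →ₗ[ℂ] Bider A := { toFun := Ψ, map_add' := hadd, map_smul' := hsmul }
  change L z = ∑ p, z p • L (Pi.single p 1)
  conv_lhs => rw [param_eq_sum z, map_sum]
  exact sum_congr rfl fun p _ => map_smul _ _ _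

end PencilGeneric

section PhasePencil

open Matrix

variable {n d : ℕ} {q : ℂ}

theorem psiRep_add (z z' : Param d) : psiRep n (z + z') = psiRep n z + psiRep n z' := by
  simp only [psiRep, Pi.add_apply, add_smul, sum_add_distrib]

theorem psiRep_smul (c : ℂ) (z : Param d) : psiRep n (c • z) = c • psiRep n z := by
  simp only [psiRep, Pi.smul_apply, smul_eq_mul, mul_smul, smul_sum]

theorem jac_combined_level (z₀ : ℂ) (z : Param d) {F : RepRing n d} (G H : RepRing n d)
    {f : RSRing n d q} (hF : LiftRS F f)
    (y : levelSet n d q) : (jac (z₀ • quasiP n d + psiRep n z) F G H).1 (lv y) = 0 := by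
  have h0 : valM (lv y) (matDer (totalAct n d) F) = 0 := by
    rw [totalAct, valM_sum]
    simp only [valM_actSeq]
    exact isBasic_of_lift hF y
  have hsm : ∀ (c : ℂ) (f : RepRing n d), evalReg (lv y) (c • f) = c * evalReg (lv y) f := fun c f => by
    rw [map_smul, smul_eq_mul]
  rw [jac_combined, ← evalReg_apply, hsm, cartan, map_sub, valM_trace, valM_trace]
  simp only [valM_mul, h0, zero_mul, trace_zero, sub_zero, mul_zero]

theorem IsReduction.isPoisson_of_combined {z₀ : ℂ} {z : Param d} {B : Bider (RSRing n d q)}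
    (h : IsReduction (levelSet_subset n d q) (glRel n d q) (z₀ • quasiP n d + psiRep n z) B) :
    IsPoisson B :=
  IsReduction.isPoisson (exists_lift_RS q) h ((quasiP_isBivector.smul z₀).add (psiRep_isBivector z))
    fun _ G H _ _ _ hF _ _ y => jac_combined_level z₀ z G H hF y

theorem isPoissonPencil_reduced {P : Bider (RSRing n d q)} {Ψ : Param d → Bider (RSRing n d q)}
    (hP : IsReducedP q P) (hΨ : ∀ z, IsReducedPsi q z (Ψ z)) : IsPoissonPencil (pencil P Ψ) := by
  intro s c
  obtain ⟨z₀, z, h⟩ := sum_pencil (quasiP n d) (psiRep n) psiRep_add psiRep_smul s c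
  refine IsReduction.isPoisson_of_combined (z₀ := z₀) (z := z) ?_
  rw [← h]
  refine IsReduction.sum s fun j _ => IsReduction.smul ?_ _
  cases j with
  | none => exact hP
  | some w => exact hΨ w

/-- The function on the phase space defined by an invariant function. -/
def descendFn (F : RepRing n d)
    (h : ∀ y y' : levelSet n d q, glRel n d q y y' → F.1 (lv y) = F.1 (lv y')) : RSRing n d q :=
  ⟨Quot.lift (fun y => F.1 (lv y)) h, restrict_mem (levelSet_subset n d q) F⟩

theorem isLift_descendFn (F : RepRing n d)
    (h : ∀ y y' : levelSet n d q, glRel n d q y y' → F.1 (lv y) = F.1 (lv y')) :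
    LiftRS F (descendFn F h) := fun _ => rfl

theorem glRel_iff {y y' : levelSet n d q} (h : glRel n d q y y') :
    ∃ a b : Mat n, a * b = 1 ∧ y'.1 = conjVec a b y.1 := by
  obtain ⟨a, ha⟩ := h
  exact ⟨a.1, (a⁻¹).1, by rw [← Units.val_mul, mul_inv_cancel, Units.val_one],
    by rw [ha, glAct_eq_conjVec]⟩

theorem pair_gr_coordFn (u : repSpace n d) (c : RSCoord n d) (δ : RVec n d) :
    pair (gr (coordFn _ c) u) δ = δ c := by
  rw [gr, grad_coordFn, dirVec_pair]

end PhasePencil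

/-! ### Vector fields on the local phase space -/

section LocalGeometry

open Matrix

variable {n d : ℕ} {q : ℂ}

/-- The labels of the local coordinates, as a disjoint union. -/
def hEquiv (n d : ℕ) : HCoord n d ≃ Fin n ⊕ ((Fin n × Fin d) ⊕ (Fin n × Fin d)) where
  toFun
    | .x i => .inl i
    | .a i α => .inr (.inl (i, α))
    | .b i α => .inr (.inr (i, α))
  invFun
    | .inl i => .x i
    | .inr (.inl (i, α)) => .a i α
    | .inr (.inr (i, α)) => .b i α
  left_inv c := by cases c <;> rfl
  right_inv c := by rcases c with (c | (c | c)) <;> rfl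

instance : Fintype (HCoord n d) := Fintype.ofEquiv _ (hEquiv n d).symm

theorem sum_HCoord {M : Type} [AddCommMonoid M] (f : HCoord n d → M) : ∑ c, f c =
    (∑ i, f (.x i)) + ((∑ i, ∑ α, f (.a i α)) + ∑ i, ∑ α, f (.b i α)) := by
  rw [← Equiv.sum_comp (hEquiv n d).symm]
  simp only [Fintype.sum_sum_type, Fintype.sum_prod_type]
  rfl

/-- The vector `(x_i)`. -/
def hx (u : HVec n d) : Fin n → ℂ := fun i => u (.x i)

/-- The column `(a_i^α)_i`. -/
def ha (u : HVec n d) (α : Fin d) : Fin n → ℂ := fun i => u (.a i α)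

/-- The row `(b_i^α)_i`. -/
def hb (u : HVec n d) (α : Fin d) : Fin n → ℂ := fun i => u (.b i α)

/-- The projection of affine space onto the affine subspace of equations `∑_α a_i^α = 1`. -/
def proj (v : HVec n d) : HVec n d
  | .x i => v (.x i)
  | .a i α => v (.a i α) - (∑ γ, v (.a i γ) - 1) / d
  | .b i α => v (.b i α)

theorem proj_eq_self {u : HVec n d} (hu : ∀ i, ∑ α, u (.a i α) = 1) : proj u = u := by
  funext c
  cases c <;> simp [proj, hu]

/-- The open set of points which project to the local phase space. -/
def projSet (n d : ℕ) (q : ℂ) : Set (HVec n d) := {v | proj v ∈ hreg n d q}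

theorem denom_ne_zero (hq1 : q ≠ 1) {x : Fin n → ℂ} (h0 : ∀ i, x i ≠ 0)
    (h : ∀ i j, i ≠ j → x i ≠ x j ∧ x i ≠ q * x j) (i j : Fin n) : x i * (x j)⁻¹ - q ≠ 0 := by
  intro h1
  have h2 : x i = q * x j := by
    have := sub_eq_zero.1 h1
    rw [← this, mul_assoc, inv_mul_cancel₀ (h0 j), mul_one]
  by_cases hij : i = j
  · subst hij
    apply hq1
    have : (q - 1) * x i = 0 := by linear_combination -h2
    exact sub_eq_zero.1 ((mul_eq_zero.1 this).resolve_right (h0 i))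
  · exact (h i j hij).2 h2

theorem continuous_proj : Continuous (proj : (HVec n d) → HVec n d) := by
  refine continuous_pi fun c => ?_
  cases c <;> simp only [proj] <;> fun_prop

/-- The denominators `x_i - q x_j` do not vanish, also for `i = j` as `q ≠ 1`. -/
theorem isOpen_projSet (hd : d ≠ 0) (hq1 : q ≠ 1) : IsOpen (projSet n d q) := by
  let A : Set (HVec n d) := {v | (∀ i, v (.x i) ≠ 0) ∧
    ∀ i j, i ≠ j → v (.x i) ≠ v (.x j) ∧ v (.x i) ≠ q * v (.x j)}
  have hA : IsOpen A := by
    have : A = (⋂ i, {v | v (.x i) ≠ 0}) ∩ ⋂ i, ⋂ j, {v | i ≠ j → v (.x i) ≠ v (.x j) ∧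
        v (.x i) ≠ q * v (.x j)} := by
      ext v; simp [A]
    rw [this]
    refine (isOpen_iInter_of_finite fun i => isOpen_ne_fun (continuous_apply _) continuous_const).inter
      (isOpen_iInter_of_finite fun i => isOpen_iInter_of_finite fun j => ?_)
    by_cases hij : i = j
    · simp [hij]
    · simp only [ne_eq, hij, not_false_eq_true, true_imp_iff]
      have hc : ∀ c : HCoord n d, Continuous fun v : HVec n d => v c := fun c => continuous_apply c
      exact (isOpen_ne_fun (hc _) (hc _)).inter (isOpen_ne_fun (hc _) (continuous_const.mul (hc _)))
  have hB : ∀ k, ContinuousOn (fun v : HVec n d => (locCalZ q (proj v) k).det) A := by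
    intro k
    rw [continuousOn_iff_continuous_domRestrict]
    refine Continuous.matrix_det (continuous_matrix fun i j => ?_)
    have hc : ∀ c : HCoord n d, Continuous fun v : A => proj v.1 c := fun c =>
      (continuous_apply c).comp (continuous_proj.comp continuous_subtype_val)
    have hx0 : ∀ (v : A) i, proj v.1 (.x i) ≠ 0 := fun v i => v.2.1 i
    refine Continuous.add ?_ (continuous_finsetSum _ fun β _ => (hc _).mul (hc _))
    refine Continuous.div (continuous_const.mul (continuous_finsetSum _ fun β _ => (hc _).mul (hc _)))
      (((hc _).mul ((hc _).inv₀ fun v => hx0 v j)).sub continuous_const) fun v => ?_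
    exact denom_ne_zero (x := hx (proj v.1)) hq1 (hx0 v) v.2.2 i j
  have hS : projSet n d q = ⋂ k : Fin (d + 1), A ∩ {v | (locCalZ q (proj v) k).det ≠ 0} := by
    ext v
    simp only [projSet, hreg, Set.mem_iInter, Set.mem_inter_iff, Set.mem_ofPred_eq]
    constructor
    · rintro ⟨h1, h2, -, h4⟩ k
      exact ⟨⟨h1, h2⟩, h4 k (by omega)⟩
    · intro h
      refine ⟨(h 0).1.1, (h 0).1.2, fun i => ?_, fun k hk => (h ⟨k, by omega⟩).2⟩
      simp only [proj, sum_sub_distrib, Finset.sum_const, Finset.card_univ, Fintype.card_fin,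
        nsmul_eq_mul]
      have : (d : ℂ) ≠ 0 := Nat.cast_ne_zero.2 hd
      field_simp
      ring
  rw [hS]
  exact isOpen_iInter_of_finite fun k => (hB k).isOpen_inter_preimage hA isOpen_ne

/-- The coordinate ring of the local phase space before taking the quotient. -/
abbrev HRing (n d : ℕ) (q : ℂ) : Subalgebra ℂ (hreg n d q → ℂ) := Reg (hreg n d q)

theorem hreg_subset_projSet {u : HVec n d} (hu : u ∈ hreg n d q) : u ∈ projSet n d q := by
  change proj u ∈ hreg n d q
  rwa [proj_eq_self hu.2.2.1]

/-- Pullback along the projection. -/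
def projPull (n d : ℕ) (q : ℂ) : HRing n d q →ₐ[ℂ] Reg (projSet n d q) :=
  comapReg (fun v => ⟨proj v.1, v.2⟩) fun c => by
    cases c with
    | x i => exact (coordFn (projSet n d q) (.x i)).2
    | b i α => exact (coordFn (projSet n d q) (.b i α)).2
    | a i α =>
      have : (fun v : projSet n d q => proj v.1 (.a i α)) = (coordFn (projSet n d q) (.a i α) -
          (d : ℂ)⁻¹ • (∑ γ, coordFn (projSet n d q) (.a i γ) - 1) : Reg (projSet n d q)).1 := by
        funext v
        rw [← evalReg_apply, map_sub, map_smul, map_sub, map_sum, map_one]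
        simp only [evalReg_apply, coordFn_apply, proj, smul_eq_mul]
        ring
      change (fun v : projSet n d q => proj v.1 (.a i α)) ∈ _
      rw [this]
      exact Subtype.property _

/-- Restriction to the local phase space. -/
def projRes (n d : ℕ) (q : ℂ) : Reg (projSet n d q) →ₐ[ℂ] HRing n d q :=
  comapReg (fun u => ⟨u.1, hreg_subset_projSet u.2⟩) fun c => (coordFn (hreg n d q) c).2

theorem projRes_projPull (f : HRing n d q) : projRes n d q (projPull n d q f) = f := by
  ext u
  exact congrArg f.1 (Subtype.ext (proj_eq_self u.2.2.2.1))

/-- The vector field on the local phase space which is the projection of a coordinate vector field. -/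
def hD (hV : IsOpen (projSet n d q)) (c : HCoord n d) : Der(HRing n d q) :=
  Derivation.mk' ((projRes n d q).toLinearMap ∘ₗ (partialD hV c).toLinearMap ∘ₗ
      (projPull n d q).toLinearMap) fun f g => by
    change projRes n d q (partialD hV c (projPull n d q (f * g))) =
      f * projRes n d q (partialD hV c (projPull n d q g)) +
        g * projRes n d q (partialD hV c (projPull n d q f))
    rw [map_mul, Derivation.leibniz, map_add, smul_eq_mul, smul_eq_mul, map_mul, map_mul,
      projRes_projPull, projRes_projPull]

variable (hV : IsOpen (projSet n d q))

/-- The differential of a function on the local phase space, as a covector. -/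
def hgrad (f : HRing n d q) (u : hreg n d q) : HVec n d := fun c => (hD hV c f).1 u

/-- Vectors tangent to the local phase space. -/
def IsHTangent (w : HVec n d) : Prop := ∀ i, ∑ α, w (.a i α) = 0

theorem hgrad_add (f g : HRing n d q) (u : hreg n d q) :
    hgrad hV (f + g) u = hgrad hV f u + hgrad hV g u := by
  funext c; simp [hgrad]

theorem hgrad_mul (f g : HRing n d q) (u : hreg n d q) :
    hgrad hV (f * g) u = f.1 u • hgrad hV g u + g.1 u • hgrad hV f u := by
  funext c; simp [hgrad]

theorem hgrad_smul (c : ℂ) (f : HRing n d q) (u : hreg n d q) :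
    hgrad hV (c • f) u = c • hgrad hV f u := by
  funext e; simp [hgrad]

theorem pair_add_left {ι : Type} [Fintype ι] (ζ ζ' δ : ι → ℂ) :
    pair (ζ + ζ') δ = pair ζ δ + pair ζ' δ := add_dotProduct _ _ _

theorem pair_smul_left {ι : Type} [Fintype ι] (c : ℂ) (ζ δ : ι → ℂ) :
    pair (c • ζ) δ = c * pair ζ δ := smul_dotProduct _ _ _

theorem pair_add_right {ι : Type} [Fintype ι] (ζ δ δ' : ι → ℂ) :
    pair ζ (δ + δ') = pair ζ δ + pair ζ δ' := dotProduct_add _ _ _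

theorem pair_smul_right {ι : Type} [Fintype ι] (c : ℂ) (ζ δ : ι → ℂ) :
    pair ζ (c • δ) = c * pair ζ δ := dotProduct_smul _ _ _

/-- The derivative of functions in the direction of a vector. -/
def hdir (u : hreg n d q) (w : HVec n d) : HRing n d q →ₗ[ℂ] ℂ where
  toFun f := pair (hgrad hV f u) w
  map_add' f g := by rw [hgrad_add, pair_add_left]
  map_smul' c f := by rw [hgrad_smul, pair_smul_left]; rfl

theorem hdir_apply (u : hreg n d q) (w : HVec n d) (f : HRing n d q) :
    hdir hV u w f = pair (hgrad hV f u) w := rfl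

theorem hdir_tangent (u : hreg n d q) (w : HVec n d) :
    IsTangentVector (HRing n d q) u (hdir hV u w) := by
  intro f g
  simp only [hdir_apply, hgrad_mul, pair_add_left, pair_smul_left]

/-- The coordinates `a_i^α` are subject to `∑_α a_i^α = 1`, whence the correction by the mean. -/
theorem hgrad_coordFn (c : HCoord n d) (u : hreg n d q) : hgrad hV (coordFn _ c) u = match c with
    | .x i => dirVec (.x i)
    | .a i α => dirVec (.a i α) - (d : ℂ)⁻¹ • ∑ γ, dirVec (.a i γ)
    | .b i α => dirVec (.b i α) := by
  have h1 : ∀ e c : HCoord n d, (projRes n d q (partialD hV e (coordFn _ c))).1 u = dirVec c e := by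
    intro e c
    rw [partialD_coordFn, AlgHom.commutes]
    classical
    change dirVec e c = dirVec c e
    simp [dirVec, Pi.single_apply, eq_comm]
  funext e
  cases c with
  | x i => exact h1 e _
  | b i α => exact h1 e _
  | a i α =>
    change (projRes n d q (partialD hV e (projPull n d q (coordFn _ (.a i α))))).1 u = _
    have : projPull n d q (coordFn _ (.a i α)) = coordFn (projSet n d q) (.a i α) -
          (d : ℂ)⁻¹ • (∑ γ, coordFn (projSet n d q) (.a i γ) - 1) := by
      ext v
      rw [← evalReg_apply v (_ - _), map_sub, map_smul, map_sub, map_sum, map_one]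
      change proj v.1 (.a i α) = _
      simp only [evalReg_apply, coordFn_apply, proj, smul_eq_mul]
      ring
    rw [this, map_sub, Derivation.map_smul, map_sub (partialD hV e) (∑ γ, _), map_sum,
      Derivation.map_one_eq_zero, sub_zero, ← evalReg_apply, map_sub, map_sub, map_smul, map_smul, map_sum,
      map_sum]
    simp only [evalReg_apply, h1, Pi.sub_apply, Pi.smul_apply, Finset.sum_apply, smul_eq_mul]

theorem hdir_coordFn (u : hreg n d q) {w : HVec n d} (hw : IsHTangent w) (c : HCoord n d) :
    hdir hV u w (coordFn _ c) = w c := by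
  rw [hdir_apply, hgrad_coordFn]
  cases c with
  | x i => exact dirVec_pair _ _
  | b i α => exact dirVec_pair _ _
  | a i α =>
    have h2 : ∀ s : Finset (Fin d), pair (∑ γ ∈ s, dirVec (HCoord.a i γ)) w = ∑ γ ∈ s, w (.a i γ) := by
      intro s
      induction s using Finset.induction_on with
      | empty => simp [pair]
      | insert a s ha ih => rw [sum_insert ha, sum_insert ha, pair_add_left, ih, dirVec_pair]
    change pair (dirVec _ - (d : ℂ)⁻¹ • ∑ γ, dirVec _) w = _
    rw [sub_eq_add_neg, ← neg_smul, pair_add_left, pair_smul_left, h2, hw i, mul_zero, add_zero,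
      dirVec_pair]

/-- All tangent vectors are directional derivatives. -/
theorem eq_hdir {u : hreg n d q} {v : HRing n d q →ₗ[ℂ] ℂ} (hv : IsTangentVector (HRing n d q) u v) :
    IsHTangent (fun c => v (coordFn _ c)) ∧ v = hdir hV u fun c => v (coordFn _ c) := by
  have hw : IsHTangent (fun c => v (coordFn _ c)) := by
    intro i
    rw [← map_sum]
    have : ∑ α, coordFn (hreg n d q) (.a i α) = 1 := by
      ext u
      rw [← evalReg_apply, map_sum]
      exact u.2.2.2.1 i
    rw [this, tangent_one hv]
  exact ⟨hw, tangent_ext hv (hdir_tangent hV u _) fun c => (hdir_coordFn hV u hw c).symm⟩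

end LocalGeometry

/-! ### The slice -/

section Slice

open Matrix

variable {n d : ℕ} {q : ℂ} {u : HVec n d}

/-- The point of the level set defined by a point of the local phase space. -/
def sliceVec (q : ℂ) (u : HVec n d) : RVec n d :=
  mkVec (diagonal (hx u)) (locCalZ q u 0) (fun α => hb u α ᵥ* (locCalZ q u α)⁻¹) (ha u)

theorem sum_filter_lt_succ {M : Type} [AddCommMonoid M] (f : Fin d → M) {k : ℕ} (hk : k < d) :
    ∑ β : Fin d with β.1 < k + 1, f β = f ⟨k, hk⟩ + ∑ β : Fin d with β.1 < k, f β := by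
  have h : univ.filter (fun β : Fin d => β.1 < k + 1) =
      insert ⟨k, hk⟩ (univ.filter fun β : Fin d => β.1 < k) := by
    ext β
    simp only [mem_filter, mem_univ, true_and, mem_insert, Fin.ext_iff]
    omega
  rw [h, sum_insert (by simp)]

theorem locCalZ_succ (q : ℂ) (u : HVec n d) (k : ℕ) (hk : k < d) :
    locCalZ q u (k + 1) = locCalZ q u k + vecMulVec (ha u ⟨k, hk⟩) (hb u ⟨k, hk⟩) := by
  ext i j
  simp only [locCalZ, of_apply, Matrix.add_apply, vecMulVec_apply, sum_filter_lt_succ _ hk, ha, hb]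
  ring

theorem locCalZ_zero (q : ℂ) (u : HVec n d) (i j : Fin n) : locCalZ q u 0 i j = locZ q u i j := by
  simp [locCalZ]

theorem locCalZ_last (q : ℂ) (u : HVec n d) (i j : Fin n) :
    locCalZ q u d i j = locZ q u i j + ∑ β, u (.a i β) * u (.b j β) := by
  rw [locCalZ, of_apply, filter_true_of_mem fun β _ => β.2]

theorem rowV_slice (u : HVec n d) (α : Fin d) :
    rowV (sliceVec q u) α = hb u α ᵥ* (locCalZ q u α)⁻¹ := rfl

theorem colW_slice (u : HVec n d) (α : Fin d) : colW (sliceVec q u) α = ha u α := rfl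

theorem matX_slice (u : HVec n d) : matX (sliceVec q u) = diagonal (hx u) := rfl

theorem matZ_slice (u : HVec n d) : matZ (sliceVec q u) = locCalZ q u 0 := rfl

theorem rowV_slice_mul (hu : u ∈ hreg n d q) (α : Fin d) :
    rowV (sliceVec q u) α ᵥ* locCalZ q u α = hb u α := by
  rw [rowV_slice, vecMul_vecMul, nonsing_inv_mul _ (hu.2.2.2 α α.2.le).isUnit, vecMul_one]

theorem muN_slice_mul (hu : u ∈ hreg n d q) (k : ℕ) (hk : k < d) :
    muN (sliceVec q u) k * locCalZ q u k = locCalZ q u (k + 1) := by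
  rw [muN, dif_pos hk, matWV_eq, add_mul, one_mul, vecMulVec_mul, rowV_slice_mul hu ⟨k, hk⟩,
    locCalZ_succ q u k hk, colW_slice]

theorem kprod_slice_mul (hu : u ∈ hreg n d q) (k : ℕ) (hk : k ≤ d) :
    kprod (muN (sliceVec q u)) k * matZ (sliceVec q u) = locCalZ q u k := by
  induction k with
  | zero => rw [kprod, one_mul, matZ_slice]
  | succ k ih => rw [kprod, mul_assoc, ih (by omega), muN_slice_mul hu k hk]

theorem sub_q_mul_ne_zero (hq1 : q ≠ 1) (hu : u ∈ hreg n d q) (i j : Fin n) :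
    u (.x i) - q * u (.x j) ≠ 0 := by
  intro h
  have h3 : u (.x j) ≠ 0 := hu.1 j
  apply denom_ne_zero (x := hx u) hq1 hu.1 hu.2.1 i j
  simp only [hx]
  field_simp
  linear_combination h

/-- The definition of `Z_{ij}` is the equation `X Z_0 = q Z_d X` for diagonal `X`, solved for `Z`.
-/
theorem sliceVec_mem (hq1 : q ≠ 1) (hu : u ∈ hreg n d q) : sliceVec q u ∈ levelSet n d q := by
  rw [mem_levelSet_iff]
  refine ⟨⟨?_, hu.2.2.2 0 (Nat.zero_le _), fun α => ?_⟩, ?_⟩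
  · rw [matX_slice, det_diagonal]
    exact prod_ne_zero_iff.2 fun i _ => hu.1 i
  · intro h
    have h1 := congrArg det (muN_slice_mul hu α α.2)
    rw [det_mul, muN, dif_pos α.2, h, zero_mul] at h1
    exact hu.2.2.2 (α + 1) α.2 h1.symm
  · rw [levelEq, kprod_slice_mul hu d le_rfl, matX_slice, matZ_slice, sub_eq_zero]
    ext i j
    rw [diagonal_mul, Matrix.smul_apply, mul_diagonal, locCalZ_last, locCalZ_zero, locZ]
    have h1 := denom_ne_zero (x := hx u) hq1 hu.1 hu.2.1 i j
    have h2 : u (.x j) ≠ 0 := hu.1 j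
    have h4 : u (.x i) - q * u (.x j) ≠ 0 := sub_q_mul_ne_zero hq1 hu i j
    simp only [hx, smul_eq_mul] at h1 ⊢
    generalize ∑ β, u (.a i β) * u (.b j β) = t at *
    rw [show u (.x i) * (u (.x j))⁻¹ - q = (u (.x i) - q * u (.x j)) / u (.x j) by field_simp]
    field_simp
    ring

/-- The slice, as a map to the representation space. -/
def slicePt (hq1 : q ≠ 1) (u : hreg n d q) : levelSet n d q := ⟨sliceVec q u.1, sliceVec_mem hq1 u.2⟩

theorem Reg.sum_mem' {ι κ : Type} {U : Set (ι → ℂ)} (s : Finset κ) {f : κ → U → ℂ}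
    (h : ∀ k ∈ s, f k ∈ Reg U) : (fun u => ∑ k ∈ s, f k u) ∈ Reg U := by
  have := (Reg U).sum_mem h
  convert this using 1
  funext u
  simp

theorem hcoord_mem (c : HCoord n d) : (fun u : hreg n d q => u.1 c) ∈ HRing n d q :=
  (coordFn (hreg n d q) c).2

theorem locZ_mem (hq1 : q ≠ 1) (i j : Fin n) :
    (fun u : hreg n d q => locZ q u.1 i j) ∈ HRing n d q := by
  have h1 : (fun u : hreg n d q => (u.1 (.x j))⁻¹) ∈ HRing n d q :=
    Reg.inv_mem (hcoord_mem (.x j)) fun u => u.2.1 j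
  have h2 : (fun u : hreg n d q => u.1 (.x i) * (u.1 (.x j))⁻¹ - q) ∈ HRing n d q :=
    (HRing n d q).sub_mem ((HRing n d q).mul_mem (hcoord_mem _) h1) ((HRing n d q).algebraMap_mem q)
  have h3 := Reg.inv_mem h2 fun u => denom_ne_zero (x := hx u.1) hq1 u.2.1 u.2.2.1 i j
  have h4 : (fun u : hreg n d q => ∑ β, u.1 (.a i β) * u.1 (.b j β)) ∈ HRing n d q :=
    Reg.sum_mem' _ fun _ _ => (HRing n d q).mul_mem (hcoord_mem _) (hcoord_mem _)
  have h5 := (HRing n d q).mul_mem ((HRing n d q).mul_mem ((HRing n d q).algebraMap_mem q) h4) h3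
  exact h5

theorem locCalZ_mem (hq1 : q ≠ 1) (k : ℕ) (i j : Fin n) :
    (fun u : hreg n d q => locCalZ q u.1 k i j) ∈ HRing n d q :=
  (HRing n d q).add_mem (locZ_mem hq1 i j)
    (Reg.sum_mem' _ fun _ _ => (HRing n d q).mul_mem (hcoord_mem _) (hcoord_mem _))

theorem inv_locCalZ_mem (hq1 : q ≠ 1) (k : ℕ) (hk : k ≤ d) (i j : Fin n) :
    (fun u : hreg n d q => (locCalZ q u.1 k)⁻¹ i j) ∈ HRing n d q := by
  let A : Matrix (Fin n) (Fin n) (HRing n d q) := Matrix.of fun i j => ⟨_, locCalZ_mem hq1 k i j⟩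
  have hA : ∀ u : hreg n d q, A.map (evalReg u) = locCalZ q u.1 k := fun u => rfl
  have hdet : ∀ u : hreg n d q, A.det.1 u = (locCalZ q u.1 k).det := fun u => by
    rw [← hA u]; exact RingHom.map_det (evalReg u).toRingHom A
  have hadj : ∀ u : hreg n d q, (A.adjugate i j).1 u = (locCalZ q u.1 k).adjugate i j := fun u => by
    rw [← hA u]
    exact congrFun (congrFun (RingHom.map_adjugate (evalReg u).toRingHom A) i) j
  have h1 := Reg.inv_mem A.det.2 fun u => by rw [hdet]; exact u.2.2.2.2 k hk
  have h2 := (HRing n d q).mul_mem h1 (A.adjugate i j).2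
  convert h2 using 1
  funext u
  rw [Pi.mul_apply, hdet, hadj, inv_def, Ring.inverse_eq_inv', Matrix.smul_apply, smul_eq_mul]

theorem slice_mem (hq1 : q ≠ 1) (c : RSCoord n d) :
    (fun u : hreg n d q => sliceVec q u.1 c) ∈ HRing n d q := by
  cases c with
  | X i j =>
    by_cases h : i = j
    · subst h
      have : (fun u : hreg n d q => sliceVec q u.1 (.X i i)) = fun u => u.1 (.x i) := by
        funext u; exact diagonal_apply_eq _ _
      rw [this]; exact hcoord_mem _
    · have : (fun u : hreg n d q => sliceVec q u.1 (.X i j)) = fun u => 0 := by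
        funext u; exact diagonal_apply_ne _ h
      rw [this]; exact (HRing n d q).zero_mem
  | Z i j => exact locCalZ_mem hq1 0 i j
  | W α i => exact hcoord_mem _
  | V α j =>
    exact Reg.sum_mem' (f := fun k u => u.1 (.b k α) * (locCalZ q u.1 α)⁻¹ k j) univ fun k _ =>
      (HRing n d q).mul_mem (hcoord_mem _) (inv_locCalZ_mem hq1 α α.2.le k j)

/-- Pullback along the slice. -/
def slicePull (hq1 : q ≠ 1) : RepRing n d →ₐ[ℂ] HRing n d q :=
  comapReg (fun u => lv (slicePt hq1 u)) (slice_mem hq1)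

theorem slicePull_apply (hq1 : q ≠ 1) (F : RepRing n d) (u : hreg n d q) :
    (slicePull hq1 F).1 u = F.1 (lv (slicePt hq1 u)) := rfl

/-! The coordinates `X`, `W_α` and `V_α Z_α`. -/

/-- The row `V_α Z_α`, where `Z_α` is the product of `Z` with the preceding matrices `Id + W_β V_β`. -/
def rowB (y : RVec n d) (α : Fin d) : Fin n → ℂ := rowV y α ᵥ* (kprod (muN y) α * matZ y)

/-- The derivative of the product of `Z` with the first matrices `Id + W_β V_β`. -/
def dZk (y δ : RVec n d) (k : ℕ) : Mat n := dK y δ k * matZ y + kprod (muN y) k * matZ δ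

/-- The derivative of the row `V_α Z_α`. -/
def dB (y δ : RVec n d) (α : Fin d) : Fin n → ℂ :=
  rowV δ α ᵥ* (kprod (muN y) α * matZ y) + rowV y α ᵥ* dZk y δ α

theorem dZk_succ (y δ : RVec n d) (α : Fin d) : dZk y δ (α + 1) = dZk y δ α +
    vecMulVec (colW δ α) (rowB y α) + vecMulVec (colW y α) (dB y δ α) := by
  have hmu : muN y α = 1 + vecMulVec (colW y α) (rowV y α) := by rw [muN, dif_pos α.2, matWV_eq]
  have hdmu : dmu y δ α = vecMulVec (colW δ α) (rowV y α) + vecMulVec (colW y α) (rowV δ α) := by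
    rw [dmu, dif_pos α.2]
  rw [dZk, dK, kprod, hmu, hdmu, rowB, dB, vecMulVec_add, ← vecMulVec_mul, ← vecMulVec_mul,
    ← vecMulVec_mul, dZk]
  noncomm_ring

theorem dZk_eq (y δ : RVec n d) (k : ℕ) (hk : k ≤ d) : dZk y δ k = matZ δ +
    ∑ α : Fin d with α.1 < k,
      (vecMulVec (colW δ α) (rowB y α) + vecMulVec (colW y α) (dB y δ α)) := by
  induction k with
  | zero => simp [dZk, dK, kprod]
  | succ k ih =>
    rw [dZk_succ y δ ⟨k, hk⟩, ih (by omega), sum_filter_lt_succ _ hk]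
    abel

theorem dLevel_eq (y δ : RVec n d) : dLevel q y δ = matX δ * matZ y + matX y * matZ δ -
    q • (dZk y δ d * matX y + kprod (muN y) d * matZ y * matX δ) := by
  rw [dLevel, dZk, add_mul]

theorem rowB_slice (hu : u ∈ hreg n d q) (α : Fin d) : rowB (sliceVec q u) α = hb u α := by
  rw [rowB, kprod_slice_mul hu α α.2.le, rowV_slice_mul hu]

/-- Tangent vectors of the level set at points of the slice are determined by their components in the
directions of `X`, of the `W_α` and of the `V_α Z_α`. -/
theorem eq_zero_of_coords (hq1 : q ≠ 1) (hu : u ∈ hreg n d q)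
    {δ : RVec n d} (h : dLevel q (sliceVec q u) δ = 0) (hX : matX δ = 0)
    (hW : ∀ α, colW δ α = 0) (hB : ∀ α, dB (sliceVec q u) δ α = 0) : δ = 0 := by
  have hk : ∀ k ≤ d, dZk (sliceVec q u) δ k = matZ δ := fun k hk => by
    rw [dZk_eq _ _ k hk]
    simp [hW, hB]
  have hZ : matZ δ = 0 := by
    rw [dLevel_eq, hk d le_rfl, hX, zero_mul, zero_add, mul_zero, add_zero, matX_slice] at h
    ext i j
    have h1 := congrFun (congrFun h i) j
    rw [Matrix.sub_apply, diagonal_mul, Matrix.smul_apply, mul_diagonal, smul_eq_mul] at h1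
    have h4 : hx u i - q * hx u j ≠ 0 := sub_q_mul_ne_zero hq1 hu i j
    have h5 : (hx u i - q * hx u j) * matZ δ i j = 0 := by
      rw [Matrix.zero_apply] at h1
      linear_combination h1
    exact (mul_eq_zero.1 h5).resolve_left h4
  have hV : ∀ α, rowV δ α = 0 := fun α => by
    have h1 := hB α
    rw [dB, hk α α.2.le, hZ, vecMul_zero, add_zero, kprod_slice_mul hu α α.2.le] at h1
    have h2 : rowV δ α ᵥ* locCalZ q u α ᵥ* (locCalZ q u α)⁻¹ = 0 := by rw [h1, zero_vecMul]
    rwa [vecMul_vecMul, mul_nonsing_inv _ (hu.2.2.2 α α.2.le).isUnit, vecMul_one] at h2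
  funext c
  cases c with
  | X i j => exact congrFun (congrFun hX i) j
  | Z i j => exact congrFun (congrFun hZ i) j
  | V α j => exact congrFun (hV α) j
  | W α j => exact congrFun (hW α) j

/-! Linearity in the tangent vector. -/

theorem dd_add_smul {ι : Type} [Fintype ι] (y δ δ' : ι → ℂ) (c : ℂ) (p : MvPolynomial ι ℂ) :
    dd y (δ + c • δ') p = dd y δ p + c * dd y δ' p := by
  simp only [← ddL_apply, map_add, map_smul, smul_eq_mul]

theorem dK_add_smul (y δ δ' : RVec n d) (c : ℂ) (k : ℕ) :
    dK y (δ + c • δ') k = dK y δ k + c • dK y δ' k := by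
  simp only [← ddM_kprod]
  ext i j
  exact dd_add_smul _ _ _ _ _

theorem dZk_add_smul (y δ δ' : RVec n d) (c : ℂ) (k : ℕ) :
    dZk y (δ + c • δ') k = dZk y δ k + c • dZk y δ' k := by
  have hZ : matZ (δ + c • δ') = matZ δ + c • matZ δ' := rfl
  simp only [dZk, dK_add_smul, hZ, add_mul, mul_add, smul_mul, Matrix.mul_smul, smul_add]
  abel

theorem dB_add_smul (y δ δ' : RVec n d) (c : ℂ) (α : Fin d) :
    dB y (δ + c • δ') α = dB y δ α + c • dB y δ' α := by
  have hV : rowV (δ + c • δ') α = rowV δ α + c • rowV δ' α := rfl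
  simp only [dB, dZk_add_smul, hV, add_vecMul, smul_vecMul, vecMul_add, vecMul_smul, smul_add]
  abel

theorem dLevel_add_smul (y δ δ' : RVec n d) (c : ℂ) :
    dLevel q y (δ + c • δ') = dLevel q y δ + c • dLevel q y δ' := by
  simp only [← ddM_polEq]
  ext i j
  exact dd_add_smul _ _ _ _ _

/-! Gauge vectors. -/

theorem dK_gaugeVec (y : RVec n d) (η : Mat n) (k : ℕ) (hk : k ≤ d) :
    dK y (gaugeVec y η) k = η * kprod (muN y) k - kprod (muN y) k * η := by
  induction k with
  | zero => simp [dK, kprod]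
  | succ k ih =>
    have hmu : muN y k = 1 + vecMulVec (colW y ⟨k, hk⟩) (rowV y ⟨k, hk⟩) := by
      rw [muN, dif_pos (show k < d from hk), matWV_eq]
    have hV : rowV (gaugeVec y η) ⟨k, hk⟩ = -(rowV y ⟨k, hk⟩ ᵥ* η) := rfl
    have hW : colW (gaugeVec y η) ⟨k, hk⟩ = η *ᵥ colW y ⟨k, hk⟩ := rfl
    have hdmu : dmu y (gaugeVec y η) k = η * muN y k - muN y k * η := by
      rw [dmu, dif_pos (show k < d from hk), hV, hW, hmu, vecMulVec_neg, ← vecMulVec_mul, ← mul_vecMulVec]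
      noncomm_ring
    rw [dK, ih (by omega), hdmu, kprod]
    noncomm_ring

theorem dZk_gaugeVec (y : RVec n d) (η : Mat n) (k : ℕ) (hk : k ≤ d) :
    dZk y (gaugeVec y η) k = η * (kprod (muN y) k * matZ y) - kprod (muN y) k * matZ y * η := by
  have hZ : matZ (gaugeVec y η) = η * matZ y - matZ y * η := rfl
  rw [dZk, dK_gaugeVec y η k hk, hZ]
  noncomm_ring

theorem dB_gaugeVec (y : RVec n d) (η : Mat n) (α : Fin d) :
    dB y (gaugeVec y η) α = -(rowB y α ᵥ* η) := by
  have hV : rowV (gaugeVec y η) α = -(rowV y α ᵥ* η) := rfl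
  rw [dB, dZk_gaugeVec y η α α.2.le, hV, vecMul_sub, neg_vecMul, vecMul_vecMul, rowB, vecMul_vecMul]
  abel

theorem dLevel_gaugeVec {y : RVec n d} (hy : levelEq q y = 0) (η : Mat n) :
    dLevel q y (gaugeVec y η) = 0 := by
  have hX : matX (gaugeVec y η) = η * matX y - matX y * η := rfl
  have hZ : matZ (gaugeVec y η) = η * matZ y - matZ y * η := rfl
  have h1 : dLevel q y (gaugeVec y η) = η * levelEq q y - levelEq q y * η := by
    rw [dLevel_eq, dZk_gaugeVec y η d le_rfl, hX, hZ, levelEq]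
    simp only [mul_sub, sub_mul, smul_add, smul_sub, mul_assoc, Matrix.mul_smul, smul_mul]
    abel
  rw [h1, hy, mul_zero, zero_mul, sub_zero]

/-! The projection of tangent vectors to the slice along the gauge orbits. -/

/-- The infinitesimal transformation which brings a tangent vector back to the slice. -/
def compens (u : HVec n d) (δ : RVec n d) : Mat n := Matrix.of fun i j => if i = j then
      -(∑ α, colW δ α i) - ∑ k ∈ univ.erase i, matX δ i k / (u (.x i) - u (.x k))
    else matX δ i j / (u (.x i) - u (.x j))

/-- The projection of tangent vectors of the level set to tangent vectors of the local phase space. -/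
def rho (q : ℂ) (u : HVec n d) (δ : RVec n d) : HVec n d
  | .x i => matX δ i i
  | .a i α => colW δ α i + (compens u δ *ᵥ ha u α) i
  | .b i α => dB (sliceVec q u) δ α i - (hb u α ᵥ* compens u δ) i

theorem sum_compens (u : HVec n d) (δ : RVec n d) (i : Fin n) :
    ∑ k, compens u δ i k = -∑ α, colW δ α i := by
  rw [← add_sum_erase _ _ (mem_univ i)]
  have : ∑ k ∈ univ.erase i, compens u δ i k =
      ∑ k ∈ univ.erase i, matX δ i k / (u (.x i) - u (.x k)) :=
    sum_congr rfl fun k hk => by rw [compens, of_apply, if_neg (ne_of_mem_erase hk).symm]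
  rw [this, compens, of_apply, if_pos rfl]
  ring

theorem sum_mulVec_ha (hu : u ∈ hreg n d q) (A : Mat n)
    (i : Fin n) : ∑ α, (A *ᵥ ha u α) i = ∑ k, A i k := by
  simp only [mulVec, dotProduct, ha]
  rw [sum_comm]
  refine sum_congr rfl fun k _ => ?_
  rw [← mul_sum, hu.2.2.1 k, mul_one]

theorem rho_tangent (hu : u ∈ hreg n d q) (δ : RVec n d) : IsHTangent (rho q u δ) := by
  intro i
  simp only [rho, sum_add_distrib]
  rw [sum_mulVec_ha hu, sum_compens, add_neg_cancel]

theorem compens_gaugeVec (hu : u ∈ hreg n d q) (η : Mat n) :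
    compens u (gaugeVec (sliceVec q u) η) = -η := by
  have hX : ∀ i j, i ≠ j → matX (gaugeVec (sliceVec q u) η) i j / (u (.x i) - u (.x j)) = -η i j := by
    intro i j hij
    have h : matX (gaugeVec (sliceVec q u) η) = η * diagonal (hx u) - diagonal (hx u) * η := rfl
    have h1 : u (.x i) - u (.x j) ≠ 0 := sub_ne_zero.2 (hu.2.1 i j hij).1
    rw [h, Matrix.sub_apply, mul_diagonal, diagonal_mul, div_eq_iff h1]
    simp only [hx]
    ring
  have hoff : ∀ i j, i ≠ j → compens u (gaugeVec (sliceVec q u) η) i j = -η i j := fun i j hij => by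
    rw [compens, of_apply, if_neg hij, hX i j hij]
  ext i j
  by_cases hij : i = j
  · subst hij
    have h1 := sum_compens u (gaugeVec (sliceVec q u) η) i
    have hW : ∀ α, colW (gaugeVec (sliceVec q u) η) α = η *ᵥ ha u α := fun α => rfl
    simp only [hW] at h1
    rw [sum_mulVec_ha hu, ← add_sum_erase _ _ (mem_univ i),
      ← add_sum_erase _ (fun k => η i k) (mem_univ i),
      sum_congr rfl fun k hk => hoff i k (ne_of_mem_erase hk).symm,
      sum_neg_distrib] at h1
    rw [Matrix.neg_apply]
    linear_combination h1
  · exact hoff i j hij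

/-- The projection is along the gauge orbits. -/
theorem rho_gaugeVec (hu : u ∈ hreg n d q) (η : Mat n) :
    rho q u (gaugeVec (sliceVec q u) η) = 0 := by
  have hW : ∀ α, colW (gaugeVec (sliceVec q u) η) α = η *ᵥ ha u α := fun α => rfl
  funext c
  cases c with
  | x i =>
    have h : matX (gaugeVec (sliceVec q u) η) = η * diagonal (hx u) - diagonal (hx u) * η := rfl
    simp only [rho, h, Matrix.sub_apply, mul_diagonal, diagonal_mul, Pi.zero_apply]
    ring
  | a i α => simp only [rho, compens_gaugeVec hu, hW, neg_mulVec, Pi.neg_apply, add_neg_cancel, Pi.zero_apply]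
  | b i α =>
    simp only [rho, compens_gaugeVec hu, dB_gaugeVec, rowB_slice hu, vecMul_neg, Pi.neg_apply, sub_self,
      Pi.zero_apply]

theorem compens_add_smul (u : HVec n d) (δ δ' : RVec n d) (c : ℂ) :
    compens u (δ + c • δ') = compens u δ + c • compens u δ' := by
  have hX : matX (δ + c • δ') = matX δ + c • matX δ' := rfl
  have hW : ∀ α, colW (δ + c • δ') α = colW δ α + c • colW δ' α := fun _ => rfl
  ext i j
  simp only [compens, of_apply, hX, hW, Matrix.add_apply, Matrix.smul_apply, Pi.add_apply, Pi.smul_apply,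
    smul_eq_mul]
  split_ifs
  · simp only [add_div, sum_add_distrib, mul_div_assoc, ← mul_sum]
    ring
  · ring

/-- The projection of tangent vectors, as a linear map. -/
def rhoL (q : ℂ) (u : HVec n d) : (RVec n d) →ₗ[ℂ] (HVec n d) :=
  have key : ∀ δ δ' (c : ℂ), rho q u (δ + c • δ') = rho q u δ + c • rho q u δ' := fun δ δ' c => by
    funext e
    cases e with
    | x i => rfl
    | a i α =>
      have hW : colW (δ + c • δ') α = colW δ α + c • colW δ' α := rfl
      simp only [rho, compens_add_smul, hW, add_mulVec, smul_mulVec, Pi.add_apply, Pi.smul_apply,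
        smul_eq_mul]
      ring
    | b i α =>
      simp only [rho, compens_add_smul, dB_add_smul, vecMul_add, vecMul_smul, Pi.add_apply, Pi.smul_apply,
        smul_eq_mul]
      ring
  { toFun := rho q u
    map_add' := fun δ δ' => by simpa using key δ δ' 1
    map_smul' := fun c δ => by
      have h0 : rho q u 0 = 0 := by
        have := key 0 0 1
        simpa using this
      have := key 0 δ c
      simpa [h0] using this }

theorem rhoL_apply (u : HVec n d) (δ : RVec n d) : rhoL q u δ = rho q u δ := rfl

end Slice

/-! ### The differential of the slice -/

section SliceDifferential

open Matrix

variable {n d : ℕ} {q : ℂ} {u : HVec n d} (hV : IsOpen (projSet n d q)) (hq1 : q ≠ 1)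

/-- The differential of the slice. -/
def ds (u : hreg n d q) (w : HVec n d) : RVec n d := fun c =>
  hdir hV u w (slicePull hq1 (coordFn _ c))

theorem hdir_slicePull (u : hreg n d q) (w : HVec n d) (F : RepRing n d) :
    hdir hV u w (slicePull hq1 F) = pair (gr F (lv (slicePt hq1 u))) (ds hV hq1 u w) := by
  have h1 := comapReg_tangent (fun u => lv (slicePt hq1 u)) (slice_mem (d := d) hq1)
    (hdir_tangent hV u w)
  have h2 := tangent_eq_dirAt (isOpen_repSpace n d) h1
  exact DFunLike.congr_fun h2 F

theorem hdir_slicePull_poly (u : hreg n d q) (w : HVec n d) (p : MvPolynomial (RSCoord n d) ℂ) :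
    dd (sliceVec q u.1) (ds hV hq1 u w) p = hdir hV u w (slicePull hq1 (polyFn _ p)) := by
  rw [hdir_slicePull]
  exact (dirAt_polyFn (isOpen_repSpace n d) (lv (slicePt hq1 u)) _ p).symm

theorem dLevel_ds (u : hreg n d q) (w : HVec n d) :
    dLevel q (sliceVec q u.1) (ds hV hq1 u w) = 0 := by
  rw [← ddM_polEq]
  ext i j
  change dd _ _ _ = 0
  rw [hdir_slicePull_poly]
  have : slicePull hq1 (polyFn (repSpace n d) (polEq n d q i j)) = 0 := by
    ext u
    rw [slicePull_apply, polyFn_apply]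
    have h1 := evM_polEq q (slicePt hq1 u).1
    rw [((mem_levelSet_iff q _).1 (slicePt hq1 u).2).2] at h1
    exact congrFun (congrFun h1 i) j
  rw [this, map_zero]

theorem matX_ds (u : hreg n d q) {w : HVec n d} (hw : IsHTangent w) :
    matX (ds hV hq1 u w) = diagonal (hx w) := by
  ext i j
  change hdir hV u w (slicePull hq1 (coordFn _ (.X i j))) = _
  by_cases h : i = j
  · subst h
    have : slicePull hq1 (coordFn (repSpace n d) (.X i i)) = coordFn _ (.x i) := by
      ext u; exact diagonal_apply_eq _ _
    rw [this, hdir_coordFn hV u hw, diagonal_apply_eq, hx]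
  · have : slicePull hq1 (coordFn (repSpace n d) (.X i j)) = 0 := by
      ext u; exact diagonal_apply_ne _ h
    rw [this, map_zero, diagonal_apply_ne _ h]

theorem colW_ds (u : hreg n d q) {w : HVec n d} (hw : IsHTangent w) (α : Fin d) :
    colW (ds hV hq1 u w) α = ha w α := by
  funext i
  exact hdir_coordFn hV u hw _

/-- The polynomials giving the entries of the row `V_α Z_α`. -/
def polB (n : ℕ) {d : ℕ} (α : Fin d) (i : Fin n) : MvPolynomial (RSCoord n d) ℂ :=
  ∑ j, MvPolynomial.X (.V α j) * (kprod (polMu n d) α * polZ n d) j i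

theorem eval_polB (y : RVec n d) (α : Fin d) (i : Fin n) :
    eval y (polB n α i) = rowB y α i := by
  have h : ∀ j, eval y ((kprod (polMu n d) α * polZ n d) j i) =
      (kprod (muN y) α * matZ y) j i := fun j => by
    rw [← evM_kprod, ← evM_polZ, ← evM_mul]; rfl
  simp only [polB, map_sum, map_mul, MvPolynomial.eval_X, h]
  rfl

theorem dd_polB (y δ : RVec n d) (α : Fin d) (i : Fin n) : dd y δ (polB n α i) = dB y δ α i := by
  have h : ∀ j, eval y ((kprod (polMu n d) α * polZ n d) j i) =
      (kprod (muN y) α * matZ y) j i := fun j => by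
    rw [← evM_kprod, ← evM_polZ, ← evM_mul]; rfl
  have h' : ∀ j, dd y δ ((kprod (polMu n d) α * polZ n d) j i) = dZk y δ α j i := fun j => by
    rw [dZk, ← ddM_kprod, ← evM_kprod, ← evM_polZ, ← ddM_polZ y δ, ← ddM_mul]; rfl
  simp only [polB, dd_sum, dd_mul, dd_X, h, h', MvPolynomial.eval_X, sum_add_distrib]
  rfl

theorem dB_ds (u : hreg n d q) {w : HVec n d} (hw : IsHTangent w) (α : Fin d) :
    dB (sliceVec q u.1) (ds hV hq1 u w) α = hb w α := by
  funext i
  rw [← dd_polB, hdir_slicePull_poly]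
  have : slicePull hq1 (polyFn (repSpace n d) (polB n α i)) = coordFn _ (.b i α) := by
    ext u
    rw [slicePull_apply, polyFn_apply, eval_polB]
    exact congrFun (rowB_slice u.2 α) i
  rw [this, hdir_coordFn hV u hw, hb]

/-- A tangent vector of the level set is the sum of a vector tangent to the slice and of a gauge
vector. -/
theorem ds_rho (u : hreg n d q) {δ : RVec n d} (hδ : dLevel q (sliceVec q u.1) δ = 0) :
    ds hV hq1 u (rho q u.1 δ) = δ + gaugeVec (sliceVec q u.1) (compens u.1 δ) := by
  have hw := rho_tangent u.2 (q := q) δ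
  set y := sliceVec q u.1 with hy
  set g := gaugeVec y (compens u.1 δ) with hg
  have hly : levelEq q y = 0 := ((mem_levelSet_iff q _).1 (slicePt hq1 u).2).2
  have e1 : δ + g = δ + (1 : ℂ) • g := by rw [one_smul]
  have hX : matX (δ + g + (-1 : ℂ) • ds hV hq1 u (rho q u.1 δ)) =
      matX δ + matX g - matX (ds hV hq1 u (rho q u.1 δ)) := by
    change matX δ + matX g + (-1 : ℂ) • matX (ds hV hq1 u (rho q u.1 δ)) = _
    rw [neg_one_smul, sub_eq_add_neg]
  have hW : ∀ α, colW (δ + g + (-1 : ℂ) • ds hV hq1 u (rho q u.1 δ)) α =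
      colW δ α + colW g α - colW (ds hV hq1 u (rho q u.1 δ)) α := fun α => by
    change colW δ α + colW g α + (-1 : ℂ) • colW (ds hV hq1 u (rho q u.1 δ)) α = _
    rw [neg_one_smul, sub_eq_add_neg]
  have h0 := eq_zero_of_coords hq1 u.2 (δ := δ + g + (-1 : ℂ) • ds hV hq1 u (rho q u.1 δ)) ?_ ?_ ?_ ?_
  · have : ds hV hq1 u (rho q u.1 δ) = δ + g - (δ + g + (-1 : ℂ) • ds hV hq1 u (rho q u.1 δ)) := by
      rw [neg_one_smul]; abel
    rw [this, h0, sub_zero]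
  · rw [dLevel_add_smul, dLevel_ds, e1, dLevel_add_smul, hδ, hg, dLevel_gaugeVec hly]
    simp
  · rw [hX, matX_ds hV hq1 u hw]
    have h1 : matX g = compens u.1 δ * diagonal (hx u.1) - diagonal (hx u.1) * compens u.1 δ := rfl
    ext i j
    rw [h1, Matrix.sub_apply, Matrix.add_apply, Matrix.sub_apply, mul_diagonal, diagonal_mul]
    by_cases hij : i = j
    · subst hij
      rw [diagonal_apply_eq]
      simp only [hx, rho, Matrix.zero_apply]
      ring
    · have h2 : u.1 (.x i) - u.1 (.x j) ≠ 0 := sub_ne_zero.2 (u.2.2.1 i j hij).1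
      rw [diagonal_apply_ne _ hij, compens, of_apply, if_neg hij, Matrix.zero_apply]
      simp only [hx]
      field_simp
      ring
  · intro α
    rw [hW, colW_ds hV hq1 u hw]
    funext i
    have h1 : colW g α = compens u.1 δ *ᵥ ha u.1 α := rfl
    rw [h1]
    simp only [ha, rho, Pi.sub_apply, Pi.add_apply, Pi.zero_apply, sub_self]
  · intro α
    rw [dB_add_smul, e1, dB_add_smul, one_smul, dB_ds hV hq1 u hw, hg, dB_gaugeVec, rowB_slice u.2]
    funext i
    simp only [hb, rho, Pi.add_apply, Pi.zero_apply, Pi.neg_apply, Pi.smul_apply, smul_eq_mul]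
    ring

/-! The adjoint of the projection of tangent vectors. -/

/-- The pullback of covectors along the projection of tangent vectors. -/
def rhoT (q : ℂ) (u : HVec n d) (h : HVec n d) : RVec n d := fun c => pair h (rho q u (dirVec c))

theorem eq_sum_dirVec {ι : Type} [Fintype ι] (δ : ι → ℂ) : δ = ∑ c, δ c • dirVec c := by
  classical
  funext e
  simp [dirVec, Pi.single_apply]

theorem pair_sum_right {ι κ : Type} [Fintype ι] (s : Finset κ) (ζ : ι → ℂ) (δ : κ → ι → ℂ) :
    pair ζ (∑ k ∈ s, δ k) = ∑ k ∈ s, pair ζ (δ k) := dotProduct_sum _ _ _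

theorem pair_rhoT (u h : HVec n d) (δ : RVec n d) : pair (rhoT q u h) δ = pair h (rho q u δ) := by
  conv_rhs => rw [eq_sum_dirVec δ, ← rhoL_apply, map_sum, pair_sum_right]
  rw [pair]
  refine sum_congr rfl fun c _ => ?_
  rw [map_smul, pair_smul_right, rhoT, mul_comm, rhoL_apply]

theorem isBasic_rhoT (hu : u ∈ hreg n d q) (h : HVec n d) :
    IsBasic (sliceVec q u) (rhoT q u h) := by
  rw [isBasic_iff]
  intro ξ
  rw [pair_rhoT, rho_gaugeVec hu]
  exact dotProduct_zero _

/-- The linear regular function with given differential. -/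
def linFn (φ : RVec n d) : RepRing n d := ∑ c, φ c • coordFn _ c

theorem gr_linFn (φ : RVec n d) (u : repSpace n d) : gr (linFn φ) u = φ := by
  funext e
  rw [← pair_dirVec (gr (linFn φ) u)]
  change dirAt (isOpen_repSpace n d) u (dirVec e) (linFn φ) = _
  rw [linFn, map_sum]
  have : ∀ c, dirAt (isOpen_repSpace n d) u (dirVec e) (φ c • coordFn _ c) = φ c * dirVec e c :=
    fun c => by
      rw [map_smul, smul_eq_mul]
      congr 1
      exact pair_gr_coordFn u c _
  simp only [this]
  exact pair_dirVec φ e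

theorem pair_hamVec_antisymm {y : RVec n d} (hy : y ∈ repSpace n d) {φ ζ : RVec n d}
    (hφ : IsBasic y φ) (hζ : IsBasic y ζ) : pair φ (hamVec y ζ) = -pair ζ (hamVec y φ) := by
  have h1 := quasiP_at ⟨y, hy⟩ (linFn φ) (linFn ζ) (by rw [gr_linFn]; exact hζ)
  have h2 := quasiP_at ⟨y, hy⟩ (linFn ζ) (linFn φ) (by rw [gr_linFn]; exact hφ)
  rw [gr_linFn, gr_linFn] at h1 h2
  rw [← h1, ← h2, quasiP_isBivector.antisymm]
  rfl

/-- The form on covectors of the local phase space which corresponds to the quasi-Poisson bracket. -/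
def omegaForm (q : ℂ) (u h h' : HVec n d) : ℂ :=
  pair h (rho q u (hamVec (sliceVec q u) (rhoT q u h')))

theorem omegaForm_antisymm (hq1 : q ≠ 1) (hu : u ∈ hreg n d q)
    (h h' : HVec n d) : omegaForm q u h h' = -omegaForm q u h' h := by
  rw [omegaForm, omegaForm, ← pair_rhoT, ← pair_rhoT]
  exact pair_hamVec_antisymm (sliceVec_mem hq1 hu).1 (isBasic_rhoT hu h) (isBasic_rhoT hu h')

variable {hV hq1}

/-- The differential of a lift, evaluated on vectors tangent to the level set. -/
theorem pair_gr_lift {F : RepRing n d} {f : RSRing n d q}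
    (hF : LiftRS F f) (u : hreg n d q) {δ : RVec n d}
    (hδ : dLevel q (sliceVec q u.1) δ = 0) : pair (gr F (lv (slicePt hq1 u))) δ =
      pair (hgrad hV (slicePull hq1 F) u) (rho q u.1 δ) := by
  have h1 := hdir_slicePull hV hq1 u (rho q u.1 δ) F
  rw [ds_rho hV hq1 u hδ, pair_add_right] at h1
  have h2 := (isBasic_iff _ _).1 (isBasic_of_lift hF (slicePt hq1 u)) (compens u.1 δ)
  have h2' : pair (gr F (lv (slicePt hq1 u))) (gaugeVec (sliceVec q u.1) (compens u.1 δ)) = 0 := h2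
  rw [h2', add_zero] at h1
  exact h1.symm

/-- The quasi-Poisson bracket of lifts, in terms of the local phase space. -/
theorem quasiP_slice {F G : RepRing n d} {f g : RSRing n d q} (hF : LiftRS F f)
    (hG : LiftRS G g) (u : hreg n d q) :
    (quasiP n d F G).1 (lv (slicePt hq1 u)) =
      omegaForm q u.1 (hgrad hV (slicePull hq1 F) u) (hgrad hV (slicePull hq1 G) u) := by
  have hy : sliceVec q u.1 ∈ levelSet n d q := sliceVec_mem hq1 u.2
  have hly : levelEq q (sliceVec q u.1) = 0 := ((mem_levelSet_iff q _).1 hy).2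
  have hbF : IsBasic (sliceVec q u.1) (gr F (lv (slicePt hq1 u))) := isBasic_of_lift hF (slicePt hq1 u)
  have hbG : IsBasic (sliceVec q u.1) (gr G (lv (slicePt hq1 u))) := isBasic_of_lift hG (slicePt hq1 u)
  have hbF' := isBasic_rhoT u.2 (hgrad hV (slicePull hq1 F) u)
  have h1 : (quasiP n d F G).1 (lv (slicePt hq1 u)) =
      pair (gr F (lv (slicePt hq1 u))) (hamVec (sliceVec q u.1) (gr G (lv (slicePt hq1 u)))) :=
    quasiP_at _ _ _ hbG
  rw [h1, pair_gr_lift (hV := hV) (hq1 := hq1) hF u (dLevel_hamVec hly hbG), ← pair_rhoT,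
    pair_hamVec_antisymm hy.1 hbF' hbG,
    pair_gr_lift (hV := hV) (hq1 := hq1) hG u (dLevel_hamVec hly hbF'),
    omegaForm_antisymm hq1 u.2, omegaForm]

theorem psiRep_slice (z : Param d) {F G : RepRing n d} {f g : RSRing n d q} (hF : LiftRS F f)
    (hG : LiftRS G g) (u : hreg n d q) :
    (psiRep n z F G).1 (lv (slicePt hq1 u)) = ∑ p : {p : Fin d × Fin d // p.1 < p.2},
      z p * (pair (hgrad hV (slicePull hq1 F) u) (rho q u.1 (scaleVec (sliceVec q u.1) p.1.1)) *
        pair (hgrad hV (slicePull hq1 G) u) (rho q u.1 (scaleVec (sliceVec q u.1) p.1.2)) -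
        pair (hgrad hV (slicePull hq1 G) u) (rho q u.1 (scaleVec (sliceVec q u.1) p.1.1)) *
        pair (hgrad hV (slicePull hq1 F) u) (rho q u.1 (scaleVec (sliceVec q u.1) p.1.2))) := by
  have hy : sliceVec q u.1 ∈ levelSet n d q := sliceVec_mem hq1 u.2
  have hs := fun α => dLevel_scaleVec q hy.1 α
  have h1 : (psiRep n z F G).1 (lv (slicePt hq1 u)) = ∑ p : {p : Fin d × Fin d // p.1 < p.2},
      z p * (pair (gr F (lv (slicePt hq1 u))) (scaleVec (sliceVec q u.1) p.1.1) *
        pair (gr G (lv (slicePt hq1 u))) (scaleVec (sliceVec q u.1) p.1.2) -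
        pair (gr G (lv (slicePt hq1 u))) (scaleVec (sliceVec q u.1) p.1.1) *
        pair (gr F (lv (slicePt hq1 u))) (scaleVec (sliceVec q u.1) p.1.2)) := psiRep_at z _ F G
  rw [h1]
  simp only [pair_gr_lift (hV := hV) (hq1 := hq1) hF u (hs _),
    pair_gr_lift (hV := hV) (hq1 := hq1) hG u (hs _)]

end SliceDifferential

/-! ### Hamiltonian vectors on the slice -/

section TailSums

variable {d : ℕ} {M : Type} [AddCommMonoid M]

/-- The sum of the terms of index at least `k`. -/
def tailSum (f : Fin d → M) (k : ℕ) : M := ∑ γ : Fin d with k ≤ γ.1, f γ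

theorem tailSum_eq (f : Fin d → M) (α : Fin d) : tailSum f α = f α + tailSum f (α + 1) := by
  have h : univ.filter (fun β : Fin d => α.1 ≤ β.1) =
      insert α (univ.filter fun β : Fin d => α.1 + 1 ≤ β.1) := by
    ext β
    simp only [mem_filter, mem_univ, true_and, mem_insert, Fin.ext_iff]
    omega
  rw [tailSum, h, sum_insert (by simp), tailSum]

theorem tailSum_last (f : Fin d → M) : tailSum f d = 0 := by
  rw [tailSum, Finset.filter_false_of_mem fun γ _ => not_le.2 γ.2, sum_empty]

theorem tailSum_zero (f : Fin d → M) : tailSum f 0 = ∑ γ, f γ := by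
  rw [tailSum, filter_true_of_mem fun γ _ => Nat.zero_le _]

theorem tailSum_induction {p : ℕ → Prop} (h0 : p d) (h : ∀ α : Fin d, p (α + 1) → p α) (k : ℕ)
    (hk : k ≤ d) : p k := by
  induction hk using Nat.decreasingInduction with
  | self => exact h0
  | of_succ k hk ih => exact h ⟨k, hk⟩ ih

end TailSums

section HamSlice

open Matrix

variable {n d : ℕ} {q : ℂ} {u : HVec n d}

/-- The derivative of `pair h (rho q u δ)` with respect to `compens u δ`. -/
def covL (u h : HVec n d) : Mat n :=
  ∑ α, (vecMulVec (ha u α) (ha h α) - vecMulVec (hb h α) (hb u α))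

/-- The component along `X` of the pullback of a covector to the slice coordinates. -/
def covX (u h : HVec n d) : Mat n := Matrix.of fun j i =>
  if i = j then h (.x i) else (covL u h j i - covL u h i i) / (u (.x i) - u (.x j))

/-- The component along `W_α` of the pullback of a covector to the slice coordinates. -/
def covW (u h : HVec n d) (α : Fin d) : Fin n → ℂ := fun i => h (.a i α) - covL u h i i

/-- The adjoint of `rho`, in the coordinates `X`, `W_α`, `V_α Z_α`. -/
theorem pair_rho (u h : HVec n d) (δ : RVec n d) : pair h (rho q u δ) =
    trace (covX u h * matX δ) + ∑ α, covW u h α ⬝ᵥ colW δ α +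
      ∑ α, hb h α ⬝ᵥ dB (sliceVec q u) δ α := by
  set C := compens u δ with hC
  have h1 : pair h (rho q u δ) = (∑ i, h (.x i) * matX δ i i) + ∑ α, ha h α ⬝ᵥ colW δ α +
      ∑ α, hb h α ⬝ᵥ dB (sliceVec q u) δ α + trace (C * covL u h) := by
    have e1 : ∀ α, trace (C * vecMulVec (ha u α) (ha h α)) = ha h α ⬝ᵥ (C *ᵥ ha u α) := fun α => by
      rw [mul_vecMulVec, trace_vecMulVec, dotProduct_comm]
    have e2 : ∀ α, trace (C * vecMulVec (hb h α) (hb u α)) = hb h α ⬝ᵥ (hb u α ᵥ* C) := fun α => by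
      rw [mul_vecMulVec, trace_vecMulVec, dotProduct_comm, dotProduct_mulVec, dotProduct_comm]
    rw [covL, mul_sum, trace_sum]
    simp only [mul_sub, trace_sub, e1, e2, sum_sub_distrib]
    rw [pair, sum_HCoord]
    have e3 : ∑ i, ∑ α, h (.a i α) * rho q u δ (.a i α) =
        ∑ α, ha h α ⬝ᵥ colW δ α + ∑ α, ha h α ⬝ᵥ (C *ᵥ ha u α) := by
      rw [sum_comm, ← sum_add_distrib]
      refine sum_congr rfl fun α _ => ?_
      rw [← dotProduct_add]; rfl
    have e4 : ∑ i, ∑ α, h (.b i α) * rho q u δ (.b i α) =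
        ∑ α, hb h α ⬝ᵥ dB (sliceVec q u) δ α - ∑ α, hb h α ⬝ᵥ (hb u α ᵥ* C) := by
      rw [sum_comm, ← sum_sub_distrib]
      refine sum_congr rfl fun α _ => ?_
      rw [← dotProduct_sub]; rfl
    rw [e3, e4]
    simp only [rho]
    ring
  have h2 : ∀ i, ∑ j, C i j * covL u h j i = -(∑ α, colW δ α i) * covL u h i i +
      ∑ j ∈ univ.erase i, covX u h j i * matX δ i j := by
    intro i
    have e1 : ∀ j ∈ univ.erase i, C i j * covL u h j i =
        C i j * covL u h i i + covX u h j i * matX δ i j := fun j hj => by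
      have hij : i ≠ j := (ne_of_mem_erase hj).symm
      rw [hC, compens, of_apply, if_neg hij, covX, of_apply, if_neg hij]
      ring
    rw [← add_sum_erase _ _ (mem_univ i), sum_congr rfl e1, sum_add_distrib,
      ← sum_mul, ← add_assoc, ← add_mul, add_sum_erase _ (fun j => C i j) (mem_univ i), sum_compens]
  have h3 : trace (C * covL u h) = ∑ i, ∑ j, C i j * covL u h j i := rfl
  have h4 : trace (covX u h * matX δ) = ∑ i, (h (.x i) * matX δ i i +
      ∑ j ∈ univ.erase i, covX u h j i * matX δ i j) := by
    rw [trace_mul_comm, trace]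
    refine sum_congr rfl fun i _ => ?_
    rw [diag_apply, mul_apply, ← add_sum_erase _ _ (mem_univ i)]
    congr 1
    · rw [covX, of_apply, if_pos rfl, mul_comm]
    · exact sum_congr rfl fun j _ => mul_comm _ _
  have h5 : ∑ α, covW u h α ⬝ᵥ colW δ α = ∑ α, ha h α ⬝ᵥ colW δ α -
      ∑ i, (∑ α, colW δ α i) * covL u h i i := by
    simp only [sum_mul]
    rw [sum_comm (γ := Fin n), ← sum_sub_distrib]
    refine sum_congr rfl fun α _ => ?_
    simp only [dotProduct, covW, ← sum_sub_distrib, ha]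
    exact sum_congr rfl fun i _ => by ring
  rw [h1, h3, h4, h5, sum_congr rfl fun i _ => h2 i, sum_add_distrib, sum_add_distrib]
  simp only [neg_mul, sum_neg_distrib]
  ring

/-- Partial sums of the matrices of the covector and the point in the `b`-directions. -/
def covT (u h : HVec n d) (k : ℕ) : Mat n := tailSum (fun γ => vecMulVec (hb h γ) (hb u γ)) k

/-- The component along `Z_k` of the pullback of a covector in the directions of the last `B_γ`. -/
def covN (q : ℂ) (u h : HVec n d) (k : ℕ) : Mat n := covT u h k * (locCalZ q u k)⁻¹

theorem covN_mul (hu : u ∈ hreg n d q) (h : HVec n d) (k : ℕ) (hk : k ≤ d) :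
    covN q u h k * locCalZ q u k = covT u h k := by
  rw [covN, mul_assoc, nonsing_inv_mul _ (hu.2.2.2 k hk).isUnit, mul_one]

/-- The component of the covector along `dB_α` in the recursion for `covN`. -/
def covP (q : ℂ) (u h : HVec n d) (α : Fin d) : Fin n → ℂ := hb h α + covN q u h (α + 1) *ᵥ ha u α

theorem covN_eq (hu : u ∈ hreg n d q) (h : HVec n d) (α : Fin d) :
    covN q u h α = covN q u h (α + 1) + vecMulVec (covP q u h α) (rowV (sliceVec q u) α) := by
  have hZ : IsUnit (locCalZ q u α) := (isUnit_iff_isUnit_det _).2 (hu.2.2.2 α α.2.le).isUnit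
  apply hZ.mul_right_cancel
  have h2 := covN_mul hu h (α + 1) α.2
  rw [locCalZ_succ q u α α.2, mul_add, mul_vecMulVec] at h2
  rw [covN_mul hu h α α.2.le, covT, tailSum_eq, ← covT, ← h2, add_mul, vecMulVec_mul,
    rowV_slice_mul hu, covP, add_vecMulVec]
  abel

theorem sum_hb_dB (hu : u ∈ hreg n d q) (h : HVec n d) (δ : RVec n d) (k : ℕ) (hk : k ≤ d) :
    tailSum (fun α => hb h α ⬝ᵥ dB (sliceVec q u) δ α) k =
      trace (covN q u h k * dZk (sliceVec q u) δ k) + tailSum (fun α =>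
        (locCalZ q u α *ᵥ covP q u h α) ⬝ᵥ rowV δ α +
          (hb u α ᵥ* covN q u h (α + 1)) ⬝ᵥ colW δ α) k := by
  revert k
  refine tailSum_induction ?_ fun α ih => ?_
  · simp [tailSum_last, covN, covT]
  · have e1 : dB (sliceVec q u) δ α = rowV δ α ᵥ* locCalZ q u α +
        rowV (sliceVec q u) α ᵥ* dZk (sliceVec q u) δ α := by
      rw [dB, kprod_slice_mul hu α α.2.le]
    have e2 : (locCalZ q u α *ᵥ covP q u h α) ⬝ᵥ rowV δ α =
        covP q u h α ⬝ᵥ (rowV δ α ᵥ* locCalZ q u α) := by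
      rw [dotProduct_comm, dotProduct_mulVec, dotProduct_comm]
    have e3 : covP q u h α ⬝ᵥ (rowV (sliceVec q u) α ᵥ* dZk (sliceVec q u) δ α) =
        trace (vecMulVec (covP q u h α) (rowV (sliceVec q u) α) * dZk (sliceVec q u) δ α) := by
      rw [vecMulVec_mul, trace_vecMulVec]
    have e4 : trace (covN q u h (α + 1) * vecMulVec (colW δ α) (hb u α)) =
        (hb u α ᵥ* covN q u h (α + 1)) ⬝ᵥ colW δ α := by
      rw [mul_vecMulVec, trace_vecMulVec, dotProduct_comm, dotProduct_mulVec]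
    have e5 : trace (covN q u h (α + 1) * vecMulVec (ha u α) (dB (sliceVec q u) δ α)) =
        (covN q u h (α + 1) *ᵥ ha u α) ⬝ᵥ dB (sliceVec q u) δ α := by
      rw [mul_vecMulVec, trace_vecMulVec]
    have e6 : hb h α ⬝ᵥ dB (sliceVec q u) δ α + (covN q u h (α + 1) *ᵥ ha u α) ⬝ᵥ
        dB (sliceVec q u) δ α = covP q u h α ⬝ᵥ dB (sliceVec q u) δ α := by
      rw [covP, add_dotProduct]
    rw [tailSum_eq, tailSum_eq, ih, dZk_succ, rowB_slice hu, colW_slice, mul_add, mul_add, trace_add,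
      trace_add, e4, e5, covN_eq hu h α, add_mul, trace_add, e2, ← e3]
    rw [e1, dotProduct_add, dotProduct_add, dotProduct_add] at e6
    rw [e1, dotProduct_add, dotProduct_add]
    linear_combination e6

/-- The adjoint of `rho` in the original coordinates; `covN` and `covP` undo the products `Z_α`. -/
theorem rhoT_eq (hu : u ∈ hreg n d q) (h : HVec n d) : rhoT q u h =
    mkVec (covX u h)ᵀ (covN q u h 0)ᵀ (fun α => locCalZ q u α *ᵥ covP q u h α)
      (fun α => covW u h α + hb u α ᵥ* covN q u h (α + 1)) := by
  funext c
  rw [← pair_dirVec (mkVec _ _ _ _) c, rhoT, pair_rho, ← tailSum_zero (fun α => hb h α ⬝ᵥ _),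
    sum_hb_dB hu h _ 0 (Nat.zero_le _), tailSum_zero, pair_RSCoord]
  generalize dirVec c = δ
  have h3 : dZk (sliceVec q u) δ 0 = matZ δ := by simp [dZk, dK, kprod]
  have hg : ∀ (A B : Mat n) v w, gradX (mkVec (d := d) Aᵀ Bᵀ v w) = A ∧ gradZ (mkVec Aᵀ Bᵀ v w) = B ∧
      rowV (mkVec Aᵀ Bᵀ v w) = v ∧ colW (mkVec Aᵀ Bᵀ v w) = w := fun _ _ _ _ => ⟨rfl, rfl, rfl, rfl⟩
  obtain ⟨g1, g2, g3, g4⟩ := hg (covX u h) (covN q u h 0) (fun α => locCalZ q u α *ᵥ covP q u h α)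
    fun α => covW u h α + hb u α ᵥ* covN q u h (α + 1)
  simp only [g1, g2, g3, g4, h3, sum_add_distrib, add_dotProduct]
  ring

theorem gradX_rhoT (hu : u ∈ hreg n d q) (h : HVec n d) :
    gradX (rhoT q u h) = covX u h := by rw [rhoT_eq hu]; rfl

theorem gradZ_rhoT (hu : u ∈ hreg n d q) (h : HVec n d) :
    gradZ (rhoT q u h) = covN q u h 0 := by rw [rhoT_eq hu]; rfl

theorem rowV_rhoT (hu : u ∈ hreg n d q) (h : HVec n d) (α : Fin d) :
    rowV (rhoT q u h) α = locCalZ q u α *ᵥ covP q u h α := by rw [rhoT_eq hu]; rfl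

theorem colW_rhoT (hu : u ∈ hreg n d q) (h : HVec n d) (α : Fin d) :
    colW (rhoT q u h) α = covW u h α + hb u α ᵥ* covN q u h (α + 1) := by rw [rhoT_eq hu]; rfl

/-- Partial sums of the matrices `a_γ ⊗ covW_γ`. -/
def covS (u h : HVec n d) (k : ℕ) : Mat n := tailSum (fun γ => vecMulVec (ha u γ) (covW u h γ)) k

theorem covT_zero_apply (u h : HVec n d) (i j : Fin n) :
    covT u h 0 i j = ∑ γ, h (.b i γ) * u (.b j γ) := by
  rw [covT, tailSum_zero, Matrix.sum_apply]; rfl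

theorem covL_apply (u h : HVec n d) (i j : Fin n) :
    covL u h i j = (∑ γ, u (.a i γ) * h (.a j γ)) - ∑ γ, h (.b i γ) * u (.b j γ) := by
  rw [covL, Matrix.sum_apply, ← sum_sub_distrib]; rfl

theorem covS_apply (u h : HVec n d) (k : ℕ) (i j : Fin n) :
    covS u h k i j = tailSum (fun γ => u (.a i γ) * covW u h γ j) k := by
  rw [covS, tailSum, Matrix.sum_apply]; rfl

theorem covS_zero_apply (hu : u ∈ hreg n d q) (h : HVec n d) (i j : Fin n) :
    covS u h 0 i j = (∑ γ, u (.a i γ) * h (.a j γ)) - covL u h j j := by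
  simp only [covS_apply, tailSum_zero, covW, mul_sub, sum_sub_distrib]
  rw [← sum_mul, hu.2.2.1 i, one_mul]

theorem momSum_three_slice (hu : u ∈ hreg n d q) (h : HVec n d) :
    momSum (sliceVec q u) (rhoT q u h) 3 = -covS u h 0 := by
  rw [momSum_three, gradX_rhoT hu, gradZ_rhoT hu, matX_slice, matZ_slice, covN_mul hu h 0 (Nat.zero_le _)]
  ext i j
  have h2 := covL_apply u h i j
  rw [Matrix.sub_apply, Matrix.sub_apply, Matrix.neg_apply, diagonal_mul, mul_diagonal, covT_zero_apply,
    covS_zero_apply hu]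
  by_cases hij : i = j
  · subst hij
    linear_combination -h2
  · have h5 : u (.x j) - u (.x i) ≠ 0 := sub_ne_zero.2 (hu.2.1 j i (Ne.symm hij)).1
    rw [covX, of_apply, if_neg (Ne.symm hij)]
    simp only [hx]
    field_simp
    linear_combination (u (.x i) - u (.x j)) * h2

/-- The partial moments as tail sums, since the total moment vanishes. -/
theorem momSum_slice (hu : u ∈ hreg n d q) (h : HVec n d) (k : ℕ) (hk : k ≤ d) :
    momSum (sliceVec q u) (rhoT q u h) (4 + k) = -covS u h k + locCalZ q u k * covN q u h k := by
  induction k with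
  | zero =>
    rw [add_zero, momSum, sum_range_succ, ← momSum, momSum_three_slice hu]
    simp only [actPt]
    rw [gradZ_rhoT hu, matZ_slice]
  | succ k ih =>
    set α : Fin d := ⟨k, hk⟩ with hα
    have e1 := ih (by omega)
    rw [← add_assoc, momSum, sum_range_succ, ← momSum, e1]
    have e2 := actPt_spin (sliceVec q u) (rhoT q u h) α
    have e3 : covS u h k = vecMulVec (ha u α) (covW u h α) + covS u h (k + 1) := tailSum_eq _ α
    have e4 : covN q u h k = covN q u h (k + 1) + vecMulVec (covP q u h α) (rowV (sliceVec q u) α) :=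
      covN_eq hu h α
    have e5 : locCalZ q u (k + 1) = locCalZ q u k + vecMulVec (ha u α) (hb u α) :=
      locCalZ_succ q u k hk
    have e6 : actPt (sliceVec q u) (rhoT q u h) (4 + k) = vecMulVec (ha u α) (covW u h α) +
        vecMulVec (ha u α) (hb u α) * covN q u h (k + 1) -
        locCalZ q u k * vecMulVec (covP q u h α) (rowV (sliceVec q u) α) := by
      rw [e2, colW_slice, colW_rhoT hu, rowV_rhoT hu, vecMulVec_add, vecMulVec_mul, mul_vecMulVec]
    rw [e6, e3, e4, e5]
    noncomm_ring

theorem trace_momSum_slice (hu : u ∈ hreg n d q) (h : HVec n d) (k : ℕ)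
    (hk : k ≤ d) : trace (momSum (sliceVec q u) (rhoT q u h) (4 + k)) =
      tailSum (fun γ => hb u γ ⬝ᵥ hb h γ) k - tailSum (fun γ => covW u h γ ⬝ᵥ ha u γ) k := by
  rw [momSum_slice hu h k hk, trace_add, trace_neg, trace_mul_comm (locCalZ q u k), covN_mul hu h k hk]
  simp only [covT, covS, tailSum, trace_sum, trace_vecMulVec]
  simp only [dotProduct_comm (hb h _), dotProduct_comm (ha u _)]
  ring

/-- The coefficient of the scaling of `W_α` in a Hamiltonian vector. -/
def covC (u h : HVec n d) (α : Fin d) : ℂ :=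
  tailSum (fun γ => hb u γ ⬝ᵥ hb h γ) (α + 1) - tailSum (fun γ => covW u h γ ⬝ᵥ ha u γ) α

theorem matX_hamVec_slice (hu : u ∈ hreg n d q) (h : HVec n d) :
    matX (hamVec (sliceVec q u) (rhoT q u h)) = diagonal (hx u) * covS u h 0 := by
  rw [matX_hamVec, momSum_three_slice hu, matX_slice, mul_neg, neg_neg]

theorem rowV_slice_dotProduct (hu : u ∈ hreg n d q) (h : HVec n d) (α : Fin d) :
    rowV (sliceVec q u) α ⬝ᵥ rowV (rhoT q u h) α =
      hb u α ⬝ᵥ hb h α + hb u α ⬝ᵥ (covN q u h (α + 1) *ᵥ ha u α) := by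
  rw [rowV_rhoT hu, dotProduct_mulVec, rowV_slice_mul hu, covP, dotProduct_add]

theorem colW_hamVec_slice (hu : u ∈ hreg n d q) (h : HVec n d) (α : Fin d) :
    colW (hamVec (sliceVec q u) (rhoT q u h)) α = -(covS u h (α + 1) *ᵥ ha u α) -
      locCalZ q u α *ᵥ hb h α + covC u h α • ha u α := by
  set ζ := rhoT q u h with hζ
  set y := sliceVec q u with hy
  have h2 : colW y α = ha u α := rfl
  have h3 : rowV ζ α = locCalZ q u α *ᵥ covP q u h α := rowV_rhoT hu h α
  have h4 : colW ζ α ⬝ᵥ ha u α = covW u h α ⬝ᵥ ha u α +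
      hb u α ⬝ᵥ (covN q u h (α + 1) *ᵥ ha u α) := by
    rw [hζ, colW_rhoT hu, add_dotProduct, dotProduct_mulVec]
  have h6 : momSum y ζ (4 + α) *ᵥ ha u α = -((covW u h α ⬝ᵥ ha u α) • ha u α) -
      covS u h (α + 1) *ᵥ ha u α + locCalZ q u α *ᵥ (covN q u h (α + 1) *ᵥ ha u α) +
      (rowV y α ⬝ᵥ ha u α) • (locCalZ q u α *ᵥ covP q u h α) := by
    rw [hy, hζ, momSum_slice hu h α α.2.le, covS, tailSum_eq, ← covS, covN_eq hu h α, add_mulVec,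
      neg_mulVec, add_mulVec, mul_add, add_mulVec, vecMulVec_mulVec, mul_vecMulVec, vecMulVec_mulVec,
      ← mulVec_mulVec, op_smul_eq_smul, op_smul_eq_smul]
    abel
  rw [colW_hamVec, h2, h4, rowV_slice_dotProduct hu, h6, h3, hy, hζ, trace_momSum_slice hu h α α.2.le, tailSum_eq, covC, covP, mulVec_add]
  module

theorem dZk_hamVec_slice (hu : u ∈ hreg n d q) (h : HVec n d) (k : ℕ)
    (hk : k ≤ d) : dZk (sliceVec q u) (hamVec (sliceVec q u) (rhoT q u h)) k =
      momSum (sliceVec q u) (rhoT q u h) (4 + k) * locCalZ q u k -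
        locCalZ q u k * diagonal (hx u) * covX u h := by
  set ζ := rhoT q u h with hζ
  set y := sliceVec q u with hy
  rw [dZk, dK_hamVec y ζ k hk, matZ_hamVec, momSum_four, momSum_three, momSum_two, ← kprod_slice_mul hu k hk,
    ← hy, ← gradX_rhoT hu h, ← hζ, ← matX_slice (q := q) u, ← hy]
  noncomm_ring

theorem dB_hamVec_slice (hu : u ∈ hreg n d q) (h : HVec n d) (α : Fin d) :
    dB (sliceVec q u) (hamVec (sliceVec q u) (rhoT q u h)) α = covW u h α ᵥ* locCalZ q u α +
      hb u α ᵥ* covT u h (α + 1) - covC u h α • hb u α -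
        (hb u α ᵥ* diagonal (hx u)) ᵥ* covX u h := by
  set ζ := rhoT q u h with hζ
  set y := sliceVec q u with hy
  have h2 : rowV y α ᵥ* locCalZ q u α = hb u α := rowV_slice_mul hu α
  have h6 : hb u α ᵥ* covN q u h (α + 1) ᵥ* locCalZ q u α = hb u α ᵥ* covT u h (α + 1) -
      (hb u α ⬝ᵥ (covN q u h (α + 1) *ᵥ ha u α)) • hb u α := by
    have e := covN_mul hu h (α + 1) α.2
    rw [locCalZ_succ q u α α.2, mul_add, mul_vecMulVec] at e
    rw [← e, vecMul_vecMul, vecMul_add, vecMul_vecMulVec]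
    abel
  have hK : kprod (muN y) α * matZ y = locCalZ q u α := kprod_slice_mul hu α α.2.le
  have hD : dZk y (hamVec y ζ) α = momSum y ζ (4 + α) * locCalZ q u α -
      locCalZ q u α * diagonal (hx u) * covX u h := dZk_hamVec_slice hu h α α.2.le
  rw [dB, hK, rowV_hamVec, hD, sub_vecMul,
    sub_vecMul, add_vecMul, smul_vecMul, smul_vecMul, h2, vecMul_sub, vecMul_vecMul _ (momSum y ζ (4 + α)),
    rowV_slice_dotProduct hu, hζ, colW_rhoT hu, add_vecMul, h6, hy, trace_momSum_slice hu h α α.2.le, tailSum_eq, covC, ← hy,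
    mul_assoc, ← vecMul_vecMul (rowV y α) (locCalZ q u α), h2,
    ← vecMul_vecMul (hb u α) (diagonal (hx u))]
  module

end HamSlice

/-! ### The Hamiltonian vectors of the coordinates of the local phase space -/

section PartialSums

variable {d : ℕ}

theorem tailSum_ite (f : Fin d → ℂ) (β : Fin d) (k : ℕ) :
    tailSum (fun γ => if γ = β then f γ else 0) k = if k ≤ β.1 then f β else 0 := by
  rw [tailSum, sum_ite_eq']
  simp

theorem tailSum_sub (f g : Fin d → ℂ) (k : ℕ) :
    tailSum (fun γ => f γ - g γ) k = tailSum f k - tailSum g k := sum_sub_distrib _ _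

theorem tailSum_mul (f : Fin d → ℂ) (c : ℂ) (k : ℕ) :
    tailSum (fun γ => f γ * c) k = tailSum f k * c := (sum_mul _ _ _).symm

theorem sum_ite_lt (f : Fin d → ℂ) (k : ℕ) :
    ∑ γ : Fin d, (if γ.1 < k then f γ else 0) = ∑ γ, f γ - tailSum f k := by
  rw [tailSum, ← sum_filter, eq_sub_iff_add_eq,
    ← Finset.sum_filter_add_sum_filter_not univ (fun γ : Fin d => γ.1 < k)]
  simp only [not_lt]

theorem sum_Iio (f : Fin d → ℂ) (β : Fin d) : ∑ γ ∈ Finset.Iio β, f γ = ∑ γ, f γ - tailSum f β := by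
  rw [← sum_ite_lt, ← sum_filter]
  refine sum_congr ?_ fun _ _ => rfl
  ext γ
  simp

theorem sum_o_mul (f : Fin d → ℂ) (α : Fin d) :
    ∑ γ, o α γ * f γ = 2 * tailSum f (α + 1) + f α - ∑ γ, f γ := by
  have h : ∀ γ, o α γ * f γ = (f γ - if γ.1 < α.1 + 1 then f γ else 0) - if γ.1 < α.1 then f γ else 0 := by
    intro γ
    rcases lt_trichotomy α γ with h | h | h
    · have h1 : ¬ γ.1 < α.1 + 1 := by have : α.1 < γ.1 := h; omega
      have h2 : ¬ γ.1 < α.1 := by have : α.1 < γ.1 := h; omega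
      simp [o, h, h1, h2]
    · subst h; simp [o]
    · have h1 : γ.1 < α.1 + 1 := by have : γ.1 < α.1 := h; omega
      have h2 : γ.1 < α.1 := h
      simp [o, h, not_lt_of_gt h, h1, h2]
  simp only [h, sum_sub_distrib, sum_ite_lt]
  rw [tailSum_eq f α]
  ring

/-- The double sum over all pairs splits according to the order of the indices. -/
theorem sum_tailSum_mul (f g : Fin d → ℂ) :
    ∑ γ : Fin d, tailSum f (γ + 1) * g γ = (∑ γ, f γ) * (∑ γ, g γ) - ∑ γ : Fin d, tailSum g γ * f γ := by
  have h : ∀ (γ : Fin d), tailSum f (γ + 1) = ∑ μ : Fin d, if γ.1 + 1 ≤ μ.1 then f μ else 0 := fun γ => by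
    rw [tailSum, sum_filter]
  have h' : ∀ (γ : Fin d), tailSum g γ = ∑ μ : Fin d, if γ.1 ≤ μ.1 then g μ else 0 := fun γ => by
    rw [tailSum, sum_filter]
  simp only [h, h', sum_mul]
  rw [sum_comm (γ := Fin d), ← sum_sub_distrib]
  refine sum_congr rfl fun μ _ => ?_
  rw [mul_sum, ← sum_sub_distrib]
  refine sum_congr rfl fun γ _ => ?_
  by_cases hc : γ.1 + 1 ≤ μ.1
  · rw [if_pos hc, if_neg (by omega)]; ring
  · rw [if_neg hc, if_pos (by omega)]; ring

end PartialSums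

section HamCoord

open Matrix

variable {n d : ℕ} {q : ℂ} {u : HVec n d}

/-- The vector of the local phase space which corresponds to a covector. -/
def hamH (q : ℂ) (u h : HVec n d) : HVec n d := rho q u (hamVec (sliceVec q u) (rhoT q u h))

theorem omegaForm_eq (u h h' : HVec n d) : omegaForm q u h h' = pair h (hamH q u h') := rfl

/-- The component along `W_α` of the Hamiltonian vector of a covector. -/
def hamW (q : ℂ) (u h : HVec n d) (α : Fin d) : Fin n → ℂ :=
  -(covS u h (α + 1) *ᵥ ha u α) - locCalZ q u α *ᵥ hb h α + covC u h α • ha u α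

/-- The off-diagonal part of the matrix of the infinitesimal transformation in `hamH`. -/
def hamXi (u h : HVec n d) (i k : Fin n) : ℂ :=
  if i = k then 0 else u (.x i) * covS u h 0 i k / (u (.x i) - u (.x k))

theorem compens_hamVec (hu : u ∈ hreg n d q) (h : HVec n d) (i k : Fin n) :
    compens u (hamVec (sliceVec q u) (rhoT q u h)) i k = hamXi u h i k -
      if i = k then ∑ α, hamW q u h α i + ∑ l, hamXi u h i l else 0 := by
  have h1 : ∀ i k, matX (hamVec (sliceVec q u) (rhoT q u h)) i k = u (.x i) * covS u h 0 i k :=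
    fun i k => by rw [matX_hamVec_slice hu, diagonal_mul]; rfl
  have h2 : ∀ α, colW (hamVec (sliceVec q u) (rhoT q u h)) α = hamW q u h α :=
    fun α => colW_hamVec_slice hu h α
  simp only [compens, of_apply, h1, h2]
  by_cases hik : i = k
  · subst hik
    rw [if_pos rfl, if_pos rfl, hamXi, if_pos rfl, ← add_sum_erase _ _ (mem_univ i), hamXi,
      if_pos rfl, zero_add, sum_congr (g := fun l => hamXi u h i l) rfl fun l hl => by
        rw [hamXi, if_neg (ne_of_mem_erase hl).symm]]
    ring
  · rw [if_neg hik, if_neg hik, hamXi, if_neg hik, sub_zero]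

theorem hamH_x (hu : u ∈ hreg n d q) (h : HVec n d) (i : Fin n) :
    hamH q u h (.x i) = u (.x i) * covS u h 0 i i := by
  rw [hamH, rho, matX_hamVec_slice hu, diagonal_mul]; rfl

theorem hamH_a (hu : u ∈ hreg n d q) (h : HVec n d) (i : Fin n) (α : Fin d) :
    hamH q u h (.a i α) = hamW q u h α i - u (.a i α) * ∑ γ, hamW q u h γ i +
      ∑ k, hamXi u h i k * (u (.a k α) - u (.a i α)) := by
  rw [hamH, rho, colW_hamVec_slice hu, ← hamW, mulVec, dotProduct]
  simp only [compens_hamVec hu, sub_mul, mul_sub, ite_mul, zero_mul, sum_sub_distrib,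
    sum_ite_eq, mem_univ, if_true, ha, add_mul, sum_mul]
  have : u (.a i α) * ∑ γ, hamW q u h γ i = ∑ γ, hamW q u h γ i * u (.a i α) := by
    rw [mul_comm, sum_mul]
  rw [this]
  ring

/-- The coefficients of `b_k^α` in the Hamiltonian vector of a covector in the direction `b_i^α`. -/
def hamKappa (u h : HVec n d) (k i : Fin n) : ℂ :=
  if i = k then u (.x i) * h (.x i) else u (.x k) * covT u h 0 k i / (u (.x k) - u (.x i))

theorem hamH_b (hu : u ∈ hreg n d q) (h : HVec n d) (i : Fin n) (α : Fin d) :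
    hamH q u h (.b i α) = (covW u h α ᵥ* locCalZ q u α) i + (hb u α ᵥ* covT u h (α + 1)) i -
      covC u h α * u (.b i α) + u (.b i α) * (∑ γ, hamW q u h γ i + ∑ k, hamXi u h i k) -
      ∑ k, u (.b k α) * hamKappa u h k i := by
  have h1 : ∀ k, u (.x k) * covX u h k i + hamXi u h k i = hamKappa u h k i := by
    intro k
    by_cases hik : i = k
    · subst hik
      rw [covX, of_apply, if_pos rfl, hamXi, if_pos rfl, hamKappa, if_pos rfl, add_zero]
    · have e4 : u (.x i) - u (.x k) ≠ 0 := sub_ne_zero.2 (hu.2.1 i k hik).1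
      have e5 : u (.x k) - u (.x i) ≠ 0 := sub_ne_zero.2 (hu.2.1 i k hik).1.symm
      rw [covX, of_apply, if_neg hik, hamXi, if_neg (Ne.symm hik), hamKappa, if_neg hik, covT_zero_apply,
        covS_zero_apply hu, covL_apply u h k i]
      field_simp
      ring
  rw [hamH, rho, dB_hamVec_slice hu]
  simp only [Pi.sub_apply, Pi.add_apply, Pi.smul_apply, smul_eq_mul]
  have h2 : (hb u α ᵥ* diagonal (hx u) ᵥ* covX u h) i = ∑ k, u (.b k α) * (u (.x k) * covX u h k i) := by
    rw [vecMul, dotProduct]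
    refine sum_congr rfl fun k _ => ?_
    rw [vecMul_diagonal]
    simp only [hb, hx]
    ring
  have h3 : (hb u α ᵥ* compens u (hamVec (sliceVec q u) (rhoT q u h))) i =
      ∑ k, u (.b k α) * hamXi u h k i - u (.b i α) * (∑ γ, hamW q u h γ i + ∑ k, hamXi u h i k) := by
    rw [vecMul, dotProduct]
    simp only [compens_hamVec hu, mul_sub, mul_ite, mul_zero, sum_sub_distrib,
      sum_ite_eq', mem_univ, if_true, hb]
  rw [h2, h3]
  simp only [← h1, mul_add, sum_add_distrib, hb]
  ring

theorem locCalZ_apply (u : HVec n d) (α : Fin d) (i j : Fin n) :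
    locCalZ q u α i j = locZ q u i j + ∑ γ ∈ Finset.Iio α, u (.a i γ) * u (.b j γ) := by
  rw [locCalZ, of_apply]
  congr 1
  refine sum_congr ?_ fun _ _ => rfl
  ext γ
  simp

/-! The coordinates `x_j`. -/

theorem dirVec_apply {ι : Type} [DecidableEq ι] (c e : ι) : dirVec c e = if e = c then (1 : ℂ) else 0 := by
  by_cases h : e = c
  · subst h; simp [dirVec]
  · simp [dirVec, h]

theorem ha_dirX (j : Fin n) (α : Fin d) : ha (dirVec (.x j)) α = 0 := by
  classical
  funext i; simp [ha, dirVec_apply]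

theorem hb_dirX (j : Fin n) (α : Fin d) : hb (dirVec (.x j)) α = 0 := by
  classical
  funext i; simp [hb, dirVec_apply]

theorem covL_dirX (u : HVec n d) (j : Fin n) : covL u (dirVec (.x j)) = 0 := by
  simp [covL, ha_dirX, hb_dirX]

theorem covW_dirX (u : HVec n d) (j : Fin n) (α : Fin d) : covW u (dirVec (.x j)) α = 0 := by
  funext i
  have := congrFun (ha_dirX (d := d) j α) i
  simp only [ha] at this
  simp [covW, covL_dirX, this]

theorem covS_dirX (u : HVec n d) (j : Fin n) (k : ℕ) : covS u (dirVec (.x j)) k = 0 := by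
  simp [covS, tailSum, covW_dirX]

theorem covT_dirX (u : HVec n d) (j : Fin n) (k : ℕ) : covT u (dirVec (.x j)) k = 0 := by
  simp [covT, tailSum, hb_dirX]

theorem covC_dirX (u : HVec n d) (j : Fin n) (α : Fin d) : covC u (dirVec (.x j)) α = 0 := by
  simp [covC, tailSum, hb_dirX, covW_dirX]

theorem hamW_dirX (u : HVec n d) (j : Fin n) (α : Fin d) : hamW q u (dirVec (.x j)) α = 0 := by
  simp [hamW, covS_dirX, hb_dirX, covC_dirX]

theorem hamXi_dirX (u : HVec n d) (j i k : Fin n) : hamXi u (dirVec (.x j)) i k = 0 := by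
  simp [hamXi, covS_dirX]

theorem hamH_dirX (hu : u ∈ hreg n d q) (j : Fin n) :
    (∀ i, hamH q u (dirVec (.x j)) (.x i) = 0) ∧ (∀ i α, hamH q u (dirVec (.x j)) (.a i α) = 0) ∧
      ∀ i α, hamH q u (dirVec (.x j)) (.b i α) = if j = i then -(u (.x j) * u (.b i α)) else 0 := by
  classical
  refine ⟨fun i => ?_, fun i α => ?_, fun i α => ?_⟩
  · rw [hamH_x hu, covS_dirX, Matrix.zero_apply, mul_zero]
  · rw [hamH_a hu]; simp [hamW_dirX, hamXi_dirX]
  · rw [hamH_b hu]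
    simp only [hamW_dirX, hamXi_dirX, covW_dirX, covT_dirX, covC_dirX, hamKappa, dirVec_apply]
    simp only [zero_vecMul, vecMul_zero, Pi.zero_apply, sum_const_zero, zero_mul, add_zero, mul_zero,
      sub_zero, zero_sub, Matrix.zero_apply, zero_div, HCoord.x.injEq, mul_ite, mul_one, sum_ite_eq,
      mem_univ, if_true]
    by_cases h : i = j
    · subst h; simp; ring
    · simp [h, Ne.symm h]

/-! The coordinates `a_j^β`. -/

/-- The partial sums of the `a_i^γ`. -/
def tailA (u : HVec n d) (i : Fin n) (k : ℕ) : ℂ := tailSum (fun γ => u (.a i γ)) k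

theorem tailA_eq (u : HVec n d) (i : Fin n) (α : Fin d) :
    tailA u i α = u (.a i α) + tailA u i (α + 1) := tailSum_eq _ α

theorem sum_o_tailA (hu : u ∈ hreg n d q) (α : Fin d) (i j : Fin n) (c c₁ c₂ : ℂ) :
    ∑ γ, o α γ * c * (c₁ * u (.a j γ) + c₂ * u (.a i γ)) =
      c * c₁ * (2 * tailA u j (α + 1) + u (.a j α) - 1) +
        c * c₂ * (2 * tailA u i (α + 1) + u (.a i α) - 1) := by
  have e1 := sum_o_mul (fun γ => u (.a i γ)) α
  have e2 := sum_o_mul (fun γ => u (.a j γ)) α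
  rw [hu.2.2.1] at e1 e2
  rw [tailA, tailA, ← e1, ← e2, mul_sum, mul_sum, ← sum_add_distrib]
  exact sum_congr rfl fun γ _ => by ring

theorem sum_Iio_tailA (hu : u ∈ hreg n d q) (i j : Fin n) (β : Fin d) :
    ∑ γ ∈ Finset.Iio β, u (.a i γ) * (u (.b j γ) - u (.b j β)) =
      (∑ γ ∈ Finset.Iio β, u (.a i γ) * u (.b j γ)) - (1 - tailA u i β) * u (.b j β) := by
  simp only [mul_sub, sum_sub_distrib]
  rw [← sum_mul, sum_Iio (fun γ => u (.a i γ)), hu.2.2.1, tailA]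

theorem ha_dirA (j : Fin n) (β α : Fin d) (i : Fin n) :
    dirVec (HCoord.a j β) (HCoord.a i α) = if i = j then (if α = β then (1 : ℂ) else 0) else 0 := by
  classical
  simp only [dirVec_apply, HCoord.a.injEq]
  split_ifs <;> tauto

theorem hb_dirA (j : Fin n) (β α : Fin d) : hb (dirVec (.a j β)) α = 0 := by
  classical
  funext i; simp [hb, dirVec_apply]

theorem covL_dirA (u : HVec n d) (j : Fin n) (β : Fin d) (k l : Fin n) :
    covL u (dirVec (.a j β)) k l = if l = j then u (.a k β) else 0 := by
  rw [covL, Matrix.sum_apply]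
  simp only [hb_dirA, zero_vecMulVec, sub_zero, vecMulVec_apply, ha, ha_dirA]
  split_ifs <;> simp

theorem covW_dirA (u : HVec n d) (j : Fin n) (β α : Fin d) (l : Fin n) :
    covW u (dirVec (.a j β)) α l = if l = j then ((if α = β then 1 else 0) - u (.a j β)) else 0 := by
  rw [covW, ha_dirA, covL_dirA]
  split_ifs <;> simp_all

theorem covS_dirA (u : HVec n d) (j : Fin n) (β : Fin d) (k : ℕ) (i l : Fin n) :
    covS u (dirVec (.a j β)) k i l = if l = j then
      ((if k ≤ β.1 then u (.a i β) else 0) - u (.a j β) * tailA u i k) else 0 := by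
  simp only [covS_apply, covW_dirA]
  split_ifs with h1 h2
  · simp only [mul_sub, mul_ite, mul_one, mul_zero]
    rw [tailSum_sub, tailSum_ite, tailSum_mul, if_pos h2, tailA, mul_comm (tailSum _ _)]
  · simp only [mul_sub, mul_ite, mul_one, mul_zero]
    rw [tailSum_sub, tailSum_ite, tailSum_mul, if_neg ‹_›, tailA, mul_comm (tailSum _ _)]
  · simp [tailSum]

theorem covT_dirA (u : HVec n d) (j : Fin n) (β : Fin d) (k : ℕ) :
    covT u (dirVec (.a j β)) k = 0 := by
  simp [covT, tailSum, hb_dirA]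

theorem covC_dirA (u : HVec n d) (j : Fin n) (β α : Fin d) : covC u (dirVec (.a j β)) α =
    u (.a j β) * tailA u j α - if α.1 ≤ β.1 then u (.a j β) else 0 := by
  have h1 : ∀ γ, covW u (dirVec (.a j β)) γ ⬝ᵥ ha u γ =
      (if γ = β then u (.a j γ) else 0) - u (.a j γ) * u (.a j β) := fun γ => by
    simp only [dotProduct, covW_dirA, ite_mul, zero_mul, sum_ite_eq', mem_univ, if_true, ha,
      sub_mul, one_mul]
    ring
  simp only [covC, h1, hb_dirA, dotProduct_zero, tailSum_sub, tailSum_mul, tailSum_ite, tailA]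
  simp only [tailSum, sum_const_zero]
  ring

theorem hamW_dirA (u : HVec n d) (j : Fin n) (β α : Fin d) (i : Fin n) :
    hamW q u (dirVec (.a j β)) α i =
      -(((if α.1 + 1 ≤ β.1 then u (.a i β) else 0) - u (.a j β) * tailA u i (α + 1)) * u (.a j α)) +
      (u (.a j β) * tailA u j α - if α.1 ≤ β.1 then u (.a j β) else 0) * u (.a i α) := by
  rw [hamW, hb_dirA, mulVec_zero, sub_zero, covC_dirA]
  simp only [Pi.add_apply, Pi.neg_apply, Pi.smul_apply, smul_eq_mul, mulVec, dotProduct, covS_dirA, ite_mul,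
    zero_mul, sum_ite_eq', mem_univ, if_true, ha]

theorem sum_hamW_dirA (hu : u ∈ hreg n d q) (j : Fin n) (β : Fin d) (i : Fin n) :
    ∑ α, hamW q u (dirVec (.a j β)) α i =
      -(u (.a i β) * (1 - tailA u j β)) + u (.a j β) * tailA u i (β + 1) := by
  have h1 := sum_tailSum_mul (fun γ => u (.a i γ)) (fun γ => u (.a j γ))
  rw [hu.2.2.1, hu.2.2.1] at h1
  have h2 := sum_ite_lt (fun γ => u (.a j γ)) β
  have h3 := sum_ite_lt (fun γ => u (.a i γ)) (β + 1)
  rw [hu.2.2.1] at h2 h3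
  have e : ∀ α : Fin d, hamW q u (dirVec (.a j β)) α i =
      -(u (.a i β) * if α.1 < β.1 then u (.a j α) else 0) +
        u (.a j β) * (tailA u i (α + 1) * u (.a j α)) + u (.a j β) * (tailA u j α * u (.a i α)) -
        u (.a j β) * if α.1 < β.1 + 1 then u (.a i α) else 0 := fun α => by
    rw [hamW_dirA]
    simp only [Nat.lt_succ_iff, Nat.succ_le_iff]
    split_ifs <;> ring
  simp only [e, sum_sub_distrib, sum_add_distrib, sum_neg_distrib, ← mul_sum, tailA]
  rw [h2, h3]
  linear_combination u (.a j β) * h1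

theorem half_cotTerm (hu : u ∈ hreg n d q) {i j : Fin n} (h : i ≠ j) :
    u (.x i) / (u (.x i) - u (.x j)) = cotTerm u i j + 1 / 2 ∧
      u (.x j) / (u (.x i) - u (.x j)) = cotTerm u i j - 1 / 2 := by
  have e : u (.x i) - u (.x j) ≠ 0 := sub_ne_zero.2 (hu.2.1 i j h).1
  rw [cotTerm, if_neg h]
  constructor <;> field_simp <;> ring

theorem cotTerm_symm (u : HVec n d) (i j : Fin n) : cotTerm u j i = -cotTerm u i j := by
  rw [cotTerm, cotTerm]
  by_cases h : i = j
  · simp [h]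
  · rw [if_neg h, if_neg (Ne.symm h), ← neg_sub (u (.x i)), div_neg]
    ring

theorem hamXi_dirA (hu : u ∈ hreg n d q) (j : Fin n) (β : Fin d) (i k : Fin n) :
    hamXi u (dirVec (.a j β)) i k = if k = j then (cotTerm u i j + 1 / 2) * (u (.a i β) - u (.a j β)) else 0 := by
  rw [hamXi, covS_dirA, tailA, tailSum_zero, hu.2.2.1, if_pos (Nat.zero_le _)]
  by_cases hk : k = j
  · subst hk
    by_cases hi : i = k
    · subst hi; simp
    · rw [if_neg hi, if_pos rfl, if_pos rfl, ← (half_cotTerm hu hi).1]; ring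
  · simp [hk]

theorem hamH_dirA_a (hu : u ∈ hreg n d q) (i j : Fin n) (α β : Fin d) :
    hamH q u (dirVec (.a j β)) (.a i α) =
    cotTerm u i j * (u (.a i α) * u (.a j β) + u (.a j α) * u (.a i β)
      - u (.a j α) * u (.a j β) - u (.a i α) * u (.a i β))
    + 1 / 2 * o β α * (u (.a i α) * u (.a j β) + u (.a j α) * u (.a i β))
    + 1 / 2 * ∑ γ, o α γ * u (.a j β) * (u (.a i α) * u (.a j γ) + u (.a j α) * u (.a i γ))
    - 1 / 2 * ∑ γ, o β γ * u (.a i α) * (u (.a j β) * u (.a i γ) + u (.a i β) * u (.a j γ)) := by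
  have hx : ∑ k, hamXi u (dirVec (.a j β)) i k * (u (.a k α) - u (.a i α)) =
      (cotTerm u i j + 1 / 2) * (u (.a i β) - u (.a j β)) * (u (.a j α) - u (.a i α)) := by
    simp only [hamXi_dirA hu, ite_mul, zero_mul, sum_ite_eq', mem_univ, if_true]
  rw [hamH_a hu, sum_hamW_dirA hu, hamW_dirA, hx, sum_o_tailA hu,
    sum_o_tailA hu, tailA_eq u j α, tailA_eq u j β, o]
  rcases lt_trichotomy α β with h | h | h
  · have h2 : α.1 + 1 ≤ β.1 := h
    have h3 : α.1 ≤ β.1 := by omega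
    rw [if_pos h2, if_pos h3, if_neg (not_lt_of_gt h), if_pos h]
    ring
  · subst h
    simp
    ring
  · have h2 : ¬ α.1 + 1 ≤ β.1 := by have : β.1 < α.1 := h; omega
    have h3 : ¬ α.1 ≤ β.1 := by have : β.1 < α.1 := h; omega
    rw [if_neg h2, if_neg h3, if_pos h]
    ring

theorem hamH_dirA_b (hu : u ∈ hreg n d q) (i j : Fin n) (α β : Fin d) :
    hamH q u (dirVec (.a i α)) (.b j β) = -(
    u (.a i α) * locZ q u i j
    - (if α = β then locZ q u i j else 0)
    - cotTerm u i j * (u (.a i α) - u (.a j α)) * u (.b j β)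
    + (if α < β then u (.a i α) * u (.b j β) else 0)
    + u (.a i α) * ∑ γ ∈ Finset.Iio β, u (.a i γ) * (u (.b j γ) - u (.b j β))
    - (if α = β then ∑ γ ∈ Finset.Iio β, u (.a i γ) * u (.b j γ) else 0)
    - 1 / 2 * ∑ γ, o α γ * u (.b j β) * (u (.a i α) * u (.a j γ) + u (.a j α) * u (.a i γ))) := by
  classical
  have hx : ∑ k, hamXi u (dirVec (.a i α)) j k =
      (cotTerm u j i + 1 / 2) * (u (.a j α) - u (.a i α)) := by
    simp only [hamXi_dirA hu, sum_ite_eq', mem_univ, if_true]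
  have hk : ∀ k, hamKappa u (dirVec (.a i α)) k j = 0 := fun k => by
    simp [hamKappa, covT_dirA, dirVec_apply]
  have hw : (covW u (dirVec (.a i α)) β ᵥ* locCalZ q u β) j =
      ((if α = β then 1 else 0) - u (.a i α)) * locCalZ q u β i j := by
    simp only [vecMul, dotProduct, covW_dirA, ite_mul, zero_mul, sum_ite_eq', mem_univ, if_true,
      eq_comm (a := β)]
  rw [hamH_b hu, hw, covT_dirA, vecMul_zero, covC_dirA, sum_hamW_dirA hu, hx, sum_o_tailA hu,
    sum_Iio_tailA hu, locCalZ_apply,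
    cotTerm_symm u i j]
  simp only [hk, mul_zero, sum_const_zero, Pi.zero_apply]
  rw [tailA_eq u i α]
  rcases lt_trichotomy α β with h | h | h
  · have h3 : ¬ β.1 ≤ α.1 := by have : α.1 < β.1 := h; omega
    rw [if_neg h3, if_neg h.ne, if_neg h.ne, if_neg h.ne, if_pos h]
    ring
  · subst h
    simp only [le_refl, if_true, lt_irrefl, if_false]
    rw [tailA_eq u i α]
    ring
  · have h3 : β.1 ≤ α.1 := by have : β.1 < α.1 := h; omega
    rw [if_pos h3, if_neg h.ne', if_neg h.ne', if_neg h.ne', if_neg (not_lt_of_gt h)]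
    ring

theorem hamH_dirA_x (hu : u ∈ hreg n d q) (i j : Fin n) (α : Fin d) :
    hamH q u (dirVec (.a i α)) (.x j) = 0 := by
  rw [hamH_x hu, covS_dirA, tailA, tailSum_zero, hu.2.2.1, if_pos (Nat.zero_le _)]
  split_ifs with h
  · subst h; ring
  · ring

/-! The coordinates `b_j^β`. -/

theorem hb_dirB (j : Fin n) (β α : Fin d) (i : Fin n) :
    dirVec (HCoord.b j β) (HCoord.b i α) = if i = j then (if α = β then (1 : ℂ) else 0) else 0 := by
  classical
  simp only [dirVec_apply, HCoord.b.injEq]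
  split_ifs <;> tauto

theorem ha_dirB (j : Fin n) (β α : Fin d) : ha (dirVec (.b j β)) α = 0 := by
  classical
  funext i; simp [ha, dirVec_apply]

theorem covL_dirB (u : HVec n d) (j : Fin n) (β : Fin d) (k l : Fin n) :
    covL u (dirVec (.b j β)) k l = if k = j then -u (.b l β) else 0 := by
  rw [covL, Matrix.sum_apply]
  simp only [ha_dirB, vecMulVec_zero, zero_sub, Matrix.neg_apply, vecMulVec_apply, hb, hb_dirB]
  split_ifs <;> simp

theorem covW_dirB (u : HVec n d) (j : Fin n) (β α : Fin d) (l : Fin n) :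
    covW u (dirVec (.b j β)) α l = if l = j then u (.b j β) else 0 := by
  have h := congrFun (ha_dirB j β α) l
  simp only [ha, Pi.zero_apply] at h
  rw [covW, h, covL_dirB]
  split_ifs <;> simp_all

theorem covS_dirB (u : HVec n d) (j : Fin n) (β : Fin d) (k : ℕ) (i l : Fin n) :
    covS u (dirVec (.b j β)) k i l = if l = j then tailA u i k * u (.b j β) else 0 := by
  simp only [covS_apply, covW_dirB]
  rw [tailSum_mul, tailA]
  split_ifs <;> simp

theorem covT_dirB (u : HVec n d) (j : Fin n) (β : Fin d) (k : ℕ) (i l : Fin n) :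
    covT u (dirVec (.b j β)) k i l = if i = j then (if k ≤ β.1 then u (.b l β) else 0) else 0 := by
  have : covT u (dirVec (.b j β)) k i l =
      tailSum (fun γ => dirVec (HCoord.b j β) (HCoord.b i γ) * u (.b l γ)) k := by
    rw [covT, tailSum, Matrix.sum_apply]; rfl
  rw [this]
  simp only [hb_dirB]
  by_cases h : i = j
  · simp only [h, if_true, ite_mul, one_mul, zero_mul]
    rw [tailSum_ite]
  · simp [h, tailSum]

theorem covC_dirB (u : HVec n d) (j : Fin n) (β α : Fin d) : covC u (dirVec (.b j β)) α =
    (if α.1 + 1 ≤ β.1 then u (.b j β) else 0) - tailA u j α * u (.b j β) := by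
  have h1 : ∀ γ, covW u (dirVec (.b j β)) γ ⬝ᵥ ha u γ = u (.a j γ) * u (.b j β) := fun γ => by
    simp only [dotProduct, covW_dirB, ite_mul, zero_mul, sum_ite_eq', mem_univ, if_true, ha]
    ring
  have h2 : ∀ γ, hb u γ ⬝ᵥ hb (dirVec (.b j β)) γ = if γ = β then u (.b j γ) else 0 := fun γ => by
    simp only [dotProduct, hb, hb_dirB, mul_ite, mul_zero, sum_ite_eq', mem_univ, if_true, mul_one]
  simp only [covC, h1, h2, tailSum_mul, tailSum_ite, tailA]

theorem hamW_dirB (u : HVec n d) (j : Fin n) (β α : Fin d) (i : Fin n) :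
    hamW q u (dirVec (.b j β)) α i =
      -(tailA u i (α + 1) * u (.b j β) * u (.a j α)) - (if α = β then locCalZ q u α i j else 0) +
      ((if α.1 + 1 ≤ β.1 then u (.b j β) else 0) - tailA u j α * u (.b j β)) * u (.a i α) := by
  rw [hamW, covC_dirB]
  simp only [Pi.add_apply, Pi.sub_apply, Pi.neg_apply, Pi.smul_apply, smul_eq_mul, mulVec, dotProduct, covS_dirB, ite_mul,
    zero_mul, sum_ite_eq', mem_univ, if_true, ha, hb, hb_dirB, mul_ite, mul_zero, mul_one]

theorem sum_hamW_dirB (hu : u ∈ hreg n d q) (j : Fin n) (β : Fin d) (i : Fin n) :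
    ∑ α, hamW q u (dirVec (.b j β)) α i = -locCalZ q u β i j - u (.b j β) * tailA u i β := by
  have h1 := sum_tailSum_mul (fun γ => u (.a i γ)) (fun γ => u (.a j γ))
  rw [hu.2.2.1, hu.2.2.1] at h1
  have h2 := sum_ite_lt (fun γ => u (.a i γ)) β
  rw [hu.2.2.1] at h2
  have e : ∀ α : Fin d, hamW q u (dirVec (.b j β)) α i =
      -(u (.b j β) * (tailA u i (α + 1) * u (.a j α))) - (if α = β then locCalZ q u α i j else 0) +
        u (.b j β) * (if α.1 < β.1 then u (.a i α) else 0) - u (.b j β) * (tailA u j α * u (.a i α)) :=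
    fun α => by
      rw [hamW_dirB]
      simp only [Nat.succ_le_iff]
      split_ifs <;> ring
  simp only [e, sum_sub_distrib, sum_add_distrib, sum_neg_distrib, ← mul_sum,
    tailA, sum_ite_eq', mem_univ, if_true]
  rw [h2]
  linear_combination -u (.b j β) * h1

theorem hamXi_dirB (hu : u ∈ hreg n d q) (j : Fin n) (β : Fin d) (i k : Fin n) :
    hamXi u (dirVec (.b j β)) i k = if k = j then
      (if i = j then 0 else (cotTerm u i j + 1 / 2) * u (.b j β)) else 0 := by
  rw [hamXi, covS_dirB, tailA, tailSum_zero, hu.2.2.1]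
  by_cases hk : k = j
  · subst hk
    by_cases hi : i = k
    · subst hi; simp
    · rw [if_neg hi, if_pos rfl, if_pos rfl, if_neg hi, ← (half_cotTerm hu hi).1]; ring
  · simp [hk]

theorem hamKappa_dirB (hu : u ∈ hreg n d q) (j : Fin n) (β : Fin d) (k i : Fin n) :
    hamKappa u (dirVec (.b j β)) k i = if k = j then
      (if i = j then 0 else -((cotTerm u i j - 1 / 2) * u (.b i β))) else 0 := by
  classical
  rw [hamKappa, covT_dirB, if_pos (Nat.zero_le _)]
  by_cases hk : k = j
  · subst hk
    by_cases hi : i = k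
    · subst hi; simp [dirVec_apply]
    · rw [if_neg hi, if_pos rfl, if_pos rfl, if_neg hi, ← (half_cotTerm hu hi).2, ← neg_sub (u (.x i)),
        div_neg]
      ring
  · simp [hk, dirVec_apply]

theorem hamH_dirB_b (hu : u ∈ hreg n d q) (i j : Fin n) (α β : Fin d) :
    hamH q u (dirVec (.b j β)) (.b i α) =
    cotTerm u i j * (u (.b i α) * u (.b j β) + u (.b j α) * u (.b i β))
    - u (.b i α) * locZ q u i j + u (.b j β) * locZ q u j i
    + 1 / 2 * o β α * (u (.b i α) * u (.b j β) - u (.b j α) * u (.b i β))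
    - u (.b i α) * ∑ γ ∈ Finset.Iio β, u (.a i γ) * (u (.b j γ) - u (.b j β))
    + u (.b j β) * ∑ γ ∈ Finset.Iio α, u (.a j γ) * (u (.b i γ) - u (.b i α)) := by
  have hw : (covW u (dirVec (.b j β)) α ᵥ* locCalZ q u α) i = u (.b j β) * locCalZ q u α j i := by
    simp only [vecMul, dotProduct, covW_dirB, ite_mul, zero_mul, sum_ite_eq', mem_univ, if_true]
  have ht : (hb u α ᵥ* covT u (dirVec (.b j β)) (α + 1)) i =
      u (.b j α) * if α.1 + 1 ≤ β.1 then u (.b i β) else 0 := by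
    simp only [vecMul, dotProduct, covT_dirB, mul_ite, mul_zero, sum_ite_eq', mem_univ, if_true, hb]
  have hx : u (.b i α) * ∑ k, hamXi u (dirVec (.b j β)) i k -
      ∑ k, u (.b k α) * hamKappa u (dirVec (.b j β)) k i =
      (cotTerm u i j + 1 / 2) * (u (.b i α) * u (.b j β)) +
        (cotTerm u i j - 1 / 2) * (u (.b j α) * u (.b i β)) := by
    simp only [hamXi_dirB hu, hamKappa_dirB hu, mul_ite, mul_zero, sum_ite_eq', mem_univ, if_true]
    by_cases h : i = j
    · subst h; simp [cotTerm]
    · simp only [h, if_false]; ring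
  rw [hamH_b hu, hw, ht, covC_dirB, sum_hamW_dirB hu, sum_Iio_tailA hu,
    sum_Iio_tailA hu, mul_add, locCalZ_apply, locCalZ_apply, o]
  rcases lt_trichotomy α β with h | h | h
  · have h2 : α.1 + 1 ≤ β.1 := h
    rw [if_pos h2, if_pos h2, if_neg (not_lt_of_gt h), if_pos h]
    linear_combination hx
  · subst h
    simp only [lt_irrefl, if_false]
    rw [if_neg (by omega), if_neg (by omega)]
    linear_combination hx
  · have h2 : ¬ α.1 + 1 ≤ β.1 := by have : β.1 < α.1 := h; omega
    rw [if_neg h2, if_neg h2, if_pos h]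
    linear_combination hx

end HamCoord

/-! ### The brackets on the local phase space -/

section LocalBrackets

open Matrix

variable {n d : ℕ} {q : ℂ} {u : HVec n d}

/-! Regularity of explicit functions. -/

theorem reg_add {f g : hreg n d q → ℂ} (hf : f ∈ HRing n d q) (hg : g ∈ HRing n d q) :
    (fun u => f u + g u) ∈ HRing n d q := (HRing n d q).add_mem hf hg

theorem reg_sub {f g : hreg n d q → ℂ} (hf : f ∈ HRing n d q) (hg : g ∈ HRing n d q) :
    (fun u => f u - g u) ∈ HRing n d q := (HRing n d q).sub_mem hf hg

theorem reg_neg {f : hreg n d q → ℂ} (hf : f ∈ HRing n d q) :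
    (fun u => -f u) ∈ HRing n d q := (HRing n d q).neg_mem hf

theorem reg_mul {f g : hreg n d q → ℂ} (hf : f ∈ HRing n d q) (hg : g ∈ HRing n d q) :
    (fun u => f u * g u) ∈ HRing n d q := (HRing n d q).mul_mem hf hg

theorem reg_const (c : ℂ) : (fun _ : hreg n d q => c) ∈ HRing n d q := (HRing n d q).algebraMap_mem c

theorem reg_ite (p : Prop) [Decidable p] {f g : hreg n d q → ℂ} (hf : f ∈ HRing n d q)
    (hg : g ∈ HRing n d q) : (fun u => if p then f u else g u) ∈ HRing n d q := by
  by_cases h : p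
  · simp only [if_pos h]; exact hf
  · simp only [if_neg h]; exact hg

theorem cotTerm_mem (i j : Fin n) : (fun u : hreg n d q => cotTerm u.1 i j) ∈ HRing n d q := by
  by_cases h : i = j
  · simp only [cotTerm, if_pos h]; exact reg_const 0
  · simp only [cotTerm, if_neg h, div_eq_mul_inv]
    exact reg_mul (reg_const _) (reg_mul (reg_add (hcoord_mem _) (hcoord_mem _))
      (Reg.inv_mem (reg_sub (hcoord_mem _) (hcoord_mem _)) fun u => sub_ne_zero.2 (u.2.2.1 i j h).1))

/-- To check a symmetric statement on pairs of local coordinates, it suffices to consider the pairs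
in the order `x`, `a`, `b`. -/
theorem coord_pairs {p : HCoord n d → HCoord n d → Prop} (symm : ∀ c e, p c e → p e c)
    (xx : ∀ i j, p (.x i) (.x j)) (xa : ∀ i j β, p (.x i) (.a j β)) (xb : ∀ i j β, p (.x i) (.b j β))
    (aa : ∀ i j α β, p (.a i α) (.a j β)) (ab : ∀ i j α β, p (.a i α) (.b j β))
    (bb : ∀ i j α β, p (.b i α) (.b j β)) : ∀ c e, p c e
  | .x i, .x j => xx i j
  | .x i, .a j β => xa i j β
  | .x i, .b j β => xb i j β
  | .a i α, .x j => symm _ _ (xa j i α)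
  | .a i α, .a j β => aa i j α β
  | .a i α, .b j β => ab i j α β
  | .b i α, .x j => symm _ _ (xb j i α)
  | .b i α, .a j β => symm _ _ (ab j i β α)
  | .b i α, .b j β => bb i j α β

/-! The form on covectors in coordinates. -/

theorem hamH_dirVec_antisymm (hq1 : q ≠ 1) (hu : u ∈ hreg n d q)
    (c e : HCoord n d) : hamH q u (dirVec e) c = -hamH q u (dirVec c) e := by
  have h := omegaForm_antisymm hq1 hu (dirVec c) (dirVec e)
  rwa [omegaForm_eq, omegaForm_eq, dirVec_pair, dirVec_pair] at h

theorem hamH_eq_sum (hq1 : q ≠ 1) (hu : u ∈ hreg n d q) (h : HVec n d)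
    (c : HCoord n d) : hamH q u h c = ∑ e, h e * hamH q u (dirVec e) c := by
  have h1 := omegaForm_antisymm hq1 hu (dirVec c) h
  rw [omegaForm_eq, omegaForm_eq, dirVec_pair, pair, ← sum_neg_distrib] at h1
  rw [h1]
  refine sum_congr rfl fun e _ => ?_
  rw [hamH_dirVec_antisymm hq1 hu c e]
  ring

theorem hamH_tangent (hu : u ∈ hreg n d q) (h : HVec n d) :
    IsHTangent (hamH q u h) := rho_tangent hu _

theorem hamH_dirB_x (hu : u ∈ hreg n d q) (i j : Fin n) (β : Fin d) :
    hamH q u (dirVec (.b j β)) (.x i) = if i = j then u (.x i) * u (.b j β) else 0 := by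
  rw [hamH_x hu, covS_dirB, tailA, tailSum_zero, hu.2.2.1]
  split_ifs <;> simp

theorem hamH_mem (hq1 : q ≠ 1) : ∀ c e : HCoord n d,
    (fun u : hreg n d q => hamH q u.1 (dirVec e) c) ∈ HRing n d q := by
  refine coord_pairs (fun c e h => ?_) ?_ ?_ ?_ ?_ ?_ ?_
  · simp only [fun u : hreg n d q => hamH_dirVec_antisymm hq1 u.2 e c]
    exact reg_neg h
  · intro i j
    simp only [fun u : hreg n d q => (hamH_dirX u.2 j).1]
    exact reg_const 0
  · intro i j β
    simp only [fun u : hreg n d q => hamH_dirA_x u.2 j i β]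
    exact reg_const 0
  · intro i j β
    simp only [fun u : hreg n d q => hamH_dirB_x u.2 i j β]
    exact reg_ite _ (reg_mul (hcoord_mem _) (hcoord_mem _)) (reg_const 0)
  · intro i j α β
    simp only [fun u : hreg n d q => hamH_dirA_a u.2 i j α β]
    repeat' first
      | exact cotTerm_mem _ _ | exact reg_const _ | exact hcoord_mem _ | apply reg_add | apply reg_sub
      | apply reg_mul | (refine Reg.sum_mem' _ fun _ _ => ?_)
  · intro i j α β
    simp only [fun u : hreg n d q => hamH_dirVec_antisymm hq1 u.2 (.a i α) (.b j β),
      fun u : hreg n d q => hamH_dirA_b u.2 i j α β]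
    repeat' first
      | exact cotTerm_mem _ _ | exact locZ_mem hq1 _ _ | exact reg_const _ | exact hcoord_mem _
      | apply reg_add | apply reg_sub | apply reg_neg | apply reg_mul | apply reg_ite
      | (refine Reg.sum_mem' _ fun _ _ => ?_)
  · intro i j α β
    simp only [fun u : hreg n d q => hamH_dirB_b u.2 i j α β]
    repeat' first
      | exact cotTerm_mem _ _ | exact locZ_mem hq1 _ _ | exact reg_const _ | exact hcoord_mem _
      | apply reg_add | apply reg_sub | apply reg_mul | (refine Reg.sum_mem' _ fun _ _ => ?_)

variable (hV : IsOpen (projSet n d q)) (hq1 : q ≠ 1)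

/-- The biderivation `f, g ↦ D f * E g`. -/
def tensorD {A : Type} [CommRing A] [Algebra ℂ A] (D E : Der(A)) : Bider A :=
  (LinearMap.toSpanSingleton A (Der(A)) E).compDer D

theorem tensorD_apply {A : Type} [CommRing A] [Algebra ℂ A] (D E : Der(A)) (f g : A) :
    tensorD D E f g = D f * E g := by
  simp [tensorD]

/-- The bracket `{-,-}_0` on the local phase space before taking the quotient. -/
def bracketZero : Bider (HRing n d q) :=
  ∑ c, ∑ e, (⟨_, hamH_mem hq1 c e⟩ : HRing n d q) • tensorD (hD hV c) (hD hV e)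

theorem bracketZero_at (f g : HRing n d q) (u : hreg n d q) : (bracketZero hV hq1 f g).1 u =
    omegaForm q u.1 (hgrad hV f u) (hgrad hV g u) := by
  rw [omegaForm_eq, pair, ← evalReg_apply, bracketZero, bider_sum_apply, map_sum]
  refine sum_congr rfl fun c _ => ?_
  rw [bider_sum_apply, map_sum, hamH_eq_sum hq1 u.2, mul_sum]
  refine sum_congr rfl fun e _ => ?_
  rw [Derivation.smul_apply, Derivation.smul_apply, tensorD_apply, smul_eq_mul, map_mul, map_mul]
  change hamH q u.1 (dirVec e) c * (hgrad hV f u c * hgrad hV g u e) = _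
  ring

theorem bracketZero_isBivector : IsBivector (bracketZero hV hq1) := by
  intro f
  ext u
  rw [bracketZero_at]
  have h := omegaForm_antisymm hq1 u.2 (hgrad hV f u) (hgrad hV f u)
  change _ = (0 : ℂ)
  linear_combination h / 2

theorem bracketZero_coordFn (c e : HCoord n d) (u : hreg n d q) :
    (bracketZero hV hq1 (coordFn _ c) (coordFn _ e)).1 u = hamH q u.1 (dirVec e) c := by
  rw [bracketZero_at, omegaForm_eq, ← hdir_apply, hdir_coordFn hV u (hamH_tangent u.2 _)]
  have h := omegaForm_antisymm hq1 u.2 (dirVec c) (hgrad hV (coordFn _ e) u)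
  rw [omegaForm_eq, omegaForm_eq, dirVec_pair, ← hdir_apply, hdir_coordFn hV u (hamH_tangent u.2 _)] at h
  rw [h, hamH_dirVec_antisymm hq1 u.2 c e]

/-- The local formulas are the components of the vectors `hamH` of the coordinate covectors. -/
theorem bracketZero_spec : IsBracketZero q (bracketZero hV hq1) where
  bivector := bracketZero_isBivector hV hq1
  xx i j u := by rw [bracketZero_coordFn, (hamH_dirX u.2 j).1]
  xa i j α u := by rw [bracketZero_coordFn, hamH_dirA_x u.2]
  xb i j α u := by rw [bracketZero_coordFn, hamH_dirB_x u.2]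
  aa i j α β u := by rw [bracketZero_coordFn, hamH_dirA_a u.2]
  ab i j α β u := by
    rw [bracketZero_coordFn, hamH_dirVec_antisymm hq1 u.2, hamH_dirA_b u.2, neg_neg]
  bb i j α β u := by rw [bracketZero_coordFn, hamH_dirB_b u.2]

/-! The scaling vector fields. -/

/-- The values of the vector field on the local phase space which corresponds to the scaling of
`W_α` and `V_α`. -/
def scaleH (u : HVec n d) (α : Fin d) : HVec n d
  | .x _ => 0
  | .a i β => ((if β = α then 1 else 0) - u (.a i α)) * u (.a i β)
  | .b i β => -(((if β = α then 1 else 0) - u (.a i α)) * u (.b i β))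

theorem dK_scaleVec (y : RVec n d) (α : Fin d) (k : ℕ) : dK y (scaleVec y α) k = 0 := by
  have h : ∀ k, dmu y (scaleVec y α) k = 0 := by
    intro k
    rw [dmu]
    split_ifs with hk
    · have hW : colW (scaleVec y α) ⟨k, hk⟩ = (Pi.single α (colW y α) : Fin d → Fin n → ℂ) ⟨k, hk⟩ := rfl
      have hV : rowV (scaleVec y α) ⟨k, hk⟩ = (Pi.single α (-rowV y α) : Fin d → Fin n → ℂ) ⟨k, hk⟩ := rfl
      rw [hW, hV, Pi.single_apply, Pi.single_apply]
      split_ifs with h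
      · rw [h, vecMulVec_neg, add_neg_cancel]
      · rw [zero_vecMulVec, vecMulVec_zero, add_zero]
    · rfl
  induction k with
  | zero => rfl
  | succ k ih => rw [dK, h, ih, zero_mul, mul_zero, add_zero]

/-- The scalings leave the slice, and the compensating gauge transformation makes them quadratic. -/
theorem rho_scaleVec (hu : u ∈ hreg n d q) (α : Fin d) :
    rho q u (scaleVec (sliceVec q u) α) = scaleH u α := by
  have hX : matX (scaleVec (sliceVec q u) α) = 0 := rfl
  have hZ : matZ (scaleVec (sliceVec q u) α) = 0 := rfl
  have hW : ∀ γ i, colW (scaleVec (sliceVec q u) α) γ i = if γ = α then u (.a i α) else 0 := by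
    intro γ i
    change (Pi.single α (ha u α) : Fin d → Fin n → ℂ) γ i = _
    rw [Pi.single_apply]
    split_ifs <;> rfl
  have hV : ∀ γ, rowV (scaleVec (sliceVec q u) α) γ = if γ = α then -rowV (sliceVec q u) γ else 0 := by
    intro γ
    change (Pi.single α (-rowV (sliceVec q u) α) : Fin d → Fin n → ℂ) γ = _
    rw [Pi.single_apply]
    split_ifs with h
    · rw [h]
    · rfl
  have hC : compens u (scaleVec (sliceVec q u) α) = diagonal fun i => -u (.a i α) := by
    ext i k
    by_cases h : i = k
    · subst h; simp [compens, hX, hW]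
    · simp [compens, hX, h]
  have hB : ∀ γ, dB (sliceVec q u) (scaleVec (sliceVec q u) α) γ = if γ = α then -hb u γ else 0 := by
    intro γ
    rw [dB, dZk, dK_scaleVec, hZ, hV, zero_mul, mul_zero, add_zero, vecMul_zero, add_zero,
      kprod_slice_mul hu γ γ.2.le]
    split_ifs with h
    · rw [neg_vecMul, rowV_slice_mul hu]
    · rw [zero_vecMul]
  funext c
  cases c with
  | x i => simp [rho, hX, scaleH]
  | a i β =>
    simp only [rho, hW, hC, mulVec_diagonal, scaleH, ha]
    by_cases h : β = α
    · subst h; simp; ring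
    · simp [h]
  | b i β =>
    simp only [rho, hB, hC, vecMul_diagonal, scaleH]
    by_cases h : β = α
    · subst h; simp [hb]; ring
    · simp [h, hb]; ring

theorem scaleH_tangent (hu : u ∈ hreg n d q) (α : Fin d) : IsHTangent (scaleH u α) := by
  rw [← rho_scaleVec hu]
  exact rho_tangent hu _

theorem scaleH_mem (α : Fin d) (c : HCoord n d) :
    (fun u : hreg n d q => scaleH u.1 α c) ∈ HRing n d q := by
  cases c with
  | x i => exact reg_const 0
  | a i β => exact reg_mul (reg_sub (reg_const _) (hcoord_mem _)) (hcoord_mem _)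
  | b i β => exact reg_neg (reg_mul (reg_sub (reg_const _) (hcoord_mem _)) (hcoord_mem _))

/-- The vector field on the local phase space which corresponds to the scaling of `W_α` and `V_α`. -/
def locScale (α : Fin d) : Der(HRing n d q) :=
  ∑ c, (⟨_, scaleH_mem α c⟩ : HRing n d q) • hD hV c

theorem locScale_at (α : Fin d) (f : HRing n d q) (u : hreg n d q) :
    (locScale hV α f).1 u = pair (hgrad hV f u) (scaleH u.1 α) := by
  rw [← evalReg_apply, locScale, derivation_sum_apply, map_sum, pair]
  refine sum_congr rfl fun c _ => ?_
  rw [Derivation.smul_apply, smul_eq_mul, map_mul, mul_comm]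
  rfl

theorem locScale_coordFn (α : Fin d) (c : HCoord n d) (u : hreg n d q) :
    (locScale hV α (coordFn _ c)).1 u = scaleH u.1 α c := by
  rw [locScale_at, ← hdir_apply, hdir_coordFn hV u (scaleH_tangent u.2 α)]

/-- The bracket `ψ_z^loc` on the local phase space before taking the quotient. -/
def bracketPsi (z : Param d) : Bider (HRing n d q) :=
  ∑ p : {p : Fin d × Fin d // p.1 < p.2}, z p • wedge (locScale hV p.1.1) (locScale hV p.1.2)

theorem bracketPsi_isBivector (z : Param d) : IsBivector (bracketPsi hV z) :=
  IsBivector.sum _ fun _ _ => (wedge_isBivector _ _).smul _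

theorem bracketPsi_at (z : Param d) (f g : HRing n d q) (u : hreg n d q) :
    (bracketPsi hV z f g).1 u = ∑ p : {p : Fin d × Fin d // p.1 < p.2},
      z p * ((locScale hV p.1.1 f).1 u * (locScale hV p.1.2 g).1 u -
        (locScale hV p.1.1 g).1 u * (locScale hV p.1.2 f).1 u) := by
  rw [← evalReg_apply, bracketPsi, bider_sum_apply, map_sum]
  refine sum_congr rfl fun p _ => ?_
  rw [Derivation.smul_apply, Derivation.smul_apply, wedge_apply, map_smul, smul_eq_mul, map_sub, map_mul,
    map_mul]
  simp only [evalReg_apply]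
  ring

theorem sum_pairs_skewExt (z : Param d) (X Y : Fin d → ℂ) :
    ∑ p : {p : Fin d × Fin d // p.1 < p.2}, z p * (X p.1.1 * Y p.1.2 - Y p.1.1 * X p.1.2) =
      ∑ μ, ∑ ν, skewExt z μ ν * (X μ * Y ν) := by
  let s : Fin d → Fin d → ℂ := fun μ ν => if h : μ < ν then z ⟨(μ, ν), h⟩ else 0
  have hs : ∀ T : Fin d → Fin d → ℂ, ∑ p : {p : Fin d × Fin d // p.1 < p.2}, z p * T p.1.1 p.1.2 =
      ∑ μ, ∑ ν, s μ ν * T μ ν := by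
    intro T
    rw [← Fintype.sum_prod_type' (f := fun μ ν => s μ ν * T μ ν)]
    rw [← Finset.sum_filter_of_ne (p := fun p : Fin d × Fin d => p.1 < p.2) fun p _ h => by
        by_contra hp
        exact h (by simp only [s, dif_neg hp, zero_mul]),
      sum_subtype (p := fun p : Fin d × Fin d => p.1 < p.2) _ fun p => by simp]
    refine sum_congr rfl fun p _ => ?_
    simp only [s, dif_pos p.2]
  have hz : ∀ μ ν, skewExt z μ ν = s μ ν - s ν μ := by
    intro μ ν
    simp only [skewExt, s]
    rcases lt_trichotomy μ ν with h | h | h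
    · simp [h, not_lt_of_gt h]
    · subst h; simp
    · simp [h, not_lt_of_gt h]
  rw [hs fun μ ν => X μ * Y ν - Y μ * X ν]
  simp only [hz, mul_sub, sub_mul, sum_sub_distrib]
  congr 1
  rw [sum_comm]
  exact sum_congr rfl fun _ _ => sum_congr rfl fun _ _ => by ring

theorem sum_skewExt_scale (z : Param d) (u : HVec n d) (i j : Fin n) (α β : Fin d) :
    ∑ μ, ∑ ν, skewExt z μ ν * (((if α = μ then 1 else 0) - u (.a i μ)) *
      ((if β = ν then 1 else 0) - u (.a j ν))) = locG z u i j α β := by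
  have hskew : ∀ μ ν, skewExt z μ ν = -skewExt z ν μ := by
    intro μ ν
    simp only [skewExt]
    rcases lt_trichotomy μ ν with h | h | h
    · simp [h, not_lt_of_gt h]
    · subst h; simp
    · simp [h, not_lt_of_gt h]
  have e : ∀ μ ν, skewExt z μ ν * (((if α = μ then 1 else 0) - u (.a i μ)) *
      ((if β = ν then 1 else 0) - u (.a j ν))) =
      (if α = μ then (if β = ν then skewExt z μ ν else 0) else 0) -
        (if α = μ then skewExt z μ ν * u (.a j ν) else 0) -
        (if β = ν then skewExt z μ ν * u (.a i μ) else 0) + skewExt z μ ν * u (.a i μ) * u (.a j ν) := by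
    intro μ ν
    split_ifs <;> ring
  simp only [e, sum_add_distrib, sum_sub_distrib, sum_ite_eq, mem_univ, if_true, locG]
  have h2 : ∑ μ, ∑ ν, (if α = μ then skewExt z μ ν * u (.a j ν) else 0) =
      -∑ ν, skewExt z ν α * u (.a j ν) := by
    rw [sum_comm, ← sum_neg_distrib]
    refine sum_congr rfl fun ν _ => ?_
    rw [sum_ite_eq, if_pos (mem_univ _), hskew α ν]
    ring
  have h1 : ∑ μ, (if α = μ then ∑ ν, (if β = ν then skewExt z μ ν else 0) else 0) = skewExt z α β := by
    simp
  rw [h2]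
  simp
  ring

theorem bracketPsi_coordFn (z : Param d) (c e : HCoord n d) (u : hreg n d q) :
    (bracketPsi hV z (coordFn _ c) (coordFn _ e)).1 u =
      ∑ μ, ∑ ν, skewExt z μ ν * (scaleH u.1 μ c * scaleH u.1 ν e) := by
  simp only [bracketPsi_at, locScale_coordFn]
  exact sum_pairs_skewExt z (fun μ => scaleH u.1 μ c) fun μ => scaleH u.1 μ e

theorem bracketPsi_spec (z : Param d) : IsPsiLoc q z (bracketPsi hV z) where
  bivector := bracketPsi_isBivector hV z
  xx i j u := by simp only [bracketPsi_at, locScale_coordFn, scaleH]; simp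
  xa i j α u := by simp only [bracketPsi_at, locScale_coordFn, scaleH]; simp
  xb i j α u := by simp only [bracketPsi_at, locScale_coordFn, scaleH]; simp
  aa i j α β u := by
    simp only [bracketPsi_coordFn, ← sum_skewExt_scale, sum_mul, scaleH]
    exact sum_congr rfl fun _ _ => sum_congr rfl fun _ _ => by ring
  ab i j α β u := by
    simp only [bracketPsi_coordFn, ← sum_skewExt_scale, sum_mul, scaleH, ← sum_neg_distrib]
    exact sum_congr rfl fun _ _ => sum_congr rfl fun _ _ => by ring
  bb i j α β u := by
    simp only [bracketPsi_coordFn, ← sum_skewExt_scale, sum_mul, scaleH]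
    exact sum_congr rfl fun _ _ => sum_congr rfl fun _ _ => by ring

/-! Uniqueness and invariance under permutations. -/

theorem IsBracketZero.unique {P Q : Bider (HRing n d q)} (hP : IsBracketZero q P)
    (hQ : IsBracketZero q Q) : P = Q := by
  refine bider_ext_coord (coord_pairs (fun c e h => by
    rw [hP.bivector.antisymm, hQ.bivector.antisymm, h]) ?_ ?_ ?_ ?_ ?_ ?_) <;> intros <;> ext u <;>
    simp only [hP.xx, hP.xa, hP.xb, hP.aa, hP.ab, hP.bb, hQ.xx, hQ.xa, hQ.xb, hQ.aa, hQ.ab, hQ.bb]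

theorem IsPsiLoc.unique {z : Param d} {P Q : Bider (HRing n d q)} (hP : IsPsiLoc q z P)
    (hQ : IsPsiLoc q z Q) : P = Q := by
  refine bider_ext_coord (coord_pairs (fun c e h => by
    rw [hP.bivector.antisymm, hQ.bivector.antisymm, h]) ?_ ?_ ?_ ?_ ?_ ?_) <;> intros <;> ext u <;>
    simp only [hP.xx, hP.xa, hP.xb, hP.aa, hP.ab, hP.bb, hQ.xx, hQ.xa, hQ.xb, hQ.aa, hQ.ab, hQ.bb]

theorem locZ_permAct (σ : Equiv.Perm (Fin n)) (u : HVec n d) (i j : Fin n) :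
    locZ q (permAct σ u) i j = locZ q u (σ i) (σ j) := rfl

theorem locCalZ_permAct (σ : Equiv.Perm (Fin n)) (u : HVec n d) (k : ℕ) :
    locCalZ q (permAct σ u) k = (locCalZ q u k).submatrix σ σ := rfl

theorem cotTerm_permAct (σ : Equiv.Perm (Fin n)) (u : HVec n d) (i j : Fin n) :
    cotTerm (permAct σ u) i j = cotTerm u (σ i) (σ j) := by
  simp only [cotTerm, permAct, σ.injective.eq_iff]

theorem permAct_mem (σ : Equiv.Perm (Fin n)) (hu : u ∈ hreg n d q) : permAct σ u ∈ hreg n d q :=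
  ⟨fun i => hu.1 _, fun i j h => hu.2.1 _ _ fun h' => h (σ.injective h'), fun i => hu.2.2.1 _,
    fun k hk => by rw [locCalZ_permAct, det_submatrix_equiv_self]; exact hu.2.2.2 k hk⟩

/-- The action of permutations on the local phase space. -/
def permPt (σ : Equiv.Perm (Fin n)) (u : hreg n d q) : hreg n d q := ⟨permAct σ u.1, permAct_mem σ u.2⟩

/-- The action of permutations on the local coordinates. -/
def permCoord (σ : Equiv.Perm (Fin n)) : HCoord n d → HCoord n d
  | .x i => .x (σ i)
  | .a i α => .a (σ i) α
  | .b i α => .b (σ i) α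

theorem permAct_apply (σ : Equiv.Perm (Fin n)) (u : HVec n d) (c : HCoord n d) :
    permAct σ u c = u (permCoord σ c) := by
  cases c <;> rfl

theorem permPt_mem (σ : Equiv.Perm (Fin n)) (c : HCoord n d) :
    (fun u : hreg n d q => (permPt σ u).1 c) ∈ Reg (hreg n d q) := by
  change (fun u : hreg n d q => permAct σ u.1 c) ∈ _
  simp only [permAct_apply]
  exact hcoord_mem _

/-- The action of permutations on functions. -/
def permFn (σ : Equiv.Perm (Fin n)) : HRing n d q →ₐ[ℂ] HRing n d q :=
  comapReg (permPt σ) (permPt_mem σ)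

theorem permFn_coordFn (σ : Equiv.Perm (Fin n)) (c : HCoord n d) :
    permFn σ (coordFn (hreg n d q) c) = coordFn _ (permCoord σ c) := by
  ext u
  exact permAct_apply σ u.1 c

/-- Equivariance of a bracket can be checked on the coordinate functions. -/
theorem bider_perm {P : Bider (HRing n d q)} (σ : Equiv.Perm (Fin n))
    (h : ∀ c e u, (P (coordFn _ c) (coordFn _ e)).1 (permPt σ u) =
      (P (coordFn _ (permCoord σ c)) (coordFn _ (permCoord σ e))).1 u) (f g : HRing n d q) (u : hreg n d q) :
    (P f g).1 (permPt σ u) = (P (permFn σ f) (permFn σ g)).1 u := by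
  have h1 : ∀ c, (P (coordFn _ c) g).1 (permPt σ u) = (P (permFn σ (coordFn _ c)) (permFn σ g)).1 u := by
    intro c
    refine DFunLike.congr_fun (tangent_ext (derAt_tangent (permPt σ u) (P (coordFn _ c)))
      (comapReg_tangent (permPt σ) (permPt_mem σ) (derAt_tangent u (P (permFn σ (coordFn _ c))))) fun e => ?_) g
    rw [derAt_apply, h]
    change _ = (P (permFn σ (coordFn _ c)) (permFn σ (coordFn _ e))).1 u
    rw [permFn_coordFn, permFn_coordFn]
  exact DFunLike.congr_fun (tangent_ext (derAtLeft_tangent (permPt σ u) P g)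
    (comapReg_tangent (permPt σ) (permPt_mem σ) (derAtLeft_tangent u P (permFn σ g))) h1) f

/-- Uniqueness of biderivations with given values on coordinates yields invariance. -/
theorem descends_of_perm {P : Bider (HRing n d q)} (hP : IsBivector P)
    (h : ∀ σ c e u, (P (coordFn _ c) (coordFn _ e)).1 (permPt σ u) =
      (P (coordFn _ (permCoord σ c)) (coordFn _ (permCoord σ e))).1 u) :
    Descends (Set.Subset.refl _) (permRel n d q) P where
  bivector := hP
  left F G g hF _ y := by
    have : F = 0 := by ext u; exact hF u
    rw [this, map_zero]; rfl
  inv F G f g hF hG y y' hy := by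
    obtain ⟨σ, hσ⟩ := hy
    have hy' : y' = permPt σ y := Subtype.ext hσ
    have hinv : ∀ {F : HRing n d q} {f : LocRing n d q},
        IsLift (Set.Subset.refl _) (permRel n d q) F f → permFn σ F = F := by
      intro F f hF
      ext u
      have h1 := hF (permPt σ u)
      have h2 := hF u
      change F.1 (permPt σ u) = F.1 u
      have h3 : Quot.mk (permRel n d q) u = Quot.mk _ (permPt σ u) := Quot.sound ⟨σ, rfl⟩
      rw [← h3] at h1
      exact h1.trans h2.symm
    subst hy'
    have h1 := bider_perm σ (h σ) F G y
    rw [hinv hF, hinv hG] at h1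
    exact h1.symm

theorem perm_swap {P : Bider (HRing n d q)} (hP : IsBivector P) {σ : Equiv.Perm (Fin n)}
    {f g f' g' : HRing n d q} (h : ∀ u, (P f g).1 (permPt σ u) = (P f' g').1 u) (u : hreg n d q) :
    (P g f).1 (permPt σ u) = (P g' f').1 u := by
  rw [hP.antisymm g, hP.antisymm g']
  exact congrArg Neg.neg (h u)

theorem exists_lift_loc (f : LocRing n d q) :
    ∃ F : HRing n d q, IsLift (Set.Subset.refl _) (permRel n d q) F f :=
  ⟨⟨_, f.2⟩, fun _ => rfl⟩

theorem bracketZero_descends :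
    Descends (Set.Subset.refl _) (permRel n d q) (bracketZero hV hq1) := by
  have hB := bracketZero_spec hV hq1
  refine descends_of_perm hB.bivector fun σ =>
    coord_pairs (fun c e => perm_swap hB.bivector) ?_ ?_ ?_ ?_ ?_ ?_
  all_goals
    intros
    simp only [permCoord, hB.xx, hB.xa, hB.xb, hB.aa, hB.ab, hB.bb, permPt, locZ_permAct, cotTerm_permAct,
      σ.injective.eq_iff]
    try rfl

theorem bracketPsi_descends (z : Param d) :
    Descends (Set.Subset.refl _) (permRel n d q) (bracketPsi hV z) := by
  have hB := bracketPsi_spec hV z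
  refine descends_of_perm hB.bivector fun σ =>
    coord_pairs (fun c e => perm_swap hB.bivector) ?_ ?_ ?_ ?_ ?_ ?_
  all_goals
    intros
    simp only [permCoord, hB.xx, hB.xa, hB.xb, hB.aa, hB.ab, hB.bb, permPt]
    try rfl

theorem isLocalZero_iff (B : Bider (LocRing n d q)) : IsLocalZero q B ↔
    IsReduction (Set.Subset.refl _) (permRel n d q) (bracketZero hV hq1) B := by
  constructor
  · rintro ⟨B', h, h'⟩
    rwa [h.unique (bracketZero_spec hV hq1)] at h'
  · exact fun h => ⟨_, bracketZero_spec hV hq1, h⟩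

theorem isLocalPsi_iff (z : Param d) (B : Bider (LocRing n d q)) : IsLocalPsi q z B ↔
    IsReduction (Set.Subset.refl _) (permRel n d q) (bracketPsi hV z) B := by
  constructor
  · rintro ⟨B', h, h'⟩
    rwa [h.unique (bracketPsi_spec hV z)] at h'
  · exact fun h => ⟨_, bracketPsi_spec hV z, h⟩

theorem existsUnique_isLocalZero (hd : d ≠ 0) (hq1 : q ≠ 1) :
    ∃! B : Bider (LocRing n d q), IsLocalZero q B := by
  have hV := isOpen_projSet (n := n) hd hq1
  obtain ⟨B, hB⟩ := (bracketZero_descends hV hq1).exists_reduction exists_lift_loc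
  refine ⟨B, (isLocalZero_iff hV hq1 B).2 hB, fun B' h => ?_⟩
  exact ((isLocalZero_iff hV hq1 B').1 h).unique exists_lift_loc hB

theorem existsUnique_isLocalPsi (hd : d ≠ 0) (hq1 : q ≠ 1) (z : Param d) :
    ∃! B : Bider (LocRing n d q), IsLocalPsi q z B := by
  have hV := isOpen_projSet (n := n) hd hq1
  obtain ⟨B, hB⟩ := (bracketPsi_descends hV z).exists_reduction exists_lift_loc
  refine ⟨B, (isLocalPsi_iff hV z B).2 hB, fun B' h => ?_⟩
  exact ((isLocalPsi_iff hV z B').1 h).unique exists_lift_loc hB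

end LocalBrackets

/-! ### The Jacobi identity on the local phase space -/

section LocalJacobi

open Matrix

variable {n d : ℕ} {q : ℂ}

/-- The trace of a power of `X`. -/
def tracePow (n d k : ℕ) : RepRing n d := polyFn (repSpace n d) (trace (polX n d ^ k))

theorem evM_pow (y : RVec n d) (A : Matrix (Fin n) (Fin n) (MvPolynomial (RSCoord n d) ℂ)) (k : ℕ) :
    evM y (A ^ k) = evM y A ^ k := by
  induction k with
  | zero => rw [pow_zero, pow_zero, evM_one]
  | succ k ih => rw [pow_succ, evM_mul, ih, pow_succ]

theorem tracePow_apply (k : ℕ) (u : repSpace n d) : (tracePow n d k).1 u = trace (matX u.1 ^ k) := by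
  rw [tracePow, polyFn_apply, ← evM_polX u.1, ← evM_pow, trace, map_sum]
  rfl

/-- The function `V_α Z_α X ^ k W_β`, where `Z_α` is the product of `Z` with the preceding matrices
`Id + W_γ V_γ`. -/
def spinPow (n : ℕ) {d : ℕ} (α β : Fin d) (k : ℕ) : RepRing n d := polyFn (repSpace n d)
  (∑ i, ∑ l, polB n α i * ((polX n d ^ k) i l * MvPolynomial.X (.W β l)))

theorem spinPow_apply (α β : Fin d) (k : ℕ) (u : repSpace n d) :
    (spinPow n α β k).1 u = rowB u.1 α ⬝ᵥ (matX u.1 ^ k *ᵥ colW u.1 β) := by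
  rw [spinPow, polyFn_apply, ← evM_polX u.1, ← evM_pow]
  simp only [map_sum, map_mul, eval_polB, MvPolynomial.eval_X, dotProduct, mulVec, mul_sum]
  rfl

theorem pow_conj {a b : Mat n} (hba : b * a = 1) (hab : a * b = 1)
    (A : Mat n) (k : ℕ) : (a * A * b) ^ k = a * A ^ k * b := by
  induction k with
  | zero => rw [pow_zero, pow_zero, mul_one, hab]
  | succ k ih =>
    rw [pow_succ, ih, pow_succ]
    calc a * A ^ k * b * (a * A * b) = a * A ^ k * (b * a) * A * b := by noncomm_ring
      _ = a * (A ^ k * A) * b := by rw [hba]; noncomm_ring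

theorem tracePow_inv (k : ℕ) (y y' : levelSet n d q) (h : glRel n d q y y') :
    (tracePow n d k).1 (lv y) = (tracePow n d k).1 (lv y') := by
  obtain ⟨a, b, hab, h⟩ := glRel_iff h
  rw [tracePow_apply, tracePow_apply, h, matX_conjVec, pow_conj (mul_eq_one_comm.1 hab) hab, mul_assoc,
    trace_mul_comm, mul_assoc, mul_eq_one_comm.1 hab, mul_one]

theorem spinPow_inv (α β : Fin d) (k : ℕ) (y y' : levelSet n d q) (h : glRel n d q y y') :
    (spinPow n α β k).1 (lv y) = (spinPow n α β k).1 (lv y') := by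
  obtain ⟨a, b, hab, h⟩ := glRel_iff h
  have hba := mul_eq_one_comm.1 hab
  have hB : rowB y'.1 α = rowB y.1 α ᵥ* b := by
    rw [h, rowB, rowB, kprod_conjVec hab, matZ_conjVec, rowV_conjVec, vecMul_vecMul, vecMul_vecMul]
    congr 1
    calc b * (a * kprod (muN y.1) α * b * (a * matZ y.1 * b)) =
        (b * a) * kprod (muN y.1) α * (b * a) * matZ y.1 * b := by noncomm_ring
      _ = _ := by rw [hba]; noncomm_ring
  rw [spinPow_apply, spinPow_apply, hB, h, matX_conjVec, pow_conj hba hab, colW_conjVec, mulVec_mulVec,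
    ← dotProduct_mulVec, mulVec_mulVec]
  congr 2
  calc matX y.1 ^ k = (b * a) * matX y.1 ^ k * (b * a) := by rw [hba, one_mul, mul_one]
    _ = _ := by noncomm_ring

variable (hV : IsOpen (projSet n d q)) (hq1 : q ≠ 1)

theorem slicePull_tracePow (k : ℕ) : slicePull hq1 (tracePow n d k) =
    ∑ i, coordFn (hreg n d q) (.x i) ^ k := by
  ext u
  rw [slicePull_apply, tracePow_apply, ← evalReg_apply u (∑ i, _), map_sum]
  change trace (matX (sliceVec q u.1) ^ k) = _
  rw [matX_slice, diagonal_pow, trace_diagonal]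
  refine sum_congr rfl fun i _ => ?_
  rw [map_pow]
  rfl

theorem slicePull_spinPow (α β : Fin d) (k : ℕ) : slicePull hq1 (spinPow n α β k) =
    ∑ i, coordFn (hreg n d q) (.b i α) * (coordFn _ (.x i) ^ k * coordFn _ (.a i β)) := by
  ext u
  rw [slicePull_apply, spinPow_apply, ← evalReg_apply u (∑ i, _), map_sum]
  change rowB (sliceVec q u.1) α ⬝ᵥ (matX (sliceVec q u.1) ^ k *ᵥ colW (sliceVec q u.1) β) = _
  rw [matX_slice, diagonal_pow, rowB_slice u.2]
  refine sum_congr rfl fun i _ => ?_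
  rw [map_mul, map_mul, map_pow, mulVec_diagonal]
  rfl

theorem tangent_pow {X : Type} {A : Subalgebra ℂ (X → ℂ)} {x : X} {v : A →ₗ[ℂ] ℂ}
    (hv : IsTangentVector A x v) (f : A) (k : ℕ) :
    v (f ^ (k + 1)) = (k + 1 : ℂ) * (f.1 x) ^ k * v f := by
  induction k with
  | zero => simp
  | succ k ih =>
    have h : (f ^ (k + 1)).1 x = f.1 x ^ (k + 1) := rfl
    rw [pow_succ, hv, ih, h]
    push_cast
    ring

theorem exists_b_ne_zero {u : HVec n d} (hu : u ∈ hreg n d q) (i : Fin n) : ∃ α, u (.b i α) ≠ 0 := by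
  by_contra! h
  refine hu.2.2.2 0 (Nat.zero_le _) (det_eq_zero_of_column_eq_zero i fun j => ?_)
  rw [locCalZ_zero, locZ]
  simp [h]

theorem eq_zero_of_sum_mul_pow {u : HVec n d} (hu : u ∈ hreg n d q) {f : Fin n → ℂ}
    (h : ∀ k : ℕ, ∑ i, f i * u (.x i) ^ k = 0) : ∀ i, f i = 0 := by
  have hinj : Function.Injective fun i => u (.x i) := fun i j hij => by
    by_contra hne
    exact (hu.2.1 i j hne).1 hij
  exact congrFun (Matrix.eq_zero_of_forall_pow_sum_mul_pow_eq_zero hinj fun k => h k)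

/-- Tangent vectors of the local phase space are determined by their values on the pullbacks of the
functions on the spin Ruijsenaars-Schneider space. -/
theorem tangent_eq_zero_of_slice {u : hreg n d q} {v : HRing n d q →ₗ[ℂ] ℂ}
    (hv : IsTangentVector (HRing n d q) u v)
    (h : ∀ (F : RepRing n d) (f : RSRing n d q), LiftRS F f → v (slicePull hq1 F) = 0) : v = 0 := by
  have hx : ∀ i, v (coordFn _ (.x i)) = 0 := by
    refine eq_zero_of_sum_mul_pow u.2 fun k => ?_
    have h2 := h _ _ (isLift_descendFn _ (tracePow_inv (q := q) (k + 1)))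
    rw [slicePull_tracePow, map_sum] at h2
    simp only [tangent_pow hv, mul_assoc] at h2
    rw [← mul_sum] at h2
    rw [← (mul_eq_zero.1 h2).resolve_left (Nat.cast_add_one_ne_zero _)]
    exact sum_congr rfl fun i _ => mul_comm _ _
  have hab : ∀ α β i, v (coordFn (hreg n d q) (.b i α)) * u.1 (.a i β) +
      u.1 (.b i α) * v (coordFn (hreg n d q) (.a i β)) = 0 := fun α β => by
    refine eq_zero_of_sum_mul_pow u.2 fun k => ?_
    have h2 := h _ _ (isLift_descendFn _ (spinPow_inv (q := q) α β k))
    rw [slicePull_spinPow, map_sum] at h2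
    rw [← h2]
    refine sum_congr rfl fun i _ => ?_
    have hp : v (coordFn _ (.x i) ^ k) = 0 := by
      rcases k with _ | m
      · rw [pow_zero, tangent_one hv]
      · rw [tangent_pow hv, hx, mul_zero]
    have e1 : (coordFn (hreg n d q) (.x i) ^ k).1 u = u.1 (.x i) ^ k := rfl
    have e2 : (coordFn (hreg n d q) (.x i) ^ k * coordFn (hreg n d q) (.a i β)).1 u =
      u.1 (.x i) ^ k * u.1 (.a i β) := rfl
    rw [hv, hv, hp, e1, e2, coordFn_apply, coordFn_apply]
    ring
  have hsum : ∀ i, ∑ α, v (coordFn _ (.a i α)) = 0 := by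
    intro i
    rw [← map_sum]
    have : ∑ α, coordFn (hreg n d q) (.a i α) = 1 := by
      ext u
      rw [← evalReg_apply, map_sum]
      exact u.2.2.2.1 i
    rw [this, tangent_one hv]
  have hb : ∀ i α, v (coordFn _ (.b i α)) = 0 := by
    intro i α
    have h1 : ∑ β, (v (coordFn _ (.b i α)) * u.1 (.a i β) + u.1 (.b i α) * v (coordFn _ (.a i β))) = 0 :=
      sum_eq_zero fun β _ => hab α β i
    rwa [sum_add_distrib, ← mul_sum, ← mul_sum, hsum, u.2.2.2.1 i, mul_one, mul_zero,
      add_zero] at h1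
  refine tangent_ext hv (fun f g => by simp) fun c => ?_
  rw [LinearMap.zero_apply]
  cases c with
  | x i => exact hx i
  | b i α => exact hb i α
  | a i β =>
    obtain ⟨α, hα⟩ := exists_b_ne_zero u.2 i
    have h1 := hab α β i
    rw [hb, zero_mul, zero_add] at h1
    exact (mul_eq_zero.1 h1).resolve_left hα

/-- The combined bracket on the local phase space before taking the quotient. -/
def bracketLoc (z₀ : ℂ) (z : Param d) : Bider (HRing n d q) := z₀ • bracketZero hV hq1 + bracketPsi hV z

theorem bracketLoc_isBivector (z₀ : ℂ) (z : Param d) : IsBivector (bracketLoc hV hq1 z₀ z) :=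
  ((bracketZero_isBivector hV hq1).smul z₀).add (bracketPsi_isBivector hV z)

/-- The slice intertwines the brackets. -/
theorem bracketLoc_slicePull (z₀ : ℂ) (z : Param d) {F G : RepRing n d} {f g : RSRing n d q}
    (hF : LiftRS F f) (hG : LiftRS G g) :
    bracketLoc hV hq1 z₀ z (slicePull hq1 F) (slicePull hq1 G) =
      slicePull hq1 ((z₀ • quasiP n d + psiRep n z) F G) := by
  ext u
  have h1 := quasiP_slice (hV := hV) (hq1 := hq1) hF hG u
  have h2 := psiRep_slice (hV := hV) (hq1 := hq1) z hF hG u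
  have h3 : (bracketLoc hV hq1 z₀ z (slicePull hq1 F) (slicePull hq1 G)).1 u =
      z₀ * (bracketZero hV hq1 (slicePull hq1 F) (slicePull hq1 G)).1 u +
        (bracketPsi hV z (slicePull hq1 F) (slicePull hq1 G)).1 u := rfl
  have h4 : (slicePull hq1 ((z₀ • quasiP n d + psiRep n z) F G)).1 u =
      z₀ * (quasiP n d F G).1 (lv (slicePt hq1 u)) + (psiRep n z F G).1 (lv (slicePt hq1 u)) := rfl
  rw [h3, h4, h1, h2, bracketZero_at, bracketPsi_at]
  simp only [rho_scaleVec u.2, locScale_at]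

theorem slicePull_congr {F F' : RepRing n d} {f : RSRing n d q} (hF : LiftRS F f)
    (hF' : LiftRS F' f) : slicePull hq1 F = slicePull hq1 F' := by
  ext u
  exact (hF (slicePt hq1 u)).trans (hF' (slicePt hq1 u)).symm

/-- The jacobiator is a derivation in each argument, so that invariant functions on the slice
suffice. -/
theorem jac_bracketLoc (hqn : ∀ k : ℕ, 1 ≤ k → k ≤ n → q ^ k ≠ 1) (z₀ : ℂ) (z : Param d)
    (f g h : HRing n d q) : jac (bracketLoc hV hq1 z₀ z) f g h = 0 := by
  set P := bracketLoc hV hq1 z₀ z with hP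
  have hPb : IsBivector P := bracketLoc_isBivector hV hq1 z₀ z
  obtain ⟨B₁, hB₁⟩ := (quasiP_descends hqn (d := d)).exists_reduction (exists_lift_RS q)
  obtain ⟨B₂, hB₂⟩ := (psiRep_descends hqn z).exists_reduction (exists_lift_RS q)
  have hB := (hB₁.smul z₀).add hB₂
  have hBP := IsReduction.isPoisson_of_combined hB
  have key : ∀ {F G : RepRing n d} {f g : RSRing n d q}, LiftRS F f → LiftRS G g →
      ∀ {K : RepRing n d}, LiftRS K ((z₀ • B₁ + B₂) f g) →
      P (slicePull hq1 F) (slicePull hq1 G) = slicePull hq1 K := by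
    intro F G f g hF hG K hK
    rw [hP, bracketLoc_slicePull hV hq1 z₀ z hF hG]
    exact slicePull_congr hq1 (fun y => hB F G f g hF hG y) hK
  have h3 : ∀ (F G H : RepRing n d) (f g h : RSRing n d q), LiftRS F f → LiftRS G g → LiftRS H h →
      jac P (slicePull hq1 F) (slicePull hq1 G) (slicePull hq1 H) = 0 := by
    intro F G H f g h hF hG hH
    have step : ∀ {F G H : RepRing n d} {f g h : RSRing n d q}, LiftRS F f → LiftRS G g →
        LiftRS H h → ∀ u : hreg n d q,
        (P (slicePull hq1 F) (P (slicePull hq1 G) (slicePull hq1 H))).1 u =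
          ((z₀ • B₁ + B₂) f ((z₀ • B₁ + B₂) g h)).1 (Quot.mk _ (slicePt hq1 u)) := by
      intro F G H f g h hF hG hH u
      obtain ⟨K, hK⟩ := exists_lift_RS q ((z₀ • B₁ + B₂) g h)
      obtain ⟨K', hK'⟩ := exists_lift_RS q ((z₀ • B₁ + B₂) f ((z₀ • B₁ + B₂) g h))
      rw [key hG hH hK, key hF hK hK']
      exact hK' (slicePt hq1 u)
    ext u
    have e := congrArg (fun φ : RSRing n d q => φ.1 (Quot.mk _ (slicePt hq1 u))) (hBP.2 f g h)
    change (P _ (P _ _)).1 u + (P _ (P _ _)).1 u + (P _ (P _ _)).1 u = 0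
    rw [step hF hG hH, step hG hH hF, step hH hF hG]
    exact e
  -- the arguments are replaced by pullbacks one at a time
  have ext1 : ∀ g h : HRing n d q, (∀ (F : RepRing n d) (f : RSRing n d q),
      LiftRS F f → jac P (slicePull hq1 F) g h = 0) →
      ∀ f, jac P f g h = 0 := by
    intro g h hyp f
    ext u
    have := tangent_eq_zero_of_slice hq1 (derAt_tangent u (jacDer P g h)) fun F f hF => by
      rw [derAt_apply, jacDer_apply hPb, ← jac_rotate, hyp F f hF]; rfl
    have h1 := DFunLike.congr_fun this f
    rw [derAt_apply, jacDer_apply hPb] at h1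
    rw [jac_rotate]
    exact h1
  refine ext1 g h (fun F f' hF => ?_) f
  rw [jac_rotate]
  refine ext1 h _ (fun G g' hG => ?_) g
  rw [jac_rotate]
  refine ext1 _ _ (fun H h' hH => ?_) h
  exact h3 _ _ _ _ _ _ hH hF hG

theorem isPoisson_loc (hqn : ∀ k : ℕ, 1 ≤ k → k ≤ n → q ^ k ≠ 1) (z₀ : ℂ) (z : Param d)
    {B : Bider (LocRing n d q)}
    (hB : IsReduction (Set.Subset.refl _) (permRel n d q) (bracketLoc hV hq1 z₀ z) B) : IsPoisson B :=
  IsReduction.isPoisson exists_lift_loc hB (bracketLoc_isBivector hV hq1 z₀ z)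
    fun F G H _ _ _ _ _ _ y => by rw [jac_bracketLoc hV hq1 hqn]; rfl

theorem bracketPsi_add (z z' : Param d) : bracketPsi hV (z + z') = bracketPsi hV z + bracketPsi hV z' := by
  simp only [bracketPsi, Pi.add_apply, add_smul, sum_add_distrib]

theorem bracketPsi_smul (c : ℂ) (z : Param d) : bracketPsi hV (c • z) = c • bracketPsi hV z := by
  simp only [bracketPsi, Pi.smul_apply, smul_eq_mul, mul_smul, smul_sum]

theorem isReduction_bracketLoc {B₀ : Bider (LocRing n d q)} {Ψ : Param d → Bider (LocRing n d q)}
    (h₀ : IsLocalZero q B₀) (hΨ : ∀ z, IsLocalPsi q z (Ψ z)) (z₀ : ℂ) (z : Param d) :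
    IsReduction (Set.Subset.refl _) (permRel n d q) (bracketLoc hV hq1 z₀ z) (z₀ • B₀ + Ψ z) :=
  (((isLocalZero_iff hV hq1 B₀).1 h₀).smul z₀).add ((isLocalPsi_iff hV z _).1 (hΨ z))

theorem isPoissonPencil_loc (hV : IsOpen (projSet n d q)) (hq1 : q ≠ 1)
    (hqn : ∀ k : ℕ, 1 ≤ k → k ≤ n → q ^ k ≠ 1) {B₀ : Bider (LocRing n d q)}
    {Ψ : Param d → Bider (LocRing n d q)} (h₀ : IsLocalZero q B₀) (hΨ : ∀ z, IsLocalPsi q z (Ψ z)) :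
    IsPoissonPencil (pencil B₀ Ψ) := by
  intro s c
  obtain ⟨z₀, z, h⟩ :=
    sum_pencil (bracketZero hV hq1) (bracketPsi hV) (bracketPsi_add hV) (bracketPsi_smul hV) s c
  refine isPoisson_loc hV hq1 hqn z₀ z ?_
  rw [bracketLoc, ← h]
  refine IsReduction.sum s fun j _ => IsReduction.smul ?_ _
  cases j with
  | none => exact (isLocalZero_iff hV hq1 B₀).1 h₀
  | some z => exact (isLocalPsi_iff hV z _).1 (hΨ z)

end LocalJacobi

/-! ### Non-degeneracy on the local phase space -/

section Nondegeneracy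

open Matrix

variable {n d : ℕ} {q : ℂ}

/-- The pairing of a spin covector, recovered from its moment `N`, with a vector. -/
theorem spin_pairing {w v gv gw dv dw : Fin n → ℂ} {N μ' : Mat n} {e : ℂ}
    (hμ : μ' * (1 + vecMulVec w v) = 1) (hw : (1 + v ⬝ᵥ w) • gv = N *ᵥ w) (hv : gw = v ᵥ* N - e • v)
    (he : v ⬝ᵥ gv = e) (hs : 1 + v ⬝ᵥ w ≠ 0) :
    gv ⬝ᵥ dv + gw ⬝ᵥ dw = trace (N * (μ' * (vecMulVec dw v + vecMulVec w dv))) := by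
  have h1 : (1 + v ⬝ᵥ w) • (μ' *ᵥ w) = w := by
    have h := congrArg (· *ᵥ w) hμ
    simp only [← mulVec_mulVec, add_mulVec, one_mulVec, vecMulVec_mulVec] at h
    rw [add_smul, one_smul, ← mulVec_smul, ← mulVec_add]
    rwa [op_smul_eq_smul] at h
  have h2 : N *ᵥ (μ' *ᵥ w) = gv := by
    refine smul_right_injective _ hs ?_
    change (1 + v ⬝ᵥ w) • _ = (1 + v ⬝ᵥ w) • _
    rw [← mulVec_smul, h1, hw]
  have h3 : v ᵥ* (N * μ') = gw := by
    have h : (v ᵥ* (N * μ')) ᵥ* (1 + vecMulVec w v) = v ᵥ* N := by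
      rw [vecMul_vecMul, mul_assoc, hμ, mul_one]
    rw [vecMul_add, vecMul_one, vecMul_vecMulVec, ← dotProduct_mulVec, ← mulVec_mulVec, h2, he] at h
    rw [hv, ← h, add_sub_cancel_right]
  rw [mul_add, mul_add, trace_add, mul_vecMulVec, mul_vecMulVec, mul_vecMulVec, mul_vecMulVec, h2,
    trace_vecMulVec, trace_vecMulVec, mulVec_mulVec, ← h3, ← dotProduct_mulVec, dotProduct_comm v]
  ring

/-- The linear algebra behind the non-degeneracy: `δX`, `δZ`, `δK` solve the linearization of the
equation `X Z = q K Z X`. -/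
theorem level_pairing {X X' Z Z' K K' gX gZ N₀ N₁ N₂ ξ δX δZ δK : Mat n}
    (hX : X * X' = 1) (hZ : Z * Z' = 1) (hK : K * K' = 1) (hE : X * Z = q • (K * Z * X))
    (hδ : δX * Z + X * δZ = q • (δK * Z * X + K * δZ * X + K * Z * δX))
    (h1 : X * N₁ = -(ξ * X)) (h2 : N₁ * Z = Z * N₂) (h0 : -(ξ * K) = K * N₀)
    (hgX : gX * X = N₂ - N₁) (hgZ : Z * gZ = N₀ - N₁) :
    trace (gX * δX) + trace (gZ * δZ) + trace (N₀ * (K' * δK)) = 0 := by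
  have hX' := mul_eq_one_comm.1 hX
  have hZ' := mul_eq_one_comm.1 hZ
  have hK' := mul_eq_one_comm.1 hK
  have e0 : N₀ = -(K' * ξ * K) := by
    calc N₀ = K' * K * N₀ := by rw [hK', one_mul]
      _ = K' * -(ξ * K) := by rw [h0, mul_assoc]
      _ = _ := by noncomm_ring
  have e1 : N₁ = -(X' * ξ * X) := by
    calc N₁ = X' * X * N₁ := by rw [hX', one_mul]
      _ = X' * -(ξ * X) := by rw [← h1, mul_assoc]
      _ = _ := by noncomm_ring
  have e2 : N₂ = Z' * N₁ * Z := by rw [mul_assoc, h2, ← mul_assoc, hZ', one_mul]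
  have eX : gX = (N₂ - N₁) * X' := by rw [← hgX, mul_assoc, hX, mul_one]
  have eZ : gZ = Z' * (N₀ - N₁) := by rw [← hgZ, ← mul_assoc, hZ', one_mul]
  -- the inverse of the equation `X Z = q K Z X`
  have hI : q • (Z' * X') = X' * Z' * K' := by
    calc q • (Z' * X') = X' * Z' * K' * (q • (K * Z * X)) * (Z' * X') := by
          rw [mul_smul_comm, smul_mul_assoc]
          congr 1
          calc Z' * X' = X' * (Z' * (K' * K) * Z) * X * (Z' * X') := by
                rw [hK', mul_one, hZ', mul_one, hX', one_mul]
            _ = _ := by noncomm_ring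
      _ = X' * Z' * K' * (X * (Z * Z') * X') := by rw [← hE]; noncomm_ring
      _ = _ := by rw [hZ, mul_one, hX, mul_one]
  have cX : ∀ A, X * (X' * A) = A := fun A => by rw [← mul_assoc, hX, one_mul]
  have cZ : ∀ A, Z * (Z' * A) = A := fun A => by rw [← mul_assoc, hZ, one_mul]
  have cK : ∀ A, K * (K' * A) = A := fun A => by rw [← mul_assoc, hK, one_mul]
  have hM : δX * X' + X * (δZ * (Z' * X')) =
      δK * K' + K * (δZ * (Z' * K')) + K * (Z * (δX * (X' * (Z' * K')))) := by
    have h := congrArg (· * (Z' * X')) hδ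
    simp only [smul_mul_assoc] at h
    rw [← mul_smul_comm, hI] at h
    simpa only [add_mul, mul_assoc, cX, cZ] using h
  have t : ∀ A B : Mat n, trace (A * (ξ * B)) = trace (ξ * (B * A)) := fun A B => by
    rw [trace_mul_comm, mul_assoc]
  have eX' : gX * δX = X' * (ξ * δX) - X' * Z' * K' * (ξ * (K * (Z * δX))) := by
    calc gX * δX = X' * (ξ * (X * (X' * δX))) - Z' * X' * (ξ * (X * Z * (X' * δX))) := by
          rw [eX, e2, e1]; noncomm_ring
      _ = X' * (ξ * δX) - q • (Z' * X') * (ξ * (K * (Z * (X * (X' * δX))))) := by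
          rw [cX, hE]
          simp only [smul_mul_assoc, mul_smul_comm, mul_assoc, cX]
      _ = _ := by rw [cX, hI]
  have eZ' : gZ * δZ = Z' * X' * (ξ * (X * δZ)) - Z' * K' * (ξ * (K * δZ)) := by
    rw [eZ, e0, e1]; noncomm_ring
  have eK' : N₀ * (K' * δK) = -(K' * (ξ * δK)) := by rw [e0, neg_mul, mul_assoc, mul_assoc, cK]
  rw [eX', eZ', eK', trace_sub, trace_sub, trace_neg, t, t, t, t, t]
  have h := congrArg (fun M => trace (ξ * M)) hM
  simp only [mul_add, trace_add, mul_assoc] at h ⊢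
  linear_combination h

theorem one_add_dot_ne_zero {y : RVec n d} (hy : y ∈ repSpace n d) (α : Fin d) :
    1 + rowV y α ⬝ᵥ colW y α ≠ 0 := by
  have h := hy.2.2 α
  rwa [matWV_eq, vecMulVec_eq Unit, det_one_add_replicateCol_mul_replicateRow] at h

/-- An invariant covector of vanishing scaling weights whose Hamiltonian vector is tangent to the orbit
vanishes on the level set. -/
theorem pair_eq_zero_of_hamVec {y : RVec n d} (hy : y ∈ levelSet n d q) {ζ : RVec n d}
    (hζ : IsBasic y ζ) (hs : ∀ α, scalePt y ζ α = 0) {ξ : Mat n}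
    (h : hamVec y ζ = gaugeVec y ξ) {δ : RVec n d} (hδ : dLevel q y δ = 0) : pair ζ δ = 0 := by
  obtain ⟨hr, hE⟩ := (mem_levelSet_iff q y).1 hy
  have hμ := isUnit_muN hr
  have hK := isUnit_kprod hμ
  set N : ℕ → Mat n := fun k => momSum y ζ (4 + k) - ξ with hN
  have htr : ∀ m ≤ d, trace (momSum y ζ (4 + m)) = 0 := fun m hm => by
    rw [trace_momSum y ζ m hm, sum_eq_zero fun β _ => hs β]
  have hNK : ∀ k ≤ d, N k * kprod (muN y) k = kprod (muN y) k * N 0 := by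
    intro k hk
    have h1 := dK_hamVec y ζ k hk
    rw [h, dK_gaugeVec y ξ k hk] at h1
    rw [hN]
    change (momSum y ζ (4 + k) - ξ) * _ = _ * (momSum y ζ 4 - ξ)
    rw [sub_mul, mul_sub]
    linear_combination (norm := noncomm_ring) -h1
  have hspin : ∀ α : Fin d, rowV ζ α ⬝ᵥ rowV δ α + colW ζ α ⬝ᵥ colW δ α =
      trace (N 0 * ((kprod (muN y) (α + 1))⁻¹ * dmu y δ α * kprod (muN y) α)) := by
    intro α
    have hm : muN y α = 1 + vecMulVec (colW y α) (rowV y α) := by rw [muN, dif_pos α.2]; rfl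
    have hsα : colW y α ⬝ᵥ colW ζ α = rowV y α ⬝ᵥ rowV ζ α := sub_eq_zero.1 (hs α)
    have h1 : rowV (hamVec y ζ) α = -(rowV y α ᵥ* ξ) := by rw [h]; rfl
    have h2 : colW (hamVec y ζ) α = ξ *ᵥ colW y α := by rw [h]; rfl
    rw [rowV_hamVec] at h1
    rw [colW_hamVec] at h2
    rw [htr _ α.2.le, zero_smul] at h1 h2
    rw [dotProduct_comm (colW ζ α), hsα] at h2
    have := spin_pairing (N := N α) (μ' := (muN y α)⁻¹) (e := rowV y α ⬝ᵥ rowV ζ α) (dv := rowV δ α)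
      (dw := colW δ α) (gv := rowV ζ α) (gw := colW ζ α)
      (by rw [← hm, nonsing_inv_mul _ (hμ α)])
      (by rw [hN]; simp only [sub_mulVec]; rw [← h2]; abel)
      (by rw [hN]; simp only [vecMul_sub]; rw [← sub_eq_zero] at h1 ⊢; rw [← h1]; abel) rfl
      (one_add_dot_ne_zero hr α)
    rw [this, dmu, dif_pos α.2]
    have hk := hNK α α.2.le
    have e1 : (kprod (muN y) (α + 1))⁻¹ = (kprod (muN y) α)⁻¹ * (muN y α)⁻¹ := by
      rw [kprod, Matrix.mul_inv_rev]
    have e2 : N α = kprod (muN y) α * N 0 * (kprod (muN y) α)⁻¹ := by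
      rw [← hk, mul_assoc, mul_nonsing_inv _ (hK α), mul_one]
    rw [e1, e2, mul_assoc, mul_assoc, trace_mul_comm]
    simp only [mul_assoc]
  have hsum : ∑ α : Fin d, trace (N 0 * ((kprod (muN y) (α + 1))⁻¹ * dmu y δ α * kprod (muN y) α)) =
      trace (N 0 * ((kprod (muN y) d)⁻¹ * dK y δ d)) := by
    rw [dK_eq hr, ← mul_assoc _ (kprod _ _), nonsing_inv_mul _ (hK d), one_mul, mul_sum, trace_sum,
      sum_range]
  rw [pair_RSCoord, sum_congr rfl fun α _ => hspin α, hsum]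
  have hx : matX (hamVec y ζ) = ξ * matX y - matX y * ξ := by rw [h]; rfl
  have hz : matZ (hamVec y ζ) = ξ * matZ y - matZ y * ξ := by rw [h]; rfl
  rw [matX_hamVec] at hx
  rw [matZ_hamVec] at hz
  have h0 : momSum y ζ (4 + d) = 0 := hζ
  refine level_pairing (X := matX y) (Z := matZ y) (K := kprod (muN y) d) (q := q)
    (N₁ := momSum y ζ 3 - ξ) (N₂ := momSum y ζ 2 - ξ) (ξ := ξ)
    (mul_nonsing_inv _ (isUnit_iff_ne_zero.2 hr.1)) (mul_nonsing_inv _ (isUnit_iff_ne_zero.2 hr.2.1))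
    (mul_nonsing_inv _ (hK d)) (sub_eq_zero.1 hE) (sub_eq_zero.1 hδ) ?_ ?_ ?_ ?_ ?_
  · rw [mul_sub]; linear_combination (norm := noncomm_ring) -hx
  · rw [mul_sub, sub_mul]; linear_combination (norm := noncomm_ring) hz
  · rw [← hNK d le_rfl, hN]
    simp only [h0, zero_sub, neg_mul]
  · rw [momSum_two, momSum_three]; noncomm_ring
  · rw [hN, momSum_three]
    change _ = momSum y ζ 4 - ξ - _
    rw [momSum_four]; noncomm_ring

/-- The covector with components `W_γ`, `V_γ` at `γ`, the differential of `V_γ W_γ`. -/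
def spinCov (y : RVec n d) (γ : Fin d) : RVec n d :=
  mkVec 0 0 (Pi.single γ (colW y γ)) (Pi.single γ (rowV y γ))

theorem actPt_spinCov (y : RVec n d) (γ : Fin d) (k : ℕ) : actPt y (spinCov y γ) k = 0 := by
  have hX : gradX (spinCov y γ) = 0 := rfl
  have hZ : gradZ (spinCov y γ) = 0 := rfl
  match k with
  | 0 => rw [actPt, hX, mul_zero]
  | 1 => rw [actPt, hZ, zero_mul, neg_zero]
  | 2 => rw [actPt, hX, zero_mul, neg_zero]
  | 3 => rw [actPt, hZ, mul_zero]
  | k + 4 =>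
    rw [actPt]
    split_ifs with hk
    · change vecMulVec _ ((Pi.single γ (rowV y γ) : Fin d → Fin n → ℂ) ⟨k, hk⟩) -
        vecMulVec ((Pi.single γ (colW y γ) : Fin d → Fin n → ℂ) ⟨k, hk⟩) _ = 0
      by_cases h : (⟨k, hk⟩ : Fin d) = γ
      · subst h; simp
      · rw [Pi.single_eq_of_ne h, Pi.single_eq_of_ne h, vecMulVec_zero, zero_vecMulVec, sub_zero]
    · rfl

theorem hamVec_spinCov (y : RVec n d) (γ : Fin d) : hamVec y (spinCov y γ) =
    -(1 + rowV y γ ⬝ᵥ colW y γ) • scaleVec y γ := by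
  have hm : ∀ k, momSum y (spinCov y γ) k = 0 := fun k => sum_eq_zero fun j _ => actPt_spinCov y γ j
  have hv : ∀ α, rowV (spinCov y γ) α = (Pi.single γ (colW y γ) : Fin d → Fin n → ℂ) α := fun _ => rfl
  have hw : ∀ α, colW (spinCov y γ) α = (Pi.single γ (rowV y γ) : Fin d → Fin n → ℂ) α := fun _ => rfl
  have e : ∀ α, α ≠ γ → rowV (spinCov y γ) α = 0 ∧ colW (spinCov y γ) α = 0 := fun α h => by
    rw [hv, hw, Pi.single_eq_of_ne h, Pi.single_eq_of_ne h]; exact ⟨rfl, rfl⟩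
  funext c
  cases c with
  | X i j => simp [hamVec, mkVec, hm, scaleVec]
  | Z i j => simp [hamVec, mkVec, hm, scaleVec]
  | V α j =>
    by_cases h : α = γ
    · subst h; simp [hamVec, mkVec, hm, scaleVec, hv, hw]; ring
    · simp [hamVec, mkVec, hm, scaleVec, e α h, Pi.single_eq_of_ne h]
  | W α j =>
    by_cases h : α = γ
    · subst h; simp [hamVec, mkVec, hm, scaleVec, hv, hw]; ring
    · simp [hamVec, mkVec, hm, scaleVec, e α h, Pi.single_eq_of_ne h]

/-- The Hamiltonian vector of a covector `ζ` for the bracket `z₀ P + ψ_z`. -/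
def combVec (z₀ : ℂ) (z : Param d) (y ζ : RVec n d) : RVec n d :=
  z₀ • hamVec y ζ + ∑ p : {p : Fin d × Fin d // p.1 < p.2}, z p •
    (scalePt y ζ p.1.2 • scaleVec y p.1.1 - scalePt y ζ p.1.1 • scaleVec y p.1.2)

theorem scalePt_spinCov (y : RVec n d) (γ α : Fin d) : scalePt y (spinCov y γ) α = 0 := by
  rw [← trace_actPt_spin, actPt_spinCov, trace_zero]

/-- The functions `V_γ W_γ` have Hamiltonian vectors proportional to the scalings, which forces `ζ`
to vanish on the scalings; then the terms of `ψ_z` drop out. -/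
theorem pair_eq_zero_of_combVec {z₀ : ℂ} (hz₀ : z₀ ≠ 0) (z : Param d) {y : RVec n d}
    (hy : y ∈ levelSet n d q) {ζ : RVec n d} (hζ : IsBasic y ζ) {ξ : Mat n}
    (h : combVec z₀ z y ζ = gaugeVec y ξ) {δ : RVec n d} (hδ : dLevel q y δ = 0) :
    pair ζ δ = 0 := by
  have hb : ∀ γ, IsBasic y (spinCov y γ) := fun γ => sum_eq_zero fun j _ => actPt_spinCov y γ j
  have hs : ∀ γ, scalePt y ζ γ = 0 := by
    intro γ
    have h1 : pair (spinCov y γ) (combVec z₀ z y ζ) = 0 := by rw [h, (isBasic_iff _ _).1 (hb γ)]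
    have h2 : pair (spinCov y γ) (combVec z₀ z y ζ) = z₀ * pair (spinCov y γ) (hamVec y ζ) := by
      rw [combVec, pair_add_right, pair_smul_right, pair_sum_right, sum_eq_zero, add_zero]
      intro p _
      rw [pair_smul_right, sub_eq_add_neg, ← neg_smul, pair_add_right, pair_smul_right, pair_smul_right,
        pair_scaleVec, pair_scaleVec, scalePt_spinCov, scalePt_spinCov]
      ring
    rw [h2, pair_hamVec_antisymm hy.1 (hb γ) hζ, hamVec_spinCov, pair_smul_right, pair_scaleVec] at h1
    have h3 : z₀ * (1 + rowV y γ ⬝ᵥ colW y γ) * scalePt y ζ γ = 0 := by rw [← h1]; ring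
    exact (mul_eq_zero.1 h3).resolve_left (mul_ne_zero hz₀ (one_add_dot_ne_zero hy.1 γ))
  have h4 : hamVec y ζ = gaugeVec y (z₀⁻¹ • ξ) := by
    have h5 : z₀ • hamVec y ζ = gaugeVec y ξ := by
      rw [← h, combVec]
      simp [hs]
    have h6 : gaugeVec y (z₀⁻¹ • ξ) = z₀⁻¹ • gaugeVec y ξ := by
      funext c
      cases c <;> simp [gaugeVec, mkVec, mul_sub, Matrix.vecMul_smul, Matrix.smul_mulVec]
    rw [h6, ← h5, smul_smul, inv_mul_cancel₀ hz₀, one_smul]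
  exact pair_eq_zero_of_hamVec hy hζ hs h4 hδ

end Nondegeneracy

/-! ### The quotient by the symmetric group -/

section Galois

variable {n d : ℕ} {q : ℂ}

/-- A bivector on `U` is non-degenerate at a point if the functions without Hamiltonian vector there
have no differential. -/
theorem exists_hamiltonian {ι : Type} [Fintype ι] {U : Set (ι → ℂ)} {P : Bider (Reg U)} (u : U)
    (hker : ∀ F, (∀ g, (P g F).1 u = 0) → ∀ v, IsTangentVector (Reg U) u v → v F = 0)
    {v : Reg U →ₗ[ℂ] ℂ} (hv : IsTangentVector (Reg U) u v) : ∃ f, ∀ g, v g = (P f g).1 u := by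
  let T : Reg U →ₗ[ℂ] (ι → ℂ) :=
    { toFun := fun f c => (P f (coordFn U c)).1 u
      map_add' := fun f g => by funext c; rw [map_add]; rfl
      map_smul' := fun a f => by funext c; rw [Derivation.map_smul]; rfl }
  have hmem : (fun c => v (coordFn U c)) ∈ LinearMap.range T := by
    by_contra hnot
    obtain ⟨φ, hφ, hφ'⟩ := Submodule.exists_dual_map_eq_bot_of_notMem hnot inferInstance
    have hφs : ∀ w : ι → ℂ, φ w = ∑ c, φ (dirVec c) * w c := fun w => by
      conv_lhs => rw [eq_sum_dirVec w]
      rw [map_sum]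
      exact sum_congr rfl fun c _ => by rw [map_smul, smul_eq_mul, mul_comm]
    let F : Reg U := ∑ c, φ (dirVec c) • coordFn U c
    have hF : ∀ w : Reg U →ₗ[ℂ] ℂ, w F = φ fun c => w (coordFn U c) := fun w => by
      rw [hφs, map_sum]
      exact sum_congr rfl fun c _ => by rw [map_smul, smul_eq_mul]
    refine hφ ?_
    rw [← hF]
    refine hker F (fun g => ?_) v hv
    have h1 := hF (derAt u (P g))
    rw [derAt_apply] at h1
    rw [h1]
    have h2 : φ (T g) ∈ (LinearMap.range T).map φ := ⟨_, ⟨g, rfl⟩, rfl⟩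
    rw [hφ'] at h2
    exact h2
  obtain ⟨f, hf⟩ := hmem
  exact ⟨f, fun g => DFunLike.congr_fun (tangent_ext hv (derAt_tangent u (P f)) fun c =>
    (congrFun hf c).symm) g⟩

theorem permPt_permPt (σ τ : Equiv.Perm (Fin n)) (u : hreg n d q) :
    permPt σ (permPt τ u) = permPt (τ * σ) u := by
  refine Subtype.ext (funext fun c => ?_)
  cases c <;> rfl

theorem permPt_one (u : hreg n d q) : permPt 1 u = u := Subtype.ext (funext fun c => by cases c <;> rfl)

/-- The sum of the translates of a function under the symmetric group. -/
def locTr : HRing n d q →ₗ[ℂ] LocRing n d q where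
  toFun F := ⟨Quot.lift (fun u => ∑ σ, F.1 (permPt σ u)) (by
      rintro u v ⟨τ, hτ⟩
      have hv : v = permPt τ u := Subtype.ext hτ
      simp only [hv, permPt_permPt]
      exact (Fintype.sum_equiv (Equiv.mulLeft τ) _ _ fun σ => rfl).symm),
    Reg.sum_mem' _ fun σ _ => (permFn σ F).2⟩
  map_add' F G := by
    ext y
    induction y using Quot.ind
    exact sum_add_distrib
  map_smul' c F := by
    ext y
    induction y using Quot.ind
    exact (mul_sum _ _ _).symm

theorem locTr_apply (F : HRing n d q) (u : hreg n d q) :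
    (locTr F).1 (Quot.mk _ u) = ∑ σ, F.1 (permPt σ u) := rfl

/-- The pullback of functions on the quotient. -/
def locPull : LocRing n d q →ₗ[ℂ] HRing n d q where
  toFun f := ⟨_, f.2⟩
  map_add' _ _ := rfl
  map_smul' _ _ := rfl

theorem locPull_perm (f : LocRing n d q) (σ : Equiv.Perm (Fin n)) (u : hreg n d q) :
    (locPull f).1 (permPt σ u) = f.1 (Quot.mk _ u) :=
  congrArg f.1 (Quot.sound ⟨σ, rfl⟩ : Quot.mk (permRel n d q) u = Quot.mk _ (permPt σ u)).symm

theorem locTr_mul_locPull (F : HRing n d q) (f : LocRing n d q) : locTr (F * locPull f) = locTr F * f := by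
  ext y
  induction y using Quot.ind with
  | mk u =>
    change ∑ σ, F.1 (permPt σ u) * (locPull f).1 (permPt σ u) = (∑ σ, F.1 (permPt σ u)) * f.1 (Quot.mk _ u)
    rw [sum_mul]
    exact sum_congr rfl fun σ _ => by rw [locPull_perm]

/-- The action of the symmetric group is free, as the `x_i` are distinct: hence the quotient map is a
Galois covering, and there are elements as in the Galois theory of commutative rings. -/
theorem exists_galois_elements (s : Finset (Equiv.Perm (Fin n))) (hs : 1 ∉ s) :
    ∃ (K : Type) (_ : Fintype K) (a b : K → HRing n d q),
      (∀ u, ∑ k, (a k).1 u * (b k).1 u = 1) ∧ ∀ σ ∈ s, ∀ u, ∑ k, (a k).1 u * (b k).1 (permPt σ u) = 0 := by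
  classical
  induction s using Finset.induction_on with
  | empty => exact ⟨Unit, inferInstance, 1, 1, fun u => by simp, fun σ h => by simp at h⟩
  | insert τ s hτ ih =>
    obtain ⟨K, _, a, b, h1, h2⟩ := ih fun h => hs (mem_insert_of_mem h)
    have hne : τ ≠ 1 := fun h => hs (h ▸ mem_insert_self _ _)
    obtain ⟨i, hi⟩ : ∃ i, τ i ≠ i := by
      by_contra! h
      exact hne (Equiv.ext h)
    have hx : ∀ u : hreg n d q, u.1 (.x i) - u.1 (.x (τ i)) ≠ 0 := fun u =>
      sub_ne_zero.2 (u.2.2.1 _ _ hi.symm).1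
    let X : HRing n d q := coordFn _ (.x i)
    let R : HRing n d q := ⟨_, Reg.inv_mem (reg_sub (hcoord_mem (.x i)) (hcoord_mem (.x (τ i)))) hx⟩
    let a' : Bool → HRing n d q := fun e => if e then R else -(R * coordFn _ (.x (τ i)))
    let b' : Bool → HRing n d q := fun e => if e then X else 1
    have hs' : ∀ u v : hreg n d q, ∑ k : K × Bool, (a k.1 * a' k.2).1 u * (b k.1 * b' k.2).1 v =
        (∑ k, (a k).1 u * (b k).1 v) *
          ((u.1 (.x i) - u.1 (.x (τ i)))⁻¹ * (v.1 (.x i) - u.1 (.x (τ i)))) := by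
      intro u v
      rw [Fintype.sum_prod_type, sum_mul]
      refine sum_congr rfl fun k _ => ?_
      rw [Fintype.sum_bool]
      change (a k).1 u * (u.1 (.x i) - u.1 (.x (τ i)))⁻¹ * ((b k).1 v * v.1 (.x i)) +
        (a k).1 u * -((u.1 (.x i) - u.1 (.x (τ i)))⁻¹ * u.1 (.x (τ i))) * ((b k).1 v * 1) = _
      ring
    refine ⟨K × Bool, inferInstance, fun k => a k.1 * a' k.2, fun k => b k.1 * b' k.2, fun u => ?_,
      fun σ hσ u => ?_⟩
    · rw [hs', h1, inv_mul_cancel₀ (hx u), mul_one]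
    · rw [hs']
      rcases mem_insert.1 hσ with rfl | h
      · change _ * (_ * (u.1 (.x (σ i)) - u.1 (.x (σ i)))) = 0
        rw [sub_self, mul_zero, mul_zero]
      · rw [h2 σ h, zero_mul]

theorem tangent_permFn {u : hreg n d q} {w : HRing n d q →ₗ[ℂ] ℂ} (hw : IsTangentVector (HRing n d q) u w)
    (σ : Equiv.Perm (Fin n)) (F G : HRing n d q) : w (permFn σ (F * G)) =
      F.1 (permPt σ u) * w (permFn σ G) + G.1 (permPt σ u) * w (permFn σ F) :=
  comapReg_tangent (permPt σ) (permPt_mem σ) hw F G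

/-- The quotient map is étale: tangent vectors of the quotient extend, and every differential is the
differential of an invariant function. -/
theorem exists_extension_tangent (u : hreg n d q) :
    (∀ v, IsTangentVector (LocRing n d q) (Quot.mk _ u) v →
      ∃ v', IsTangentVector (HRing n d q) u v' ∧ ∀ f, v' (locPull f) = v f) ∧
      ∀ F : HRing n d q, ∃ f : LocRing n d q, ∀ w, IsTangentVector (HRing n d q) u w →
        w (locPull f) = w F := by
  obtain ⟨K, _, a, b, h1, h2⟩ := exists_galois_elements (n := n) (d := d) (q := q)
    (univ.erase 1) (Finset.notMem_erase _ _)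
  have h2' : ∀ σ, σ ≠ 1 → ∀ u, ∑ k, (a k).1 u * (b k).1 (permPt σ u) = 0 := fun σ hσ =>
    h2 σ (mem_erase.2 ⟨hσ, mem_univ _⟩)
  -- `β` and `β'` are `1` at `u`, and `β` vanishes at the other points of the orbit
  let β : HRing n d q := ∑ k, (a k).1 u • b k
  let β' : HRing n d q := ∑ k, (b k).1 u • a k
  have hβ : ∀ w, β.1 w = ∑ k, (a k).1 u * (b k).1 w := fun w => by
    rw [← evalReg_apply, map_sum]; rfl
  have hβ1 : β.1 u = 1 := (hβ u).trans (h1 u)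
  have hβσ : ∀ σ, σ ≠ 1 → β.1 (permPt σ u) = 0 := fun σ hσ => (hβ _).trans (h2' σ hσ u)
  have hval : ∀ F : HRing n d q, (locTr (β * F)).1 (Quot.mk _ u) = F.1 u := by
    intro F
    rw [locTr_apply, sum_eq_single 1]
    · change β.1 _ * F.1 _ = _
      rw [permPt_one, hβ1, one_mul]
    · intro σ _ hσ
      change β.1 _ * F.1 _ = 0
      rw [hβσ σ hσ, zero_mul]
    · exact fun h => absurd (mem_univ _) h
  have hbval : ∀ (k : K) (F : HRing n d q), (locTr (b k * (β * F))).1 (Quot.mk _ u) = (b k).1 u * F.1 u :=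
    fun k F => by rw [mul_left_comm, hval]; rfl
  have haval : ∀ (k : K) (F : HRing n d q), (locTr (a k * (β * F))).1 (Quot.mk _ u) = (a k).1 u * F.1 u :=
    fun k F => by rw [mul_left_comm, hval]; rfl
  have hcas : ∀ P R : HRing n d q, locTr (P * R) = ∑ k, locTr (b k * P) * locTr (a k * R) := by
    intro P R
    ext y
    induction y using Quot.ind with
    | mk w =>
      have e : (∑ k, locTr (b k * P) * locTr (a k * R)).1 (Quot.mk _ w) =
          ∑ k, (∑ σ, (b k).1 (permPt σ w) * P.1 (permPt σ w)) * ∑ τ, (a k).1 (permPt τ w) * R.1 (permPt τ w) := by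
        rw [AddSubmonoidClass.coe_finsetSum, Finset.sum_apply]
        rfl
      rw [e]
      simp only [sum_mul_sum]
      rw [sum_comm]
      refine sum_congr rfl fun σ _ => ?_
      rw [sum_comm, sum_eq_single σ]
      · have h3 : ∀ k, (b k).1 (permPt σ w) * P.1 (permPt σ w) * ((a k).1 (permPt σ w) * R.1 (permPt σ w)) =
            (a k).1 (permPt σ w) * (b k).1 (permPt σ w) * (P.1 (permPt σ w) * R.1 (permPt σ w)) :=
          fun k => by ring
        simp only [h3]
        rw [← sum_mul, h1, one_mul]
        rfl
      · intro τ _ hτ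
        have h3 : ∀ k, (b k).1 (permPt σ w) * P.1 (permPt σ w) * ((a k).1 (permPt τ w) * R.1 (permPt τ w)) =
            (a k).1 (permPt τ w) * (b k).1 (permPt (τ⁻¹ * σ) (permPt τ w)) *
              (P.1 (permPt σ w) * R.1 (permPt τ w)) := fun k => by
          rw [permPt_permPt, mul_inv_cancel_left]; ring
        simp only [h3]
        rw [← sum_mul, h2' _ (fun h => hτ (inv_mul_eq_one.1 h)), zero_mul]
      · exact fun h => absurd (mem_univ _) h
  refine ⟨fun v hv => ?_, fun F => ?_⟩
  -- the sum over the orbit of `β * β * F` is an invariant function which agrees with `F` at `u`;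
  -- its derivative `lam F` is a tangent vector up to the multiple `lam 1` of the evaluation
  · let lam : HRing n d q →ₗ[ℂ] ℂ := v ∘ₗ locTr ∘ₗ LinearMap.mulLeft ℂ (β * β)
    let lam' : HRing n d q →ₗ[ℂ] ℂ := v ∘ₗ locTr ∘ₗ LinearMap.mulLeft ℂ (β' * β)
    have hl : ∀ F, lam F = v (locTr (β * β * F)) := fun _ => rfl
    have hl' : ∀ F, lam' F = v (locTr (β' * β * F)) := fun _ => rfl
    have hs : ∀ (c : K → ℂ) (e : K → HRing n d q) (F : HRing n d q),
        ∑ k, c k * v (locTr (e k * F)) = v (locTr ((∑ k, c k • e k) * F)) := by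
      intro c e F
      rw [sum_mul, map_sum, map_sum]
      exact sum_congr rfl fun k _ => by rw [smul_mul_assoc, map_smul, map_smul, smul_eq_mul]
    have hmul : ∀ F G, lam (F * G) = F.1 u * lam' G + G.1 u * lam F := by
      intro F G
      have e1 : β * β * (F * G) = (β * F) * (β * G) := by ring
      rw [hl, e1, hcas, map_sum, sum_congr rfl fun k _ => hv _ _]
      simp only [hbval, haval]
      rw [sum_add_distrib, hl, hl', mul_assoc β' β G, mul_assoc β β F, ← hs, ← hs, mul_sum, mul_sum]
      congr 1 <;> exact sum_congr rfl fun k _ => by ring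
    have hl1 : lam' 1 = 0 := by
      have h := hmul 1 1
      have e : (1 : HRing n d q).1 u = 1 := rfl
      rw [mul_one, e] at h
      linear_combination -h
    have hrel : ∀ G, lam' G = lam G - G.1 u * lam 1 := by
      intro G
      have h := hmul 1 G
      have e : (1 : HRing n d q).1 u = 1 := rfl
      rw [one_mul, e] at h
      linear_combination -h
    refine ⟨lam', fun F G => ?_, fun f => ?_⟩
    · have e : (F * G).1 u = F.1 u * G.1 u := rfl
      rw [hrel (F * G), hmul, hrel F, e]
      ring
    · have e : (locPull f).1 u = f.1 (Quot.mk _ u) := rfl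
      have h3 : (locTr (β * β)).1 (Quot.mk _ u) = 1 := (hval β).trans hβ1
      rw [hrel, hl, hl, locTr_mul_locPull, mul_one, hv, h3, e]
      ring
  · let F₀ : HRing n d q := β * (β * (F - algebraMap ℂ _ (F.1 u)))
    refine ⟨locTr F₀, fun w hw => ?_⟩
    have e : locPull (locTr F₀) = ∑ σ, permFn σ F₀ := by
      ext y
      rw [← evalReg_apply y (∑ σ, _), map_sum]
      rfl
    have hw1 : w (algebraMap ℂ _ (F.1 u)) = 0 := by
      rw [Algebra.algebraMap_eq_smul_one, map_smul, tangent_one hw, smul_zero]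
    rw [e, map_sum, sum_eq_single 1]
    · have e0 : (F - algebraMap ℂ (HRing n d q) (F.1 u)).1 u = 0 := sub_self (F.1 u)
      have e1 : (β * (F - algebraMap ℂ (HRing n d q) (F.1 u))).1 u = 0 := by
        change β.1 u * (F - algebraMap ℂ (HRing n d q) (F.1 u)).1 u = 0
        rw [e0, mul_zero]
      have e2 : permFn 1 F₀ = F₀ := by
        ext y
        change F₀.1 (permPt 1 y) = _
        rw [permPt_one]
      rw [e2, hw, hw, e0, e1, hβ1, map_sub, hw1]
      ring
    · intro σ _ hσ
      have e1 : (β * (F - algebraMap ℂ (HRing n d q) (F.1 u))).1 (permPt σ u) = 0 := by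
        change β.1 _ * _ = 0
        rw [hβσ σ hσ, zero_mul]
      rw [tangent_permFn hw, hβσ σ hσ, e1, zero_mul, zero_mul, add_zero]
    · exact fun h => absurd (mem_univ _) h

variable (hV : IsOpen (projSet n d q)) (hq1 : q ≠ 1)

theorem bracketLoc_at (z₀ : ℂ) (z : Param d) (f g : HRing n d q) (u : hreg n d q) :
    (bracketLoc hV hq1 z₀ z f g).1 u = pair (hgrad hV f u)
      (rho q u.1 (combVec z₀ z (sliceVec q u.1) (rhoT q u.1 (hgrad hV g u)))) := by
  have h3 : (bracketLoc hV hq1 z₀ z f g).1 u = z₀ * (bracketZero hV hq1 f g).1 u +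
    (bracketPsi hV z f g).1 u := rfl
  have hsub : ∀ a b, pair (hgrad hV f u) (a - b) = pair (hgrad hV f u) a - pair (hgrad hV f u) b :=
    fun a b => dotProduct_sub _ _ _
  have hs : ∀ α, scalePt (sliceVec q u.1) (rhoT q u.1 (hgrad hV g u)) α = (locScale hV α g).1 u := fun α => by
    rw [← pair_scaleVec, pair_rhoT, rho_scaleVec u.2, locScale_at]
  rw [h3, bracketZero_at, bracketPsi_at, omegaForm_eq, hamH, combVec, ← rhoL_apply, ← rhoL_apply, map_add,
    map_smul, map_sum, pair_add_right, pair_smul_right, pair_sum_right]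
  congr 1
  refine sum_congr rfl fun p _ => ?_
  rw [map_smul, map_sub, map_smul, map_smul, rhoL_apply, rhoL_apply, rho_scaleVec u.2, rho_scaleVec u.2, hs,
    hs, pair_smul_right, hsub, pair_smul_right, pair_smul_right, ← locScale_at, ← locScale_at]
  ring

/-- A function with vanishing Hamiltonian vector on the slice lifts to a basic covector whose
Hamiltonian vector is tangent to the gauge orbit. -/
theorem bracketLoc_nondegenerate {z₀ : ℂ} (hz₀ : z₀ ≠ 0) (z : Param d) (u : hreg n d q) (F : HRing n d q)
    (hF : ∀ g, (bracketLoc hV hq1 z₀ z g F).1 u = 0) (v : HRing n d q →ₗ[ℂ] ℂ)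
    (hv : IsTangentVector (HRing n d q) u v) : v F = 0 := by
  obtain ⟨hw, hvw⟩ := eq_hdir hV hv
  set w : HVec n d := fun c => v (coordFn _ c) with hwdef
  set ζ := rhoT q u.1 (hgrad hV F u) with hζ
  set δ := combVec z₀ z (sliceVec q u.1) ζ with hδdef
  have hy := sliceVec_mem hq1 u.2
  have hE := ((mem_levelSet_iff q _).1 hy).2
  have hbas : IsBasic (sliceVec q u.1) ζ := isBasic_rhoT u.2 _
  have hρ : rho q u.1 δ = 0 := by
    funext c
    rw [← hdir_coordFn hV u (rho_tangent u.2 δ) c, hdir_apply, hδdef, ← bracketLoc_at]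
    exact hF _
  have hδ : dLevel q (sliceVec q u.1) δ = 0 := by
    let L : (RVec n d) →ₗ[ℂ] Mat n :=
      { toFun := dLevel q (sliceVec q u.1)
        map_add' := fun a b => by simpa using dLevel_add_smul (sliceVec q u.1) a b 1
        map_smul' := fun c a => by
          have h0 := dLevel_add_smul (q := q) (sliceVec q u.1) 0 0 1
          have h1 := dLevel_add_smul (q := q) (sliceVec q u.1) 0 a c
          rw [one_smul, one_smul, add_zero, left_eq_add] at h0
          simpa [h0] using h1 }
    have hs : ∀ α, L (scaleVec (sliceVec q u.1) α) = 0 := dLevel_scaleVec q hy.1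
    change L δ = 0
    rw [hδdef, combVec, map_add, map_smul, map_sum, show L (hamVec _ ζ) = 0 from dLevel_hamVec hE hbas,
      smul_zero, zero_add]
    exact sum_eq_zero fun p _ => by rw [map_smul, map_sub, map_smul, map_smul, hs, hs]; simp
  have h1 := ds_rho hV hq1 u hδ
  have h0 : ds hV hq1 u (0 : HVec n d) = 0 := by
    funext c
    exact dotProduct_zero _
  rw [hρ, h0] at h1
  have h2 : δ = gaugeVec (sliceVec q u.1) (-compens u.1 δ) := by
    have : gaugeVec (sliceVec q u.1) (-compens u.1 δ) = -gaugeVec (sliceVec q u.1) (compens u.1 δ) := by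
      funext c
      cases c <;> simp [gaugeVec, mkVec, Matrix.vecMul_neg, Matrix.neg_mulVec] <;> ring
    rw [this]
    exact eq_neg_of_add_eq_zero_left h1.symm
  have h3 := pair_eq_zero_of_combVec hz₀ z hy hbas h2 (dLevel_ds hV hq1 u w)
  have h4 : rho q u.1 (ds hV hq1 u w) = w := by
    have hC : compens u.1 (ds hV hq1 u w) = 0 := by
      ext i j
      simp only [compens, Matrix.of_apply, matX_ds hV hq1 u hw, colW_ds hV hq1 u hw, Matrix.zero_apply]
      split_ifs with h
      · have h5 : ∑ k ∈ univ.erase i, Matrix.diagonal (hx w) i k / (u.1 (.x i) - u.1 (.x k)) = 0 :=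
          sum_eq_zero fun k hk => by
            rw [Matrix.diagonal_apply_ne _ (ne_of_mem_erase hk).symm, zero_div]
        rw [h5, sub_zero, neg_eq_zero]
        exact hw i
      · rw [Matrix.diagonal_apply_ne _ h, zero_div]
    funext c
    cases c with
    | x i => simp [rho, matX_ds hV hq1 u hw, hx]
    | a i α => simp [rho, hC, colW_ds hV hq1 u hw, ha]
    | b i α => simp [rho, hC, dB_ds hV hq1 u hw, hb]
  rw [hζ, pair_rhoT, h4] at h3
  rw [hvw, hdir_apply]
  exact h3

theorem isNondegenerate_loc {z₀ : ℂ} (hz₀ : z₀ ≠ 0) (z : Param d) {B : Bider (LocRing n d q)}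
    (hB : IsReduction (Set.Subset.refl _) (permRel n d q) (bracketLoc hV hq1 z₀ z) B) :
    IsNondegenerate B := by
  intro y v hv
  induction y using Quot.ind with
  | mk u =>
    have hP := bracketLoc_isBivector hV hq1 z₀ z
    obtain ⟨hext, hsurj⟩ := exists_extension_tangent u
    obtain ⟨v', hv', hext⟩ := hext v hv
    obtain ⟨F, hF⟩ := exists_hamiltonian u (bracketLoc_nondegenerate hV hq1 hz₀ z u) hv'
    obtain ⟨f, hf⟩ := hsurj F
    refine ⟨f, fun g => ?_⟩
    have h1 := hB (locPull f) (locPull g) f g (fun _ => rfl) (fun _ => rfl) u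
    have h2 := hf (derAt u (bracketLoc hV hq1 z₀ z (locPull g))) (derAt_tangent u _)
    rw [derAt_apply, derAt_apply] at h2
    rw [← hext, hF, ← h1, hP.antisymm, hP.antisymm (locPull f)]
    exact congrArg Neg.neg h2.symm

end Galois

/-! ### The order of the local pencil -/

section LocalOrder

open Matrix Polynomial

variable {n d : ℕ} {q : ℂ}

/-- A kernel vector consists of the partial fraction coefficients of a function with numerator of
degree less than `n` and `n` zeros. -/
theorem det_cauchy_ne_zero {x y : Fin n → ℂ} (hx : Function.Injective x) (hy : Function.Injective y)
    (hxy : ∀ i j, x i - y j ≠ 0) : (Matrix.of fun i j => (x i - y j)⁻¹).det ≠ 0 := by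
  intro h
  obtain ⟨c, hc, h0⟩ := exists_mulVec_eq_zero_iff.2 h
  -- the numerator of the rational function `∑ c_j / (T - y_j)` has too many roots
  let p : ℂ[X] := ∑ j, C (c j) * ∏ k ∈ univ.erase j, (X - C (y k))
  have hev : ∀ t, p.eval t = ∑ j, c j * ∏ k ∈ univ.erase j, (t - y k) := fun t => by
    simp [p, eval_finsetSum, eval_prod]
  have hn : n ≠ 0 := by
    rintro rfl
    exact hc (Subsingleton.elim _ _)
  have hp : p = 0 := by
    refine eq_zero_of_natDegree_lt_card_of_eval_eq_zero p hx (fun i => ?_) ?_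
    · have h1 := congrFun h0 i
      rw [mulVec, dotProduct] at h1
      have h2 : ∀ j, c j * ∏ k ∈ univ.erase j, (x i - y k) =
          (∏ k, (x i - y k)) * ((x i - y j)⁻¹ * c j) := fun j => by
        rw [← Finset.mul_prod_erase _ _ (mem_univ j), mul_comm (x i - y j), mul_assoc,
          mul_inv_cancel_left₀ (hxy i j), mul_comm]
      rw [hev, sum_congr rfl fun j _ => h2 j, ← mul_sum]
      exact mul_eq_zero_of_right _ h1
    · rw [Fintype.card_fin]
      refine lt_of_le_of_lt (natDegree_sum_le_of_forall_le (n := n - 1) _ _ fun j _ => ?_) (by omega)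
      refine (natDegree_C_mul_le _ _).trans ((natDegree_prod_le _ _).trans ?_)
      simp
  refine hc (funext fun j => ?_)
  have h1 := hev (y j)
  rw [hp, eval_zero, sum_eq_single j] at h1
  · refine (mul_eq_zero.1 h1.symm).resolve_right (prod_ne_zero_iff.2 fun k hk => sub_ne_zero.2 ?_)
    exact fun e => ne_of_mem_erase hk (hy e).symm
  · intro k _ hk
    rw [Finset.prod_eq_zero (mem_erase.2 ⟨hk.symm, mem_univ j⟩) (sub_self _), mul_zero]
  · exact fun h => absurd (mem_univ _) h

/-- A point of the local phase space. The `x_i` are powers of a real number larger than `|q|` and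
`|q|⁻¹`, so that `x_i ≠ q x_j`, and the `Z_k` are Cauchy matrices up to diagonal factors. -/
def samplePoint (n d : ℕ) (q : ℂ) : HVec n (d + 1)
  | .x i => (((‖q‖ + ‖q‖⁻¹ + 1) ^ i.1 : ℝ) : ℂ)
  | .a _ _ => ((d : ℂ) + 1)⁻¹
  | .b _ β => if β = 0 then 1 else 0

theorem samplePoint_mem (hq : q ≠ 0) (hq1 : q ≠ 1) : samplePoint n d q ∈ hreg n (d + 1) q := by
  set T : ℝ := ‖q‖ + ‖q‖⁻¹ + 1 with hT
  have hq0 : 0 < ‖q‖ := norm_pos_iff.2 hq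
  have hqi : 0 < ‖q‖⁻¹ := inv_pos.2 hq0
  have hT1 : 1 < T := by linarith
  have hqT : 1 < ‖q‖ * T := by
    have : ‖q‖ * T = ‖q‖ ^ 2 + 1 + ‖q‖ := by rw [hT]; field_simp
    linarith [sq_nonneg ‖q‖]
  have hTp : ∀ i : ℕ, 0 < T ^ i := fun i => by positivity
  set x : Fin n → ℂ := fun i => ((T ^ i.1 : ℝ) : ℂ) with hxdef
  have hx0 : ∀ i, x i ≠ 0 := fun i => Complex.ofReal_ne_zero.2 (hTp i).ne'
  have hinj : Function.Injective x := fun i j h =>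
    Fin.ext (pow_right_injective₀ (by linarith) hT1.ne' (Complex.ofReal_injective h))
  have hxq : ∀ i j, i ≠ j → x i ≠ q * x j := by
    intro i j hij h
    have h1 : T ^ i.1 = ‖q‖ * T ^ j.1 := by
      have := congrArg norm h
      rwa [norm_mul, Complex.norm_real, Complex.norm_real, Real.norm_of_nonneg (hTp _).le,
        Real.norm_of_nonneg (hTp _).le] at this
    rcases lt_or_gt_of_ne (Fin.val_ne_of_ne hij) with h2 | h2
    · have h3 := pow_le_pow_right₀ hT1.le (Nat.succ_le_of_lt h2)
      rw [Nat.succ_eq_add_one, pow_succ] at h3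
      nlinarith [hTp i]
    · have h3 := pow_le_pow_right₀ hT1.le (Nat.succ_le_of_lt h2)
      rw [Nat.succ_eq_add_one, pow_succ] at h3
      nlinarith [hTp j]
  have hne : ∀ i j, x i - q * x j ≠ 0 := by
    intro i j
    by_cases h : i = j
    · subst h
      rw [← one_sub_mul]
      exact mul_ne_zero (sub_ne_zero.2 hq1.symm) (hx0 i)
    · exact sub_ne_zero.2 (hxq i j h)
  set c : ℂ := ((d : ℂ) + 1)⁻¹ with hc
  have hc0 : c ≠ 0 := inv_ne_zero (Nat.cast_add_one_ne_zero d)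
  have hC := det_cauchy_ne_zero hinj (fun i j h => hinj (mul_left_cancel₀ hq h)) hne
  have hZ : ∀ i j, locZ q (samplePoint n d q) i j = q * c * x j * (x i - q * x j)⁻¹ := by
    intro i j
    have h1 : x i * (x j)⁻¹ - q = (x i - q * x j) * (x j)⁻¹ := by
      rw [sub_mul, mul_assoc q, mul_inv_cancel₀ (hx0 j), mul_one]
    change q * (∑ β : Fin (d + 1), c * (if β = 0 then 1 else 0)) / (x i * (x j)⁻¹ - q) = _
    rw [h1]
    simp
    field_simp
  refine ⟨hx0, fun i j h => ⟨hinj.ne h, hxq i j h⟩, fun i => ?_, fun k _ => ?_⟩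
  · change ∑ _ : Fin (d + 1), c = 1
    simp [hc, Nat.cast_add_one_ne_zero d]
  · rcases k with _ | k
    · have : locCalZ q (samplePoint n d q) 0 =
          (Matrix.of fun i j => (x i - q * x j)⁻¹) * diagonal fun j => q * c * x j := by
        ext i j
        rw [locCalZ_zero, hZ, mul_diagonal, of_apply, mul_comm]
      rw [this, det_mul, det_diagonal]
      exact mul_ne_zero hC (prod_ne_zero_iff.2 fun j _ => mul_ne_zero (mul_ne_zero hq hc0) (hx0 j))
    · have : locCalZ q (samplePoint n d q) (k + 1) =
          (diagonal fun i => c * x i) * Matrix.of fun i j => (x i - q * x j)⁻¹ := by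
        ext i j
        rw [diagonal_mul, of_apply, locCalZ, of_apply, hZ]
        change _ + ∑ β ∈ univ.filter (fun β : Fin (d + 1) => β.1 < k + 1),
          c * (if β = 0 then 1 else 0) = _
        rw [Finset.sum_eq_single_of_mem 0 (by simp) fun β _ h => by rw [if_neg h, mul_zero], if_pos rfl]
        have := hne i j
        field_simp
        ring
      rw [this, det_mul, det_diagonal]
      exact mul_ne_zero (prod_ne_zero_iff.2 fun j _ => mul_ne_zero hc0 (hx0 j)) hC

theorem exists_linearIndependent_sample (hV : IsOpen (projSet (n + 1) (d + 1) q)) (hq1 : q ≠ 1)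
    (u : hreg (n + 1) (d + 1) q) (hu : u.1 = samplePoint (n + 1) d q) :
    ∃ J : Fin ((d + 1 - 1) * (d + 1 - 2) / 2 + 1) → Option (Param (d + 1)),
      LinearIndependent ℂ fun i => valueAt u (pencil (bracketZero hV hq1) (bracketPsi hV) (J i)) := by
  have ha : ∀ α, u.1 (.a 0 α) = ((d : ℂ) + 1)⁻¹ := fun α => by rw [hu]; rfl
  have hb : u.1 (.b 0 0) = 1 := by rw [hu]; rfl
  refine exists_linearIndependent _ _ u (fun γ f => (locScale hV γ f).1 u)
    (fun z f g => bracketPsi_at hV z f g u) (fun α => coordFn _ (.a 0 α.succ) * coordFn _ (.b 0 0))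
    (inv_ne_zero (Nat.cast_add_one_ne_zero d)) (fun γ α => ?_) (coordFn _ (.x 0)) (coordFn _ (.b 0 0))
    (fun γ => locScale_coordFn hV γ _ u) ?_
  · rw [Derivation.leibniz]
    change u.1 (.a 0 α.succ) * (locScale hV γ.succ (coordFn _ (.b 0 0))).1 u +
      u.1 (.b 0 0) * (locScale hV γ.succ (coordFn _ (.a 0 α.succ))).1 u = _
    rw [locScale_coordFn, locScale_coordFn]
    simp only [scaleH, hb, ha, if_neg (Fin.succ_ne_zero γ).symm, Fin.succ_inj]
    by_cases h : γ = α
    · rw [if_pos h, if_pos h.symm]; ring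
    · rw [if_neg h, if_neg (Ne.symm h)]; ring
  · refine ne_of_eq_of_ne ((bracketZero_spec hV hq1).xb 0 0 0 u) ?_
    rw [if_pos rfl, hb, mul_one]
    exact u.2.1 0

theorem valueAt_sum {X J : Type} [Fintype J] {A : Subalgebra ℂ (X → ℂ)} (x : X) (c : J → ℂ) (P : J → Bider A) :
    valueAt x (∑ i, c i • P i) = ∑ i, c i • valueAt x (P i) := by
  have h : ∀ Q : Bider A, valueAt x Q = valueAtL x Q := fun _ => rfl
  rw [h, map_sum]
  refine sum_congr rfl fun i _ => ?_
  rw [map_smul, h]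

/-- The order of a pencil is bounded below as soon as its values at a point restrict those of the local
brackets to functions whose differentials span the cotangent space. -/
theorem exists_order_transfer {X : Type} {A : Subalgebra ℂ (X → ℂ)} (hq : q ≠ 0) (hq1 : q ≠ 1)
    (hV : IsOpen (projSet (n + 1) (d + 1) q)) {B₀ : Bider A} {Ψ : Param (d + 1) → Bider A}
    (hadd : ∀ z z', Ψ (z + z') = Ψ z + Ψ z') (hsmul : ∀ (c : ℂ) z, Ψ (c • z) = c • Ψ z)
    (π : hreg (n + 1) (d + 1) q → X) (S : Set (HRing (n + 1) (d + 1) q))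
    (hsep : ∀ u v, IsTangentVector (HRing (n + 1) (d + 1) q) u v → (∀ F ∈ S, v F = 0) → v = 0)
    (hval : ∀ F ∈ S, ∀ G ∈ S, ∃ f g : A, ∀ j u, valueAt (π u) (pencil B₀ Ψ j) f g =
      valueAt u (pencil (bracketZero hV hq1) (bracketPsi hV) j) F G) :
    ∃ r, HasPencilOrder (pencil B₀ Ψ) r ∧ (d + 1 - 1) * (d + 1 - 2) / 2 + 1 ≤ r := by
  let u : hreg (n + 1) (d + 1) q := ⟨samplePoint _ d q, samplePoint_mem hq hq1⟩
  obtain ⟨J, hJ⟩ := exists_linearIndependent_sample hV hq1 u rfl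
  have hk := Nat.le_add_left 1 ((d + 1 - 1) * (d + 1 - 2) / 2)
  generalize (d + 1 - 1) * (d + 1 - 2) / 2 + 1 = k at J hJ hk ⊢
  refine exists_order B₀ Ψ (linear_param Ψ hadd hsmul) hk J (π u) ?_
  rw [Fintype.linearIndependent_iff] at hJ ⊢
  intro c hc
  refine hJ c ?_
  obtain ⟨Q, hQ⟩ : ∃ Q : Bider (HRing (n + 1) (d + 1) q), valueAt u Q =
      ∑ i, c i • valueAt u (pencil (bracketZero hV hq1) (bracketPsi hV) (J i)) :=
    ⟨_, valueAt_sum u c fun i => pencil (bracketZero hV hq1) (bracketPsi hV) (J i)⟩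
  have hS : ∀ F ∈ S, ∀ G ∈ S, (Q F G).1 u = 0 := by
    intro F hF G hG
    obtain ⟨f, g, h⟩ := hval F hF G hG
    have h1 := congrFun (congrFun hc f) g
    change valueAt u Q F G = 0
    rw [hQ]
    simpa [Finset.sum_apply, h] using h1
  rw [← hQ]
  have h1 : ∀ F, ∀ G ∈ S, (Q F G).1 u = 0 := fun F G hG =>
    DFunLike.congr_fun (hsep u _ (derAtLeft_tangent u Q G) fun F hF => hS F hF G hG) F
  funext F G
  exact DFunLike.congr_fun (hsep u _ (derAt_tangent u (Q F)) fun G hG => h1 F G hG) G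

theorem exists_order_loc (hq : q ≠ 0) (hq1 : q ≠ 1) (hV : IsOpen (projSet (n + 1) (d + 1) q))
    {B₀ : Bider (LocRing (n + 1) (d + 1) q)} {Ψ : Param (d + 1) → Bider (LocRing (n + 1) (d + 1) q)}
    (h₀ : IsLocalZero q B₀) (hΨ : ∀ z, IsLocalPsi q z (Ψ z)) :
    ∃ r, HasPencilOrder (pencil B₀ Ψ) r ∧ (d + 1 - 1) * (d + 1 - 2) / 2 + 1 ≤ r := by
  have h₀ := (isLocalZero_iff hV hq1 B₀).1 h₀
  have hΨ := fun z => (isLocalPsi_iff hV z (Ψ z)).1 (hΨ z)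
  refine exists_order_transfer hq hq1 hV (fun z z' => (hΨ (z + z')).unique exists_lift_loc
      (by rw [bracketPsi_add]; exact (hΨ z).add (hΨ z')))
    (fun c z => (hΨ (c • z)).unique exists_lift_loc (by rw [bracketPsi_smul]; exact (hΨ z).smul c))
    (Quot.mk _) (Set.range locPull) (fun u v hv h => ?_) ?_
  · ext F
    obtain ⟨f, hf⟩ := (exists_extension_tangent u).2 F
    rw [← hf v hv, h _ ⟨f, rfl⟩, LinearMap.zero_apply]
  · rintro _ ⟨f, rfl⟩ _ ⟨g, rfl⟩
    refine ⟨f, g, fun j u => ?_⟩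
    cases j with
    | none => exact (h₀ _ _ f g (fun _ => rfl) (fun _ => rfl) u).symm
    | some z => exact (hΨ z _ _ f g (fun _ => rfl) (fun _ => rfl) u).symm

theorem exists_order_reduced (hq : q ≠ 0) (hq1 : q ≠ 1) (hV : IsOpen (projSet (n + 1) (d + 1) q))
    {P : Bider (RSRing (n + 1) (d + 1) q)} {Ψ : Param (d + 1) → Bider (RSRing (n + 1) (d + 1) q)}
    (hP : IsReducedP q P) (hΨ : ∀ z, IsReducedPsi q z (Ψ z)) :
    ∃ r, HasPencilOrder (pencil P Ψ) r ∧ (d + 1 - 1) * (d + 1 - 2) / 2 + 1 ≤ r := by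
  refine exists_order_transfer hq hq1 hV
    (fun z z' => IsReduction.unique (exists_lift_RS q) (hΨ (z + z'))
      (by rw [psiRep_add]; exact IsReduction.add (hΨ z) (hΨ z')))
    (fun c z => IsReduction.unique (exists_lift_RS q) (hΨ (c • z))
      (by rw [psiRep_smul]; exact IsReduction.smul (hΨ z) c))
    (fun u => Quot.mk _ (slicePt hq1 u))
    {G | ∃ F f, LiftRS F f ∧ G = slicePull hq1 F}
    (fun u v hv h => tangent_eq_zero_of_slice hq1 hv fun F f hF => h _ ⟨F, f, hF, rfl⟩) ?_
  rintro _ ⟨F, f, hF, rfl⟩ _ ⟨G, g, hG, rfl⟩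
  refine ⟨f, g, fun j u => ?_⟩
  cases j with
  | none =>
    refine (hP F G f g hF hG (slicePt hq1 u)).symm.trans ((quasiP_slice (hV := hV) hF hG u).trans ?_)
    exact (bracketZero_at hV hq1 _ _ u).symm
  | some z =>
    refine (hΨ z F G f g hF hG (slicePt hq1 u)).symm.trans ((psiRep_slice (hV := hV) z hF hG u).trans ?_)
    simp only [rho_scaleVec u.2, ← locScale_at]
    exact (bracketPsi_at hV z _ _ u).symm

end LocalOrder

end SpinRS

end

theorem corollary5p4 (n d : ℕ) (hn : 1 ≤ n) (hd : 2 ≤ d) (q : ℂ) (hq : q ≠ 0)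
    (hqn : ∀ k : ℕ, 1 ≤ k → k ≤ n → q ^ k ≠ 1) :
    -- the brackets on the local phase space are uniquely determined and span a Poisson pencil
    ((∃! B₀ : SpinRS.Bider (SpinRS.LocRing n d q), SpinRS.IsLocalZero q B₀) ∧
      (∀ z : SpinRS.Param d,
        ∃! ψ : SpinRS.Bider (SpinRS.LocRing n d q), SpinRS.IsLocalPsi q z ψ) ∧
      ∀ (B₀ : SpinRS.Bider (SpinRS.LocRing n d q))
        (Ψ : SpinRS.Param d → SpinRS.Bider (SpinRS.LocRing n d q)),
        SpinRS.IsLocalZero q B₀ → (∀ z, SpinRS.IsLocalPsi q z (Ψ z)) →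
          SpinRS.IsPoissonPencil (SpinRS.pencil B₀ Ψ) ∧
          (∀ (z₀ : ℂ) (z : SpinRS.Param d), SpinRS.IsPoisson (z₀ • B₀ + Ψ z) ∧
            (z₀ ≠ 0 → SpinRS.IsNondegenerate (z₀ • B₀ + Ψ z))) ∧
          ∃ r : ℕ, SpinRS.HasPencilOrder (SpinRS.pencil B₀ Ψ) r ∧
            (d - 1) * (d - 2) / 2 + 1 ≤ r) ∧
    -- the pencil on the phase space
    ((∃! P : SpinRS.Bider (SpinRS.RSRing n d q), SpinRS.IsReducedP q P) ∧
      (∀ z : SpinRS.Param d,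
        ∃! ψ : SpinRS.Bider (SpinRS.RSRing n d q), SpinRS.IsReducedPsi q z ψ) ∧
      ∀ (P : SpinRS.Bider (SpinRS.RSRing n d q))
        (Ψ : SpinRS.Param d → SpinRS.Bider (SpinRS.RSRing n d q)),
        SpinRS.IsReducedP q P → (∀ z, SpinRS.IsReducedPsi q z (Ψ z)) →
          SpinRS.IsPoissonPencil (SpinRS.pencil P Ψ) ∧
          ∃ r : ℕ, SpinRS.HasPencilOrder (SpinRS.pencil P Ψ) r ∧
            (d - 1) * (d - 2) / 2 + 1 ≤ r) := by
  have hq1 : q ≠ 1 := by simpa using hqn 1 le_rfl hn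
  have hd0 : d ≠ 0 := by omega
  have hV := SpinRS.isOpen_projSet (n := n) hd0 hq1
  obtain ⟨n, rfl⟩ := Nat.exists_eq_add_of_le' hn
  obtain ⟨d, rfl⟩ := Nat.exists_eq_add_of_le' (show 1 ≤ d by omega)
  refine ⟨⟨SpinRS.existsUnique_isLocalZero hd0 hq1, SpinRS.existsUnique_isLocalPsi hd0 hq1,
    fun B₀ Ψ h₀ hΨ => ⟨SpinRS.isPoissonPencil_loc hV hq1 hqn h₀ hΨ, fun z₀ z => ?_,
      SpinRS.exists_order_loc hq hq1 hV h₀ hΨ⟩⟩, ?_, fun z => ?_,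
    fun P Ψ hP hΨ => ⟨SpinRS.isPoissonPencil_reduced hP hΨ, SpinRS.exists_order_reduced hq hq1 hV hP hΨ⟩⟩
  · have hB := SpinRS.isReduction_bracketLoc hV hq1 h₀ hΨ z₀ z
    exact ⟨SpinRS.isPoisson_loc hV hq1 hqn z₀ z hB, fun h => SpinRS.isNondegenerate_loc hV hq1 h z hB⟩
  · obtain ⟨B, hB⟩ := (SpinRS.quasiP_descends hqn (d := d + 1)).exists_reduction (SpinRS.exists_lift_RS q)
    exact ⟨B, hB, fun B' h => SpinRS.IsReduction.unique (SpinRS.exists_lift_RS q) h hB⟩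
  · obtain ⟨B, hB⟩ := (SpinRS.psiRep_descends hqn z).exists_reduction (SpinRS.exists_lift_RS q)
    exact ⟨B, hB, fun B' h => SpinRS.IsReduction.unique (SpinRS.exists_lift_RS q) h hB⟩
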